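/- Conventions. A Fréchet space is a complete Hausdorff locally convex real topological vector space, smoothness is meant in the sense of Michal–Bastiani (Hamilton, Milnor), and a Fréchet Lie group $G$ is a group which is a manifold modelled on such a space with smooth group operations; $\mathfrak g=T_1G$. $\Delta^n\subset\mathbb R^n$ is the standard simplex; a map on $\Delta^n$ (or on a manifold with corners) is smooth if locally it extends to a smooth map on an open set. A smooth simplicial set $X$ is a contravariant functor to sets from the category of the simplices $\Delta^n$, $n\ge 0$, and all smooth maps between them; maps of smooth simplicial sets are natural transformations, and $H^*(X,\mathbb R)$ is the cohomology algebra (with cup product) of the underlying simplicial set. Examples are $\Delta^n_\bullet$ (smooth maps $\Delta^k\to\Delta^n$) and, for a smooth manifold $Y$ (finite-dimensional, possibly with boundary or corners), $Y_\bullet$ (smooth maps $\Delta^k\to Y$). A simplicial $G$-bundle $P$ over $X$ assigns functorially to each $n$-simplex $\Sigma$ of $X$ a smooth principal $G$-bundle $P_\Sigma\to\Delta^n$, and to each smooth $\sigma:\Delta^k\to\Delta^n$ with $\Sigma'=\sigma^*\Sigma$ a smooth $G$-bundle map $P_{\Sigma'}\to P_\Sigma$ over $\sigma$. A smooth principal $G$-bundle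 $Z\to Y$ induces the simplicial $G$-bundle $Z_\bullet$ over $Y_\bullet$, $(Z_\bullet)_\Sigma=\Sigma^*Z$. A Grothendieck universe $\mathcal U$ (a class of sets closed under subsets, products of pairs, power sets and unions of families indexed by members) is $G$-admissible if it contains $G$ and all the $\Delta^n$. A bundle is $\mathcal U$-small if its total space belongs to $\mathcal U$; a simplicial bundle $P$ is $\mathcal U$-small if all the $P_\Sigma$ are. $BG^{\mathcal U}$ is the smooth simplicial set whose $n$-simplices are the $\mathcal U$-small simplicial $G$-bundles over $\Delta^n_\bullet$, with smooth maps $\Delta^k\to\Delta^n$ acting by pull-back; $EG^{\mathcal U}$ is the simplicial $G$-bundle over $BG^{\mathcal U}$ whose bundle over the simplex $P$ is $P_{\mathrm{id}_{\Delta^n}}$. The classifying map $f_P:X\to BG^{\mathcal U}$ of a $\mathcal U$-small simplicial bundle $P$ over $X$ sends an $n$-simplex $\Sigma$ to the pull-back of $P$ along $\Sigma_*:\Delta^n_\bullet\to X$. A simplicial connection $D$ on $P$ consists of a smooth $G$-connection $D_\Sigma$ on each $P_\Sigma$, compatible with pull-back along the bundle maps of $P$ over the simplicial (affine, vertices to vertices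 in order) maps $\Delta^k\to\Delta^n$. For a continuous, symmetric, $\mathrm{Ad}$-invariant multilinear functional $\rho:\mathfrak g^k\to\mathbb R$, let $\omega^{\rho,D}_\Sigma=\rho(R_\Sigma\wedge\dots\wedge R_\Sigma)$, where $R_\Sigma$ is the curvature of $D_\Sigma$; that is, in the convention $(\alpha\wedge\beta)(v,w)=\alpha(v)\beta(w)-\alpha(w)\beta(v)$, $$\omega^{\rho,D}_\Sigma(v_1,\dots,v_{2k})=\frac1{2^k}\sum_{\eta\in S_{2k}}\operatorname{sign}(\eta)\,\rho\big(R_\Sigma(v_{\eta(1)},v_{\eta(2)}),\dots,R_\Sigma(v_{\eta(2k-1)},v_{\eta(2k)})\big),$$ and let $\alpha^{\rho,D}$ be the $2k$-cochain $\Sigma\mapsto\int_{\Delta^{2k}}\omega^{\rho,D}_\Sigma$. Finally, $\mathbb R[\mathfrak g]^G$ is the algebra of $\mathrm{Ad}$-invariant continuous polynomial functions on $\mathfrak g$; $\rho$ as above gives the element $\xi\mapsto\rho(\xi,\dots,\xi)$. Proposition. Let $G$ be a Fréchet Lie group and $\mathcal U$ a $G$-admissible Grothendieck universe. Then $EG^{\mathcal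 U}$ has a simplicial connection, and there is a homomorphism of $\mathbb R$-algebras $$\Phi:\mathbb R[\mathfrak g]^G\to H^*(BG^{\mathcal U},\mathbb R)$$ such that the following holds. 1. For every $k\ge 0$, every continuous symmetric $\mathrm{Ad}$-invariant $\rho:\mathfrak g^k\to\mathbb R$ and every simplicial connection $D$ on $EG^{\mathcal U}$, the cochain $\alpha^{\rho,D}$ is a cocycle and $\Phi(\rho)=c^{\rho,\mathcal U}:=[\alpha^{\rho,D}]\in H^{2k}(BG^{\mathcal U},\mathbb R)$; in particular this class does not depend on $D$. 2. Let $Z\to Y$ be a $\mathcal U$-small smooth principal $G$-bundle over a smooth manifold. Then $Z_\bullet$ has a simplicial connection, $f_{Z_\bullet}^*EG^{\mathcal U}\cong Z_\bullet$, and for $f=f_{Z_\bullet}$, and more generally for every map of smooth simplicial sets $f:Y_\bullet\to BG^{\mathcal U}$ with $f^*EG^{\mathcal U}\cong Z_\bullet$, one has $f^*c^{\rho,\mathcal U}=c^\rho(Z_\bullet)$ in $H^{2k}(Y_\bullet,\mathbb R)$ for all $\rho$ as above, where $c^\rho(Z_\bullet)=[\alpha^{\rho,D}]$ for any simplicial connection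 $D$ on $Z_\bullet$ (it is a cocycle whose class does not depend on $D$). -/

import Mathlib

open Set Filter Topology
open scoped ContDiff Manifold DirectSum

noncomputable section

namespace ChernWeil

/-! ### Michal–Bastiani calculus in locally convex spaces -/

section Calculus

universe a b c

/-- `f` is of class `C^n` (in the sense of Michal–Bastiani, Hamilton, Milnor) on the open set `U`:
it is continuous and, for `n ≥ 1`, all directional derivatives `df (x, h)` exist at the points `x`
of `U` and the map `df` is of class `C^(n-1)` on `U × E`. -/
def CkOn {F : Type b} [AddCommGroup F] [Module ℝ F] [TopologicalSpace F] :
    ℕ → ∀ {E : Type a} [AddCommGroup E] [Module ℝ E] [TopologicalSpace E],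
      (E → F) → Set E → Prop
  | 0, _, _, _, _, f, U => ContinuousOn f U
  | n + 1, E, _, _, _, f, U => ContinuousOn f U ∧ ∃ df : E × E → F,
      (∀ x ∈ U, ∀ h : E,
        Tendsto (fun t : ℝ => t⁻¹ • (f (x + t • h) - f x)) (𝓝[≠] 0) (𝓝 (df (x, h)))) ∧
      CkOn n df (U ×ˢ univ)

/-- Smoothness (`C^n` for all finite `n`) on an open subset of a topological vector space. -/
def CInftyOn {E : Type a} [AddCommGroup E] [Module ℝ E] [TopologicalSpace E]
    {F : Type b} [AddCommGroup F] [Module ℝ F] [TopologicalSpace F] (f : E → F) (U : Set E) :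
    Prop :=
  ∀ n : ℕ, CkOn n f U

variable {E : Type a} [AddCommGroup E] [Module ℝ E] [TopologicalSpace E]
  {F : Type b} [AddCommGroup F] [Module ℝ F] [TopologicalSpace F]
  {K : Type c} [AddCommGroup K] [Module ℝ K] [TopologicalSpace K]

theorem CkOn.continuousOn {n : ℕ} {f : E → F} {U : Set E} (h : CkOn n f U) : ContinuousOn f U := by
  cases n with
  | zero => exact h
  | succ n => exact h.1

theorem CkOn.of_succ {n : ℕ} {E : Type a} [AddCommGroup E] [Module ℝ E] [TopologicalSpace E]
    {f : E → F} {U : Set E} (h : CkOn (n + 1) f U) : CkOn n f U := by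
  induction n generalizing E with
  | zero => exact h.1
  | succ n ih =>
    obtain ⟨hc, df, hd, hdf⟩ := h
    exact ⟨hc, df, hd, ih hdf⟩

theorem CkOn.mono {n : ℕ} {E : Type a} [AddCommGroup E] [Module ℝ E] [TopologicalSpace E]
    {f : E → F} {U U' : Set E} (h : CkOn n f U) (hU : U' ⊆ U) : CkOn n f U' := by
  induction n generalizing E with
  | zero => exact ContinuousOn.mono h hU
  | succ n ih =>
    obtain ⟨hc, df, hd, hdf⟩ := h
    exact ⟨hc.mono hU, df, fun x hx => hd x (hU hx), ih hdf (prod_mono_left hU)⟩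

theorem tendsto_add_smul [ContinuousAdd E] [ContinuousSMul ℝ E] (x h : E) :
    Tendsto (fun t : ℝ => x + t • h) (𝓝[≠] 0) (𝓝 x) := by
  have : Continuous fun t : ℝ => x + t • h := by fun_prop
  have h0 := this.tendsto 0
  simp only [zero_smul, add_zero] at h0
  exact h0.mono_left nhdsWithin_le_nhds

theorem CkOn.congr [IsTopologicalAddGroup E] [ContinuousSMul ℝ E] {n : ℕ} {f g : E → F}
    {U : Set E} (hU : IsOpen U) (h : CkOn n f U) (hfg : EqOn f g U) : CkOn n g U := by
  cases n with
  | zero => exact ContinuousOn.congr h hfg.symm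
  | succ n =>
    obtain ⟨hc, df, hd, hdf⟩ := h
    refine ⟨hc.congr hfg.symm, df, fun x hx h => ?_, hdf⟩
    refine (hd x hx h).congr' ?_
    filter_upwards [(tendsto_add_smul x h).eventually (hU.mem_nhds hx)] with t ht
    rw [hfg ht, hfg hx]

theorem CkOn.of_clm [IsTopologicalAddGroup F] {E : Type a} [AddCommGroup E] [Module ℝ E]
    [TopologicalSpace E] (n : ℕ) (L : E →L[ℝ] F) (U : Set E) : CkOn n L U := by
  induction n generalizing E with
  | zero => exact L.continuous.continuousOn
  | succ n ih =>
    refine ⟨L.continuous.continuousOn, fun p => L p.2, fun x _ h => ?_,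
      ih (L.comp (ContinuousLinearMap.snd ℝ E E)) _⟩
    refine tendsto_const_nhds.congr' ?_
    filter_upwards [self_mem_nhdsWithin] with t ht
    simp [smul_smul, inv_mul_cancel₀ ht]

theorem CkOn.prodMk [IsTopologicalAddGroup F] {n : ℕ} {E : Type a} [AddCommGroup E] [Module ℝ E]
    [TopologicalSpace E] {f : E → F} {g : E → K} {U : Set E} (hf : CkOn n f U) (hg : CkOn n g U) :
    CkOn n (fun x => (f x, g x)) U := by
  induction n generalizing E with
  | zero => exact ContinuousOn.prodMk hf hg
  | succ n ih =>
    obtain ⟨hc, df, hd, hdf⟩ := hf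
    obtain ⟨hc', dg, hd', hdg⟩ := hg
    refine ⟨hc.prodMk hc', fun p => (df p, dg p), fun x hx h => ?_, ih hdf hdg⟩
    exact (hd x hx h).prodMk_nhds (hd' x hx h)

/-- The mean value theorem: difference quotients along varying directions converge. -/
theorem tendsto_slope_of_continuousOn [IsTopologicalAddGroup F] [ContinuousSMul ℝ F]
    [IsTopologicalAddGroup K] [ContinuousSMul ℝ K] [LocallyConvexSpace ℝ K]
    {g : F → K} {dg : F × F → K} {U : Set F} (hU : IsOpen U)
    (hd : ∀ x ∈ U, ∀ h : F,
      Tendsto (fun t : ℝ => t⁻¹ • (g (x + t • h) - g x)) (𝓝[≠] 0) (𝓝 (dg (x, h))))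
    (hc : ContinuousOn dg (U ×ˢ univ)) {x : F} (hx : x ∈ U) (h : F) :
    Tendsto (fun p : ℝ × F => p.1⁻¹ • (g (x + p.1 • p.2) - g x)) (𝓝[≠] 0 ×ˢ 𝓝 h)
      (𝓝 (dg (x, h))) := by
  rw [(closed_nhds_basis (dg (x, h))).tendsto_right_iff]
  rintro W ⟨hW, hWc⟩
  obtain ⟨N, ⟨hN, hNc⟩, hNW⟩ := (LocallyConvexSpace.convex_basis (𝕜 := ℝ) (dg (x, h))).mem_iff.1 hW
  have hNW : closure N ⊆ W := closure_minimal hNW hWc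
  have hev : ∀ᶠ q : F × F in 𝓝 (x, h), q.1 ∈ U ∧ dg q ∈ N := by
    have h1 : U ×ˢ (univ : Set F) ∈ 𝓝 (x, h) := (hU.prod isOpen_univ).mem_nhds ⟨hx, mem_univ _⟩
    filter_upwards [h1, (hc.continuousAt h1) hN] with q hq hq'
    exact ⟨hq.1, hq'⟩
  have key : ∀ᶠ p : ℝ × F in 𝓝 ((0 : ℝ), h), ∀ s ∈ Icc (0 : ℝ) 1,
      x + (s * p.1) • p.2 ∈ U ∧ dg (x + (s * p.1) • p.2, p.2) ∈ N := by
    refine isCompact_Icc.eventually_forall_of_forall_eventually fun s _ => ?_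
    have hcont : Continuous fun z : (ℝ × F) × ℝ => (x + (z.2 * z.1.1) • z.1.2, z.1.2) := by fun_prop
    have := hcont.tendsto ((0, h), s)
    simp only [mul_zero, zero_smul, add_zero] at this
    exact this.eventually hev
  have key' : ∀ᶠ p : ℝ × F in 𝓝[≠] 0 ×ˢ 𝓝 h, p.1 ≠ 0 ∧ ∀ s ∈ Icc (0 : ℝ) 1,
      x + (s * p.1) • p.2 ∈ U ∧ dg (x + (s * p.1) • p.2, p.2) ∈ N := by
    refine Filter.Eventually.and ?_ ?_
    · have h0 : ∀ᶠ t : ℝ in 𝓝[≠] 0, t ≠ 0 := eventually_mem_nhdsWithin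
      exact h0.prod_inl _
    · rw [nhds_prod_eq] at key
      exact key.filter_mono (prod_mono nhdsWithin_le_nhds le_rfl)
  filter_upwards [key'] with p hp
  obtain ⟨hp0, hp⟩ := hp
  obtain ⟨t, k⟩ := p
  simp only at hp hp0 ⊢
  apply hNW
  by_contra hcon
  obtain ⟨φ, u, hφ, hu⟩ := geometric_hahn_banach_closed_point hNc.closure isClosed_closure hcon
  set c : ℝ → ℝ := fun s => φ (t⁻¹ • g (x + (s * t) • k)) with hcdef
  have hder : ∀ s ∈ Icc (0 : ℝ) 1, HasDerivAt c (φ (dg (x + (s * t) • k, k))) s := by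
    intro s hs
    rw [hasDerivAt_iff_tendsto_slope_zero]
    have h1 := (φ.continuous.tendsto _).comp (hd _ (hp s hs).1 k)
    have h2 : Tendsto (fun δ : ℝ => δ * t) (𝓝[≠] 0) (𝓝[≠] 0) := by
      refine tendsto_nhdsWithin_iff.2 ⟨?_, ?_⟩
      · have : Tendsto (fun δ : ℝ => δ * t) (𝓝 0) (𝓝 (0 * t)) :=
          (continuous_mul_const t).tendsto 0
        rw [zero_mul] at this
        exact this.mono_left nhdsWithin_le_nhds
      · filter_upwards [self_mem_nhdsWithin] with δ hδ
        exact mul_ne_zero hδ hp0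
    refine (h1.comp h2).congr fun δ => ?_
    simp only [hcdef, Function.comp_apply, map_smul, map_sub, smul_eq_mul, mul_inv, add_mul,
      add_smul, add_assoc]
    ring
  obtain ⟨s, hs, hs'⟩ := exists_hasDerivAt_eq_slope c _ zero_lt_one
    (fun s hs => (hder s hs).continuousAt.continuousWithinAt)
    (fun s hs => hder s (Ioo_subset_Icc_self hs))
  have h3 := hφ _ (subset_closure (hp s (Ioo_subset_Icc_self hs)).2)
  rw [hs'] at h3
  simp only [hcdef, one_mul, zero_mul, zero_smul, add_zero, sub_zero, div_one, ← map_sub,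
    ← smul_sub] at h3
  exact absurd hu (not_lt.2 h3.le)

/-- The chain rule. -/
theorem CkOn.comp {n : ℕ} {E : Type a} [AddCommGroup E] [Module ℝ E] [TopologicalSpace E]
    [IsTopologicalAddGroup E] [ContinuousSMul ℝ E]
    {F : Type b} [AddCommGroup F] [Module ℝ F] [TopologicalSpace F]
    [IsTopologicalAddGroup F] [ContinuousSMul ℝ F]
    [IsTopologicalAddGroup K] [ContinuousSMul ℝ K] [LocallyConvexSpace ℝ K]
    {g : F → K} {f : E → F} {U' : Set F} {U : Set E} (hU' : IsOpen U')
    (hg : CkOn n g U') (hf : CkOn n f U) (hfU : MapsTo f U U') : CkOn n (g ∘ f) U := by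
  induction n generalizing E F with
  | zero => exact ContinuousOn.comp hg hf hfU
  | succ n ih =>
    have hf' := hf.of_succ
    obtain ⟨hgc, dg, hgd, hdg⟩ := hg
    obtain ⟨hfc, df, hfd, hdf⟩ := hf
    refine ⟨hgc.comp hfc hfU, dg ∘ fun p => (f p.1, df p), fun x hx h => ?_, ?_⟩
    · have h1 := tendsto_slope_of_continuousOn hU' hgd hdg.continuousOn (hfU hx) (df (x, h))
      have h2 : Tendsto (fun t : ℝ => (t, t⁻¹ • (f (x + t • h) - f x))) (𝓝[≠] 0)
          (𝓝[≠] 0 ×ˢ 𝓝 (df (x, h))) := tendsto_id.prodMk (hfd x hx h)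
      refine (h1.comp h2).congr' ?_
      filter_upwards [self_mem_nhdsWithin] with t ht
      simp [smul_smul, mul_inv_cancel₀ ht]
    · refine ih (hU'.prod isOpen_univ) hdg (CkOn.prodMk ?_ hdf) fun p hp => ⟨hfU hp.1, mem_univ _⟩
      clear ih hdg hgd
      -- composition with the first projection
      have aux : ∀ (m : ℕ) {A : Type a} [AddCommGroup A] [Module ℝ A] [TopologicalSpace A]
          {B : Type a} [AddCommGroup B] [Module ℝ B] [TopologicalSpace B] (L : A →L[ℝ] B)
          (f : B → F) (U : Set B), CkOn m f U → CkOn m (f ∘ L) (L ⁻¹' U) := by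
        intro m
        induction m with
        | zero =>
          intro A _ _ _ B _ _ _ L f U h
          exact ContinuousOn.comp h L.continuous.continuousOn (mapsTo_preimage _ _)
        | succ m ih =>
          intro A _ _ _ B _ _ _ L f U h
          obtain ⟨h1, df, h2, h3⟩ := h
          refine ⟨h1.comp L.continuous.continuousOn (mapsTo_preimage _ _),
            df ∘ (L.prodMap L), fun x hx k => ?_, ?_⟩
          · simpa using h2 (L x) hx (L k)
          · refine (ih (L.prodMap L) df _ h3).mono fun p hp => ?_
            exact ⟨hp.1, mem_univ _⟩
      refine (aux n (ContinuousLinearMap.fst ℝ E E) f U hf').mono fun p hp => hp.1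

theorem CInftyOn.comp
    [IsTopologicalAddGroup E] [ContinuousSMul ℝ E]
    [IsTopologicalAddGroup F] [ContinuousSMul ℝ F]
    [IsTopologicalAddGroup K] [ContinuousSMul ℝ K] [LocallyConvexSpace ℝ K]
    {g : F → K} {f : E → F} {U' : Set F} {U : Set E} (hU' : IsOpen U')
    (hg : CInftyOn g U') (hf : CInftyOn f U) (hfU : MapsTo f U U') : CInftyOn (g ∘ f) U :=
  fun n => (hg n).comp hU' (hf n) hfU

/-- Ordinary smooth maps between normed spaces are smooth in the above sense. -/
theorem CInftyOn.of_contDiffOn {E : Type a} [NormedAddCommGroup E] [NormedSpace ℝ E]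
    {F : Type b} [NormedAddCommGroup F] [NormedSpace ℝ F] {f : E → F} {U : Set E}
    (hU : IsOpen U) (hf : ContDiffOn ℝ ∞ f U) : CInftyOn f U := by
  intro n
  induction n generalizing E with
  | zero => exact hf.continuousOn
  | succ n ih =>
    refine ⟨hf.continuousOn, fun p => fderiv ℝ f p.1 p.2, fun x hx h => ?_, ?_⟩
    · have hd : DifferentiableAt ℝ f x :=
        (hf.differentiableOn (by simp)).differentiableAt (hU.mem_nhds hx)
      have h1 := hd.hasFDerivAt.hasLineDerivAt h
      exact h1.tendsto_slope_zero
    · refine ih (hU.prod isOpen_univ) ?_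
      have h1 : ContDiffOn ℝ ∞ (fderiv ℝ f) U := hf.fderiv_of_isOpen hU (by simp)
      exact (h1.comp contDiffOn_fst fun p hp => hp.1).clm_apply contDiffOn_snd

end Calculus

/-! ### Smooth maps into manifolds modelled on locally convex spaces, Fréchet Lie groups -/

section Targets

universe a b u

variable {V : Type a} [AddCommGroup V] [Module ℝ V] [TopologicalSpace V]
  (E : Type b) [AddCommGroup E] [Module ℝ E] [TopologicalSpace E]
  {M : Type u} [TopologicalSpace M] [ChartedSpace E M]

/-- `F : V → M` is smooth on a neighbourhood of the point `x` of the topological vector space `V`,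
read in the preferred chart at `F x` of the manifold `M` modelled on `E`. -/
def SmoothNear (F : V → M) (x : V) : Prop :=
  ∃ O : Set V, IsOpen O ∧ x ∈ O ∧ MapsTo F O (chartAt E (F x)).source ∧
    CInftyOn (fun y => chartAt E (F x) (F y)) O

/-- A Lie group modelled on the locally convex space `E`: the chart transitions and the group
operations are smooth. -/
class SmoothLieGroup (G : Type u) [Group G] [TopologicalSpace G] [ChartedSpace E G] : Prop
    extends IsTopologicalGroup G where
  smooth_transition : ∀ e ∈ atlas E G, ∀ e' ∈ atlas E G,
    CInftyOn (e.symm.trans e') (e.symm.trans e').source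
  smooth_mul : ∀ e ∈ atlas E G, ∀ e' ∈ atlas E G, ∀ x ∈ e.target, ∀ y ∈ e'.target,
    SmoothNear E (fun p : E × E => e.symm p.1 * e'.symm p.2) (x, y)
  smooth_inv : ∀ e ∈ atlas E G, ∀ x ∈ e.target, SmoothNear E (fun p : E => (e.symm p)⁻¹) x

variable {E}

theorem SmoothNear.congr [IsTopologicalAddGroup V] [ContinuousSMul ℝ V] {F F' : V → M} {x : V}
    (h : SmoothNear E F x) (hF : F' =ᶠ[𝓝 x] F) : SmoothNear E F' x := by
  obtain ⟨O, hO, hx, hm, hs⟩ := h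
  obtain ⟨W, hW, hWo, hxW⟩ := eventually_nhds_iff.1 hF
  have h0 := hW x hxW
  refine ⟨O ∩ W, hO.inter hWo, ⟨hx, hxW⟩, fun y hy => ?_, fun n => ?_⟩
  · rw [h0, hW y hy.2]; exact hm hy.1
  · refine ((hs n).mono inter_subset_left).congr (hO.inter hWo) fun y hy => ?_
    simp only [h0, hW y hy.2]

theorem SmoothNear.comp [IsTopologicalAddGroup V] [ContinuousSMul ℝ V]
    {V' : Type*} [AddCommGroup V'] [Module ℝ V'] [TopologicalSpace V']
    [IsTopologicalAddGroup V'] [ContinuousSMul ℝ V'] [IsTopologicalAddGroup E]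
    [ContinuousSMul ℝ E] [LocallyConvexSpace ℝ E] {F : V' → M} {f : V → V'} {x : V} {O : Set V}
    (hO : IsOpen O) (hx : x ∈ O) (hf : CInftyOn f O) (hF : SmoothNear E F (f x)) :
    SmoothNear E (fun y => F (f y)) x := by
  obtain ⟨O', hO', hx', hm, hs⟩ := hF
  have hopen : IsOpen (O ∩ f ⁻¹' O') := (hf 0).continuousOn.isOpen_inter_preimage hO hO'
  refine ⟨O ∩ f ⁻¹' O', hopen, ⟨hx, hx'⟩, fun y hy => hm hy.2, ?_⟩
  change CInftyOn ((fun z => chartAt E (F (f x)) (F z)) ∘ f) _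
  exact CInftyOn.comp hO' hs (fun n => (hf n).mono inter_subset_left) fun y hy => hy.2

theorem CInftyOn.prodMk {K : Type*} [AddCommGroup K] [Module ℝ K] [TopologicalSpace K]
    [IsTopologicalAddGroup E] {f : V → E} {g : V → K} {U : Set V} (hf : CInftyOn f U)
    (hg : CInftyOn g U) : CInftyOn (fun x => (f x, g x)) U :=
  fun n => (hf n).prodMk (hg n)

section Group

variable [IsTopologicalAddGroup V] [ContinuousSMul ℝ V]
  [IsTopologicalAddGroup E] [ContinuousSMul ℝ E] [LocallyConvexSpace ℝ E]
  {G : Type u} [Group G] [TopologicalSpace G] [ChartedSpace E G] [SmoothLieGroup E G]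

theorem SmoothNear.inv {F : V → G} {x : V} (h : SmoothNear E F x) :
    SmoothNear E (fun y => (F y)⁻¹) x := by
  obtain ⟨O, hO, hx, hm, hs⟩ := h
  have h1 := SmoothLieGroup.smooth_inv (chartAt E (F x)) (chart_mem_atlas E _) _
    ((chartAt E (F x)).map_source (hm hx))
  refine (SmoothNear.comp hO hx hs h1).congr ?_
  filter_upwards [hO.mem_nhds hx] with y hy
  rw [(chartAt E (F x)).left_inv (hm hy)]

theorem SmoothNear.mul {F F' : V → G} {x : V} (h : SmoothNear E F x) (h' : SmoothNear E F' x) :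
    SmoothNear E (fun y => F y * F' y) x := by
  obtain ⟨O, hO, hx, hm, hs⟩ := h
  obtain ⟨O', hO', hx', hm', hs'⟩ := h'
  have h1 := SmoothLieGroup.smooth_mul (chartAt E (F x)) (chart_mem_atlas E _)
    (chartAt E (F' x)) (chart_mem_atlas E _) _ ((chartAt E (F x)).map_source (hm hx))
    _ ((chartAt E (F' x)).map_source (hm' hx'))
  have h2 : CInftyOn (fun y => (chartAt E (F x) (F y), chartAt E (F' x) (F' y))) (O ∩ O') :=
    CInftyOn.prodMk (fun n => (hs n).mono inter_subset_left)
      (fun n => (hs' n).mono inter_subset_right)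
  refine (SmoothNear.comp (hO.inter hO') ⟨hx, hx'⟩ h2 h1).congr ?_
  filter_upwards [(hO.inter hO').mem_nhds ⟨hx, hx'⟩] with y hy
  simp only [(chartAt E (F x)).left_inv (hm hy.1), (chartAt E (F' x)).left_inv (hm' hy.2)]

end Group

end Targets

/-! ### Smooth maps from finite-dimensional manifolds with corners

A map is smooth at a point of a manifold with corners if, in charts, it extends to a smooth map
defined on an open neighbourhood of this point in the model vector space. -/

section Sources

universe v v' w w' h h' b u

variable {V : Type v} [NormedAddCommGroup V] [NormedSpace ℝ V] {H : Type h} [TopologicalSpace H]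
  (I : ModelWithCorners ℝ V H) {B : Type w} [TopologicalSpace B] [ChartedSpace H B]
  {V' : Type v'} [NormedAddCommGroup V'] [NormedSpace ℝ V'] {H' : Type h'} [TopologicalSpace H']
  (I' : ModelWithCorners ℝ V' H') {B' : Type w'} [TopologicalSpace B'] [ChartedSpace H' B']
  (E : Type b) [AddCommGroup E] [Module ℝ E] [TopologicalSpace E]
  {M : Type u} [TopologicalSpace M] [ChartedSpace E M]

/-- `g : B → M` is smooth on the open subset `W` of the manifold with corners `B`. -/
def SmoothOnTo (W : Set B) (g : B → M) : Prop :=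
  ∀ x ∈ W, ∃ F : V → M, SmoothNear E F (extChartAt I x x) ∧
    ∀ᶠ y in 𝓝[range I] (extChartAt I x x), g ((extChartAt I x).symm y) = F y

/-- `f : B → B'` is a smooth map of manifolds with corners. -/
def IsSmoothMap (f : B → B') : Prop :=
  Continuous f ∧ ∀ x : B, ∃ (F : V → V') (O : Set V), IsOpen O ∧ extChartAt I x x ∈ O ∧
    ContDiffOn ℝ ∞ F O ∧ ∀ᶠ y in 𝓝[range I] (extChartAt I x x),
      extChartAt I' (f x) (f ((extChartAt I x).symm y)) = F y

variable {I I' E}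

theorem isSmoothMap_id : IsSmoothMap I I (id : B → B) := by
  refine ⟨continuous_id, fun x => ⟨id, univ, isOpen_univ, mem_univ _, contDiffOn_id, ?_⟩⟩
  filter_upwards [extChartAt_target_mem_nhdsWithin x] with y hy
  exact (extChartAt I x).right_inv hy

/-- If `f` is smooth at `x`, then near `x`, in charts, `f` is `F`, and lands in chart domains. -/
theorem IsSmoothMap.eventually_lift {f : B → B'} (hf : Continuous f) (x : B) {F : V → V'}
    (hF : ∀ᶠ y in 𝓝[range I] (extChartAt I x x),
      extChartAt I' (f x) (f ((extChartAt I x).symm y)) = F y) :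
    (∀ᶠ y in 𝓝[range I] (extChartAt I x x),
      f ((extChartAt I x).symm y) = (extChartAt I' (f x)).symm (F y)) ∧
    F (extChartAt I x x) = extChartAt I' (f x) (f x) ∧
    (∀ᶠ y in 𝓝[range I] (extChartAt I x x), F y ∈ range I') := by
  have hc : Tendsto (fun y => f ((extChartAt I x).symm y)) (𝓝[range I] (extChartAt I x x))
      (𝓝 (f x)) := by
    have h1 := (continuousAt_extChartAt_symm (I := I) x).tendsto
    rw [extChartAt_to_inv] at h1
    exact (hf.continuousAt.tendsto.comp h1).mono_left nhdsWithin_le_nhds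
  have hsrc := hc.eventually (extChartAt_source_mem_nhds (I := I') (f x))
  have h0 : F (extChartAt I x x) = extChartAt I' (f x) (f x) := by
    have := hF.self_of_nhdsWithin (mem_range_self _)
    rw [← this, extChartAt_to_inv]
  refine ⟨?_, h0, ?_⟩
  · filter_upwards [hF, hsrc] with y hy hs
    rw [← hy, (extChartAt I' (f x)).left_inv hs]
  · filter_upwards [hF, hsrc] with y hy hs
    rw [← hy]
    exact extChartAt_target_subset_range (I := I') (f x) ((extChartAt I' (f x)).map_source hs)

theorem tendsto_nhdsWithin_of_contDiffOn {F : V → V'} {O : Set V} {x : V} {s : Set V} {s' : Set V'}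
    (hO : IsOpen O) (hx : x ∈ O) (hF : ContDiffOn ℝ ∞ F O) (hs : ∀ᶠ y in 𝓝[s] x, F y ∈ s') :
    Tendsto F (𝓝[s] x) (𝓝[s'] (F x)) :=
  tendsto_nhdsWithin_iff.2
    ⟨(hF.continuousOn.continuousAt (hO.mem_nhds hx)).tendsto.mono_left nhdsWithin_le_nhds, hs⟩

theorem SmoothOnTo.comp [IsTopologicalAddGroup E] [ContinuousSMul ℝ E] [LocallyConvexSpace ℝ E]
    {f : B → B'} (hf : IsSmoothMap I I' f) {W : Set B'} {g : B' → M}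
    (hg : SmoothOnTo I' E W g) : SmoothOnTo I E (f ⁻¹' W) (fun x => g (f x)) := by
  intro x hx
  obtain ⟨F', hF', hgF⟩ := hg (f x) hx
  obtain ⟨F, O, hO, hxO, hF, hfF⟩ := hf.2 x
  obtain ⟨h1, h2, h3⟩ := IsSmoothMap.eventually_lift hf.1 x hfF
  rw [← h2] at hF' hgF
  refine ⟨fun y => F' (F y), SmoothNear.comp hO hxO (CInftyOn.of_contDiffOn hO hF) hF', ?_⟩
  have h4 := (tendsto_nhdsWithin_of_contDiffOn hO hxO hF h3).eventually hgF
  filter_upwards [h4, h1] with y hy hy'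
  rw [hy', hy]

theorem IsSmoothMap.comp {V'' : Type*} [NormedAddCommGroup V''] [NormedSpace ℝ V'']
    {H'' : Type*} [TopologicalSpace H''] {I'' : ModelWithCorners ℝ V'' H''}
    {B'' : Type*} [TopologicalSpace B''] [ChartedSpace H'' B'']
    {g : B' → B''} {f : B → B'} (hg : IsSmoothMap I' I'' g) (hf : IsSmoothMap I I' f) :
    IsSmoothMap I I'' (g ∘ f) := by
  refine ⟨hg.1.comp hf.1, fun x => ?_⟩
  obtain ⟨F', O', hO', hxO', hF', hgF⟩ := hg.2 (f x)
  obtain ⟨F, O, hO, hxO, hF, hfF⟩ := hf.2 x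
  obtain ⟨h1, h2, h3⟩ := IsSmoothMap.eventually_lift hf.1 x hfF
  rw [← h2] at hxO' hgF
  refine ⟨F' ∘ F, O ∩ F ⁻¹' O', hF.continuousOn.isOpen_inter_preimage hO hO', ⟨hxO, hxO'⟩,
    hF'.comp (hF.mono inter_subset_left) fun y hy => hy.2, ?_⟩
  have h4 := (tendsto_nhdsWithin_of_contDiffOn hO hxO hF h3).eventually hgF
  filter_upwards [h4, h1] with y hy hy'
  simp only [Function.comp_apply] at hy ⊢
  rw [hy', hy]

theorem SmoothOnTo.mono {W W' : Set B} {g : B → M} (h : SmoothOnTo I E W g) (hW : W' ⊆ W) :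
    SmoothOnTo I E W' g := fun x hx => h x (hW hx)

theorem SmoothOnTo.of_locally {W : Set B} {g : B → M}
    (h : ∀ x ∈ W, ∃ (W' : Set B) (g' : B → M), IsOpen W' ∧ x ∈ W' ∧ SmoothOnTo I E W' g' ∧
      EqOn g g' W') : SmoothOnTo I E W g := by
  intro x hx
  obtain ⟨W', g', hW', hxW', hg', he⟩ := h x hx
  obtain ⟨F, hF, hF'⟩ := hg' x hxW'
  refine ⟨F, hF, ?_⟩
  have h1 := (continuousAt_extChartAt_symm (I := I) x).tendsto
  rw [extChartAt_to_inv] at h1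
  filter_upwards [hF', nhdsWithin_le_nhds (h1.eventually (hW'.mem_nhds hxW'))] with y hy hy'
  rw [he hy', hy]

section Group

variable [IsTopologicalAddGroup E] [ContinuousSMul ℝ E] [LocallyConvexSpace ℝ E]
  {G : Type u} [Group G] [TopologicalSpace G] [ChartedSpace E G] [SmoothLieGroup E G]

theorem SmoothOnTo.inv {W : Set B} {g : B → G} (h : SmoothOnTo I E W g) :
    SmoothOnTo I E W (fun x => (g x)⁻¹) := by
  intro x hx
  obtain ⟨F, hF, hF'⟩ := h x hx
  exact ⟨_, hF.inv, hF'.mono fun y hy => by simp only [hy]⟩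

theorem SmoothOnTo.mul {W : Set B} {g g' : B → G} (h : SmoothOnTo I E W g)
    (h' : SmoothOnTo I E W g') : SmoothOnTo I E W (fun x => g x * g' x) := by
  intro x hx
  obtain ⟨F, hF, hF1⟩ := h x hx
  obtain ⟨F', hF', hF1'⟩ := h' x hx
  refine ⟨_, hF.mul hF', ?_⟩
  filter_upwards [hF1, hF1'] with y hy hy'
  simp only [hy, hy']

end Group

end Sources

/-! ### Simplices -/

section Simplices

/-- The simplex `Δⁿ = {x ∈ ℝⁿ | xᵢ ≥ 0, ∑ xᵢ ≤ 1}`. Its vertices are `0, e₁, …, eₙ`. -/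
def Simplex (n : ℕ) : Set (Fin n → ℝ) := {x | (∀ i, 0 ≤ x i) ∧ ∑ i, x i ≤ 1}

/-- The continuous retraction `x ↦ x⁺ / max (1, ∑ xᵢ⁺)` of `ℝⁿ` onto `Δⁿ`. -/
def retract (n : ℕ) (x : Fin n → ℝ) : Simplex n :=
  ⟨fun i => max (x i) 0 / max 1 (∑ j, max (x j) 0), by
    refine ⟨fun i => by positivity, ?_⟩
    rw [← Finset.sum_div, div_le_one (by positivity)]
    exact le_max_right _ _⟩

theorem retract_coe {n : ℕ} (x : Simplex n) : retract n x = x := by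
  obtain ⟨x, h0, h1⟩ := x
  have h2 : ∀ i, max (x i) 0 = x i := fun i => max_eq_left (h0 i)
  apply Subtype.ext
  funext i
  simp [retract, h2, max_eq_left h1]

theorem continuous_retract (n : ℕ) : Continuous (retract n) := by
  refine Continuous.subtype_mk (continuous_pi fun i => ?_) _
  refine Continuous.div (f := fun x : Fin n → ℝ => max (x i) 0)
    (g := fun x => max 1 (∑ j, max (x j) 0)) (by fun_prop) (by fun_prop) fun x => ?_
  positivity

theorem convex_simplex (n : ℕ) : Convex ℝ (Simplex n) := by
  rintro x ⟨hx, hx'⟩ y ⟨hy, hy'⟩ s t hs ht hst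
  refine ⟨fun i => ?_, ?_⟩
  · have := hx i
    have := hy i
    simp only [Pi.add_apply, Pi.smul_apply, smul_eq_mul]
    positivity
  · simp only [Pi.add_apply, Pi.smul_apply, smul_eq_mul, Finset.sum_add_distrib, ← Finset.mul_sum]
    nlinarith

theorem simplex_interior_nonempty (n : ℕ) : (interior (Simplex n)).Nonempty := by
  refine ⟨fun _ => 1 / (n + 1), ?_⟩
  have hopen : IsOpen ({x : Fin n → ℝ | ∀ i, 0 < x i} ∩ {x : Fin n → ℝ | ∑ i, x i < 1}) := by
    refine IsOpen.inter ?_ (isOpen_lt (by fun_prop) continuous_const)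
    rw [ofPred_forall]
    exact isOpen_iInter_of_finite fun i => isOpen_lt continuous_const (continuous_apply i)
  have hsub : {x : Fin n → ℝ | ∀ i, 0 < x i} ∩ {x : Fin n → ℝ | ∑ i, x i < 1} ⊆ Simplex n := by
    rintro x ⟨h0, h1⟩
    exact ⟨fun i => (h0 i).le, le_of_lt h1⟩
  refine interior_maximal hsub hopen ⟨fun i => ?_, ?_⟩
  · dsimp only
    positivity
  · simp only [mem_ofPred_eq, Finset.sum_const, Finset.card_univ, Fintype.card_fin, nsmul_eq_mul]
    rw [mul_one_div, div_lt_one (by positivity)]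
    linarith

/-- `Δⁿ` as a manifold with corners, through the inclusion `Δⁿ ⊆ ℝⁿ`. -/
def simplexModel (n : ℕ) : ModelWithCorners ℝ (Fin n → ℝ) (Simplex n) :=
  ModelWithCorners.ofConvexRange
    { toFun := Subtype.val
      invFun := retract n
      source := univ
      target := Simplex n
      map_source' := fun x _ => x.2
      map_target' := fun _ _ => mem_univ _
      left_inv' := fun x _ => retract_coe x
      right_inv' := fun x hx => congrArg Subtype.val (retract_coe ⟨x, hx⟩) }
    rfl (by simpa using convex_simplex n) continuous_subtype_val (continuous_retract n)
    (by simpa using simplex_interior_nonempty n)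

/-- Smooth maps `Δᵏ → Δⁿ`. -/
def SimplexMap (k n : ℕ) : Type :=
  {σ : Simplex k → Simplex n // IsSmoothMap (simplexModel k) (simplexModel n) σ}

namespace SimplexMap

instance (k n : ℕ) : CoeFun (SimplexMap k n) fun _ => Simplex k → Simplex n := ⟨Subtype.val⟩

/-- The identity of `Δⁿ`. -/
protected def id (n : ℕ) : SimplexMap n n := ⟨id, isSmoothMap_id⟩

/-- Composition of smooth maps of simplices. -/
def comp {k m n : ℕ} (σ : SimplexMap m n) (τ : SimplexMap k m) : SimplexMap k n :=
  ⟨σ.1 ∘ τ.1, σ.2.comp τ.2⟩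

/-- Barycentric coordinates of a point. -/
def bary {n : ℕ} (x : Fin n → ℝ) : Fin (n + 1) → ℝ := Fin.cons (1 - ∑ i, x i) x

theorem sum_bary {n : ℕ} (x : Fin n → ℝ) : ∑ i, bary x i = 1 := by
  simp [bary, Fin.sum_univ_succ]

theorem bary_nonneg {n : ℕ} (x : Simplex n) (i : Fin (n + 1)) : 0 ≤ bary x.1 i := by
  refine Fin.cases ?_ (fun i => ?_) i
  · simpa [bary] using x.2.2
  · simpa [bary] using x.2.1 i

/-- The affine map `ℝᵏ → ℝⁿ` sending the `i`-th vertex of `Δᵏ` to the `θ i`-th vertex of `Δⁿ`. -/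
def affineFun {k n : ℕ} (θ : Fin (k + 1) →o Fin (n + 1)) (x : Fin k → ℝ) : Fin n → ℝ :=
  fun j => ∑ i with θ i = j.succ, bary x i

theorem bary_affineFun {k n : ℕ} (θ : Fin (k + 1) →o Fin (n + 1)) (x : Fin k → ℝ)
    (j : Fin (n + 1)) : bary (affineFun θ x) j = ∑ i with θ i = j, bary x i := by
  refine Fin.cases ?_ (fun j => ?_) j
  · have h1 := Finset.sum_fiberwise (s := Finset.univ) (g := θ) (f := bary x)
    rw [Fin.sum_univ_succ, sum_bary] at h1
    simp only [bary, Fin.cons_zero, affineFun] at h1 ⊢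
    linarith
  · simp [bary, affineFun]

theorem affineFun_mem {k n : ℕ} (θ : Fin (k + 1) →o Fin (n + 1)) (x : Simplex k) :
    affineFun θ x.1 ∈ Simplex n := by
  have h : ∀ j, 0 ≤ bary (affineFun θ x.1) j := fun j => by
    rw [bary_affineFun]
    exact Finset.sum_nonneg fun i _ => bary_nonneg x i
  refine ⟨fun j => ?_, ?_⟩
  · simpa [bary] using h j.succ
  · simpa [bary] using h 0

theorem contDiff_affineFun {k n : ℕ} (θ : Fin (k + 1) →o Fin (n + 1)) :
    ContDiff ℝ ∞ (affineFun θ) := by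
  refine contDiff_pi.2 fun j => ContDiff.sum fun i _ => ?_
  refine Fin.cases ?_ (fun i => ?_) i
  · simp only [bary, Fin.cons_zero]
    fun_prop
  · simp only [bary, Fin.cons_succ]
    fun_prop

/-- The simplicial (affine, vertices to vertices) map `Δᵏ → Δⁿ` of a monotone map of vertices. -/
def affine {k n : ℕ} (θ : Fin (k + 1) →o Fin (n + 1)) : SimplexMap k n :=
  ⟨fun x => ⟨affineFun θ x.1, affineFun_mem θ x⟩, by
    refine ⟨Continuous.subtype_mk
      ((contDiff_affineFun θ).continuous.comp continuous_subtype_val) _, fun x =>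
      ⟨affineFun θ, univ, isOpen_univ, mem_univ _, (contDiff_affineFun θ).contDiffOn, ?_⟩⟩
    filter_upwards [self_mem_nhdsWithin] with y hy
    obtain ⟨y, rfl⟩ := hy
    simp only [extChartAt, chartAt_self_eq, OpenPartialHomeomorph.refl_partialEquiv,
      PartialEquiv.refl_trans, OpenPartialHomeomorph.extend, ModelWithCorners.toPartialEquiv_coe,
      ModelWithCorners.toPartialEquiv_coe_symm, ModelWithCorners.left_inv]
    rfl⟩

theorem affine_id (n : ℕ) : affine (OrderHom.id : Fin (n + 1) →o Fin (n + 1)) = SimplexMap.id n := by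
  apply Subtype.ext
  funext x
  apply Subtype.ext
  funext j
  simp [affine, affineFun, SimplexMap.id, bary, Finset.sum_filter]

theorem affine_comp {k m n : ℕ} (θ : Fin (m + 1) →o Fin (n + 1)) (η : Fin (k + 1) →o Fin (m + 1)) :
    affine (θ.comp η) = (affine θ).comp (affine η) := by
  apply Subtype.ext
  funext x
  apply Subtype.ext
  funext j
  simp only [affine, comp, affineFun, Function.comp_apply, bary_affineFun, OrderHom.comp_coe]
  simp only [Finset.sum_filter]
  have h1 : ∀ y, (if θ y = j.succ then ∑ i, if η i = y then bary x.1 i else 0 else 0) =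
      ∑ i, if η i = y then (if θ y = j.succ then bary x.1 i else 0) else 0 := by
    intro y
    split_ifs <;> simp
  simp only [h1]
  rw [Finset.sum_comm]
  simp

end SimplexMap

end Simplices

/-! ### Smooth principal bundles -/

section Bundles

universe v v' w w' h h' b u

/-- A local section, over an open subset of `B`, of a map `proj` to `B`. -/
structure LocalSection {B : Type w} [TopologicalSpace B] {P : Type u} (proj : P → B) where
  /-- the domain -/
  dom : TopologicalSpace.Opens B
  /-- the section -/
  toFun : dom → P
  proj_toFun : ∀ x : dom, proj (toFun x) = x

variable {V : Type v} [NormedAddCommGroup V] [NormedSpace ℝ V] {H : Type h} [TopologicalSpace H]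
  (I : ModelWithCorners ℝ V H)
  (E : Type b) [AddCommGroup E] [Module ℝ E] [TopologicalSpace E]
  (G : Type u) [Group G] [TopologicalSpace G] [ChartedSpace E G]
  (B : Type w) [TopologicalSpace B] [ChartedSpace H B]

variable {G B} in
/-- Two local sections of a space with a right `G`-action are compatible if they differ, on the
intersection of their domains, by a smooth `G`-valued function. -/
def Compatible {P : Type u} {proj : P → B} (act : P → G → P) (s t : LocalSection proj) : Prop :=
  ∃ g : B → G, SmoothOnTo I E (s.dom ∩ t.dom : Set B) g ∧
    ∀ (x : B) (hs : x ∈ s.dom) (ht : x ∈ t.dom), act (s.toFun ⟨x, hs⟩) (g x) = t.toFun ⟨x, ht⟩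

/-- A smooth principal `G`-bundle over the manifold with corners `B`: a set with a right action of
`G` which is free and transitive on the fibres of the projection to `B`, with a smooth structure.
The smooth structure is given by a maximal atlas of equivariant local trivializations
`(x, g) ↦ s x · g` with smooth transition functions; these trivializations are recorded
through the local sections `s`. -/
structure PrincipalBundle where
  /-- the total space -/
  Total : Type u
  /-- the projection -/
  proj : Total → B
  /-- the right action of the structure group -/
  act : Total → G → Total
  act_one : ∀ p, act p 1 = p
  act_mul : ∀ p g k, act (act p g) k = act p (g * k)
  proj_act : ∀ p g, proj (act p g) = proj p
  existsUnique_act : ∀ p q, proj p = proj q → ∃! g, act p g = q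
  /-- the smooth local sections -/
  sections : Set (LocalSection proj)
  exists_section : ∀ x : B, ∃ s ∈ sections, x ∈ s.dom
  compatible : ∀ s ∈ sections, ∀ t ∈ sections, Compatible I E act s t
  maximal : ∀ s, (∀ t ∈ sections, Compatible I E act t s) → s ∈ sections

variable {I E G B}

namespace PrincipalBundle

/-- The maximal smooth structure generated by a compatible family of local sections. -/
def ofAtlas [IsTopologicalAddGroup E] [ContinuousSMul ℝ E] [LocallyConvexSpace ℝ E]
    [SmoothLieGroup E G] (P : Type u) (proj : P → B) (act : P → G → P)
    (act_one : ∀ p, act p 1 = p) (act_mul : ∀ p g k, act (act p g) k = act p (g * k))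
    (proj_act : ∀ p g, proj (act p g) = proj p)
    (existsUnique_act : ∀ p q, proj p = proj q → ∃! g, act p g = q)
    (A : Set (LocalSection proj)) (hA : ∀ x : B, ∃ s ∈ A, x ∈ s.dom)
    (hc : ∀ s ∈ A, ∀ t ∈ A, Compatible I E act s t) : PrincipalBundle I E G B where
  Total := P
  proj := proj
  act := act
  act_one := act_one
  act_mul := act_mul
  proj_act := proj_act
  existsUnique_act := existsUnique_act
  sections := {s | ∀ t ∈ A, Compatible I E act t s}
  exists_section := fun x => by
    obtain ⟨s, hs, hx⟩ := hA x
    exact ⟨s, fun t ht => hc t ht s hs, hx⟩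
  compatible := fun s hs t ht => by
    classical
    have hex : ∀ (x : B) (h : x ∈ s.dom ∧ x ∈ t.dom),
        ∃! g, act (s.toFun ⟨x, h.1⟩) g = t.toFun ⟨x, h.2⟩ := fun x h =>
      existsUnique_act _ _ (by rw [s.proj_toFun, t.proj_toFun])
    refine ⟨fun x => if h : x ∈ s.dom ∧ x ∈ t.dom then (hex x h).choose else 1, ?_, ?_⟩
    · refine SmoothOnTo.of_locally fun x hx => ?_
      obtain ⟨r, hr, hxr⟩ := hA x
      obtain ⟨g₁, hg₁, h₁⟩ := hs r hr
      obtain ⟨g₂, hg₂, h₂⟩ := ht r hr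
      refine ⟨r.dom ∩ (s.dom ∩ t.dom), fun x => (g₁ x)⁻¹ * g₂ x,
        r.dom.2.inter (s.dom.2.inter t.dom.2), ⟨hxr, hx⟩, ?_, ?_⟩
      · exact (hg₁.mono fun y hy => ⟨hy.1, hy.2.1⟩).inv.mul
          (hg₂.mono fun y hy => ⟨hy.1, hy.2.2⟩)
      · rintro y ⟨hyr, hys, hyt⟩
        have hy : y ∈ s.dom ∧ y ∈ t.dom := ⟨hys, hyt⟩
        simp only [dif_pos hy]
        refine ((hex y hy).choose_spec.2 _ ?_).symm
        dsimp only
        rw [← h₁ y hyr hys, ← h₂ y hyr hyt, act_mul, mul_inv_cancel_left]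
    · intro x hxs hxt
      simp only [dif_pos (And.intro hxs hxt)]
      exact (hex x ⟨hxs, hxt⟩).choose_spec.1
  maximal := fun s hs t ht => hs t fun r hr => hc r hr t ht

variable {V' : Type v'} [NormedAddCommGroup V'] [NormedSpace ℝ V'] {H' : Type h'}
  [TopologicalSpace H'] {I' : ModelWithCorners ℝ V' H'} {B' : Type w'} [TopologicalSpace B']
  [ChartedSpace H' B']

/-- `Φ : P → P'` is a morphism of smooth principal bundles over the map `f` of the bases:
it is equivariant, covers `f`, and is smooth, that is, in local trivializations it is given by
smooth `G`-valued functions. -/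
structure IsBundleMap (P : PrincipalBundle I E G B) (P' : PrincipalBundle I' E G B') (f : B → B')
    (Φ : P.Total → P'.Total) : Prop where
  proj_map : ∀ p, P'.proj (Φ p) = f (P.proj p)
  map_act : ∀ p g, Φ (P.act p g) = P'.act (Φ p) g
  smooth : ∀ s ∈ P.sections, ∀ t ∈ P'.sections, ∃ g : B → G,
    SmoothOnTo I E (s.dom ∩ f ⁻¹' t.dom : Set B) g ∧
    ∀ (x : B) (hs : x ∈ s.dom) (ht : f x ∈ t.dom),
      P'.act (t.toFun ⟨f x, ht⟩) (g x) = Φ (s.toFun ⟨x, hs⟩)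

/-- The local section `x ↦ (x, s (f x))` of the pull-back `{(x, p) | f x = proj p}`. -/
def pullbackSection {B : Type} [TopologicalSpace B] {P : Type u} {proj : P → B'} {f : B → B'}
    (hf : Continuous f) (s : LocalSection proj) :
    LocalSection (fun p : {p : ULift.{u} B × P // f p.1.down = proj p.2} => p.1.1.down) where
  dom := ⟨f ⁻¹' (s.dom : Set B'), s.dom.2.preimage hf⟩
  toFun y := ⟨(⟨y⟩, s.toFun ⟨f y, y.2⟩), (s.proj_toFun ⟨f y, y.2⟩).symm⟩
  proj_toFun _ := rfl

variable [IsTopologicalAddGroup E] [ContinuousSMul ℝ E] [LocallyConvexSpace ℝ E]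
  [SmoothLieGroup E G]

/-- The pull-back `f^* P' = {(x, p) | f x = proj p}` (where `x` is lifted to the type universe
of `P'`), with the smooth structure generated by the
local sections `x ↦ (x, s (f x))`, for `s` a smooth local section of `P'`. -/
def pullback {B : Type} [TopologicalSpace B] [ChartedSpace H B]
    (P' : PrincipalBundle I' E G B') (f : B → B') (hf : IsSmoothMap I I' f) :
    PrincipalBundle I E G B :=
  ofAtlas {p : ULift.{u} B × P'.Total // f p.1.down = P'.proj p.2} (fun p => p.1.1.down)
    (fun p g => ⟨(p.1.1, P'.act p.1.2 g), by rw [P'.proj_act]; exact p.2⟩)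
    (fun p => by
      apply Subtype.ext
      simp only [P'.act_one])
    (fun p g k => by simp only [P'.act_mul])
    (fun _ _ => rfl)
    (by
      rintro ⟨⟨⟨x⟩, p⟩, hp⟩ ⟨⟨⟨y⟩, q⟩, hq⟩ (hxy : x = y)
      subst hxy
      obtain ⟨g, hg, hu⟩ := P'.existsUnique_act p q (hp.symm.trans hq)
      refine ⟨g, by simp only [hg], fun k hk => hu k ?_⟩
      have := congrArg (fun z => z.1.2) hk
      exact this)
    (pullbackSection hf.1 '' P'.sections)
    (fun x => by
      obtain ⟨s, hs, hx⟩ := P'.exists_section (f x)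
      exact ⟨_, mem_image_of_mem _ hs, hx⟩)
    (by
      rintro _ ⟨s, hs, rfl⟩ _ ⟨t, ht, rfl⟩
      obtain ⟨g, hg, hg'⟩ := P'.compatible s hs t ht
      refine ⟨fun x => g (f x), SmoothOnTo.comp hf hg, fun x hxs hxt => ?_⟩
      apply Subtype.ext
      exact Prod.ext rfl (hg' (f x) hxs hxt))

theorem pullbackSection_mem {B : Type} [TopologicalSpace B] [ChartedSpace H B]
    (P' : PrincipalBundle I' E G B') (f : B → B') (hf : IsSmoothMap I I' f)
    {s : LocalSection P'.proj} (hs : s ∈ P'.sections) :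
    pullbackSection hf.1 s ∈ (P'.pullback f hf).sections :=
  (P'.pullback f hf).maximal _ fun t ht =>
    (P'.pullback f hf).compatible t ht _ (by
      rintro _ ⟨r, hr, rfl⟩
      obtain ⟨g, hg, hg'⟩ := P'.compatible r hr s hs
      refine ⟨fun x => g (f x), SmoothOnTo.comp hf hg, fun x hxs hxt => ?_⟩
      apply Subtype.ext
      exact Prod.ext rfl (hg' (f x) hxs hxt))

/-- Smoothness of an equivariant map can be checked on suitable local sections. -/
theorem IsBundleMap.of_local {P : PrincipalBundle I E G B} {P' : PrincipalBundle I' E G B'}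
    {f : B → B'} {Φ : P.Total → P'.Total} (hf : IsSmoothMap I I' f)
    (hproj : ∀ p, P'.proj (Φ p) = f (P.proj p)) (hact : ∀ p g, Φ (P.act p g) = P'.act (Φ p) g)
    (hloc : ∀ x, ∃ s ∈ P.sections, ∃ t ∈ P'.sections, ∃ (_ : x ∈ s.dom) (_ : f x ∈ t.dom),
      ∀ (y : B) (hs : y ∈ s.dom) (ht : f y ∈ t.dom), Φ (s.toFun ⟨y, hs⟩) = t.toFun ⟨f y, ht⟩) :
    IsBundleMap P P' f Φ := by
  classical
  refine ⟨hproj, hact, fun s hs t ht => ?_⟩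
  have hex : ∀ (x : B) (h : x ∈ s.dom ∧ f x ∈ t.dom),
      ∃! g, P'.act (t.toFun ⟨f x, h.2⟩) g = Φ (s.toFun ⟨x, h.1⟩) := fun x h =>
    P'.existsUnique_act _ _ (by rw [hproj, s.proj_toFun, t.proj_toFun])
  refine ⟨fun x => if h : x ∈ s.dom ∧ f x ∈ t.dom then (hex x h).choose else 1, ?_, ?_⟩
  · refine SmoothOnTo.of_locally fun x hx => ?_
    obtain ⟨s₀, hs₀, t₀, ht₀, hxs₀, hxt₀, h₀⟩ := hloc x
    obtain ⟨a, ha, ha'⟩ := P.compatible s₀ hs₀ s hs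
    obtain ⟨b, hb, hb'⟩ := P'.compatible t₀ ht₀ t ht
    refine ⟨(s₀.dom ∩ s.dom) ∩ f ⁻¹' (t₀.dom ∩ t.dom), fun x => (b (f x))⁻¹ * a x,
      (s₀.dom.2.inter s.dom.2).inter ((t₀.dom.2.inter t.dom.2).preimage hf.1),
      ⟨⟨hxs₀, hx.1⟩, ⟨hxt₀, hx.2⟩⟩, ?_, ?_⟩
    · exact ((SmoothOnTo.comp hf hb).mono inter_subset_right).inv.mul (ha.mono inter_subset_left)
    · rintro y ⟨⟨hy1, hy2⟩, ⟨hy3, hy4⟩⟩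
      have hy : y ∈ s.dom ∧ f y ∈ t.dom := ⟨hy2, hy4⟩
      simp only [dif_pos hy]
      refine ((hex y hy).choose_spec.2 _ ?_).symm
      dsimp only
      rw [← ha' y hy1 hy2, ← hb' (f y) hy3 hy4, P'.act_mul, mul_inv_cancel_left, hact,
        h₀ y hy1 hy3]
  · intro x hxs hxt
    simp only [dif_pos (And.intro hxs hxt)]
    exact (hex x ⟨hxs, hxt⟩).choose_spec.1

end PrincipalBundle

end Bundles

/-! ### Smooth simplicial sets and simplicial bundles -/

section SmoothSimplicialSets

universe v v₁ v₂ w h b u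

/-- A smooth simplicial set: a contravariant functor to sets from the category whose objects are
the simplices `Δⁿ` and whose morphisms are all the smooth maps of simplices. -/
structure SmoothSSet where
  /-- the `n`-simplices -/
  obj : ℕ → Type v
  /-- the pull-back of simplices along a smooth map -/
  map : ∀ {k n : ℕ}, SimplexMap k n → obj n → obj k
  map_id : ∀ {n : ℕ} (x : obj n), map (SimplexMap.id n) x = x
  map_comp : ∀ {k m n : ℕ} (σ : SimplexMap m n) (τ : SimplexMap k m) (x : obj n),
    map (σ.comp τ) x = map τ (map σ x)

namespace SmoothSSet

/-- A smooth map of smooth simplicial sets. -/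
@[ext]
structure Hom (X : SmoothSSet.{v₁}) (Y : SmoothSSet.{v₂}) where
  /-- the maps on simplices -/
  app : ∀ {n : ℕ}, X.obj n → Y.obj n
  naturality : ∀ {k n : ℕ} (σ : SimplexMap k n) (x : X.obj n), app (X.map σ x) = Y.map σ (app x)

/-- The operators of the underlying simplicial set: restriction along the affine maps. -/
def res (X : SmoothSSet.{v}) {k n : ℕ} (θ : Fin (k + 1) →o Fin (n + 1)) (x : X.obj n) : X.obj k :=
  X.map (SimplexMap.affine θ) x

theorem res_id (X : SmoothSSet.{v}) {n : ℕ} (x : X.obj n) : X.res OrderHom.id x = x := by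
  rw [res, SimplexMap.affine_id, X.map_id]

theorem res_res (X : SmoothSSet.{v}) {k m n : ℕ} (θ : Fin (m + 1) →o Fin (n + 1))
    (η : Fin (k + 1) →o Fin (m + 1)) (x : X.obj n) : X.res η (X.res θ x) = X.res (θ.comp η) x := by
  rw [res, res, res, SimplexMap.affine_comp, X.map_comp]

/-- The smooth simplicial set `Δⁿ_•`, whose `k`-simplices are the smooth maps `Δᵏ → Δⁿ`. -/
def std (n : ℕ) : SmoothSSet.{0} where
  obj k := SimplexMap k n
  map σ x := x.comp σ
  map_id _ := rfl
  map_comp _ _ _ := rfl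

/-- The smooth map `σ_• : Δᵏ_• → Δⁿ_•` induced by a smooth map `σ : Δᵏ → Δⁿ`. -/
def stdMap {k n : ℕ} (σ : SimplexMap k n) : Hom (std k) (std n) where
  app x := σ.comp x
  naturality _ _ := rfl

/-- The smooth map `x_* : Δⁿ_• → X` induced by an `n`-simplex `x` of `X`. -/
def push (X : SmoothSSet.{v}) {n : ℕ} (x : X.obj n) : Hom (std n) X where
  app σ := X.map σ x
  naturality τ σ := X.map_comp σ τ x

/-- Composition of smooth maps. -/
def Hom.comp {X : SmoothSSet.{v}} {Y : SmoothSSet.{v₁}} {Z : SmoothSSet.{v₂}} (g : Hom Y Z)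
    (f : Hom X Y) : Hom X Z where
  app x := g.app (f.app x)
  naturality σ x := by rw [f.naturality, g.naturality]

theorem push_map (X : SmoothSSet.{v}) {k n : ℕ} (σ : SimplexMap k n) (x : X.obj n) :
    X.push (X.map σ x) = (X.push x).comp (stdMap σ) := by
  ext j τ
  exact (X.map_comp σ τ x).symm

/-- The smooth simplicial set `Y_•` of smooth singular simplices of a manifold with corners `Y`. -/
def sing {V : Type v₁} [NormedAddCommGroup V] [NormedSpace ℝ V] {H : Type h} [TopologicalSpace H]
    (I : ModelWithCorners ℝ V H) (Y : Type v) [TopologicalSpace Y] [ChartedSpace H Y] :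
    SmoothSSet.{v} where
  obj n := {σ : Simplex n → Y // IsSmoothMap (simplexModel n) I σ}
  map τ σ := ⟨σ.1 ∘ τ.1, σ.2.comp τ.2⟩
  map_id _ := rfl
  map_comp _ _ _ := rfl

end SmoothSSet

open SmoothSSet PrincipalBundle

variable (E : Type b) [AddCommGroup E] [Module ℝ E] [TopologicalSpace E]
  (G : Type u) [Group G] [TopologicalSpace G] [ChartedSpace E G]

/-- A smooth simplicial `G`-bundle over the smooth simplicial set `X`: a functor which assigns
to every `n`-simplex of `X` a smooth principal `G`-bundle over `Δⁿ`, and to every smooth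
`σ : Δᵏ → Δⁿ` and simplices with `x = σ^* y` a bundle map over `σ` from the bundle of `x` to
the bundle of `y`. -/
structure SimplicialBundle (X : SmoothSSet.{v}) where
  /-- the bundle over a simplex -/
  obj : ∀ {n : ℕ}, X.obj n → PrincipalBundle.{0, 0, 0, b, u} (simplexModel n) E G (Simplex n)
  /-- the bundle maps -/
  map : ∀ {k n : ℕ} (σ : SimplexMap k n) {x : X.obj k} {y : X.obj n}, X.map σ y = x →
    (obj x).Total → (obj y).Total
  isBundleMap : ∀ {k n : ℕ} (σ : SimplexMap k n) {x : X.obj k} {y : X.obj n} (e : X.map σ y = x),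
    IsBundleMap (obj x) (obj y) σ (map σ e)
  map_id : ∀ {n : ℕ} {x : X.obj n} (e : X.map (SimplexMap.id n) x = x) (p : (obj x).Total),
    map (SimplexMap.id n) e p = p
  map_comp : ∀ {k m n : ℕ} (σ : SimplexMap m n) (τ : SimplexMap k m) {x : X.obj k} {y : X.obj m}
    {z : X.obj n} (e : X.map τ y = x) (e' : X.map σ z = y) (e'' : X.map (σ.comp τ) z = x)
    (p : (obj x).Total), map (σ.comp τ) e'' p = map σ e' (map τ e p)

variable {E G}

namespace SimplicialBundle

variable {X : SmoothSSet.{v}} {Y : SmoothSSet.{v₁}}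

/-- Pull-back along a smooth map, by composition of functors. -/
def pullback (P : SimplicialBundle E G Y) (f : Hom X Y) : SimplicialBundle E G X where
  obj x := P.obj (f.app x)
  map σ _ _ e := P.map σ (by rw [← e, f.naturality])
  isBundleMap σ _ _ _ := P.isBundleMap σ _
  map_id _ := P.map_id _
  map_comp σ τ _ _ _ _ _ _ := P.map_comp σ τ _ _ _

/-- A simplicial bundle map (over the identity of the base). -/
structure Map (P Q : SimplicialBundle E G X) where
  /-- the bundle maps over the simplices -/
  app : ∀ {n : ℕ} (x : X.obj n), (P.obj x).Total → (Q.obj x).Total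
  isBundleMap : ∀ {n : ℕ} (x : X.obj n), IsBundleMap (P.obj x) (Q.obj x) id (app x)
  naturality : ∀ {k n : ℕ} (σ : SimplexMap k n) {x : X.obj k} {y : X.obj n} (e : X.map σ y = x)
    (p : (P.obj x).Total), app y (P.map σ e p) = Q.map σ e (app x p)

/-- Two simplicial bundles over `X` are isomorphic. -/
def Isomorphic (P Q : SimplicialBundle E G X) : Prop :=
  ∃ (φ : Map P Q) (ψ : Map Q P), ∀ {n : ℕ} (x : X.obj n),
    Function.LeftInverse (ψ.app x) (φ.app x) ∧ Function.RightInverse (ψ.app x) (φ.app x)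

/-- The simplicial bundle is `𝒰`-small: all its total spaces belong to `𝒰`. -/
def IsSmall (𝒰 : Set (Type u)) (P : SimplicialBundle E G X) : Prop :=
  ∀ {n : ℕ} (x : X.obj n), (P.obj x).Total ∈ 𝒰

end SimplicialBundle

open SimplicialBundle

/-! ### Universes and classifying spaces -/

/-- `𝒰` is a Grothendieck universe, in the language of types: a class of types which is closed under
subsets, products of pairs, power sets, and unions of families indexed by members. It need not
be closed under bijections. (The class of all types in `Type u` is an example.) -/
structure IsGrothendieckUniverse (𝒰 : Set (Type u)) : Prop where
  subtype_mem : ∀ A ∈ 𝒰, ∀ p : A → Prop, {a // p a} ∈ 𝒰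
  prod_mem : ∀ A ∈ 𝒰, ∀ A' ∈ 𝒰, (A × A') ∈ 𝒰
  powerset_mem : ∀ A ∈ 𝒰, Set A ∈ 𝒰
  sigma_mem : ∀ A ∈ 𝒰, ∀ C : A → Type u, (∀ a, C a ∈ 𝒰) → (Σ a, C a) ∈ 𝒰

/-- The Grothendieck universe `𝒰` is `G`-admissible: it contains `G` and all the simplices. -/
structure IsAdmissible (G : Type u) (𝒰 : Set (Type u)) : Prop extends
    IsGrothendieckUniverse 𝒰 where
  group_mem : G ∈ 𝒰
  simplex_mem : ∀ n : ℕ, ULift.{u} (Simplex n) ∈ 𝒰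

variable (E G)

/-- The smooth simplicial set `BG^𝒰`: its `n`-simplices are the `𝒰`-small simplicial `G`-bundles
over `Δⁿ_•`, and smooth maps `σ : Δᵏ → Δⁿ` act by pull-back along `σ_•`. -/
def BG (𝒰 : Set (Type u)) : SmoothSSet.{u + 1} where
  obj n := {P : SimplicialBundle.{0, b, u} E G (std n) // P.IsSmall 𝒰}
  map σ P := ⟨P.1.pullback (stdMap σ), fun x => P.2 ((stdMap σ).app x)⟩
  map_id _ := rfl
  map_comp _ _ _ := rfl

/-- The universal simplicial `G`-bundle `EG^𝒰` over `BG^𝒰`: the bundle over the simplex `P` of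
`BG^𝒰` is the value of the functor `P` at the identity of `Δⁿ`. -/
def EG (𝒰 : Set (Type u)) : SimplicialBundle E G (BG E G 𝒰) where
  obj {n} P := P.1.obj (SimplexMap.id n)
  map {k n} σ P Q e := match P, e with
    | _, rfl => Q.1.map (x := σ.comp (SimplexMap.id k)) (y := SimplexMap.id n) σ rfl
  isBundleMap {k n} σ P Q e := by
    subst e
    exact Q.1.isBundleMap (x := σ.comp (SimplexMap.id k)) (y := SimplexMap.id n) σ rfl
  map_id {n} P e p := P.1.map_id (x := SimplexMap.id n) rfl p
  map_comp {k m n} σ τ P Q R e e' e'' p := by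
    subst e'
    subst e
    exact R.1.map_comp (x := (σ.comp τ).comp (SimplexMap.id k)) (y := σ.comp (SimplexMap.id m))
      (z := SimplexMap.id n) σ τ rfl rfl rfl p

variable {E G}

/-- The classifying map `f_P : X → BG^𝒰` of a `𝒰`-small simplicial bundle `P` over `X`, which sends
the simplex `x` to the pull-back of `P` along `x_*`. -/
def classifyingMap {𝒰 : Set (Type u)} {X : SmoothSSet.{v}} (P : SimplicialBundle E G X)
    (hP : P.IsSmall 𝒰) : Hom X (BG E G 𝒰) where
  app x := ⟨P.pullback (X.push x), fun y => hP ((X.push x).app y)⟩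
  naturality σ x := by
    apply Subtype.ext
    change P.pullback (X.push (X.map σ x)) = P.pullback ((X.push x).comp (stdMap σ))
    rw [push_map]

/-- The smooth map `f : X → BG^𝒰` classifies `P` if `f^* EG^𝒰` is isomorphic to `P`. -/
def Classifies {𝒰 : Set (Type u)} {X : SmoothSSet.{v}} (f : Hom X (BG E G 𝒰))
    (P : SimplicialBundle E G X) : Prop :=
  Isomorphic ((EG E G 𝒰).pullback f) P

theorem EG_map_pullback {𝒰 : Set (Type u)} {X : SmoothSSet.{v}} (P : SimplicialBundle E G X)
    (hP : P.IsSmall 𝒰) {k n : ℕ} (σ : SimplexMap k n) (F : Hom (std k) X) (F' : Hom (std n) X)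
    (hF : F'.comp (stdMap σ) = F)
    (e : (BG E G 𝒰).map σ ⟨P.pullback F', fun x => hP (F'.app x)⟩ =
      ⟨P.pullback F, fun x => hP (F.app x)⟩)
    (e' : X.map σ (F'.app (SimplexMap.id n)) = F.app (SimplexMap.id k))
    (p : (P.obj (F.app (SimplexMap.id k))).Total) :
    (EG E G 𝒰).map σ e p = P.map σ e' p := by
  subst hF
  rfl

/-- Every `𝒰`-small simplicial bundle is classified by its classifying map. -/
theorem classifies_classifyingMap {𝒰 : Set (Type u)} {X : SmoothSSet.{v}}
    (P : SimplicialBundle E G X) (hP : P.IsSmall 𝒰) : Classifies (classifyingMap P hP) P := by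
  have e : ∀ {n : ℕ} (x : X.obj n),
      X.map (SimplexMap.id n) x = X.map (SimplexMap.id n) x := fun x => rfl
  have e' : ∀ {n : ℕ} (x : X.obj n),
      X.map (SimplexMap.id n) (X.map (SimplexMap.id n) x) = x := fun x => by
    rw [X.map_id, X.map_id]
  have he : ∀ {k n : ℕ} (σ : SimplexMap k n) {x : X.obj k} {y : X.obj n}, X.map σ y = x →
      X.map σ (X.map (SimplexMap.id n) y) = X.map (SimplexMap.id k) x := fun σ x y h => by
    rw [X.map_id, X.map_id, h]
  have hm : ∀ {k n : ℕ} (σ : SimplexMap k n) {x : X.obj k} {y : X.obj n} (h : X.map σ y = x)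
      (p : (P.obj (X.map (SimplexMap.id k) x)).Total),
      ((EG E G 𝒰).pullback (classifyingMap P hP)).map σ h p = P.map σ (he σ h) p :=
    fun {k n} σ x y h p =>
      EG_map_pullback P hP σ (X.push x) (X.push y) (by rw [← h, push_map]) _ (he σ h) p
  have hd : ∀ {k n : ℕ} (σ : SimplexMap k n) {x : X.obj k} {y : X.obj n}, X.map σ y = x →
      X.map σ y = X.map (SimplexMap.id k) x := fun σ x y h => by
    rw [X.map_id, h]
  have hc : ∀ {k n : ℕ} (σ : SimplexMap k n) {x : X.obj k} {y : X.obj n}, X.map σ y = x →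
      X.map σ (X.map (SimplexMap.id n) y) = x := fun σ x y h => by
    rw [X.map_id, h]
  refine ⟨⟨fun {n} x => P.map (SimplexMap.id n) (e x),
      fun {n} x => P.isBundleMap (SimplexMap.id n) (e x), fun {k n} σ x y h p => ?_⟩,
    ⟨fun {n} x => P.map (SimplexMap.id n) (e' x),
      fun {n} x => P.isBundleMap (SimplexMap.id n) (e' x), fun {k n} σ x y h p => ?_⟩,
    fun {n} x => ⟨fun p => ?_, fun p => ?_⟩⟩
  · exact (congrArg (P.map (SimplexMap.id n) (e y)) (hm σ h p)).trans
      ((P.map_comp (SimplexMap.id n) σ (he σ h) (e y) (hd σ h) p).symm.trans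
        (P.map_comp σ (SimplexMap.id k) (e x) h (hd σ h) p))
  · exact (P.map_comp (SimplexMap.id n) σ h (e' y) (hc σ h) p).symm.trans
      ((P.map_comp σ (SimplexMap.id k) (e' x) (he σ h) (hc σ h) p).trans (hm σ h _).symm)
  · exact (P.map_comp (SimplexMap.id n) (SimplexMap.id n) (e x) (e' x) _ p).symm.trans
      (P.map_id (X.map_id _) p)
  · exact (P.map_comp (SimplexMap.id n) (SimplexMap.id n) (e' x) (e x) (X.map_id _) p).symm.trans
      (P.map_id (X.map_id _) p)

/-- The simplicial bundle `Z_•` over `Y_•` induced by a smooth principal bundle `Z` over the manifold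
`Y`: its value at `σ : Δⁿ → Y` is `σ^* Z`. -/
def induced [IsTopologicalAddGroup E] [ContinuousSMul ℝ E] [LocallyConvexSpace ℝ E]
    [SmoothLieGroup E G] {V : Type v₁} [NormedAddCommGroup V] [NormedSpace ℝ V] {H : Type h}
    [TopologicalSpace H] {I : ModelWithCorners ℝ V H} {Y : Type v} [TopologicalSpace Y]
    [ChartedSpace H Y] (Z : PrincipalBundle I E G Y) : SimplicialBundle E G (sing I Y) where
  obj σ := Z.pullback σ.1 σ.2
  map {k n} τ σ σ' e q := ⟨(⟨τ q.1.1.down⟩, q.1.2), by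
    subst e
    exact q.2⟩
  isBundleMap {k n} τ σ σ' e := by
    subst e
    refine IsBundleMap.of_local τ.2 (fun _ => rfl) (fun _ _ => rfl) fun x => ?_
    obtain ⟨r, hr, hx⟩ := Z.exists_section (σ'.1 (τ x))
    exact ⟨_, Z.pullbackSection_mem _ (σ'.2.comp τ.2) hr, _, Z.pullbackSection_mem _ σ'.2 hr, hx,
      hx, fun _ _ _ => rfl⟩
  map_id _ _ := rfl
  map_comp := by
    intros
    rfl

theorem induced_isSmall [IsTopologicalAddGroup E] [ContinuousSMul ℝ E] [LocallyConvexSpace ℝ E]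
    [SmoothLieGroup E G] {V : Type v₁} [NormedAddCommGroup V] [NormedSpace ℝ V] {H : Type h}
    [TopologicalSpace H] {I : ModelWithCorners ℝ V H} {Y : Type v} [TopologicalSpace Y]
    [ChartedSpace H Y] (Z : PrincipalBundle I E G Y) {𝒰 : Set (Type u)} (hU : IsAdmissible G 𝒰)
    (hZ : Z.Total ∈ 𝒰) : (induced Z).IsSmall 𝒰 :=
  fun {n} _ => hU.subtype_mem _ (hU.prod_mem _ (hU.simplex_mem n) _ hZ) _

end SmoothSimplicialSets

/-! ### The cohomology algebra of a simplicial set -/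

section Cohomology

universe v v₁ v₂

/-- The real `n`-cochains of (the underlying simplicial set of) `X`. -/
def Cochain (X : SmoothSSet.{v}) (n : ℕ) : Type v := X.obj n → ℝ

namespace Cochain

variable {X : SmoothSSet.{v}} {Y : SmoothSSet.{v₁}}

instance (n : ℕ) : AddCommGroup (Cochain X n) := inferInstanceAs (AddCommGroup (X.obj n → ℝ))

instance (n : ℕ) : Module ℝ (Cochain X n) := inferInstanceAs (Module ℝ (X.obj n → ℝ))

/-- The inclusion `{0, …, m} → {0, …, n}`, `i ↦ a + i`. -/
def incl (a m n : ℕ) (h : a + m ≤ n) : Fin (m + 1) →o Fin (n + 1) where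
  toFun i := ⟨a + i, by omega⟩
  monotone' i j hij := by
    have : (i : ℕ) ≤ j := hij
    simp only [Fin.mk_le_mk]
    omega

/-- The injective monotone map `{0, …, n} → {0, …, n + 1}` which misses the value `i`. -/
def face (n i : ℕ) : Fin (n + 1) →o Fin (n + 2) where
  toFun j := ⟨if (j : ℕ) < i then j else j + 1, by split_ifs <;> omega⟩
  monotone' j k hjk := by
    have : (j : ℕ) ≤ k := hjk
    simp only [Fin.mk_le_mk]
    grind

theorem incl_apply {a m n : ℕ} (h : a + m ≤ n) (i : Fin (m + 1)) :
    (incl a m n h i : ℕ) = a + i := rfl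

theorem face_apply (n i : ℕ) (j : Fin (n + 1)) :
    (face n i j : ℕ) = if (j : ℕ) < i then (j : ℕ) else j + 1 := rfl

theorem res_congr {k n : ℕ} {θ η : Fin (k + 1) →o Fin (n + 1)} (h : ∀ i, (θ i : ℕ) = η i)
    (x : X.obj n) : X.res θ x = X.res η x := by
  have : θ = η := by
    ext i
    exact h i
  rw [this]

/-- The cup product `(a ∪ b)(x) = a (front p-face of x) * b (back q-face of x)`. -/
def cup {p q n : ℕ} (h : p + q = n) (a : Cochain X p) (b : Cochain X q) : Cochain X n := fun x =>
  a (X.res (incl 0 p n (by omega)) x) * b (X.res (incl p q n (by omega)) x)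

/-- The coboundary `(δ a)(x) = ∑ᵢ (-1)ⁱ a (dᵢ x)`. -/
def coboundary (n : ℕ) : Cochain X n →ₗ[ℝ] Cochain X (n + 1) where
  toFun a x := ∑ i ∈ Finset.range (n + 2), (-1) ^ i * a (X.res (face n i) x)
  map_add' a b := by
    funext x
    change ∑ i ∈ _, (-1) ^ i * (a _ + b _) = (∑ i ∈ _, _) + ∑ i ∈ _, _
    simp only [mul_add, Finset.sum_add_distrib]
  map_smul' r a := by
    funext x
    change ∑ i ∈ _, (-1) ^ i * (r * a _) = r * ∑ i ∈ _, _
    rw [Finset.mul_sum]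
    exact Finset.sum_congr rfl fun i _ => by ring

/-- The pull-back of cochains. -/
def comap (f : X.Hom Y) (n : ℕ) : Cochain Y n →ₗ[ℝ] Cochain X n where
  toFun a x := a (f.app x)
  map_add' _ _ := rfl
  map_smul' _ _ := rfl

/-- The unit cochain. -/
def unit : Cochain X 0 := fun _ => 1

theorem incl_zero (n : ℕ) : incl 0 n n (by omega) = OrderHom.id := by
  ext i
  simp [incl]

theorem cup_assoc {p q r m l n : ℕ} (h₁ : p + q = m) (h₂ : m + r = n) (h₃ : q + r = l)
    (h₄ : p + l = n) (a : Cochain X p) (b : Cochain X q) (c : Cochain X r) :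
    cup h₂ (cup h₁ a b) c = cup h₄ a (cup h₃ b c) := by
  funext x
  simp only [cup, SmoothSSet.res_res, mul_assoc]
  refine congrArg₂ _ (congrArg a (res_congr (fun i => ?_) x))
    (congrArg₂ _ (congrArg b (res_congr (fun i => ?_) x)) (congrArg c (res_congr (fun i => ?_) x)))
  all_goals
    simp only [OrderHom.comp_coe, Function.comp_apply, incl_apply]
    omega

theorem unit_cup {p n : ℕ} (h : 0 + p = n) (h' : n = p) (a : Cochain X p) :
    cup h unit a = h' ▸ a := by
  subst h'
  funext x
  simp only [cup, unit, one_mul, incl_zero, SmoothSSet.res_id]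

theorem cup_unit {p : ℕ} (a : Cochain X p) : cup (Nat.add_zero p) a unit = a := by
  funext x
  simp only [cup, unit, mul_one, incl_zero, SmoothSSet.res_id]

theorem mk_cup {p q n : ℕ} (h : p + q = n) (a : Cochain X p) (b : Cochain X q) :
    (GradedMonoid.mk (p + q) (cup rfl a b) : GradedMonoid (Cochain X)) =
      GradedMonoid.mk n (cup h a b) := by
  subst h
  rfl

instance : GradedMonoid.GMul (Cochain X) where
  mul a b := cup rfl a b

instance : GradedMonoid.GOne (Cochain X) where
  one := unit

instance : DirectSum.GRing (Cochain X) where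
  mul_zero a := by
    funext x
    exact mul_zero _
  zero_mul a := by
    funext x
    exact zero_mul _
  mul_add a b c := by
    funext x
    exact mul_add _ _ _
  add_mul a b c := by
    funext x
    exact add_mul _ _ _
  one_mul := fun ⟨p, a⟩ => by
    change GradedMonoid.mk (0 + p) (cup rfl unit a) = GradedMonoid.mk p a
    rw [mk_cup (Nat.zero_add p), unit_cup (Nat.zero_add p) rfl]
  mul_one := fun ⟨p, a⟩ => by
    change GradedMonoid.mk (p + 0) (cup rfl a unit) = GradedMonoid.mk p a
    rw [mk_cup (Nat.add_zero p), cup_unit]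
  mul_assoc := fun ⟨p, a⟩ ⟨q, b⟩ ⟨r, c⟩ => by
    change GradedMonoid.mk (p + q + r) (cup rfl (cup rfl a b) c) =
      GradedMonoid.mk (p + (q + r)) (cup rfl a (cup rfl b c))
    rw [mk_cup (Nat.add_assoc p q r), cup_assoc rfl _ rfl rfl]
  natCast n := fun _ => n
  natCast_zero := by
    funext x
    exact Nat.cast_zero
  natCast_succ n := by
    funext x
    exact Nat.cast_succ n
  intCast n := fun _ => n
  intCast_ofNat n := by
    funext x
    exact Int.cast_natCast n
  intCast_negSucc_ofNat n := by
    funext x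
    exact Int.cast_negSucc n

/-- The constant `0`-cochains. -/
def constant (r : ℝ) : Cochain X 0 := fun _ => r

instance : DirectSum.GAlgebra ℝ (Cochain X) where
  toFun :=
    { toFun := constant
      map_zero' := rfl
      map_add' := fun _ _ => rfl }
  map_one := rfl
  map_mul r s := by
    rfl
  commutes r := fun ⟨p, a⟩ => by
    change GradedMonoid.mk (0 + p) (cup rfl (constant r) a) =
      GradedMonoid.mk (p + 0) (cup rfl a (constant r))
    rw [mk_cup (Nat.zero_add p), mk_cup (Nat.add_zero p)]
    congr 1
    funext x
    simp only [cup, incl_zero, SmoothSSet.res_id]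
    exact mul_comm _ _
  smul_def r := fun ⟨p, a⟩ => by
    change GradedMonoid.mk p (r • a) = GradedMonoid.mk (0 + p) (cup rfl (constant r) a)
    rw [mk_cup (Nat.zero_add p)]
    congr 1
    funext x
    simp only [cup, incl_zero, SmoothSSet.res_id]
    rfl

/-- The coboundary is a graded derivation. -/
theorem coboundary_cup {p q n : ℕ} (h : p + q = n) (a : Cochain X p) (b : Cochain X q) :
    coboundary n (cup h a b) = cup (by omega : p + 1 + q = n + 1) (coboundary p a) b +
      (-1 : ℝ) ^ p • cup (by omega : p + (q + 1) = n + 1) a (coboundary q b) := by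
  subst h
  funext x
  change ∑ i ∈ Finset.range (p + q + 2), (-1) ^ i * (cup rfl a b) (X.res (face _ i) x) =
    (∑ i ∈ Finset.range (p + 2), (-1) ^ i * a (X.res (face _ i) (X.res _ x))) * b (X.res _ x) +
    (-1 : ℝ) ^ p * (a (X.res _ x) *
      ∑ i ∈ Finset.range (q + 2), (-1) ^ i * b (X.res (face _ i) (X.res _ x)))
  rw [Finset.sum_range_succ (n := p + 1), Finset.sum_range_succ' (n := q + 1),
    show p + q + 2 = (p + 1) + (q + 1) by omega, Finset.sum_range_add]
  simp only [cup, SmoothSSet.res_res, add_mul, mul_add, Finset.sum_mul, Finset.mul_sum]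
  have h1 : ∀ i ∈ Finset.range (p + 1),
      (-1 : ℝ) ^ i * (a (X.res ((face (p + q) i).comp (incl 0 p (p + q) (by omega))) x) *
        b (X.res ((face (p + q) i).comp (incl p q (p + q) (by omega))) x)) =
      (-1) ^ i * a (X.res ((incl 0 (p + 1) (p + q + 1) (by omega)).comp (face p i)) x) *
        b (X.res (incl (p + 1) q (p + q + 1) (by omega)) x) := by
    intro i hi
    rw [Finset.mem_range] at hi
    rw [mul_assoc]
    congr 3
    · refine res_congr (fun j => ?_) x
      simp only [OrderHom.comp_coe, Function.comp_apply, incl_apply, face_apply]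
      grind
    · refine res_congr (fun j => ?_) x
      simp only [OrderHom.comp_coe, Function.comp_apply, incl_apply, face_apply]
      grind
  have h2 : ∀ j ∈ Finset.range (q + 1),
      (-1 : ℝ) ^ (p + 1 + j) *
        (a (X.res ((face (p + q) (p + 1 + j)).comp (incl 0 p (p + q) (by omega))) x) *
        b (X.res ((face (p + q) (p + 1 + j)).comp (incl p q (p + q) (by omega))) x)) =
      (-1) ^ p * (a (X.res (incl 0 p (p + q + 1) (by omega)) x) * ((-1) ^ (j + 1) *
        b (X.res ((incl p (q + 1) (p + q + 1) (by omega)).comp (face q (j + 1))) x))) := by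
    intro j hj
    rw [show (-1 : ℝ) ^ (p + 1 + j) = (-1) ^ p * (-1) ^ (j + 1) by ring, mul_assoc]
    have e1 : a (X.res ((face (p + q) (p + 1 + j)).comp (incl 0 p (p + q) (by omega))) x) =
        a (X.res (incl 0 p (p + q + 1) (by omega)) x) := by
      congr 1
      refine res_congr (fun i => ?_) x
      simp only [OrderHom.comp_coe, Function.comp_apply, incl_apply, face_apply]
      grind
    have e2 : b (X.res ((face (p + q) (p + 1 + j)).comp (incl p q (p + q) (by omega))) x) =
        b (X.res ((incl p (q + 1) (p + q + 1) (by omega)).comp (face q (j + 1))) x) := by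
      congr 1
      refine res_congr (fun i => ?_) x
      simp only [OrderHom.comp_coe, Function.comp_apply, incl_apply, face_apply]
      grind
    rw [e1, e2]
    ring
  rw [Finset.sum_congr rfl h1, Finset.sum_congr rfl h2]
  have e3 : a (X.res ((incl 0 (p + 1) (p + q + 1) (by omega)).comp (face p (p + 1))) x) =
      a (X.res (incl 0 p (p + q + 1) (by omega)) x) := by
    congr 1
    refine res_congr (fun i => ?_) x
    simp only [OrderHom.comp_coe, Function.comp_apply, incl_apply, face_apply]
    grind
  have e4 : b (X.res ((incl p (q + 1) (p + q + 1) (by omega)).comp (face q 0)) x) =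
      b (X.res (incl (p + 1) q (p + q + 1) (by omega)) x) := by
    congr 1
    refine res_congr (fun i => ?_) x
    simp only [OrderHom.comp_coe, Function.comp_apply, incl_apply, face_apply]
    grind
  rw [e3, e4]
  ring

theorem coboundary_unit : coboundary 0 (unit : Cochain X 0) = 0 := by
  funext x
  change ∑ i ∈ Finset.range 2, (-1 : ℝ) ^ i * 1 = 0
  norm_num [Finset.sum_range_succ]

theorem coboundary_comap (f : X.Hom Y) {n : ℕ} (a : Cochain Y n) :
    coboundary n (comap f n a) = comap f (n + 1) (coboundary n a) := by
  funext x
  change ∑ i ∈ Finset.range (n + 2), (-1 : ℝ) ^ i * a (f.app (X.res (face n i) x)) =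
    ∑ i ∈ Finset.range (n + 2), (-1 : ℝ) ^ i * a (Y.res (face n i) (f.app x))
  simp only [SmoothSSet.res, f.naturality]

end Cochain

open Cochain

/-- The graded algebra of real cochains, with the cup product. -/
abbrev Cochains (X : SmoothSSet.{v}) : Type v := ⨁ n, Cochain X n

variable (X : SmoothSSet.{v})

/-- The differential of the cochain algebra. -/
def differential : Cochains X →ₗ[ℝ] Cochains X :=
  DirectSum.toModule ℝ ℕ _ fun n => (DirectSum.lof ℝ ℕ (Cochain X) (n + 1)).comp (coboundary n)

/-- The sign involution, `(-1)ⁿ` in degree `n`. -/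
def signInvolution : Cochains X →ₗ[ℝ] Cochains X :=
  DirectSum.toModule ℝ ℕ _ fun n => (-1 : ℝ) ^ n • DirectSum.lof ℝ ℕ (Cochain X) n

variable {X}

theorem differential_of {n : ℕ} (a : Cochain X n) :
    differential X (DirectSum.of _ n a) = DirectSum.of _ (n + 1) (coboundary n a) :=
  DirectSum.toModule_lof ℝ n a

theorem signInvolution_of {n : ℕ} (a : Cochain X n) :
    signInvolution X (DirectSum.of _ n a) = (-1 : ℝ) ^ n • DirectSum.of _ n a :=
  DirectSum.toModule_lof ℝ n a

theorem of_cup {p q n : ℕ} (h : p + q = n) (a : Cochain X p) (b : Cochain X q) :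
    (DirectSum.of (Cochain X) n (cup h a b) : Cochains X) =
      DirectSum.of _ p a * DirectSum.of _ q b := by
  subst h
  exact (DirectSum.of_mul_of a b).symm

theorem of_smul' {n : ℕ} (r : ℝ) (a : Cochain X n) :
    (DirectSum.of (Cochain X) n (r • a) : Cochains X) = r • DirectSum.of _ n a :=
  (DirectSum.lof ℝ ℕ (Cochain X) n).map_smul r a

theorem signInvolution_signInvolution (a : Cochains X) :
    signInvolution X (signInvolution X a) = a := by
  induction a using DirectSum.induction_on with
  | zero => simp
  | of n a => simp [signInvolution_of, smul_smul, ← mul_pow]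
  | add a b ha hb => rw [map_add, map_add, ha, hb]

theorem differential_signInvolution (a : Cochains X) :
    differential X (signInvolution X a) = -signInvolution X (differential X a) := by
  induction a using DirectSum.induction_on with
  | zero => simp
  | of n a => simp [signInvolution_of, differential_of, pow_succ]
  | add a b ha hb => simp only [map_add, ha, hb, neg_add]

theorem differential_mul (a b : Cochains X) :
    differential X (a * b) = differential X a * b + signInvolution X a * differential X b := by
  induction a using DirectSum.induction_on with
  | zero => simp
  | add a a' ha ha' =>
    simp only [map_add, add_mul, ha, ha']
    abel
  | of p a =>
    induction b using DirectSum.induction_on with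
    | zero => simp
    | add b b' hb hb' =>
      simp only [map_add, mul_add, hb, hb']
      abel
    | of q b =>
      rw [← of_cup rfl, differential_of, coboundary_cup, map_add, of_smul', of_cup, of_cup,
        differential_of, differential_of, signInvolution_of, smul_mul_assoc]

theorem differential_one : differential X 1 = 0 := by
  have : (1 : Cochains X) = DirectSum.of (Cochain X) 0 unit := rfl
  rw [this, differential_of, coboundary_unit, map_zero]

variable (X)

/-- The algebra of cocycles. -/
def cocycles : Subalgebra ℝ (Cochains X) where
  carrier := {a | differential X a = 0}
  mul_mem' {a b} ha hb := by
    change differential X (a * b) = 0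
    change differential X a = 0 at ha
    change differential X b = 0 at hb
    rw [differential_mul, ha, hb, zero_mul, mul_zero, add_zero]
  add_mem' {a b} ha hb := by
    change differential X (a + b) = 0
    change differential X a = 0 at ha
    change differential X b = 0 at hb
    rw [map_add, ha, hb, add_zero]
  algebraMap_mem' r := by
    change differential X (algebraMap ℝ _ r) = 0
    rw [Algebra.algebraMap_eq_smul_one, map_smul, differential_one, smul_zero]

/-- The ideal of coboundaries in the algebra of cocycles. -/
def coboundaries : Ideal (cocycles X) where
  carrier := {z | ∃ c, differential X c = z.1}
  add_mem' := by
    rintro a b ⟨c, hc⟩ ⟨c', hc'⟩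
    exact ⟨c + c', by rw [map_add, hc, hc']; rfl⟩
  zero_mem' := ⟨0, map_zero _⟩
  smul_mem' := by
    rintro ⟨z, hz⟩ a ⟨c, hc⟩
    change differential X z = 0 at hz
    refine ⟨signInvolution X z * c, ?_⟩
    rw [differential_mul, differential_signInvolution, hz, signInvolution_signInvolution, hc,
      map_zero, neg_zero, zero_mul, zero_add]
    rfl

instance : (coboundaries X).IsTwoSided where
  mul_mem_of_left := by
    rintro a ⟨z, hz⟩ ⟨c, hc⟩
    change differential X z = 0 at hz
    refine ⟨c * z, ?_⟩
    rw [differential_mul, hz, mul_zero, add_zero, hc]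
    rfl

/-- The cohomology algebra `H^*(X, ℝ)` of the underlying simplicial set of `X`. -/
abbrev Cohomology : Type v := cocycles X ⧸ coboundaries X

variable {X}

/-- `c` is the cohomology class of the cochain `a`, which is a cocycle. -/
def IsClassOf (c : Cohomology X) {n : ℕ} (a : Cochain X n) : Prop :=
  ∃ h : DirectSum.of (Cochain X) n a ∈ cocycles X, c = Ideal.Quotient.mk (coboundaries X) ⟨_, h⟩

variable {Y : SmoothSSet.{v₁}}

/-- The pull-back of cochains, as a homomorphism of algebras. -/
def cochainsMap (f : X.Hom Y) : Cochains Y →ₐ[ℝ] Cochains X :=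
  DirectSum.toAlgebra ℝ (Cochain Y)
    (fun n => (DirectSum.lof ℝ ℕ (Cochain X) n).comp (comap f n)) rfl (by
      intro p q a b
      change DirectSum.of (Cochain X) (p + q) (comap f _ (cup rfl a b)) =
        DirectSum.of (Cochain X) p (comap f p a) * DirectSum.of (Cochain X) q (comap f q b)
      rw [← of_cup rfl]
      congr 1
      funext x
      change a (Y.res _ (f.app x)) * b (Y.res _ (f.app x)) =
        a (f.app (X.res _ x)) * b (f.app (X.res _ x))
      simp only [SmoothSSet.res, f.naturality])

theorem cochainsMap_of (f : X.Hom Y) {n : ℕ} (a : Cochain Y n) :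
    cochainsMap f (DirectSum.of _ n a) = DirectSum.of _ n (comap f n a) :=
  DirectSum.toAddMonoid_of
    (fun n => ((DirectSum.lof ℝ ℕ (Cochain X) n).comp (comap f n)).toAddMonoidHom) n a

theorem differential_cochainsMap (f : X.Hom Y) (a : Cochains Y) :
    differential X (cochainsMap f a) = cochainsMap f (differential Y a) := by
  induction a using DirectSum.induction_on with
  | zero => simp
  | of n a => rw [cochainsMap_of, differential_of, differential_of, cochainsMap_of, coboundary_comap]
  | add a b ha hb => simp only [map_add, ha, hb]

/-- The pull-back of cocycles. -/
def cocyclesMap (f : X.Hom Y) : cocycles Y →ₐ[ℝ] cocycles X :=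
  ((cochainsMap f).comp (cocycles Y).val).codRestrict (cocycles X) fun z => by
    have hz : differential Y z.1 = 0 := z.2
    change differential X (cochainsMap f z.1) = 0
    rw [differential_cochainsMap, hz, map_zero]

/-- The pull-back `f^* : H^*(Y, ℝ) → H^*(X, ℝ)` in cohomology. -/
def cohomologyMap (f : X.Hom Y) : Cohomology Y →ₐ[ℝ] Cohomology X :=
  Ideal.Quotient.liftₐ (coboundaries Y)
    ((Ideal.Quotient.mkₐ ℝ (coboundaries X)).comp (cocyclesMap f)) (by
      rintro z ⟨c, hc⟩
      refine Ideal.Quotient.eq_zero_iff_mem.2 ⟨cochainsMap f c, ?_⟩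
      rw [differential_cochainsMap, hc]
      rfl)

end Cohomology

/-! ### Lie algebra -/

section LieAlgebra

universe b u

variable (E : Type b) [AddCommGroup E] [Module ℝ E] [TopologicalSpace E]
  {G : Type u} [Group G] [TopologicalSpace G] [ChartedSpace E G]

/-- The curve `t ↦ φ⁻¹ (φ 1 + t v)` through `1`, for `φ` the preferred chart at `1`. The derivative
of `φ` at `1` identifies the Lie algebra `𝔤 = T₁ G` with the model space `E`, and under
this identification the curve has the velocity `v`. -/
def chartCurve (v : E) (t : ℝ) : G :=
  (chartAt E (1 : G)).symm (chartAt E (1 : G) 1 + t • v)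

/-- The adjoint action of `G` on `𝔤 = E`: the derivative at `1` of `k ↦ g k g⁻¹`. -/
def Ad (g : G) (w : E) : E :=
  deriv (fun t : ℝ => chartAt E (1 : G) (g * chartCurve E w t * g⁻¹)) 0

variable (G) in
/-- The Lie bracket of `𝔤 = E`: the derivative at `1` of the adjoint action. -/
def bracket (v w : E) : E := deriv (fun t : ℝ => Ad E (chartCurve E v t : G) w) 0

/-- The left logarithmic derivative `g⁻¹ dg` at the point `x`, in the direction `v`. -/
def logDeriv {n : ℕ} (g : Simplex n → G) (x : Simplex n) (v : Fin n → ℝ) : E :=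
  fderivWithin ℝ (fun y => chartAt E (1 : G) ((g x)⁻¹ * g (retract n y))) (Simplex n) x v

/-- The symmetric, `Ad`-invariant multilinear functionals `𝔤 × ⋯ × 𝔤 → ℝ`. -/
structure IsInvariant {k : ℕ} (G : Type u) [Group G] [TopologicalSpace G] [ChartedSpace E G]
    (ρ : ContinuousMultilinearMap ℝ (fun _ : Fin k => E) ℝ) : Prop where
  symm : ∀ (σ : Equiv.Perm (Fin k)) (v : Fin k → E), ρ (fun i => v (σ i)) = ρ v
  map_Ad : ∀ (g : G) (v : Fin k → E), ρ (fun i => Ad E g (v i)) = ρ v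

end LieAlgebra

/-! ### Connections and the Chern–Weil cochains -/

section Connections

universe v b u

variable {E : Type b} [AddCommGroup E] [Module ℝ E] [TopologicalSpace E]
  {G : Type u} [Group G] [TopologicalSpace G] [ChartedSpace E G]

/-- The derivative of a map of simplices. -/
def tangentMap {k n : ℕ} (f : Simplex k → Simplex n) (x : Simplex k) (v : Fin k → ℝ) : Fin n → ℝ :=
  fderivWithin ℝ (fun y => (f (retract k y) : Fin n → ℝ)) (Simplex k) x v

/-- A family of `𝔤`-valued one-forms on `Δⁿ`, one for every local section of `proj`. -/
abbrev FormFamily {n : ℕ} {P : Type u} (proj : P → Simplex n) (E : Type b) [AddCommGroup E]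
    [Module ℝ E] : Type (max b u) :=
  LocalSection proj → Simplex n → (Fin n → ℝ) →ₗ[ℝ] E

/-- For a bundle map `Φ : P → P'` over `f`, the family `A` of local gauge potentials on `P` is the
pull-back of the family `A'` on `P'`: if `Φ (s x) = t (f x) · g x`, then
`A s = Ad (g⁻¹) (f^* (A' t)) + g⁻¹ dg`. -/
def IsPullbackForm {k n : ℕ} {P : PrincipalBundle (simplexModel k) E G (Simplex k)}
    {P' : PrincipalBundle (simplexModel n) E G (Simplex n)} (A : FormFamily P.proj E)
    (A' : FormFamily P'.proj E) (f : Simplex k → Simplex n) (Φ : P.Total → P'.Total) : Prop :=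
  ∀ s ∈ P.sections, ∀ t ∈ P'.sections, ∀ g : Simplex k → G,
    (∀ (x : Simplex k) (hs : x ∈ s.dom) (ht : f x ∈ t.dom),
      P'.act (t.toFun ⟨f x, ht⟩) (g x) = Φ (s.toFun ⟨x, hs⟩)) →
    ∀ x ∈ s.dom, f x ∈ t.dom → ∀ v : Fin k → ℝ,
      A s x v = Ad E (g x)⁻¹ (A' t (f x) (tangentMap f x v)) + logDeriv E g x v

/-- A smooth `G`-invariant Ehresmann connection on a principal bundle over `Δⁿ`. It is given by
the pull-backs of the connection one-form along the smooth local sections of the bundle (the local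
gauge potentials), which are smooth `𝔤`-valued one-forms, related by the gauge transformation rule.
(Only the values at smooth local sections, on their domains, have a meaning.) -/
structure Connection {n : ℕ} (P : PrincipalBundle (simplexModel n) E G (Simplex n)) where
  /-- the local gauge potentials -/
  form : FormFamily P.proj E
  smooth : ∀ s ∈ P.sections, ∀ v : Fin n → ℝ,
    SmoothOnTo (simplexModel n) E (s.dom : Set (Simplex n)) fun x => form s x v
  gauge : IsPullbackForm form form id id

namespace Connection

variable {n : ℕ} {P : PrincipalBundle (simplexModel n) E G (Simplex n)}

/-- The curvature `dA + [A, A] / 2`, in the local trivialization given by the local section `s`. -/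
def curvature (D : Connection P) (s : LocalSection P.proj) (x : Simplex n) (v w : Fin n → ℝ) : E :=
  fderivWithin ℝ (fun y => D.form s (retract n y) w) (Simplex n) x v -
    fderivWithin ℝ (fun y => D.form s (retract n y) v) (Simplex n) x w +
    bracket E G (D.form s x v) (D.form s x w)

/-- The Chern–Weil form `ρ (R ∧ ⋯ ∧ R)`, computed at `x` in a local trivialization near `x`.
Values of forms are taken in the convention `(α ∧ β) (v, w) = α v * β w - α w * β v`, so that the
integral of a top form over a simplex is the integral of its value on the standard basis. In
the convention `(α ∧ β) (v, w) = (α v * β w - α w * β v) / 2`, where `R` has half the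
value, the same form is given by the sum below with the factor `1 / (2 * k)!`. -/
def chernWeilForm {k : ℕ} (ρ : ContinuousMultilinearMap ℝ (fun _ : Fin k => E) ℝ)
    (D : Connection P) (x : Simplex n) (v : Fin (2 * k) → Fin n → ℝ) : ℝ :=
  1 / 2 ^ k * ∑ η : Equiv.Perm (Fin (2 * k)), ((Equiv.Perm.sign η : ℤ) : ℝ) *
    ρ fun i => D.curvature (P.exists_section x).choose x
      (v (η ⟨2 * i, by omega⟩)) (v (η ⟨2 * i + 1, by omega⟩))

end Connection

/-- A simplicial connection on a simplicial bundle: a connection on the bundle of every simplex,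
compatible with pull-back along the simplicial (affine, vertices to vertices) maps. -/
structure SimplicialConnection {X : SmoothSSet.{v}} (P : SimplicialBundle E G X) where
  /-- the connection over a simplex -/
  conn : ∀ {n : ℕ} (x : X.obj n), Connection (P.obj x)
  compat : ∀ {k n : ℕ} (θ : Fin (k + 1) →o Fin (n + 1)) {x : X.obj k} {y : X.obj n}
    (e : X.map (SimplexMap.affine θ) y = x),
    IsPullbackForm (conn x).form (conn y).form (SimplexMap.affine θ)
      (P.map (SimplexMap.affine θ) e)

/-- The Chern–Weil cochain: the integrals over the simplices of the Chern–Weil forms. -/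
def chernWeilCochain {X : SmoothSSet.{v}} {P : SimplicialBundle E G X} {k : ℕ}
    (ρ : ContinuousMultilinearMap ℝ (fun _ : Fin k => E) ℝ) (D : SimplicialConnection P) :
    Cochain X (2 * k) := fun x =>
  ∫ y in Simplex (2 * k), (D.conn x).chernWeilForm ρ (retract (2 * k) y) fun i => Pi.single i 1

end Connections

/-! ### Invariant polynomials -/

section Polynomials

universe b u

variable (E : Type b) [AddCommGroup E] [Module ℝ E] [TopologicalSpace E]

/-- The homogeneous continuous polynomial functions `x ↦ ρ (x, …, x)`. -/
def homogeneousPolynomials : Set (E → ℝ) :=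
  {f | ∃ (k : ℕ) (ρ : ContinuousMultilinearMap ℝ (fun _ : Fin k => E) ℝ), f = fun x => ρ fun _ => x}

variable {E} in
theorem homogeneousPolynomials_mul {f g : E → ℝ} (hf : f ∈ homogeneousPolynomials E)
    (hg : g ∈ homogeneousPolynomials E) : f * g ∈ homogeneousPolynomials E := by
  obtain ⟨k, ρ, rfl⟩ := hf
  obtain ⟨l, τ, rfl⟩ := hg
  refine ⟨k + l, ⟨((LinearMap.mul' ℝ ℝ).compMultilinearMap
    (ρ.toMultilinearMap.domCoprod τ.toMultilinearMap)).domDomCongr finSumFinEquiv, ?_⟩, ?_⟩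
  · change Continuous fun v : Fin (k + l) → E =>
      ρ (fun i => v (finSumFinEquiv (Sum.inl i))) * τ (fun i => v (finSumFinEquiv (Sum.inr i)))
    exact (ρ.cont.comp (by fun_prop)).mul (τ.cont.comp (by fun_prop))
  · rfl

/-- The algebra of continuous polynomial functions on `E`. -/
def polynomials : Subalgebra ℝ (E → ℝ) :=
  (Submodule.span ℝ (homogeneousPolynomials E)).toSubalgebra
    (Submodule.subset_span ⟨0, ContinuousMultilinearMap.constOfIsEmpty ℝ _ 1, rfl⟩)
    (fun f g hf hg => by
      induction hf, hg using Submodule.span_induction₂ with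
      | mem_mem f g hf hg => exact Submodule.subset_span (homogeneousPolynomials_mul hf hg)
      | zero_left g hg => rw [zero_mul]; exact zero_mem _
      | zero_right f hf => rw [mul_zero]; exact zero_mem _
      | add_left f f' g _ _ _ h h' => rw [add_mul]; exact add_mem h h'
      | add_right f g g' _ _ _ h h' => rw [mul_add]; exact add_mem h h'
      | smul_left r f g _ _ h => rw [smul_mul_assoc]; exact Submodule.smul_mem _ r h
      | smul_right r f g _ _ h => rw [mul_smul_comm]; exact Submodule.smul_mem _ r h)

variable (G : Type u) [Group G] [TopologicalSpace G] [ChartedSpace E G]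

/-- The algebra `ℝ[𝔤]^G` of the `Ad`-invariant continuous polynomial functions on `𝔤 = E`. -/
def invariantPolynomials : Subalgebra ℝ (E → ℝ) where
  carrier := {f | f ∈ polynomials E ∧ ∀ (g : G) (x : E), f (Ad E g x) = f x}
  mul_mem' := fun {f f'} hf hf' => ⟨mul_mem hf.1 hf'.1, fun g x => by
    rw [Pi.mul_apply, Pi.mul_apply, hf.2, hf'.2]⟩
  add_mem' := fun {f f'} hf hf' => ⟨add_mem hf.1 hf'.1, fun g x => by
    rw [Pi.add_apply, Pi.add_apply, hf.2, hf'.2]⟩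
  algebraMap_mem' r := ⟨algebraMap_mem _ r, fun _ _ => rfl⟩

variable {E G}

/-- The polynomial `x ↦ ρ (x, …, x)`, for an invariant symmetric multilinear functional `ρ`. -/
def IsInvariant.polynomial {k : ℕ} {ρ : ContinuousMultilinearMap ℝ (fun _ : Fin k => E) ℝ}
    (h : IsInvariant E G ρ) : invariantPolynomials E G :=
  ⟨fun x => ρ fun _ => x, Submodule.subset_span ⟨k, ρ, rfl⟩, fun g x => h.map_Ad g fun _ => x⟩

end Polynomials

end ChernWeil

end

/-!
# The Chern–Weil homomorphism of the classifying space of a Fréchet Lie group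

The theorem follows from three facts about an arbitrary simplicial bundle `P` over a smooth
simplicial set `X`, applied to `EG` and to the simplicial bundle of `Z`.

*Simplicial connections exist* (`nonempty_simplicialConnection`), by induction on the dimension of
the simplices. On a degenerate simplex the connection is forced: it is the pull-back along the
degeneracy of minimal dimension. On a nondegenerate simplex the connections on the faces agree where
the faces meet, and extend to the simplex: locally, a one-form on the boundary is extended by
correcting it on one face after the other (`exists_oneForm_extension`), and the local extensions are
glued by a partition of unity (`exists_connection_extension`).

*The class of the Chern–Weil cochain does not depend on the connection, and is natural*
(`SimplicialConnection.chernWeilClass_eq`, `SimplicialConnection.chernWeilClass_pullback`). In local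
gauges a connection is a smooth `𝔤`-valued one-form `A`. The form `ρ (R ∧ ⋯ ∧ R)` of its curvature
is invariant under gauge transformations (`gaugeForm_eq`), by the Maurer–Cartan equation
(`maurerCartan`) and the invariance of `ρ`. It is closed: at any given point, a gauge in which `A`
vanishes there makes `R` equal to `dA`, up to second order (`extDeriv_chernWeilAlt`). So the
Chern–Weil forms are a closed form on the simplices of `X`, compatible with the simplicial maps, and
Stokes' theorem shows that its integrals are a cocycle (`IsClosedSimplicialForm.mem_cocycles`).
Stokes' theorem on the prisms `[0, 1] × Δⁿ`, for the straight line between two connections, shows that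
the two cocycles are cohomologous (`IsClosedPrismForm.exists_differential`). Stokes' theorem itself
is reduced to the cube, by a smooth map which collapses the cube onto the simplex
(`stokes_simplex`).

*The class is multiplicative in `ρ`* (`SimplicialConnection.chernWeilClass_tensor`). Since
`ρ (R ∧ ⋯ ∧ R)` is multiplicative with respect to the wedge product of forms, it has to be shown that
integration takes wedge products to cup products in cohomology
(`IsClosedSimplicialForm.toCohomology_wedge`). In the coordinates `1 ≥ t_1 ≥ ⋯ ≥ t_n ≥ 0` of `Δⁿ`, every
smooth monotone self-map `ψ` of `[0, 1]` acts on all simplices, compatibly with the simplicial maps,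
and homotopically to the identity. Reparametrizing the first factor by a `ψ` which is constant on
`[0, 1 / 2]`, and the second one by a `ψ'` which is constant on `[1 / 2, 1]`, makes the wedge product
a product of forms in separate variables, whose integral is exactly the cup product of the integrals
on the front and the back face (`integralCochain_wedge_reparam`).

Finally, every invariant polynomial is in a unique way a sum of diagonals of invariant symmetric
multilinear functionals, by polarization and the uniqueness of homogeneous components
(`diagonal_injective`, `diagonal_surjective`); this turns the classes of the functionals into a
homomorphism of algebras (`SimplicialConnection.chernWeilHom`).
-/

open Set Filter Topology
open scoped ContDiff Manifold DirectSum

set_option linter.unusedSectionVars false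

noncomputable section

namespace ChernWeil

/-! ### Directional derivatives -/

section DirectionalDerivative

universe a b c u₁ u₂

variable {V : Type a} [AddCommGroup V] [Module ℝ V] [TopologicalSpace V]
  [IsTopologicalAddGroup V] [ContinuousSMul ℝ V]
  {W : Type c} [AddCommGroup W] [Module ℝ W] [TopologicalSpace W]
  [IsTopologicalAddGroup W] [ContinuousSMul ℝ W]
  {F : Type b} [AddCommGroup F] [Module ℝ F] [TopologicalSpace F]
  [IsTopologicalAddGroup F] [ContinuousSMul ℝ F] [T2Space F] [LocallyConvexSpace ℝ F]

/-- The directional derivative of `f` at `x` in the direction `h`, as a limit of difference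
quotients (a junk value if the limit does not exist). -/
def dd {V : Type a} [AddCommGroup V] [Module ℝ V] {F : Type b} [AddCommGroup F] [Module ℝ F]
    [TopologicalSpace F] (f : V → F) (x h : V) : F :=
  limUnder (𝓝[≠] (0 : ℝ)) fun t : ℝ => t⁻¹ • (f (x + t • h) - f x)

/-- `f` has the directional derivative `d` at `x` in the direction `h`. -/
def HasDD {V : Type a} [AddCommGroup V] [Module ℝ V] {F : Type b} [AddCommGroup F] [Module ℝ F]
    [TopologicalSpace F] (f : V → F) (d : F) (x h : V) : Prop :=
  Tendsto (fun t : ℝ => t⁻¹ • (f (x + t • h) - f x)) (𝓝[≠] 0) (𝓝 d)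

theorem HasDD.dd_eq {f : V → F} {d : F} {x h : V} (hf : HasDD f d x h) : dd f x h = d :=
  hf.limUnder_eq

theorem CInftyOn.mono {f : V → F} {U U' : Set V} (hf : CInftyOn f U) (h : U' ⊆ U) :
    CInftyOn f U' := fun n => (hf n).mono h

theorem CInftyOn.congr {f g : V → F} {U : Set V} (hf : CInftyOn f U) (hU : IsOpen U)
    (h : EqOn f g U) : CInftyOn g U := fun n => (hf n).congr hU h

theorem CInftyOn.hasDD {f : V → F} {U : Set V} (hf : CInftyOn f U) {x : V} (hx : x ∈ U) (h : V) :
    HasDD f (dd f x h) x h := by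
  obtain ⟨-, df, hd, -⟩ := hf 1
  have : HasDD f (df (x, h)) x h := hd x hx h
  rwa [this.dd_eq]

theorem CInftyOn.dd {f : V → F} {U : Set V} (hU : IsOpen U) (hf : CInftyOn f U) :
    CInftyOn (fun p : V × V => ChernWeil.dd f p.1 p.2) (U ×ˢ univ) := by
  intro n
  obtain ⟨-, df, hd, hdf⟩ := hf (n + 1)
  refine hdf.congr (hU.prod isOpen_univ) fun p hp => ?_
  have : HasDD f (df (p.1, p.2)) p.1 p.2 := hd p.1 hp.1 p.2
  exact this.dd_eq.symm

theorem CInftyOn.continuousOn {f : V → F} {U : Set V} (hf : CInftyOn f U) : ContinuousOn f U :=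
  hf 0

theorem CInftyOn.of_clm (L : V →L[ℝ] F) (U : Set V) : CInftyOn L U := fun n => CkOn.of_clm n L U

theorem CInftyOn.clm_comp {K : Type*} [AddCommGroup K] [Module ℝ K] [TopologicalSpace K]
    [IsTopologicalAddGroup K] [ContinuousSMul ℝ K] [LocallyConvexSpace ℝ K] [T2Space K]
    (L : F →L[ℝ] K) {f : V → F} {U : Set V} (hf : CInftyOn f U) :
    CInftyOn (fun x => L (f x)) U :=
  CInftyOn.comp (g := L) isOpen_univ (CInftyOn.of_clm L univ) hf fun _ _ => mem_univ _

theorem CInftyOn.comp_clm {f : W → F} {U : Set W} (hU : IsOpen U) (hf : CInftyOn f U)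
    (L : V →L[ℝ] W) : CInftyOn (fun x => f (L x)) (L ⁻¹' U) :=
  CInftyOn.comp hU hf (fun n => CkOn.of_clm n L _) fun _ h => h

theorem CInftyOn.const (c : F) (U : Set V) : CInftyOn (fun _ : V => c) U := by
  have aux : ∀ (n : ℕ) {V : Type a} [AddCommGroup V] [Module ℝ V] [TopologicalSpace V]
      (c : F) (U : Set V), CkOn n (fun _ : V => c) U := by
    intro n
    induction n with
    | zero => intros; exact continuousOn_const
    | succ n ih =>
      intro V _ _ _ c U
      refine ⟨continuousOn_const, fun _ => 0, fun x _ h => ?_, ih _ _⟩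
      simp
  exact fun n => aux n c U

theorem CInftyOn.add {f g : V → F} {U : Set V} (hf : CInftyOn f U) (hg : CInftyOn g U) :
    CInftyOn (fun x => f x + g x) U :=
  CInftyOn.clm_comp (ContinuousLinearMap.fst ℝ F F + ContinuousLinearMap.snd ℝ F F)
    (CInftyOn.prodMk hf hg)

theorem CInftyOn.sub {f g : V → F} {U : Set V} (hf : CInftyOn f U) (hg : CInftyOn g U) :
    CInftyOn (fun x => f x - g x) U :=
  CInftyOn.clm_comp (ContinuousLinearMap.fst ℝ F F - ContinuousLinearMap.snd ℝ F F)
    (CInftyOn.prodMk hf hg)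

theorem CInftyOn.sum {ι : Type*} (s : Finset ι) {f : ι → V → F} {U : Set V}
    (hf : ∀ i ∈ s, CInftyOn (f i) U) : CInftyOn (fun x => ∑ i ∈ s, f i x) U := by
  classical
  induction s using Finset.induction_on with
  | empty => simpa using CInftyOn.const (0 : F) U
  | insert i s hi ih =>
    simp only [Finset.sum_insert hi]
    exact (hf i (by simp)).add (ih fun j hj => hf j (by simp [hj]))

/-! #### Rules for directional derivatives -/

theorem HasDD.const (c : F) (x h : V) : HasDD (fun _ : V => c) 0 x h := by
  simp [HasDD]

theorem HasDD.add {f g : V → F} {d d' : F} {x h : V} (hf : HasDD f d x h) (hg : HasDD g d' x h) :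
    HasDD (fun y => f y + g y) (d + d') x h := by
  refine (Tendsto.add hf hg).congr fun t => ?_
  simp only [← smul_add]
  congr 1
  abel

theorem HasDD.sub {f g : V → F} {d d' : F} {x h : V} (hf : HasDD f d x h) (hg : HasDD g d' x h) :
    HasDD (fun y => f y - g y) (d - d') x h := by
  refine (Tendsto.sub hf hg).congr fun t => ?_
  simp only [← smul_sub]
  congr 1
  abel

theorem HasDD.clm_comp {K : Type*} [AddCommGroup K] [Module ℝ K] [TopologicalSpace K]
    (L : F →L[ℝ] K) {f : V → F} {d : F} {x h : V} (hf : HasDD f d x h) :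
    HasDD (fun y => L (f y)) (L d) x h := by
  refine ((L.continuous.tendsto d).comp hf).congr fun t => ?_
  simp

theorem HasDD.congr {f g : V → F} {d : F} {x h : V} (hf : HasDD f d x h) (hfg : g =ᶠ[𝓝 x] f) :
    HasDD g d x h := by
  refine Tendsto.congr' ?_ hf
  have h0 := hfg.self_of_nhds
  filter_upwards [(tendsto_add_smul x h).eventually hfg] with t ht
  rw [ht, h0]

theorem dd_congr {f g : V → F} {x h : V} (hfg : g =ᶠ[𝓝 x] f) : dd g x h = dd f x h := by
  have h0 := hfg.self_of_nhds
  have : (fun t : ℝ => t⁻¹ • (g (x + t • h) - g x)) =ᶠ[𝓝[≠] 0]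
      fun t : ℝ => t⁻¹ • (f (x + t • h) - f x) := by
    filter_upwards [(tendsto_add_smul x h).eventually hfg] with t ht
    rw [ht, h0]
  simp only [dd, limUnder, Filter.map_congr this]

theorem HasDD.prodMk {K : Type*} [AddCommGroup K] [Module ℝ K] [TopologicalSpace K]
    {f : V → F} {g : V → K} {d : F} {d' : K} {x h : V} (hf : HasDD f d x h)
    (hg : HasDD g d' x h) : HasDD (fun y => (f y, g y)) (d, d') x h :=
  Tendsto.prodMk_nhds hf hg

/-- The chain rule, for an inner function which need only have a directional derivative. -/
theorem HasDD.comp {f : V → W} {g : W → F} {U : Set W} (hU : IsOpen U) (hg : CInftyOn g U)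
    {x h : V} {d : W} (hf : HasDD f d x h) (hx : f x ∈ U) :
    HasDD (fun y => g (f y)) (dd g (f x) d) x h := by
  have h1 := tendsto_slope_of_continuousOn hU (dg := fun p => ChernWeil.dd g p.1 p.2)
    (fun x hx h => hg.hasDD hx h) (hg.dd hU).continuousOn hx d
  have h2 : Tendsto (fun t : ℝ => (t, t⁻¹ • (f (x + t • h) - f x))) (𝓝[≠] 0)
      (𝓝[≠] 0 ×ˢ 𝓝 d) := tendsto_id.prodMk hf
  refine (h1.comp h2).congr' ?_
  filter_upwards [self_mem_nhdsWithin] with t ht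
  simp [smul_smul, mul_inv_cancel₀ ht]

/-- The linearity of directional derivatives in the direction. -/
theorem CInftyOn.dd_add_right {f : V → F} {U : Set V} (hU : IsOpen U) (hf : CInftyOn f U) {x : V}
    (hx : x ∈ U) (h k : V) : ChernWeil.dd f x (h + k) =
      ChernWeil.dd f x h + ChernWeil.dd f x k := by
  by_contra hne
  obtain ⟨φ, hφ⟩ := SeparatingDual.exists_separating_of_ne (R := ℝ) hne
  refine hφ ?_
  have hev : ∀ᶠ p : ℝ × ℝ in 𝓝 ((0 : ℝ), (0 : ℝ)), x + p.1 • h + p.2 • k ∈ U := by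
    have hc : Continuous fun p : ℝ × ℝ => x + p.1 • h + p.2 • k := by fun_prop
    refine (hc.tendsto _).eventually (hU.mem_nhds ?_)
    simpa using hx
  set F₁ : ℝ × ℝ → ℝ := fun p => φ (ChernWeil.dd f (x + p.1 • h + p.2 • k) h)
  set F₂ : ℝ × ℝ → ℝ := fun p => φ (ChernWeil.dd f (x + p.1 • h + p.2 • k) k)
  have hcont : ∀ l : V, ContinuousAt
      (fun p : ℝ × ℝ => φ (ChernWeil.dd f (x + p.1 • h + p.2 • k) l)) (0, 0) := by
    intro l
    have h1 : ContinuousAt (fun q : V × V => ChernWeil.dd f q.1 q.2) (x, l) :=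
      (hf.dd hU).continuousOn.continuousAt ((hU.prod isOpen_univ).mem_nhds ⟨hx, mem_univ _⟩)
    have h2 : ContinuousAt (fun p : ℝ × ℝ => (x + p.1 • h + p.2 • k, l)) (0, 0) := by
      have : Continuous fun p : ℝ × ℝ => (x + p.1 • h + p.2 • k, l) := by fun_prop
      exact this.continuousAt
    refine φ.continuous.continuousAt.comp (ContinuousAt.comp (f := fun p : ℝ × ℝ =>
      (x + p.1 • h + p.2 • k, l)) (g := fun q : V × V => ChernWeil.dd f q.1 q.2) ?_ h2)
    simpa using h1
  have hpart : ∀ (y : V) (l : V), y ∈ U → HasDerivAt (fun s : ℝ => φ (f (y + s • l)))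
      (φ (ChernWeil.dd f y l)) 0 := by
    intro y l hy
    rw [hasDerivAt_iff_tendsto_slope_zero]
    simpa [HasDD] using (hf.hasDD hy l).clm_comp φ
  have hpart' : ∀ (y : V) (l : V) (s : ℝ), y + s • l ∈ U →
      HasDerivAt (fun s : ℝ => φ (f (y + s • l))) (φ (ChernWeil.dd f (y + s • l) l)) s := by
    intro y l s hy
    have h1 := hpart (y + s • l) l hy
    have h2 : HasDerivAt (fun r : ℝ => r - s) 1 s := (hasDerivAt_id s).sub_const s
    have h3 := HasDerivAt.scomp (h := fun r : ℝ => r - s) s (by simpa using h1) h2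
    simp only [one_smul, Function.comp_def, add_assoc, ← add_smul] at h3
    simpa using h3
  -- partial derivatives in the plane spanned by the two directions
  have hF : HasFDerivAt (fun p : ℝ × ℝ => φ (f (x + p.1 • h + p.2 • k)))
      ((ContinuousLinearMap.toSpanSingleton ℝ (F₁ (0, 0))).coprod
        (ContinuousLinearMap.toSpanSingleton ℝ (F₂ (0, 0)))) (0, 0) := by
    refine (hasStrictFDerivAt_uncurry_coprod (𝕜 := ℝ) (u := ((0 : ℝ), (0 : ℝ)))
      (f := fun a b : ℝ => φ (f (x + a • h + b • k)))
      (f₁ := fun a b => ContinuousLinearMap.toSpanSingleton ℝ (F₁ (a, b)))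
      (f₂ := fun a b => ContinuousLinearMap.toSpanSingleton ℝ (F₂ (a, b)))
      ?_ ?_ ?_ ?_).hasFDerivAt
    · filter_upwards [hev] with p hp
      have h1 : HasDerivAt (fun s : ℝ => φ (f (x + p.2 • k + s • h)))
          (φ (ChernWeil.dd f (x + p.2 • k + p.1 • h) h)) p.1 :=
        hpart' (x + p.2 • k) h p.1 (by rwa [add_right_comm])
      simp only [add_right_comm x (p.2 • k)] at h1
      exact h1.hasFDerivAt
    · filter_upwards [hev] with p hp
      exact (hpart' (x + p.1 • h) k p.2 hp).hasFDerivAt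
    · exact (ContinuousLinearMap.toSpanSingletonCLE (𝕜 := ℝ) (E := ℝ)).continuous.continuousAt.comp (hcont h)
    · exact (ContinuousLinearMap.toSpanSingletonCLE (𝕜 := ℝ) (E := ℝ)).continuous.continuousAt.comp (hcont k)
  have hdiag : HasDerivAt (fun s : ℝ => ((s, s) : ℝ × ℝ)) (1, 1) 0 :=
    (hasDerivAt_id 0).prodMk (hasDerivAt_id 0)
  have h1 := HasFDerivAt.comp_hasDerivAt (0 : ℝ) (f := fun s : ℝ => ((s, s) : ℝ × ℝ)) hF hdiag
  have h2 := hpart x (h + k) hx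
  have h3 := h2.unique (h1.congr_of_eventuallyEq (by
    refine Filter.Eventually.of_forall fun s => ?_
    simp only [Function.comp_apply, smul_add, add_assoc]))
  rw [h3]
  simp [F₁, F₂]

theorem HasDD.smul_right {f : V → F} {d : F} {x h : V} (hf : HasDD f d x h) (c : ℝ) :
    HasDD f (c • d) x (c • h) := by
  by_cases hc : c = 0
  · subst hc
    simp [HasDD]
  have h2 : Tendsto (fun t : ℝ => t * c) (𝓝[≠] 0) (𝓝[≠] 0) := by
    refine tendsto_nhdsWithin_iff.2 ⟨?_, ?_⟩
    · have : Tendsto (fun t : ℝ => t * c) (𝓝 0) (𝓝 (0 * c)) := (continuous_mul_const c).tendsto 0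
      rw [zero_mul] at this
      exact this.mono_left nhdsWithin_le_nhds
    · filter_upwards [self_mem_nhdsWithin] with t ht
      exact mul_ne_zero ht hc
  refine ((Tendsto.comp hf h2).const_smul c).congr fun t => ?_
  simp only [Function.comp_apply, smul_smul, mul_inv]
  congr 1
  field_simp

/-- The directional derivatives of a smooth map at a point, as a linear map. -/
def ddLinear {f : V → F} {U : Set V} (hU : IsOpen U) (hf : CInftyOn f U) {x : V} (hx : x ∈ U) :
    V →ₗ[ℝ] F where
  toFun := ChernWeil.dd f x
  map_add' := hf.dd_add_right hU hx
  map_smul' c h := ((hf.hasDD hx h).smul_right c).dd_eq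

/-- Continuous bilinear maps are smooth. -/
theorem CInftyOn.bilinear {F₁ : Type u₁} {F₂ : Type u₂} [AddCommGroup F₁] [Module ℝ F₁] [TopologicalSpace F₁]
    [IsTopologicalAddGroup F₁] [ContinuousSMul ℝ F₁]
    [AddCommGroup F₂] [Module ℝ F₂] [TopologicalSpace F₂] [IsTopologicalAddGroup F₂]
    [ContinuousSMul ℝ F₂] (B : F₁ →ₗ[ℝ] F₂ →ₗ[ℝ] F)
    (hB : Continuous fun p : F₁ × F₂ => B p.1 p.2) (U : Set (F₁ × F₂)) :
    CInftyOn (fun p : F₁ × F₂ => B p.1 p.2) U := by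
  have aux : ∀ (n : ℕ) {A : Type (max u₁ u₂)} [AddCommGroup A] [Module ℝ A] [TopologicalSpace A]
      [IsTopologicalAddGroup A] [ContinuousSMul ℝ A] (L₁ : A →L[ℝ] F₁) (L₂ : A →L[ℝ] F₂)
      (U : Set A), CkOn n (fun p => B (L₁ p) (L₂ p)) U := by
    intro n
    induction n with
    | zero =>
      intro A _ _ _ _ _ L₁ L₂ U
      exact (hB.comp (L₁.continuous.prodMk L₂.continuous)).continuousOn
    | succ n ih =>
      intro A _ _ _ _ _ L₁ L₂ U
      refine ⟨(hB.comp (L₁.continuous.prodMk L₂.continuous)).continuousOn, fun q =>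
        B (L₁ q.1) (L₂ q.2) + B (L₁ q.2) (L₂ q.1), fun x _ h => ?_, ?_⟩
      · have h1 : Continuous fun t : ℝ => B (L₁ x) (L₂ h) + B (L₁ h) (L₂ x) +
            t • B (L₁ h) (L₂ h) := by fun_prop
        have h2 := (h1.tendsto 0).mono_left (nhdsWithin_le_nhds (s := {0}ᶜ))
        simp only [zero_smul, add_zero] at h2
        refine h2.congr' ?_
        filter_upwards [self_mem_nhdsWithin] with t ht
        have ht : t ≠ 0 := ht
        simp only [map_add, map_smul, LinearMap.add_apply, LinearMap.smul_apply, smul_add, smul_sub,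
          smul_smul, inv_mul_cancel_left₀ ht, inv_mul_cancel₀ ht, one_smul]
        abel
      · have h1 := ih (L₁.comp (ContinuousLinearMap.fst ℝ A A))
          (L₂.comp (ContinuousLinearMap.snd ℝ A A)) (U ×ˢ univ)
        have h2 := ih (L₁.comp (ContinuousLinearMap.snd ℝ A A))
          (L₂.comp (ContinuousLinearMap.fst ℝ A A)) (U ×ˢ univ)
        exact CkOn.comp (g := fun p : F × F => p.1 + p.2) isOpen_univ
          (CkOn.of_clm n (ContinuousLinearMap.fst ℝ F F + ContinuousLinearMap.snd ℝ F F) univ)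
          (h1.prodMk h2) fun _ _ => mem_univ _
  exact fun n => aux n (ContinuousLinearMap.fst ℝ F₁ F₂) (ContinuousLinearMap.snd ℝ F₁ F₂) U

theorem CInftyOn.smul {χ : V → ℝ} {f : V → F} {U : Set V} (hχ : CInftyOn χ U)
    (hf : CInftyOn f U) : CInftyOn (fun x => χ x • f x) U :=
  CInftyOn.comp (g := fun p : ℝ × F => p.1 • p.2) isOpen_univ
    (CInftyOn.bilinear (LinearMap.lsmul ℝ F) (by
      simp only [LinearMap.lsmul_apply]
      fun_prop) univ)
    (CInftyOn.prodMk hχ hf) fun _ _ => mem_univ _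

/-- The product rule for continuous multilinear maps. -/
theorem HasDD.multilinear {k : ℕ} {K : Type*} [AddCommGroup K] [Module ℝ K] [TopologicalSpace K]
    [IsTopologicalAddGroup K] [ContinuousSMul ℝ K]
    (ρ : ContinuousMultilinearMap ℝ (fun _ : Fin k => F) K) {f : Fin k → V → F} {d : Fin k → F}
    {x h : V} (hf : ∀ i, HasDD (f i) (d i) x h) :
    HasDD (fun y => ρ fun i => f i y) (∑ i, ρ (Function.update (fun j => f j x) i (d i))) x h := by
  classical
  have hq : Tendsto (fun t : ℝ => (t, fun i => t⁻¹ • (f i (x + t • h) - f i x))) (𝓝[≠] 0)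
      (𝓝 ((0 : ℝ), d)) :=
    (tendsto_id.mono_right nhdsWithin_le_nhds).prodMk_nhds (tendsto_pi_nhds.2 hf)
  set a : Fin k → F := fun j => f j x with ha
  have hρ := ρ.cont
  have hpw : ∀ s : Finset (Fin k), Continuous fun p : ℝ × (Fin k → F) =>
      ρ (s.piecewise p.2 a) := by
    intro s
    refine hρ.comp (continuous_pi fun i => ?_)
    by_cases hi : i ∈ s
    · simp only [Finset.piecewise_eq_of_mem _ _ _ hi]
      fun_prop
    · simpa [hi] using continuous_const
  have hc : Continuous fun p : ℝ × (Fin k → F) => (∑ i, ρ (Function.update a i (p.2 i))) +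
      ∑ s : Finset (Fin k) with 2 ≤ s.card, p.1 ^ (s.card - 1) • ρ (s.piecewise p.2 a) := by
    refine Continuous.add (continuous_finsetSum _ fun i _ => ?_)
      (continuous_finsetSum _ fun s _ => (continuous_fst.pow _).smul (hpw s))
    have := hpw {i}
    simpa only [Finset.piecewise_singleton] using this
  have h1 := (hc.tendsto ((0 : ℝ), d)).comp hq
  have h2 : (∑ i, ρ (Function.update a i (d i))) +
      ∑ s : Finset (Fin k) with 2 ≤ s.card, (0 : ℝ) ^ (s.card - 1) • ρ (s.piecewise d a) =
      ∑ i, ρ (Function.update a i (d i)) := by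
    rw [add_eq_left]
    refine Finset.sum_eq_zero fun s hs => ?_
    rw [zero_pow, zero_smul]
    have := (Finset.mem_filter.1 hs).2
    omega
  simp only [h2] at h1
  refine h1.congr' ?_
  filter_upwards [self_mem_nhdsWithin] with t ht
  have ht : t ≠ 0 := ht
  simp only [Function.comp_apply]
  set q : Fin k → F := fun i => t⁻¹ • (f i (x + t • h) - f i x) with hqdef
  have h3 : (fun i => f i (x + t • h)) = a + t • q := by
    funext i
    simp [ha, hqdef, smul_smul, mul_inv_cancel₀ ht]
  have h4 := ρ.toMultilinearMap.map_add_eq_map_add_linearDeriv_add a (t • q)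
  simp only [ContinuousMultilinearMap.coe_coe, map_smul, MultilinearMap.linearDeriv_apply] at h4
  rw [h3, h4, add_assoc, add_sub_cancel_left, smul_add, smul_smul, inv_mul_cancel₀ ht, one_smul,
    Finset.smul_sum]
  congr 1
  refine Finset.sum_congr rfl fun s hs => ?_
  have hs2 := (Finset.mem_filter.1 hs).2
  have h5 := ρ.toMultilinearMap.map_piecewise_smul (fun _ => t) (s.piecewise q a) s
  have h6 : s.piecewise (fun i => t • s.piecewise q a i) (s.piecewise q a) =
      s.piecewise (t • q) a := by
    funext i
    by_cases hi : i ∈ s <;> simp [hi]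
  rw [h6] at h5
  simp only [ContinuousMultilinearMap.coe_coe, Finset.prod_const] at h5
  rw [h5, smul_smul]
  congr 1
  obtain ⟨m, hm⟩ : ∃ m, s.card = m + 1 := ⟨s.card - 1, by omega⟩
  rw [hm, Nat.add_sub_cancel, pow_succ]
  field_simp

/-- Continuous multilinear maps are smooth. -/
theorem CInftyOn.multilinear {k : ℕ} {K : Type*} [AddCommGroup K] [Module ℝ K]
    [TopologicalSpace K] [IsTopologicalAddGroup K] [ContinuousSMul ℝ K] [T2Space K]
    [LocallyConvexSpace ℝ K]
    (ρ : ContinuousMultilinearMap ℝ (fun _ : Fin k => F) K) (U : Set (Fin k → F)) :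
    CInftyOn (fun v : Fin k → F => ρ v) U := by
  have aux : ∀ (n : ℕ) {A : Type b} [AddCommGroup A] [Module ℝ A] [TopologicalSpace A]
      [IsTopologicalAddGroup A] [ContinuousSMul ℝ A] (L : Fin k → A →L[ℝ] F)
      (U : Set A), CkOn n (fun p => ρ fun i => L i p) U := by
    intro n
    induction n with
    | zero =>
      intro A _ _ _ _ _ L U
      exact (ρ.cont.comp (continuous_pi fun i => (L i).continuous)).continuousOn
    | succ n ih =>
      intro A _ _ _ _ _ L U
      refine ⟨(ρ.cont.comp (continuous_pi fun i => (L i).continuous)).continuousOn, fun q =>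
        ∑ i, ρ (Function.update (fun j => L j q.1) i (L i q.2)), fun x _ h => ?_, ?_⟩
      · refine HasDD.multilinear ρ fun i => ?_
        refine tendsto_const_nhds.congr' ?_
        filter_upwards [self_mem_nhdsWithin] with t ht
        simp [smul_smul, inv_mul_cancel₀ (show t ≠ 0 from ht)]
      · have h1 : ∀ s : Finset (Fin k), CkOn n (fun q : A × A =>
            ∑ i ∈ s, ρ (Function.update (fun j => L j q.1) i (L i q.2))) (U ×ˢ univ) := by
          intro s
          induction s using Finset.induction_on with
          | empty => simpa using CInftyOn.const (0 : K) (U ×ˢ univ : Set (A × A)) n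
          | insert i s hi ihs =>
            simp only [Finset.sum_insert hi]
            refine CkOn.comp (g := fun p : K × K => p.1 + p.2) isOpen_univ
              (CkOn.of_clm n (ContinuousLinearMap.fst ℝ K K + ContinuousLinearMap.snd ℝ K K) univ)
              (CkOn.prodMk ?_ ihs) fun _ _ => mem_univ _
            have h2 := ih (fun j => if j = i then (L j).comp (ContinuousLinearMap.snd ℝ A A)
              else (L j).comp (ContinuousLinearMap.fst ℝ A A)) (U ×ˢ univ)
            refine (congrArg (fun g => CkOn n g (U ×ˢ univ)) ?_).mp h2
            funext q
            congr 1
            funext j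
            by_cases hj : j = i
            · subst hj; simp
            · simp [hj]
        exact h1 Finset.univ
  exact fun n => aux n (fun i => ContinuousLinearMap.proj i) U

end DirectionalDerivative

/-! ### Comparison with Fréchet derivatives on finite-dimensional spaces -/

section Frechet

universe a b c

variable {V : Type a} [NormedAddCommGroup V] [NormedSpace ℝ V] [FiniteDimensional ℝ V]
  {F : Type b} [AddCommGroup F] [Module ℝ F] [TopologicalSpace F]
  [IsTopologicalAddGroup F] [ContinuousSMul ℝ F] [T2Space F] [LocallyConvexSpace ℝ F]

/-- A smooth map on an open subset of a finite-dimensional space is Fréchet differentiable. -/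
theorem CInftyOn.hasFDerivAt {f : V → F} {U : Set V} (hU : IsOpen U) (hf : CInftyOn f U) {x : V}
    (hx : x ∈ U) :
    HasFDerivAt f (LinearMap.toContinuousLinearMap (ddLinear hU hf hx)) x := by
  set L := LinearMap.toContinuousLinearMap (ddLinear hU hf hx) with hL
  have hLa : ∀ h, L h = ChernWeil.dd f x h := fun h => rfl
  rw [hasFDerivAt_iff_isLittleOTVS]
  have key : Tendsto (fun y => (‖y - x‖)⁻¹ • (f y - f x - L (y - x))) (𝓝 x) (𝓝 0) := by
    intro N hN
    rw [Filter.mem_map]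
    -- the difference quotients converge uniformly on the unit sphere
    have h1 : ∀ u : V, ∀ᶠ p : V × ℝ in 𝓝 u ×ˢ 𝓝[≠] 0,
        p.2⁻¹ • (f (x + p.2 • p.1) - f x) - L p.1 ∈ N := by
      intro u
      have h2 := tendsto_slope_of_continuousOn hU (dg := fun p => ChernWeil.dd f p.1 p.2)
        (fun x hx h => hf.hasDD hx h) (hf.dd hU).continuousOn hx u
      have h3 : Tendsto (fun p : ℝ × V => L p.2) (𝓝[≠] 0 ×ˢ 𝓝 u) (𝓝 (L u)) :=
        (L.continuous.tendsto u).comp tendsto_snd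
      have h4 := (h2.sub h3)
      rw [hLa, sub_self] at h4
      have h5 : Tendsto Prod.swap (𝓝 u ×ˢ 𝓝[≠] (0 : ℝ)) (𝓝[≠] 0 ×ˢ 𝓝 u) :=
        tendsto_snd.prodMk tendsto_fst
      exact (h4.comp h5).eventually hN
    have h2 : ∀ᶠ t : ℝ in 𝓝[≠] 0, ∀ u ∈ Metric.sphere (0 : V) 1,
        t⁻¹ • (f (x + t • u) - f x) - L u ∈ N := by
      have h3 := (isCompact_sphere (0 : V) 1).mem_nhdsSet_prod_of_forall (l := 𝓝[≠] (0 : ℝ))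
        (s := {p : V × ℝ | p.2⁻¹ • (f (x + p.2 • p.1) - f x) - L p.1 ∈ N}) fun u _ => h1 u
      obtain ⟨A, hA, B, hB, hAB⟩ := Filter.mem_prod_iff.1 h3
      filter_upwards [hB] with t ht u hu
      exact hAB (show (u, t) ∈ A ×ˢ B from ⟨subset_of_mem_nhdsSet hA hu, ht⟩)
    rw [eventually_nhdsWithin_iff, Metric.eventually_nhds_iff] at h2
    obtain ⟨ε, hε, h2⟩ := h2
    filter_upwards [Metric.ball_mem_nhds x hε] with y hy
    by_cases hyx : y = x
    · subst hyx
      simpa using mem_of_mem_nhds hN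
    have hn : ‖y - x‖ ≠ 0 := norm_ne_zero_iff.2 (sub_ne_zero.2 hyx)
    have h3 := h2 (y := ‖y - x‖) (by simpa [dist_eq_norm] using hy) hn (‖y - x‖⁻¹ • (y - x))
      (by simp [norm_smul, hn])
    rw [smul_smul, mul_inv_cancel₀ hn, one_smul, add_sub_cancel, map_smul, ← smul_sub] at h3
    exact h3
  have h1 : (fun y => f y - f x - L (y - x)) =o[ℝ; 𝓝 x] fun y => ‖y - x‖ := by
    rw [Asymptotics.isLittleOTVS_iff_tendsto_inv_smul]
    · exact key
    · filter_upwards with y hy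
      rw [norm_eq_zero, sub_eq_zero] at hy
      simp [hy]
  refine h1.trans_isBigOTVS ?_
  rw [Asymptotics.isBigOTVS_iff_isBigO]
  exact (Asymptotics.isBigO_refl _ _).norm_left

theorem CInftyOn.fderivWithin_eq {f g : V → F} {U S : Set V} (hU : IsOpen U) (hf : CInftyOn f U)
    {x : V} (hx : x ∈ U) (hxS : x ∈ S) (hS : UniqueDiffWithinAt ℝ S x) (hg : g =ᶠ[𝓝[S] x] f)
    (h : V) : fderivWithin ℝ g S x h = ChernWeil.dd f x h := by
  have h1 := (hf.hasFDerivAt hU hx).hasFDerivWithinAt (s := S)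
  have h2 := h1.congr_of_eventuallyEq hg (hg.self_of_nhdsWithin hxS)
  rw [h2.fderivWithin hS]
  rfl

/-- Smooth maps between finite-dimensional spaces are smooth in the usual sense. -/
theorem CInftyOn.contDiffOn {F : Type c} [NormedAddCommGroup F] [NormedSpace ℝ F]
    {f : V → F} {U : Set V} (hU : IsOpen U) (hf : CInftyOn f U) : ContDiffOn ℝ ∞ f U := by
  have aux : ∀ (n : ℕ) {V : Type a} [NormedAddCommGroup V] [NormedSpace ℝ V]
      [FiniteDimensional ℝ V] {f : V → F} {U : Set V}, IsOpen U → CInftyOn f U →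
      ContDiffOn ℝ n f U := by
    intro n
    induction n with
    | zero =>
      intro V _ _ _ f U hU hf
      rw [Nat.cast_zero, contDiffOn_zero]
      exact hf.continuousOn
    | succ n ih =>
      intro V _ _ _ f U hU hf
      rw [Nat.cast_succ, contDiffOn_succ_iff_fderiv_of_isOpen hU]
      refine ⟨fun x hx => (hf.hasFDerivAt hU hx).differentiableAt.differentiableWithinAt,
        by simp, (contDiffOn_clm_apply (f := fderiv ℝ f)).2 fun h => ?_⟩
      have h1 := (ih (hU.prod isOpen_univ) (hf.dd hU)).comp
        (f := fun x : V => (x, h)) (by fun_prop) (s := U) fun x hx => ⟨hx, mem_univ _⟩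
      refine h1.congr fun x hx => ?_
      rw [(hf.hasFDerivAt hU hx).fderiv]
      rfl
  exact contDiffOn_infty.2 fun n => aux n hU hf

theorem CInftyOn.dd_eq_fderiv {F : Type b} [NormedAddCommGroup F] [NormedSpace ℝ F]
    {f : V → F} {U : Set V} (hU : IsOpen U) (hf : CInftyOn f U) {x : V} (hx : x ∈ U) (h : V) :
    ChernWeil.dd f x h = fderiv ℝ f x h := by
  rw [(hf.hasFDerivAt hU hx).fderiv]
  rfl

/-- The symmetry of second directional derivatives. -/
theorem CInftyOn.dd_comm {V : Type a} [AddCommGroup V] [Module ℝ V] [TopologicalSpace V]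
    [IsTopologicalAddGroup V] [ContinuousSMul ℝ V] [T2Space V] [LocallyConvexSpace ℝ V]
    {f : V → F} {U : Set V} (hU : IsOpen U) (hf : CInftyOn f U) {x : V}
    (hx : x ∈ U) (h k : V) : ChernWeil.dd (fun y => ChernWeil.dd f y h) x k =
      ChernWeil.dd (fun y => ChernWeil.dd f y k) x h := by
  by_contra hne
  obtain ⟨φ, hφ⟩ := SeparatingDual.exists_separating_of_ne (R := ℝ) hne
  refine hφ ?_
  -- restriction to the plane spanned by the two directions
  set e : ℝ × ℝ → V := fun p => x + p.1 • h + p.2 • k with he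
  have hec : Continuous e := by fun_prop
  set O := e ⁻¹' U with hOdef
  have hO : IsOpen O := hU.preimage hec
  have hO0 : (0 : ℝ × ℝ) ∈ O := by simpa [hOdef, he] using hx
  have hes : CInftyOn e O := by
    have h1 := (CInftyOn.const x O).add (CInftyOn.of_clm
      ((ContinuousLinearMap.fst ℝ ℝ ℝ).smulRight h + (ContinuousLinearMap.snd ℝ ℝ ℝ).smulRight k) O)
    refine h1.congr hO fun p _ => ?_
    simp [he, add_assoc]
  set g : ℝ × ℝ → ℝ := fun p => φ (f (e p)) with hg
  have hgs : CInftyOn g O := (CInftyOn.comp hU hf hes fun _ hp => hp).clm_comp φ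
  have hline : ∀ (f' : V → F), CInftyOn f' U → ∀ p ∈ O, ∀ a b : ℝ,
      HasDD (fun p => φ (f' (e p))) (φ (ChernWeil.dd f' (e p) (a • h + b • k))) p (a, b) := by
    intro f' hf' p hp a b
    refine HasDD.clm_comp φ ((hf'.hasDD (x := e p) hp (a • h + b • k)).congr' ?_)
    refine Filter.Eventually.of_forall fun t => ?_
    dsimp only
    congr 3
    simp only [he, Prod.fst_add, Prod.snd_add, Prod.smul_fst, Prod.smul_snd, smul_eq_mul, smul_add,
      add_smul, smul_smul]
    abel_nf
  have hsm : ∀ l : V, CInftyOn (fun y => ChernWeil.dd f y l) U := fun l =>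
    CInftyOn.comp (g := fun p : V × V => ChernWeil.dd f p.1 p.2) (f := fun y : V => (y, l))
      (hU.prod isOpen_univ) (hf.dd hU)
      (CInftyOn.prodMk (CInftyOn.of_clm (ContinuousLinearMap.id ℝ V) U) (CInftyOn.const l U))
      fun y hy => ⟨hy, mem_univ _⟩
  have hsnd : ∀ l a b, ChernWeil.dd (fun p => φ (ChernWeil.dd f (e p) l)) 0 (a, b) =
      φ (ChernWeil.dd (fun y => ChernWeil.dd f y l) x (a • h + b • k)) := by
    intro l a b
    have := (hline _ (hsm l) 0 hO0 a b).dd_eq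
    simpa [he] using this
  have hfst : ∀ a b : ℝ, ∀ p ∈ O, fderiv ℝ g p (a, b) =
      φ (ChernWeil.dd f (e p) (a • h + b • k)) := fun a b p hp => by
    rw [← hgs.dd_eq_fderiv hO hp]
    exact (hline f hf p hp a b).dd_eq
  have hgc : ContDiffAt ℝ ∞ g 0 := (hgs.contDiffOn hO).contDiffAt (hO.mem_nhds hO0)
  have hsymm : IsSymmSndFDerivAt ℝ g 0 := hgc.isSymmSndFDerivAt (by
    rw [minSmoothness_of_isRCLikeNormedField]
    exact WithTop.coe_le_coe.2 le_top)
  have hd2 : DifferentiableAt ℝ (fderiv ℝ g) 0 :=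
    (hgc.fderiv_right (m := 1) (WithTop.coe_le_coe.2 le_top)).differentiableAt (by simp)
  have hmix : ∀ u v : ℝ × ℝ, ChernWeil.dd (fun p => fderiv ℝ g p u) 0 v =
      fderiv ℝ (fderiv ℝ g) 0 v u := by
    intro u v
    have h1 : HasFDerivAt (fun p => fderiv ℝ g p u)
        ((ContinuousLinearMap.apply ℝ ℝ u).comp (fderiv ℝ (fderiv ℝ g) 0)) 0 :=
      (ContinuousLinearMap.apply ℝ ℝ u).hasFDerivAt.comp 0 hd2.hasFDerivAt
    exact HasDD.dd_eq (h1.hasLineDerivAt v).tendsto_slope_zero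
  have h1 := hmix (1, 0) (0, 1)
  have h2 := hmix (0, 1) (1, 0)
  rw [dd_congr (f := fun p => φ (ChernWeil.dd f (e p) h)) (by
    filter_upwards [hO.mem_nhds hO0] with p hp
    simpa using hfst 1 0 p hp), hsnd] at h1
  rw [dd_congr (f := fun p => φ (ChernWeil.dd f (e p) k)) (by
    filter_upwards [hO.mem_nhds hO0] with p hp
    simpa using hfst 0 1 p hp), hsnd] at h2
  simp only [zero_smul, one_smul, zero_add, add_zero] at h1 h2
  rw [h1, h2]
  exact hsymm (0, 1) (1, 0)

end Frechet

/-! ### The adjoint representation, the Lie bracket and the Maurer–Cartan equation -/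

section LieGroup

universe a b u

variable {V : Type a} [AddCommGroup V] [Module ℝ V] [TopologicalSpace V]
  [IsTopologicalAddGroup V] [ContinuousSMul ℝ V] [T2Space V] [LocallyConvexSpace ℝ V]
  {E : Type b} [AddCommGroup E] [Module ℝ E] [TopologicalSpace E]
  [IsTopologicalAddGroup E] [ContinuousSMul ℝ E] [T2Space E] [LocallyConvexSpace ℝ E]
  {G : Type u} [Group G] [TopologicalSpace G] [ChartedSpace E G] [SmoothLieGroup E G]

variable (E G) in
/-- The preferred chart at `1`. -/
abbrev oneChart : OpenPartialHomeomorph G E := chartAt E (1 : G)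

variable (E G) in
/-- The coordinate of `1` in the preferred chart at `1`. -/
abbrev oneCoord : E := oneChart E G 1

theorem oneCoord_mem : oneCoord E G ∈ (oneChart E G).target :=
  (oneChart E G).map_source (mem_chart_source E 1)

theorem oneChart_symm_coord : (oneChart E G).symm (oneCoord E G) = 1 :=
  (oneChart E G).left_inv (mem_chart_source E 1)

theorem SmoothNear.const (g : G) (x : V) : SmoothNear E (fun _ : V => g) x :=
  ⟨univ, isOpen_univ, mem_univ _, fun _ _ => mem_chart_source E g, CInftyOn.const _ _⟩

theorem SmoothNear.one_chart {F : V → G} {x : V} (h : SmoothNear E F x) (h1 : F x = 1) :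
    ∃ O, IsOpen O ∧ x ∈ O ∧ MapsTo F O (oneChart E G).source ∧
      CInftyOn (fun y => oneChart E G (F y)) O := by
  obtain ⟨O, hO, hx, hm, hs⟩ := h
  rw [h1] at hm hs
  exact ⟨O, hO, hx, hm, hs⟩

theorem SmoothNear.hasDD_chart {F : V → G} {x : V} (hF : SmoothNear E F x) (h1 : F x = 1) (h : V) :
    HasDD (fun y => oneChart E G (F y)) (dd (fun y => oneChart E G (F y)) x h) x h := by
  obtain ⟨O, hO, hx, -, hs⟩ := hF.one_chart h1
  exact hs.hasDD hx h

/-- The inverse of the chart at `1` is smooth. -/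
theorem smoothNear_symm {x : E} (hx : x ∈ (oneChart E G).target) :
    SmoothNear E (oneChart E G).symm x := by
  have h1 := SmoothLieGroup.smooth_mul (chartAt E (1 : G)) (chart_mem_atlas E _)
    (chartAt E (1 : G)) (chart_mem_atlas E _) x hx _ (oneCoord_mem (G := G))
  have h2 : CInftyOn (fun y : E => (y, oneCoord E G)) univ :=
    CInftyOn.prodMk (CInftyOn.of_clm (ContinuousLinearMap.id ℝ E) univ) (CInftyOn.const _ _)
  have h3 := SmoothNear.comp (f := fun y : E => (y, oneCoord E G)) isOpen_univ (mem_univ x) h2 h1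
  refine h3.congr (Filter.Eventually.of_forall fun y => ?_)
  simp only [oneChart_symm_coord, mul_one]

theorem SmoothNear.comp_clm {W : Type*} [AddCommGroup W] [Module ℝ W] [TopologicalSpace W]
    [IsTopologicalAddGroup W] [ContinuousSMul ℝ W] {F : V → G} (L : W →L[ℝ] V) {x : W}
    (h : SmoothNear E F (L x)) : SmoothNear E (fun y => F (L y)) x :=
  SmoothNear.comp isOpen_univ (mem_univ x) (fun n => CkOn.of_clm n L _) h

theorem SmoothNear.conj {F : V → G} {x : V} (hF : SmoothNear E F x) (g : G) :
    SmoothNear E (fun y => g * F y * g⁻¹) x :=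
  ((SmoothNear.const g x).mul hF).mul (SmoothNear.const g⁻¹ x)

/-- Velocities of curves through `1` add up under multiplication. -/
theorem dd_chart_mul {p q : V → G} {x : V} (hp : SmoothNear E p x) (hq : SmoothNear E q x)
    (hp1 : p x = 1) (hq1 : q x = 1) (h : V) :
    dd (fun y => oneChart E G (p y * q y)) x h =
      dd (fun y => oneChart E G (p y)) x h + dd (fun y => oneChart E G (q y)) x h := by
  set c := oneCoord E G with hc
  set m : E × E → G := fun z => (oneChart E G).symm z.1 * (oneChart E G).symm z.2 with hm
  have hms : SmoothNear E m (c, c) := SmoothLieGroup.smooth_mul (chartAt E (1 : G))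
    (chart_mem_atlas E _) (chartAt E (1 : G)) (chart_mem_atlas E _) _ oneCoord_mem _ oneCoord_mem
  have hm1 : m (c, c) = 1 := by simp only [hm, hc, oneChart_symm_coord, mul_one]
  obtain ⟨O, hO, hxO, hmO, hs⟩ := hms.one_chart hm1
  have htar : ∀ (d : E), ∀ᶠ t : ℝ in 𝓝[≠] 0, c + t • d ∈ (oneChart E G).target := fun d =>
    (tendsto_add_smul c d).eventually ((oneChart E G).open_target.mem_nhds oneCoord_mem)
  have h1 : ∀ d, dd (fun z => oneChart E G (m z)) (c, c) (d, 0) = d := by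
    intro d
    refine HasDD.dd_eq (tendsto_const_nhds.congr' ?_)
    filter_upwards [self_mem_nhdsWithin, htar d] with t ht ht'
    have e1 : m ((c, c) + t • (d, 0)) = (oneChart E G).symm (c + t • d) := by
      simp [hm, hc]
    rw [e1, hm1, (oneChart E G).right_inv ht']
    change d = t⁻¹ • (c + t • d - c)
    rw [add_sub_cancel_left, smul_smul,
      inv_mul_cancel₀ ht, one_smul]
  have h2 : ∀ d, dd (fun z => oneChart E G (m z)) (c, c) (0, d) = d := by
    intro d
    refine HasDD.dd_eq (tendsto_const_nhds.congr' ?_)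
    filter_upwards [self_mem_nhdsWithin, htar d] with t ht ht'
    have e1 : m ((c, c) + t • (0, d)) = (oneChart E G).symm (c + t • d) := by
      simp [hm, hc]
    rw [e1, hm1, (oneChart E G).right_inv ht']
    change d = t⁻¹ • (c + t • d - c)
    rw [add_sub_cancel_left, smul_smul,
      inv_mul_cancel₀ ht, one_smul]
  have h3 : HasDD (fun y => (oneChart E G (p y), oneChart E G (q y))) _ x h :=
    (hp.hasDD_chart hp1 h).prodMk (hq.hasDD_chart hq1 h)
  have h4 := HasDD.comp hO hs h3 (by simpa only [hp1, hq1] using hxO)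
  have h5 : (fun y => oneChart E G (p y * q y)) =ᶠ[𝓝 x]
      fun y => oneChart E G (m (oneChart E G (p y), oneChart E G (q y))) := by
    obtain ⟨O₁, hO₁, hx₁, hm₁, -⟩ := hp.one_chart hp1
    obtain ⟨O₂, hO₂, hx₂, hm₂, -⟩ := hq.one_chart hq1
    filter_upwards [hO₁.mem_nhds hx₁, hO₂.mem_nhds hx₂] with y hy₁ hy₂
    simp only [hm, (oneChart E G).left_inv (hm₁ hy₁), (oneChart E G).left_inv (hm₂ hy₂)]
  rw [(h4.congr h5).dd_eq]
  simp only [hp1, hq1]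
  change dd (fun z => oneChart E G (m z)) (c, c) (_, _) = _
  rw [← Prod.fst_add_snd (dd (fun y => oneChart E G (p y)) x h, dd (fun y => oneChart E G (q y)) x h),
    hs.dd_add_right hO hxO, h1, h2]

/-- Conjugation in the chart at `1`. -/
theorem conj_chart (g : G) : ∃ O, IsOpen O ∧ oneCoord E G ∈ O ∧
    CInftyOn (fun a => oneChart E G (g * (oneChart E G).symm a * g⁻¹)) O := by
  have h1 := (smoothNear_symm (E := E) (G := G) oneCoord_mem).conj g
  obtain ⟨O, hO, hx, -, hs⟩ := h1.one_chart (by simp)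
  exact ⟨O, hO, hx, hs⟩

theorem CInftyOn.deriv_eq {f : ℝ → E} {O : Set ℝ} (hO : IsOpen O) (hf : CInftyOn f O) {x : ℝ}
    (hx : x ∈ O) : deriv f x = ChernWeil.dd f x 1 := by
  change fderiv ℝ f x 1 = _
  rw [(hf.hasFDerivAt hO hx).fderiv]
  rfl

theorem deriv_comp_line {f : E → E} {O : Set E} (hO : IsOpen O) (hf : CInftyOn f O) {x : E}
    (hx : x ∈ O) (w : E) : deriv (fun t : ℝ => f (x + t • w)) 0 = dd f x w := by
  have h1 : CInftyOn (fun t : ℝ => x + t • w) univ := by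
    have := (CInftyOn.const x (univ : Set ℝ)).add
      (CInftyOn.of_clm ((ContinuousLinearMap.id ℝ ℝ).smulRight w) univ)
    simpa using this
  have hO' : IsOpen ((fun t : ℝ => x + t • w) ⁻¹' O) := hO.preimage (by fun_prop)
  have h2 : CInftyOn (fun t : ℝ => f (x + t • w)) ((fun t : ℝ => x + t • w) ⁻¹' O) :=
    CInftyOn.comp hO hf (h1.mono (subset_univ _)) fun t ht => ht
  rw [h2.deriv_eq hO' (by simpa using hx)]
  refine HasDD.dd_eq ?_
  have h3 := hf.hasDD hx w
  simpa [HasDD] using h3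

theorem Ad_eq (g : G) (w : E) :
    Ad E g w = dd (fun a => oneChart E G (g * (oneChart E G).symm a * g⁻¹)) (oneCoord E G) w := by
  obtain ⟨O, hO, hx, hs⟩ := conj_chart (E := E) g
  exact deriv_comp_line hO hs hx w

/-- Velocities of curves through `1` transform by `Ad` under conjugation. -/
theorem dd_chart_conj {p : V → G} {x : V} (hp : SmoothNear E p x) (hp1 : p x = 1) (g : G) (h : V) :
    dd (fun y => oneChart E G (g * p y * g⁻¹)) x h =
      Ad E g (dd (fun y => oneChart E G (p y)) x h) := by
  obtain ⟨O, hO, hx, hs⟩ := conj_chart (E := E) g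
  have h1 := HasDD.comp hO hs (hp.hasDD_chart hp1 h) (by simpa only [hp1] using hx)
  rw [Ad_eq, ← (show oneChart E G (p x) = oneCoord E G by rw [hp1]), ← h1.dd_eq]
  refine dd_congr ?_
  obtain ⟨O₁, hO₁, hx₁, hm₁, -⟩ := hp.one_chart hp1
  filter_upwards [hO₁.mem_nhds hx₁] with y hy₁
  rw [(oneChart E G).left_inv (hm₁ hy₁)]

theorem Ad_mul (g k : G) (w : E) : Ad E (g * k) w = Ad E g (Ad E k w) := by
  rw [Ad_eq k, ← dd_chart_conj ((smoothNear_symm oneCoord_mem).conj k)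
    (by simp), Ad_eq]
  simp only [mul_inv_rev, mul_assoc]

theorem dd_chart_symm (w : E) :
    dd (fun a => oneChart E G ((oneChart E G).symm a)) (oneCoord E G) w = w := by
  refine HasDD.dd_eq (HasDD.congr (f := id) (tendsto_const_nhds.congr' ?_) ?_)
  · filter_upwards [self_mem_nhdsWithin] with t ht
    simp [smul_smul, inv_mul_cancel₀ (show t ≠ 0 from ht)]
  · filter_upwards [(oneChart E G).open_target.mem_nhds oneCoord_mem] with a ha
    exact (oneChart E G).right_inv ha

theorem Ad_one (w : E) : Ad E (1 : G) w = w := by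
  rw [Ad_eq]
  simp only [one_mul, inv_one, mul_one]
  exact dd_chart_symm w

theorem Ad_inv_Ad (g : G) (w : E) : Ad E g⁻¹ (Ad E g w) = w := by
  rw [← Ad_mul, inv_mul_cancel, Ad_one]

theorem Ad_Ad_inv (g : G) (w : E) : Ad E g (Ad E g⁻¹ w) = w := by
  rw [← Ad_mul, mul_inv_cancel, Ad_one]

theorem smooth_Ad_aux {g : V → G} {x : V} (hg : SmoothNear E g x) :
    ∃ O, IsOpen O ∧ x ∈ O ∧ CInftyOn (fun q : V × E => Ad E (g q.1) q.2) (O ×ˢ univ) := by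
  set c := oneCoord E G
  set K : V × E → G := fun q => g q.1 * (oneChart E G).symm q.2 * (g q.1)⁻¹ with hK
  have hgf : SmoothNear E (fun q : V × E => g q.1) (x, c) :=
    SmoothNear.comp_clm (ContinuousLinearMap.fst ℝ V E) hg
  have hKs : SmoothNear E K (x, c) :=
    (hgf.mul (SmoothNear.comp_clm (x := (x, c)) (ContinuousLinearMap.snd ℝ V E)
      (smoothNear_symm oneCoord_mem))).mul hgf.inv
  obtain ⟨N, hN, hxN, -, hs⟩ := hKs.one_chart (by simp [hK, c])
  refine ⟨{y | (y, c) ∈ N}, hN.preimage (by fun_prop), hxN, ?_⟩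
  have h1 : CInftyOn (fun q : V × E => (((q.1, c), (0, q.2)) : (V × E) × V × E))
      ({y | (y, c) ∈ N} ×ˢ univ) :=
    CInftyOn.prodMk (CInftyOn.prodMk (CInftyOn.of_clm (ContinuousLinearMap.fst ℝ V E) _)
      (CInftyOn.const _ _)) (CInftyOn.prodMk (CInftyOn.const _ _)
      (CInftyOn.of_clm (ContinuousLinearMap.snd ℝ V E) _))
  have h2 := CInftyOn.comp (hN.prod isOpen_univ) (hs.dd hN) h1 fun q hq => ⟨hq.1, mem_univ _⟩
  refine h2.congr ((hN.preimage (by fun_prop)).prod isOpen_univ) fun q hq => ?_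
  rw [Ad_eq]
  simp only [dd, Function.comp_apply, hK, Prod.smul_mk, smul_zero, Prod.mk_add_mk, add_zero]
  rfl

variable (E) in
/-- The adjoint action of a group element, as a continuous linear map. -/
def AdL (g : G) : E →L[ℝ] E where
  toFun := Ad E g
  map_add' v w := by
    obtain ⟨O, hO, hx, hs⟩ := conj_chart (E := E) g
    simp only [Ad_eq, hs.dd_add_right hO hx]
  map_smul' r v := by
    obtain ⟨O, hO, hx, hs⟩ := conj_chart (E := E) g
    simp only [Ad_eq, ((hs.hasDD hx v).smul_right r).dd_eq, RingHom.id_apply]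
  cont := by
    obtain ⟨O, -, h0, hs⟩ := smooth_Ad_aux (E := E) (SmoothNear.const g (0 : ℝ))
    rw [← continuousOn_univ]
    exact hs.continuousOn.comp (f := fun w : E => ((0 : ℝ), w)) (by fun_prop)
      fun w _ => ⟨h0, mem_univ _⟩

theorem AdL_apply (g : G) (w : E) : AdL E g w = Ad E g w := rfl

theorem Ad_add (g : G) (v w : E) : Ad E g (v + w) = Ad E g v + Ad E g w := (AdL E g).map_add v w

theorem Ad_sub (g : G) (v w : E) : Ad E g (v - w) = Ad E g v - Ad E g w := (AdL E g).map_sub v w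

theorem Ad_smul (g : G) (r : ℝ) (v : E) : Ad E g (r • v) = r • Ad E g v := (AdL E g).map_smul r v

theorem Ad_zero (g : G) : Ad E g (0 : E) = 0 := (AdL E g).map_zero

/-- The adjoint action in the chart at `1`. -/
theorem smooth_Ad_chart : ∃ O, IsOpen O ∧ oneCoord E G ∈ O ∧
    CInftyOn (fun q : E × E => Ad E ((oneChart E G).symm q.1) q.2) (O ×ˢ univ) :=
  smooth_Ad_aux (smoothNear_symm oneCoord_mem)

theorem smooth_Ad_apply {g : V → G} {x : V} (hg : SmoothNear E g x) {w : V → E} {O : Set V}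
    (hO : IsOpen O) (hx : x ∈ O) (hw : CInftyOn w O) :
    ∃ O', IsOpen O' ∧ x ∈ O' ∧ CInftyOn (fun y => Ad E (g y) (w y)) O' := by
  obtain ⟨O₁, hO₁, hx₁, hs⟩ := smooth_Ad_aux hg
  refine ⟨O ∩ O₁, hO.inter hO₁, ⟨hx, hx₁⟩, ?_⟩
  exact CInftyOn.comp (g := fun q : V × E => Ad E (g q.1) q.2) (f := fun y => (y, w y))
    (hO₁.prod isOpen_univ) hs
    (CInftyOn.prodMk (CInftyOn.of_clm (ContinuousLinearMap.id ℝ V) _) (hw.mono inter_subset_left))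
    fun y hy => ⟨hy.2, mem_univ _⟩

theorem bracket_eq (v w : E) : bracket E G v w =
    dd (fun a => Ad E ((oneChart E G).symm a) w) (oneCoord E G) v := by
  obtain ⟨O, hO, hx, hs⟩ := smooth_Ad_apply (E := E) (G := G) (smoothNear_symm oneCoord_mem)
    isOpen_univ (mem_univ _) (CInftyOn.const w univ)
  exact deriv_comp_line hO hs hx v

/-- The derivative of the adjoint action in the chart at `1`. -/
theorem dd_Ad_chart (v w d : E) : dd (fun q : E × E => Ad E ((oneChart E G).symm q.1) q.2)
    (oneCoord E G, w) (v, d) = bracket E G v w + d := by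
  obtain ⟨O, hO, hx, hs⟩ := smooth_Ad_chart (E := E) (G := G)
  have hx' : (oneCoord E G, w) ∈ O ×ˢ (univ : Set E) := ⟨hx, mem_univ _⟩
  have h1 : ((v, d) : E × E) = (v, 0) + (0, d) := by simp
  rw [h1, hs.dd_add_right (hO.prod isOpen_univ) hx']
  congr 1
  · rw [bracket_eq]
    simp only [dd, Prod.smul_mk, smul_zero, Prod.mk_add_mk, add_zero]
  · refine HasDD.dd_eq (tendsto_const_nhds.congr' ?_)
    filter_upwards [self_mem_nhdsWithin] with t ht
    simp [Ad_one, smul_smul, inv_mul_cancel₀ (show t ≠ 0 from ht)]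

variable (E) in
/-- The left logarithmic derivative `g⁻¹ dg` at `x` in the direction `h`. -/
def theta (g : V → G) (x h : V) : E := dd (fun y => oneChart E G ((g x)⁻¹ * g y)) x h

theorem SmoothNear.left_translate {g : V → G} {x : V} (hg : SmoothNear E g x) (k : G) :
    SmoothNear E (fun y => k * g y) x := (SmoothNear.const k x).mul hg

theorem HasDD.Ad {g : V → G} {w : V → E} {d : E} {x h : V} (hg : SmoothNear E g x)
    (hw : HasDD w d x h) :
    HasDD (fun y => ChernWeil.Ad E (g y) (w y))
      (ChernWeil.Ad E (g x) (bracket E G (theta E g x h) (w x) + d)) x h := by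
  set k : V → G := fun y => (g x)⁻¹ * g y with hk
  have hks : SmoothNear E k x := hg.left_translate _
  have hk1 : k x = 1 := by simp [hk]
  obtain ⟨O, hO, hx, hs⟩ := smooth_Ad_chart (E := E) (G := G)
  have h1 : HasDD (fun y => (oneChart E G (k y), w y)) (theta E g x h, d) x h :=
    (hks.hasDD_chart hk1 h).prodMk hw
  have h2 := HasDD.comp (hO.prod isOpen_univ) hs h1 (by simpa only [hk1, mem_prod, mem_univ, and_true])
  simp only [hk1] at h2
  change HasDD _ (ChernWeil.dd (fun q : E × E => ChernWeil.Ad E ((oneChart E G).symm q.1) q.2)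
    (oneCoord E G, w x) (theta E g x h, d)) x h at h2
  rw [dd_Ad_chart] at h2
  refine ((h2.clm_comp (AdL E (g x))).congr ?_)
  obtain ⟨O₁, hO₁, hx₁, hm₁, -⟩ := hks.one_chart hk1
  filter_upwards [hO₁.mem_nhds hx₁] with y hy
  rw [(oneChart E G).left_inv (hm₁ hy), AdL_apply, ← Ad_mul, hk, mul_inv_cancel_left]

theorem HasDD.Ad_inv {g : V → G} {w : V → E} {x : V} (hg : SmoothNear E g x) {O : Set V}
    (hO : IsOpen O) (hx : x ∈ O) (hw : CInftyOn w O) (h : V) :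
    HasDD (fun y => ChernWeil.Ad E (g y)⁻¹ (w y))
      (ChernWeil.Ad E (g x)⁻¹ (ChernWeil.dd w x h) -
        bracket E G (theta E g x h) (ChernWeil.Ad E (g x)⁻¹ (w x))) x h := by
  obtain ⟨O', hO', hx', hs⟩ := smooth_Ad_apply hg.inv hO hx hw
  have h1 := hs.hasDD hx' h
  have h2 := HasDD.Ad hg h1
  simp only [Ad_Ad_inv] at h2
  have h3 : ChernWeil.dd w x h = _ := h2.dd_eq
  rw [h3, Ad_inv_Ad, add_sub_cancel_left]
  exact h1

/-! #### Logarithmic derivatives -/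

theorem theta_const (g : G) (x h : V) : theta E (fun _ : V => g) x h = 0 :=
  (HasDD.const _ x h).dd_eq

theorem theta_mul {g k : V → G} {x : V} (hg : SmoothNear E g x) (hk : SmoothNear E k x) (h : V) :
    theta E (fun y => g y * k y) x h = Ad E (k x)⁻¹ (theta E g x h) + theta E k x h := by
  have h1 := dd_chart_mul ((hg.left_translate (g x)⁻¹).conj (k x)⁻¹) (hk.left_translate (k x)⁻¹)
    (by simp) (by simp) h
  rw [dd_chart_conj (hg.left_translate (g x)⁻¹) (by simp)] at h1
  refine Eq.trans ?_ h1
  simp only [theta, mul_inv_rev, inv_inv, mul_assoc, mul_inv_cancel_left]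

theorem theta_comp {W : Type*} [AddCommGroup W] [Module ℝ W] [TopologicalSpace W]
    [IsTopologicalAddGroup W] [ContinuousSMul ℝ W] {g : V → G} {f : W → V} {x h : W} {d : V}
    (hg : SmoothNear E g (f x)) (hf : HasDD f d x h) :
    theta E (fun y => g (f y)) x h = theta E g (f x) d := by
  obtain ⟨O, hO, hx, -, hs⟩ := (hg.left_translate (g (f x))⁻¹).one_chart (by simp)
  exact (HasDD.comp hO hs hf hx).dd_eq

/-- Logarithmic derivatives of smooth maps are smooth. -/
theorem smooth_theta {g : V → G} {x : V} (hg : SmoothNear E g x) :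
    ∃ O, IsOpen O ∧ x ∈ O ∧ CInftyOn (fun q : V × V => theta E g q.1 q.2) (O ×ˢ univ) := by
  set m : V × V → G := fun q => (g q.1)⁻¹ * g q.2 with hm
  have hms : SmoothNear E m (x, x) :=
    (SmoothNear.comp_clm (x := (x, x)) (ContinuousLinearMap.fst ℝ V V) hg).inv.mul
      (SmoothNear.comp_clm (x := (x, x)) (ContinuousLinearMap.snd ℝ V V) hg)
  obtain ⟨N, hN, hxN, -, hs⟩ := hms.one_chart (by simp [hm])
  refine ⟨{y | (y, y) ∈ N}, hN.preimage (by fun_prop), hxN, ?_⟩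
  have h1 : CInftyOn (fun q : V × V => (((q.1, q.1), (0, q.2)) : (V × V) × V × V))
      ({y | (y, y) ∈ N} ×ˢ univ) :=
    CInftyOn.prodMk (CInftyOn.prodMk (CInftyOn.of_clm (ContinuousLinearMap.fst ℝ V V) _)
      (CInftyOn.of_clm (ContinuousLinearMap.fst ℝ V V) _)) (CInftyOn.prodMk (CInftyOn.const _ _)
      (CInftyOn.of_clm (ContinuousLinearMap.snd ℝ V V) _))
  have h2 := CInftyOn.comp (hN.prod isOpen_univ) (hs.dd hN) h1 fun q hq => ⟨hq.1, mem_univ _⟩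
  refine h2.congr ((hN.preimage (by fun_prop)).prod isOpen_univ) fun q hq => ?_
  simp only [theta, dd, Function.comp_apply, hm, Prod.smul_mk, smul_zero, Prod.mk_add_mk, add_zero]

/-! #### The Maurer–Cartan equation -/

theorem SmoothNear.eventually {g : V → G} {x : V} (hg : SmoothNear E g x) :
    ∀ᶠ y in 𝓝 x, SmoothNear E g y := by
  obtain ⟨O, hO, hx, hm, hs⟩ := hg
  set e := chartAt E (g x) with he
  filter_upwards [hO.mem_nhds hx] with y hy
  -- the chart at `g x` is replaced by the chart at `1`, translated to `g y`
  have h1 : SmoothNear E (fun a : E => e.symm a) (e (g y)) := by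
    have h2 := SmoothLieGroup.smooth_mul e (chart_mem_atlas E _) (chartAt E (1 : G))
      (chart_mem_atlas E _) _ (e.map_source (hm hy)) _ (oneCoord_mem (G := G))
    have h3 : CInftyOn (fun y : E => (y, oneCoord E G)) univ :=
      CInftyOn.prodMk (CInftyOn.of_clm (ContinuousLinearMap.id ℝ E) univ) (CInftyOn.const _ _)
    refine (SmoothNear.comp (f := fun y : E => (y, oneCoord E G)) isOpen_univ (mem_univ _) h3
      h2).congr (Filter.Eventually.of_forall fun y => ?_)
    simp
  refine (SmoothNear.comp hO hy hs h1).congr ?_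
  filter_upwards [hO.mem_nhds hy] with z hz
  exact (e.left_inv (hm hz)).symm

theorem theta_add {g : V → G} {x : V} (hg : SmoothNear E g x) (h k : V) :
    theta E g x (h + k) = theta E g x h + theta E g x k := by
  obtain ⟨O, hO, hx, -, hs⟩ := (hg.left_translate (g x)⁻¹).one_chart (by simp)
  exact hs.dd_add_right hO hx h k

theorem theta_smul {g : V → G} {x : V} (hg : SmoothNear E g x) (r : ℝ) (h : V) :
    theta E g x (r • h) = r • theta E g x h := by
  obtain ⟨O, hO, hx, -, hs⟩ := (hg.left_translate (g x)⁻¹).one_chart (by simp)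
  exact ((hs.hasDD hx h).smul_right r).dd_eq

theorem theta_zero_right {g : V → G} {x : V} (hg : SmoothNear E g x) : theta E g x 0 = 0 := by
  have := theta_smul hg 0 0
  simpa using this

theorem HasDD.of_clm {F : Type*} [AddCommGroup F] [Module ℝ F] [TopologicalSpace F]
    (L : V →L[ℝ] F) (x h : V) : HasDD L (L h) x h := by
  refine tendsto_const_nhds.congr' ?_
  filter_upwards [self_mem_nhdsWithin] with t ht
  simp [smul_smul, inv_mul_cancel₀ (show t ≠ 0 from ht)]

theorem hasDD_theta {g : V → G} {x : V} (hg : SmoothNear E g x) (h k : V) :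
    HasDD (fun y => theta E g y k) (dd (fun y => theta E g y k) x h) x h := by
  obtain ⟨O, hO, hx, hs⟩ := smooth_theta hg
  have h1 : CInftyOn (fun y : V => (y, k)) O :=
    CInftyOn.prodMk (CInftyOn.of_clm (ContinuousLinearMap.id ℝ V) O) (CInftyOn.const _ _)
  exact (CInftyOn.comp (hO.prod isOpen_univ) hs h1 fun y hy => ⟨hy, mem_univ _⟩).hasDD hx h

/-- A shift of the parameter along a line. -/
theorem HasDD.line {F : Type*} [AddCommGroup F] [Module ℝ F] [TopologicalSpace F] {f : V → F}
    {d : F} {x h : V} : HasDD f d x h ↔ HasDD (fun t : ℝ => f (x + t • h)) d 0 1 := by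
  simp [HasDD]

/-- The Maurer–Cartan equation on the plane, at a point with the value `1`: the map is, up to a
factor which is `1` on both axes, the product of its restrictions to the axes. -/
theorem maurerCartan_plane {K : ℝ × ℝ → G} (hK : SmoothNear E K 0) (h1 : K 0 = 1) :
    dd (fun p => theta E K p (0, 1)) 0 (1, 0) - dd (fun p => theta E K p (1, 0)) 0 (0, 1) =
      bracket E G (theta E K 0 (0, 1)) (theta E K 0 (1, 0)) := by
  set fs : ℝ × ℝ →L[ℝ] ℝ × ℝ := (ContinuousLinearMap.fst ℝ ℝ ℝ).prod 0 with hfs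
  set sn : ℝ × ℝ →L[ℝ] ℝ × ℝ := ContinuousLinearMap.prod 0 (ContinuousLinearMap.snd ℝ ℝ ℝ) with hsn
  have hfs0 : fs 0 = 0 := map_zero _
  have hsn0 : sn 0 = 0 := map_zero _
  have hp : SmoothNear E (fun z => K (fs z)) 0 := SmoothNear.comp_clm fs (by rwa [hfs0])
  have hq : SmoothNear E (fun z => K (sn z)) 0 := SmoothNear.comp_clm sn (by rwa [hsn0])
  set r : ℝ × ℝ → G := fun z => (K (sn z))⁻¹ * ((K (fs z))⁻¹ * K z) with hr
  have hrs : SmoothNear E r 0 := hq.inv.mul (hp.inv.mul hK)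
  have hKeq : K = fun z => K (fs z) * (K (sn z) * r z) := by
    funext z
    simp [hr]
  have hr1 : ∀ s : ℝ, r (s, 0) = 1 := fun s => by
    have e1 : fs (s, 0) = (s, 0) := by simp [hfs]
    have e2 : sn (s, 0) = 0 := by simp [hsn]
    simp [hr, e1, e2, h1]
  have hr2 : ∀ s : ℝ, r (0, s) = 1 := fun s => by
    have e1 : fs (0, s) = 0 := by simp [hfs]
    have e2 : sn (0, s) = (0, s) := by simp [hsn]
    simp [hr, e1, e2, h1]
  obtain ⟨O, hO, hxO, hmO, hs⟩ := hrs.one_chart (hr1 0)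
  -- the logarithmic derivative of a product of three factors
  have hprod : ∀ᶠ z in 𝓝 (0 : ℝ × ℝ), ∀ v, theta E K z v =
      Ad E (r z)⁻¹ (Ad E (K (sn z))⁻¹ (theta E K (fs z) (fs v)) + theta E K (sn z) (sn v)) +
        theta E r z v := by
    have e1 : ∀ᶠ z in 𝓝 (0 : ℝ × ℝ), SmoothNear E K (fs z) := by
      have := (fs.continuous.tendsto 0)
      rw [hfs0] at this
      exact this.eventually hK.eventually
    have e2 : ∀ᶠ z in 𝓝 (0 : ℝ × ℝ), SmoothNear E K (sn z) := by
      have := (sn.continuous.tendsto 0)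
      rw [hsn0] at this
      exact this.eventually hK.eventually
    filter_upwards [e1, e2, hrs.eventually] with z e1 e2 e3 v
    have e1' := SmoothNear.comp_clm fs e1
    have e2' := SmoothNear.comp_clm sn e2
    conv_lhs => rw [hKeq]
    rw [theta_mul e1' (e2'.mul e3), theta_mul e2' e3, theta_comp e1 (HasDD.of_clm fs z v),
      theta_comp e2 (HasDD.of_clm sn z v), mul_inv_rev, Ad_mul, Ad_add, add_assoc]
  have hthr : ∀ z, r z = 1 → ∀ v, theta E r z v = dd (fun y => oneChart E G (r y)) z v := by
    intro z hz v
    simp [theta, hz]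
  have hinl : Tendsto (fun s : ℝ => ((s, 0) : ℝ × ℝ)) (𝓝 0) (𝓝 0) :=
    (by fun_prop : Continuous fun s : ℝ => ((s, 0) : ℝ × ℝ)).tendsto 0
  have hinr : Tendsto (fun s : ℝ => ((0, s) : ℝ × ℝ)) (𝓝 0) (𝓝 0) :=
    (by fun_prop : Continuous fun s : ℝ => ((0, s) : ℝ × ℝ)).tendsto 0
  have hz : ((0 : ℝ), (0 : ℝ)) = 0 := rfl
  -- the two derivatives along the axes
  have hsm : ∀ l : ℝ × ℝ, CInftyOn (fun z => dd (fun y => oneChart E G (r y)) z l) O := fun l =>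
    CInftyOn.comp (g := fun p : (ℝ × ℝ) × ℝ × ℝ => dd (fun y => oneChart E G (r y)) p.1 p.2)
      (f := fun y => (y, l)) (hO.prod isOpen_univ) (hs.dd hO)
      (CInftyOn.prodMk (CInftyOn.of_clm (ContinuousLinearMap.id ℝ _) O) (CInftyOn.const l O))
      fun y hy => ⟨hy, mem_univ _⟩
  have hd1 : HasDD (fun p => theta E K p (0, 1))
      (0 + dd (fun z => dd (fun y => oneChart E G (r y)) z (0, 1)) 0 (1, 0)) 0 (1, 0) := by
    rw [HasDD.line]
    have h2 := (HasDD.const (theta E K 0 (0, 1)) (0 : ℝ) 1).add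
      (HasDD.line.1 ((hsm (0, 1)).hasDD hxO (1, 0)))
    refine h2.congr ?_
    filter_upwards [hinl.eventually hprod, hinl.eventually hK.eventually] with s hs hsK
    have e0 : (0 : ℝ × ℝ) + s • ((1 : ℝ), (0 : ℝ)) = (s, 0) := by simp
    have e1 : fs (s, 0) = (s, 0) := by simp [hfs]
    have e2 : sn (s, 0) = 0 := by simp [hsn]
    have e3 : fs (0, 1) = 0 := by simp [hfs]
    have e4 : sn (0, 1) = (0, 1) := by simp [hsn]
    rw [e0, hs, hthr _ (hr1 s), hr1, e1, e2, e3, e4, theta_zero_right hsK, Ad_zero, zero_add,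
      inv_one, Ad_one]
  have hd2 : HasDD (fun p => theta E K p (1, 0))
      (-bracket E G (theta E K 0 (0, 1)) (theta E K 0 (1, 0)) +
        dd (fun z => dd (fun y => oneChart E G (r y)) z (1, 0)) 0 (0, 1)) 0 (0, 1) := by
    rw [HasDD.line]
    have hKl : SmoothNear E (fun t : ℝ => K (0, t)) 0 :=
      SmoothNear.comp_clm (ContinuousLinearMap.inr ℝ ℝ ℝ) (by
        rw [map_zero]
        exact hK)
    have hth : theta E (fun t : ℝ => K (0, t)) 0 1 = theta E K 0 (0, 1) := by
      have := theta_comp (g := K) (f := ContinuousLinearMap.inr ℝ ℝ ℝ) (x := 0) (h := 1)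
        (by rw [map_zero]; exact hK) (HasDD.of_clm _ _ _)
      simp only [ContinuousLinearMap.inr_apply] at this
      exact this
    have h2 := (HasDD.Ad_inv hKl isOpen_univ (mem_univ _)
      (CInftyOn.const (theta E K 0 (1, 0)) univ) 1).add
      (HasDD.line.1 ((hsm (1, 0)).hasDD hxO (0, 1)))
    rw [(HasDD.const (theta E K 0 (1, 0)) (0 : ℝ) 1).dd_eq, hth, Ad_zero, zero_sub, hz, h1, inv_one,
      Ad_one] at h2
    refine h2.congr ?_
    filter_upwards [hinr.eventually hprod, hinr.eventually hK.eventually] with s hs hsK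
    have e0 : (0 : ℝ × ℝ) + s • ((0 : ℝ), (1 : ℝ)) = (0, s) := by simp
    have e1 : fs (0, s) = 0 := by simp [hfs]
    have e2 : sn (0, s) = (0, s) := by simp [hsn]
    have e3 : fs (1, 0) = (1, 0) := by simp [hfs]
    have e4 : sn (1, 0) = 0 := by simp [hsn]
    rw [e0, hs, hthr _ (hr2 s), hr2, e1, e2, e3, e4, theta_zero_right hsK, add_zero, inv_one,
      Ad_one]
  rw [hd1.dd_eq, hd2.dd_eq, hs.dd_comm hO hxO (0, 1) (1, 0)]
  abel

theorem theta_left_translate (g : V → G) (k : G) (x h : V) :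
    theta E (fun y => k * g y) x h = theta E g x h := by
  simp only [theta, mul_inv_rev, mul_assoc, inv_mul_cancel_left]

/-- The Maurer–Cartan equation for logarithmic derivatives. -/
theorem maurerCartan {g : V → G} {x : V} (hg : SmoothNear E g x) (h k : V) :
    dd (fun y => theta E g y k) x h - dd (fun y => theta E g y h) x k =
      bracket E G (theta E g x k) (theta E g x h) := by
  set L : ℝ × ℝ →L[ℝ] V := (ContinuousLinearMap.fst ℝ ℝ ℝ).smulRight h +
    (ContinuousLinearMap.snd ℝ ℝ ℝ).smulRight k with hL
  have hLa : ∀ a b, L (a, b) = a • h + b • k := fun a b => by simp [hL]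
  set e : ℝ × ℝ → V := fun p => x + L p with he
  have hes : CInftyOn e univ := (CInftyOn.const x univ).add (CInftyOn.of_clm L univ)
  have hed : ∀ p v, HasDD e (L v) p v := fun p v => by
    simpa using (HasDD.const x p v).add (HasDD.of_clm L p v)
  have he0 : e 0 = x := by simp [he]
  set K : ℝ × ℝ → G := fun p => (g x)⁻¹ * g (e p) with hKdef
  have hK : SmoothNear E K 0 :=
    (SmoothNear.comp isOpen_univ (mem_univ _) hes (by rwa [he0])).left_translate _
  have hth : ∀ᶠ p in 𝓝 (0 : ℝ × ℝ), ∀ v, theta E K p v = theta E g (e p) (L v) := by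
    have h1 : ContinuousAt e 0 := by fun_prop
    have h2 := h1.tendsto.eventually (he0 ▸ hg.eventually)
    filter_upwards [h2] with p hp v
    rw [hKdef, theta_left_translate, theta_comp hp (hed p v)]
  have key := maurerCartan_plane hK (by simp [hKdef, he0])
  have hd : ∀ u v w : V, ∀ a b : ℝ × ℝ, L a = u → L b = v →
      dd (fun p => theta E K p b) 0 a = dd (fun y => theta E g y v) x u := by
    rintro _ _ - a b rfl rfl
    have h1 := HasDD.line.1 (hasDD_theta hg (L a) (L b))
    have h2 : HasDD (fun p => theta E K p b) (dd (fun y => theta E g y (L b)) x (L a)) 0 a := by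
      rw [HasDD.line]
      refine h1.congr ?_
      have h3 : Tendsto (fun t : ℝ => (0 : ℝ × ℝ) + t • a) (𝓝 0) (𝓝 0) := by
        have : Continuous fun t : ℝ => (0 : ℝ × ℝ) + t • a := by fun_prop
        simpa using this.tendsto 0
      filter_upwards [h3.eventually hth] with t ht
      rw [ht]
      simp [he]
    exact h2.dd_eq
  have h0 := hth.self_of_nhds
  rw [hd h k 0 (1, 0) (0, 1) (by simp [hLa]) (by simp [hLa]),
    hd k h 0 (0, 1) (1, 0) (by simp [hLa]) (by simp [hLa]), h0, h0, he0, hLa, hLa] at key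
  simpa using key

/-! #### The Lie bracket -/

theorem bracket_add_right (u v w : E) :
    bracket E G u (v + w) = bracket E G u v + bracket E G u w := by
  have h : ∀ v : E, HasDD (fun a => Ad E ((oneChart E G).symm a) v) (bracket E G u v)
      (oneCoord E G) u := fun v => by
    obtain ⟨O, hO, hx, hs⟩ := smooth_Ad_apply (E := E) (G := G) (smoothNear_symm oneCoord_mem)
      isOpen_univ (mem_univ _) (CInftyOn.const v univ)
    rw [bracket_eq]
    exact hs.hasDD hx u
  rw [bracket_eq, ← ((h v).add (h w)).dd_eq]
  simp only [Ad_add]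

theorem bracket_smul_right (r : ℝ) (u v : E) : bracket E G u (r • v) = r • bracket E G u v := by
  have h : HasDD (fun a => Ad E ((oneChart E G).symm a) v) (bracket E G u v)
      (oneCoord E G) u := by
    obtain ⟨O, hO, hx, hs⟩ := smooth_Ad_apply (E := E) (G := G) (smoothNear_symm oneCoord_mem)
      isOpen_univ (mem_univ _) (CInftyOn.const v univ)
    rw [bracket_eq]
    exact hs.hasDD hx u
  have h1 := h.clm_comp (r • ContinuousLinearMap.id ℝ E)
  simp only [_root_.smul_apply, ContinuousLinearMap.id_apply] at h1
  rw [bracket_eq, ← h1.dd_eq]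
  simp only [Ad_smul]

theorem theta_chart (L : V →L[ℝ] E) (x h : V) :
    theta E (fun y => (oneChart E G).symm (oneCoord E G + L (y - x))) x h = L h := by
  simp only [theta, sub_self, map_zero, add_zero, oneChart_symm_coord, inv_one, one_mul]
  have h1 : HasDD (fun y : V => oneCoord E G + L (y - x)) (L h) x h := by
    have h2 : HasDD (fun y : V => L y) (L h) x h := HasDD.of_clm L x h
    have h3 := (HasDD.const (oneCoord E G - L x) x h).add h2
    rw [zero_add] at h3
    refine h3.congr (Filter.Eventually.of_forall fun y => ?_)
    dsimp only
    rw [map_sub]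
    abel
  refine (h1.congr ?_).dd_eq
  have h4 : Tendsto (fun y : V => oneCoord E G + L (y - x)) (𝓝 x) (𝓝 (oneCoord E G)) := by
    have : Continuous fun y : V => oneCoord E G + L (y - x) := by fun_prop
    simpa using this.tendsto x
  filter_upwards [h4.eventually ((oneChart E G).open_target.mem_nhds oneCoord_mem)] with y hy
  exact (oneChart E G).right_inv hy

/-- A map near `x`, with the value `1` at `x`, whose derivative at `x` is prescribed. -/
theorem smoothNear_chart (L : V →L[ℝ] E) (x : V) :
    SmoothNear E (fun y => (oneChart E G).symm (oneCoord E G + L (y - x)) : V → G) x := by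
  have h1 : CInftyOn (fun y : V => oneCoord E G + L (y - x)) univ := by
    have h2 := (CInftyOn.const (oneCoord E G - L x) univ).add (CInftyOn.of_clm L univ)
    refine h2.congr isOpen_univ fun y _ => ?_
    dsimp only
    rw [map_sub]
    abel
  refine SmoothNear.comp (F := (oneChart E G).symm) isOpen_univ (mem_univ x) h1 ?_
  simpa using smoothNear_symm (E := E) (G := G) oneCoord_mem

theorem bracket_antisymm (v w : E) : bracket E G v w = -bracket E G w v := by
  set L : ℝ × ℝ →L[ℝ] E := (ContinuousLinearMap.fst ℝ ℝ ℝ).smulRight v +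
    (ContinuousLinearMap.snd ℝ ℝ ℝ).smulRight w with hL
  have hg := smoothNear_chart (G := G) L 0
  have h1 := maurerCartan hg (1, 0) (0, 1)
  have h2 := maurerCartan hg (0, 1) (1, 0)
  rw [theta_chart, theta_chart] at h1 h2
  have hLv : L (1, 0) = v := by simp [hL]
  have hLw : L (0, 1) = w := by simp [hL]
  rw [hLv, hLw] at h1 h2
  rw [← h1, ← h2]
  abel

theorem bracket_add_left (u v w : E) :
    bracket E G (u + v) w = bracket E G u w + bracket E G v w := by
  rw [bracket_antisymm, bracket_add_right, neg_add, ← bracket_antisymm, ← bracket_antisymm]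

theorem bracket_smul_left (r : ℝ) (u v : E) : bracket E G (r • u) v = r • bracket E G u v := by
  rw [bracket_antisymm, bracket_smul_right, ← smul_neg, ← bracket_antisymm]

variable (E G) in
/-- The Lie bracket as a bilinear map. -/
def bracketB : E →ₗ[ℝ] E →ₗ[ℝ] E :=
  LinearMap.mk₂ ℝ (bracket E G) bracket_add_left bracket_smul_left bracket_add_right
    bracket_smul_right

theorem bracketB_apply (v w : E) : bracketB E G v w = bracket E G v w := rfl

theorem continuous_bracket : Continuous fun p : E × E => bracketB E G p.1 p.2 := by
  obtain ⟨O, hO, hx, hs⟩ := smooth_Ad_chart (E := E) (G := G)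
  have h1 := (hs.dd (hO.prod isOpen_univ)).continuousOn
  have h2 := h1.comp (f := fun p : E × E => ((oneCoord E G, p.2), (p.1, (0 : E)))) (s := univ)
    (by fun_prop) fun p _ => ⟨⟨hx, mem_univ _⟩, mem_univ _⟩
  rw [← continuousOn_univ]
  refine h2.congr fun p _ => ?_
  simp only [Function.comp_apply]
  rw [dd_Ad_chart, add_zero, bracketB_apply]

theorem CInftyOn.bracket {u w : V → E} {O : Set V} (hu : CInftyOn u O) (hw : CInftyOn w O) :
    CInftyOn (fun y => ChernWeil.bracket E G (u y) (w y)) O := by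
  have h1 : CInftyOn (fun p : E × E => bracketB E G p.1 p.2) univ :=
    CInftyOn.bilinear (bracketB E G) continuous_bracket univ
  have h2 : CInftyOn (fun y => (u y, w y)) O := CInftyOn.prodMk hu hw
  have h3 : MapsTo (fun y => (u y, w y)) O univ := fun _ _ => mem_univ _
  exact CInftyOn.comp isOpen_univ h1 h2 h3

theorem HasDD.bracket {u w : V → E} {d d' : E} {x h : V} (hu : HasDD u d x h)
    (hw : HasDD w d' x h) :
    HasDD (fun y => ChernWeil.bracket E G (u y) (w y))
      (ChernWeil.bracket E G d (w x) + ChernWeil.bracket E G (u x) d') x h := by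
  have hB := CInftyOn.bilinear (bracketB E G) continuous_bracket univ
  have h1 := HasDD.comp isOpen_univ hB (hu.prodMk hw) (mem_univ _)
  rw [show ((d, d') : E × E) = (d, 0) + (0, d') by simp, hB.dd_add_right isOpen_univ (mem_univ _)] at h1
  have h2 : ∀ a b c : E, HasDD (fun p : E × E => bracketB E G p.1 p.2) (bracketB E G c b)
      (a, b) (c, 0) := fun a b c => by
    refine tendsto_const_nhds.congr' ?_
    filter_upwards [self_mem_nhdsWithin] with t ht
    simp [smul_smul, inv_mul_cancel₀ (show t ≠ 0 from ht)]
  have h3 : ∀ a b c : E, HasDD (fun p : E × E => bracketB E G p.1 p.2) (bracketB E G a c)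
      (a, b) (0, c) := fun a b c => by
    refine tendsto_const_nhds.congr' ?_
    filter_upwards [self_mem_nhdsWithin] with t ht
    simp [smul_smul, inv_mul_cancel₀ (show t ≠ 0 from ht)]
  rw [(h2 _ _ _).dd_eq, (h3 _ _ _).dd_eq] at h1
  exact h1

/-- The adjoint action is an action by automorphisms of the Lie algebra. -/
theorem Ad_bracket (g : G) (v w : E) :
    Ad E g (bracket E G v w) = bracket E G (Ad E g v) (Ad E g w) := by
  set p : E → G := fun a => (oneChart E G).symm a
  have hp : SmoothNear E p (oneCoord E G) := smoothNear_symm oneCoord_mem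
  have hp1 : p (oneCoord E G) = 1 := oneChart_symm_coord
  have h1 := (HasDD.Ad hp (HasDD.const w (oneCoord E G) v)).clm_comp (AdL E g)
  have h2 := HasDD.Ad (hp.conj g) (HasDD.const (Ad E g w) (oneCoord E G) v)
  have hth : theta E p (oneCoord E G) v = v := by
    simp only [theta, hp1, inv_one, one_mul]
    exact dd_chart_symm v
  have hth' : theta E (fun y => g * p y * g⁻¹) (oneCoord E G) v = Ad E g v := by
    simp only [theta, hp1, mul_one, mul_inv_cancel, inv_one, one_mul]
    rw [dd_chart_conj hp hp1, show dd (fun y => oneChart E G (p y)) (oneCoord E G) v = v from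
      dd_chart_symm v]
  simp only [hp1, hth, hth', mul_one, mul_inv_cancel, Ad_one, add_zero, AdL_apply, ← Ad_mul,
    inv_mul_cancel_right] at h1 h2
  rw [← h1.dd_eq, ← h2.dd_eq]

end LieGroup

/-! ### Alternating sums -/

section AltSum

open Equiv Finset

variable {V : Type*} {n : ℕ}

/-- The alternating sum, over the permutations of the arguments, of a function of `n` arguments. -/
def altSum (f : (Fin n → V) → ℝ) (v : Fin n → V) : ℝ :=
  ∑ σ : Perm (Fin n), ((Perm.sign σ : ℤ) : ℝ) * f (v ∘ σ)

theorem altSum_perm (f : (Fin n → V) → ℝ) (π : Perm (Fin n)) (v : Fin n → V) :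
    altSum (fun w => f (w ∘ π)) v = ((Perm.sign π : ℤ) : ℝ) * altSum f v := by
  rw [altSum, altSum, Finset.mul_sum]
  refine Fintype.sum_equiv (Equiv.mulRight π) _ _ fun σ => ?_
  simp only [Equiv.coe_mulRight, Perm.sign_mul, Perm.coe_mul, Function.comp_assoc, Units.val_mul,
    Int.cast_mul]
  rw [← mul_assoc, mul_left_comm, ← Int.cast_mul, ← Int.cast_mul, ← Units.val_mul,
    ← Units.val_mul, Int.units_mul_self, mul_one]

theorem altSum_sum {ι : Type*} (s : Finset ι) (f : ι → (Fin n → V) → ℝ) (v : Fin n → V) :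
    altSum (fun w => ∑ i ∈ s, f i w) v = ∑ i ∈ s, altSum (f i) v := by
  simp only [altSum, Finset.mul_sum]
  exact Finset.sum_comm

theorem altSum_const_mul (c : ℝ) (f : (Fin n → V) → ℝ) (v : Fin n → V) :
    altSum (fun w => c * f w) v = c * altSum f v := by
  simp only [altSum, Finset.mul_sum]
  exact Finset.sum_congr rfl fun σ _ => by ring

theorem altSum_add (f g : (Fin n → V) → ℝ) (v : Fin n → V) :
    altSum (fun w => f w + g w) v = altSum f v + altSum g v := by
  simp only [altSum, mul_add, Finset.sum_add_distrib]

/-- An alternating sum can be computed after antisymmetrization over a family of permutations. -/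
theorem altSum_family {ι : Type*} [Fintype ι] (π : ι → Perm (Fin n)) (f : (Fin n → V) → ℝ)
    (v : Fin n → V) :
    altSum (fun w => ∑ k, ((Perm.sign (π k) : ℤ) : ℝ) * f (w ∘ π k)) v =
      Fintype.card ι * altSum f v := by
  rw [altSum_sum]
  have : ∀ k, altSum (fun w => ((Perm.sign (π k) : ℤ) : ℝ) * f (w ∘ π k)) v = altSum f v := by
    intro k
    rw [altSum_const_mul, altSum_perm, ← mul_assoc, ← Int.cast_mul, ← Units.val_mul,
      Int.units_mul_self]
    simp
  simp [this]

/-- An alternating sum vanishes if some partial antisymmetrization does. -/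
theorem altSum_eq_zero {ι : Type*} [Fintype ι] [Nonempty ι] (π : ι → Perm (Fin n))
    (f : (Fin n → V) → ℝ)
    (h : ∀ w, ∑ k, ((Perm.sign (π k) : ℤ) : ℝ) * f (w ∘ π k) = 0) (v : Fin n → V) :
    altSum f v = 0 := by
  have h1 := altSum_family π f v
  simp only [h] at h1
  have h2 : altSum (fun _ : Fin n → V => (0 : ℝ)) v = 0 := by simp [altSum]
  rw [h2] at h1
  have h3 : (Fintype.card ι : ℝ) ≠ 0 := by simp
  exact (mul_eq_zero.1 h1.symm).resolve_left h3

/-- The expansion of an alternating sum according to the first argument. -/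
theorem altSum_succ (f : V → (Fin n → V) → ℝ) (v : Fin (n + 1) → V) :
    ∑ i : Fin (n + 1), (-1 : ℝ) ^ (i : ℕ) * altSum (f (v i)) (i.removeNth v) =
      altSum (fun w => f (w 0) (Fin.tail w)) v := by
  let Ψ : Fin (n + 1) × Perm (Fin n) → Perm (Fin (n + 1)) := fun q =>
    q.1.cycleRange.symm * Perm.decomposeFin.symm (0, q.2)
  have h0 : ∀ q, Ψ q 0 = q.1 := fun q => by simp [Ψ]
  have hs : ∀ q i, Ψ q i.succ = q.1.succAbove (q.2 i) := fun q i => by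
    simp [Ψ, Perm.decomposeFin_symm_apply_succ]
  have hinj : Function.Injective Ψ := by
    rintro ⟨p, e⟩ ⟨p', e'⟩ h
    have hp : p = p' := (h0 (p, e)).symm.trans ((congrArg (fun π => π 0) h).trans (h0 (p', e')))
    subst hp
    refine Prod.ext rfl (Equiv.ext fun i => ?_)
    have := hs (p, e) i
    rw [h, hs] at this
    exact (Fin.succAbove_right_injective this).symm
  have hbij : Function.Bijective Ψ := by
    rw [Fintype.bijective_iff_injective_and_card]
    refine ⟨hinj, ?_⟩
    simp [Fintype.card_perm, Nat.factorial_succ]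
  rw [altSum, ← (Equiv.ofBijective Ψ hbij).sum_comp, Fintype.sum_prod_type]
  refine Finset.sum_congr rfl fun p _ => ?_
  rw [altSum, Finset.mul_sum]
  refine Finset.sum_congr rfl fun e _ => ?_
  rw [← mul_assoc]
  congr 1
  · simp only [Equiv.ofBijective_apply, Ψ]
    rw [Perm.sign_mul, Perm.sign_symm, Fin.sign_cycleRange, Perm.decomposeFin.symm_sign]
    simp
  · simp only [Equiv.ofBijective_apply, Function.comp_apply, h0]
    congr 1
    funext i
    simp [Fin.tail, hs, Fin.removeNth]

/-- The permutation of `n` letters which permutes the first and the last letters separately. -/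
def blockPerm {p q : ℕ} (e : Fin p ⊕ Fin q ≃ Fin n) (π : Perm (Fin p) × Perm (Fin q)) :
    Perm (Fin n) :=
  e.permCongr (Perm.sumCongr π.1 π.2)

theorem blockPerm_inl {p q : ℕ} (e : Fin p ⊕ Fin q ≃ Fin n) (π : Perm (Fin p) × Perm (Fin q))
    (i : Fin p) : blockPerm e π (e (Sum.inl i)) = e (Sum.inl (π.1 i)) := by
  simp [blockPerm]

theorem blockPerm_inr {p q : ℕ} (e : Fin p ⊕ Fin q ≃ Fin n) (π : Perm (Fin p) × Perm (Fin q))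
    (i : Fin q) : blockPerm e π (e (Sum.inr i)) = e (Sum.inr (π.2 i)) := by
  simp [blockPerm]

theorem sign_blockPerm {p q : ℕ} (e : Fin p ⊕ Fin q ≃ Fin n) (π : Perm (Fin p) × Perm (Fin q)) :
    Perm.sign (blockPerm e π) = Perm.sign π.1 * Perm.sign π.2 := by
  rw [blockPerm, Perm.sign_permCongr, Perm.sign_sumCongr]

/-- The product of two functions, of the first and of the last arguments. -/
def blockMul {p q : ℕ} (e : Fin p ⊕ Fin q ≃ Fin n) (f : (Fin p → V) → ℝ) (g : (Fin q → V) → ℝ)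
    (w : Fin n → V) : ℝ :=
  f (fun i => w (e (Sum.inl i))) * g fun i => w (e (Sum.inr i))

theorem blockMul_blockPerm {p q : ℕ} (e : Fin p ⊕ Fin q ≃ Fin n) (f : (Fin p → V) → ℝ)
    (g : (Fin q → V) → ℝ) (w : Fin n → V) (π : Perm (Fin p) × Perm (Fin q)) :
    blockMul e f g (w ∘ blockPerm e π) =
      f ((fun i => w (e (Sum.inl i))) ∘ π.1) * g ((fun i => w (e (Sum.inr i))) ∘ π.2) := by
  simp only [blockMul, Function.comp_def, blockPerm_inl, blockPerm_inr]

theorem blockMul_altSum {p q : ℕ} (e : Fin p ⊕ Fin q ≃ Fin n) (f : (Fin p → V) → ℝ)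
    (g : (Fin q → V) → ℝ) (w : Fin n → V) :
    blockMul e (altSum f) (altSum g) w = ∑ π : Perm (Fin p) × Perm (Fin q),
      ((Perm.sign (blockPerm e π) : ℤ) : ℝ) * blockMul e f g (w ∘ blockPerm e π) := by
  simp only [blockMul_blockPerm, sign_blockPerm, Fintype.sum_prod_type]
  rw [blockMul, altSum, altSum, Finset.sum_mul_sum]
  refine Finset.sum_congr rfl fun π _ => Finset.sum_congr rfl fun π' _ => ?_
  push_cast
  ring

theorem altSum_blockMul_altSum {p q : ℕ} (e : Fin p ⊕ Fin q ≃ Fin n) (f : (Fin p → V) → ℝ)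
    (g : (Fin q → V) → ℝ) (v : Fin n → V) :
    altSum (blockMul e (altSum f) (altSum g)) v =
      (p.factorial * q.factorial : ℝ) * altSum (blockMul e f g) v := by
  have h1 := altSum_family (fun π => blockPerm e π) (blockMul e f g) v
  rw [Fintype.card_prod, Fintype.card_perm, Fintype.card_perm, Fintype.card_fin,
    Fintype.card_fin, Nat.cast_mul] at h1
  rw [← h1]
  congr 1
  funext w
  exact blockMul_altSum e f g w

theorem altSum_blockMul_left {p q : ℕ} (e : Fin p ⊕ Fin q ≃ Fin n) (f : (Fin p → V) → ℝ)
    (g : (Fin q → V) → ℝ) (hf : ∀ w, altSum f w = 0) (v : Fin n → V) :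
    altSum (blockMul e f g) v = 0 := by
  refine altSum_eq_zero (fun π : Perm (Fin p) => blockPerm e (π, 1)) _ (fun w => ?_) v
  simp only [blockMul_blockPerm, sign_blockPerm, Perm.sign_one, mul_one, ← mul_assoc]
  rw [← Finset.sum_mul]
  have := hf fun i => w (e (Sum.inl i))
  rw [altSum] at this
  rw [this, zero_mul]

theorem altSum_blockMul_right {p q : ℕ} (e : Fin p ⊕ Fin q ≃ Fin n) (f : (Fin p → V) → ℝ)
    (g : (Fin q → V) → ℝ) (hg : ∀ w, altSum g w = 0) (v : Fin n → V) :
    altSum (blockMul e f g) v = 0 := by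
  refine altSum_eq_zero (fun π : Perm (Fin q) => blockPerm e (1, π)) _ (fun w => ?_) v
  simp only [blockMul_blockPerm, sign_blockPerm, Perm.sign_one, one_mul,
    mul_left_comm _ (f _)]
  rw [← Finset.mul_sum]
  have := hg fun i => w (e (Sum.inr i))
  rw [altSum] at this
  simp only [Perm.coe_one, Function.comp_id]
  rw [this, mul_zero]

theorem altSum_alternating [AddCommGroup V] [Module ℝ V] (α : V [⋀^Fin n]→ₗ[ℝ] ℝ)
    (v : Fin n → V) : altSum α v = n.factorial * α v := by
  have : ∀ σ : Perm (Fin n), ((Perm.sign σ : ℤ) : ℝ) * α (v ∘ σ) = α v := fun σ => by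
    rw [AlternatingMap.map_perm, Units.smul_def, zsmul_eq_mul, ← mul_assoc, ← Int.cast_mul,
      ← Units.val_mul, Int.units_mul_self]
    simp
  simp [altSum, this, Fintype.card_perm]

end AltSum

/-! ### Closed scalar differential forms -/

section Forms

open Equiv

variable {V : Type*} [NormedAddCommGroup V] [NormedSpace ℝ V] [FiniteDimensional ℝ V] {n : ℕ}

/-- The function `f` of `n` vectors is multilinear. -/
def IsMultilinear (f : (Fin n → V) → ℝ) : Prop :=
  ∃ m : MultilinearMap ℝ (fun _ : Fin n => V) ℝ, ⇑m = f

/-- The elementary alternating form `dx_{J 0} ∧ ⋯ ∧ dx_{J (n - 1)}` in the coordinates given by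
a basis. -/
def coordForm (J : Fin n → Fin (Module.finrank ℝ V)) : V [⋀^Fin n]→L[ℝ] ℝ :=
  ContinuousMultilinearMap.alternatization
    ((ContinuousMultilinearMap.mkPiAlgebra ℝ (Fin n) ℝ).compContinuousLinearMap fun i =>
      LinearMap.toContinuousLinearMap ((Module.finBasis ℝ V).coord (J i)))

/-- The antisymmetrization of a multilinear function, as a continuous alternating map. It is
defined through the values on a basis, hence for functions which need not be multilinear. -/
def antisymm (f : (Fin n → V) → ℝ) : V [⋀^Fin n]→L[ℝ] ℝ :=
  ∑ J : Fin n → Fin (Module.finrank ℝ V), f (fun i => Module.finBasis ℝ V (J i)) • coordForm J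

/-- The two sides are multilinear, hence determined by the values on a basis. -/
theorem antisymm_apply {f : (Fin n → V) → ℝ} (hf : IsMultilinear f) (v : Fin n → V) :
    antisymm f v = altSum f v := by
  obtain ⟨m, rfl⟩ := hf
  have h1 : ∀ w : Fin n → V, m w = ∑ J : Fin n → Fin (Module.finrank ℝ V),
      (m fun i => Module.finBasis ℝ V (J i)) * ∏ i, (Module.finBasis ℝ V).coord (J i) (w i) := by
    intro w
    conv_lhs =>
      rw [show w = fun i => ∑ j, (Module.finBasis ℝ V).coord j (w i) • Module.finBasis ℝ V j from
        funext fun i => ((Module.finBasis ℝ V).sum_repr (w i)).symm]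
    rw [MultilinearMap.map_sum]
    refine Finset.sum_congr rfl fun J _ => ?_
    rw [MultilinearMap.map_smul_univ, smul_eq_mul, mul_comm]
  rw [altSum, antisymm]
  have h2 : ∀ σ : Perm (Fin n), m (v ∘ σ) = _ := fun σ => h1 (v ∘ σ)
  simp only [h2, Function.comp_apply]
  rw [ContinuousAlternatingMap.sum_apply]
  simp only [Finset.mul_sum]
  rw [Finset.sum_comm]
  refine Finset.sum_congr rfl fun J _ => ?_
  rw [ContinuousAlternatingMap.smul_apply, coordForm,
    ContinuousMultilinearMap.alternatization_apply_apply, smul_eq_mul, Finset.mul_sum]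
  refine Finset.sum_congr rfl fun σ _ => ?_
  rw [Units.smul_def, zsmul_eq_mul]
  simp only [ContinuousMultilinearMap.compContinuousLinearMap_apply,
    ContinuousMultilinearMap.mkPiAlgebra_apply, LinearMap.coe_toContinuousLinearMap',
    Function.comp_apply]
  ring

theorem differentiableAt_antisymm {f : V → (Fin n → V) → ℝ} {x : V}
    (hf : ∀ w, DifferentiableAt ℝ (fun y => f y w) x) :
    DifferentiableAt ℝ (fun y => antisymm (f y)) x := by
  unfold antisymm
  exact DifferentiableAt.fun_sum fun J _ => (hf _).smul_const _

theorem extDeriv_apply_real {α : V → V [⋀^Fin n]→L[ℝ] ℝ} {x : V} (h : DifferentiableAt ℝ α x)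
    (v : Fin (n + 1) → V) : extDeriv α x v =
      ∑ i : Fin (n + 1), (-1 : ℝ) ^ (i : ℕ) * fderiv ℝ (α · (i.removeNth v)) x (v i) := by
  rw [extDeriv_apply h]
  refine Finset.sum_congr rfl fun i _ => ?_
  rw [zsmul_eq_mul]
  push_cast
  rfl

/-- The exterior derivative of an antisymmetrization. -/
theorem extDeriv_antisymm {f : V → (Fin n → V) → ℝ} {x : V}
    (hm : ∀ᶠ y in 𝓝 x, IsMultilinear (f y)) (hf : ∀ w, DifferentiableAt ℝ (fun y => f y w) x)
    (v : Fin (n + 1) → V) :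
    extDeriv (fun y => antisymm (f y)) x v =
      altSum (fun w => fderiv ℝ (fun y => f y (Fin.tail w)) x (w 0)) v := by
  rw [extDeriv_apply_real (differentiableAt_antisymm hf),
    ← altSum_succ (fun u w => fderiv ℝ (fun y => f y w) x u)]
  refine Finset.sum_congr rfl fun i _ => ?_
  congr 1
  have h1 : (fun y => antisymm (f y) (i.removeNth v)) =ᶠ[𝓝 x]
      fun y => altSum (f y) (i.removeNth v) := by
    filter_upwards [hm] with y hy
    exact antisymm_apply hy _
  rw [h1.fderiv_eq]
  unfold altSum
  rw [fderiv_fun_sum fun σ _ => (hf _).const_mul _]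
  rw [_root_.sum_apply]
  refine Finset.sum_congr rfl fun σ _ => ?_
  rw [fderiv_const_mul (hf _)]
  rfl

/-- The differential form `α` is closed on the subset `S`: near every point of `S`, it is
the restriction of a closed differentiable form on an open set. -/
def IsClosedForm (S : Set V) (α : V → V [⋀^Fin n]→L[ℝ] ℝ) : Prop :=
  ∀ p ∈ S, ∃ (O : Set V) (α' : V → V [⋀^Fin n]→L[ℝ] ℝ), IsOpen O ∧ p ∈ O ∧
    DifferentiableOn ℝ α' O ∧ (∀ x ∈ O, extDeriv α' x = 0) ∧ EqOn α α' (O ∩ S)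

theorem IsClosedForm.continuousOn {S : Set V} {α : V → V [⋀^Fin n]→L[ℝ] ℝ}
    (h : IsClosedForm S α) : ContinuousOn α S := by
  intro p hp
  obtain ⟨O, α', hO, hpO, hd, -, he⟩ := h p hp
  have h1 : ContinuousWithinAt α' S p :=
    (hd.continuousOn.continuousAt (hO.mem_nhds hpO)).continuousWithinAt
  refine h1.congr_of_eventuallyEq ?_ (he ⟨hpO, hp⟩)
  filter_upwards [mem_nhdsWithin_of_mem_nhds (hO.mem_nhds hpO), self_mem_nhdsWithin] with y hy hy'
  exact he ⟨hy, hy'⟩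

variable {W : Type*} [NormedAddCommGroup W] [NormedSpace ℝ W] [FiniteDimensional ℝ W]

/-- The pull-back of a differential form. -/
def pullForm (f : W → V) (α : V → V [⋀^Fin n]→L[ℝ] ℝ) (x : W) : W [⋀^Fin n]→L[ℝ] ℝ :=
  (α (f x)).compContinuousLinearMap (fderiv ℝ f x)

theorem IsClosedForm.pullForm {S : Set V} {S' : Set W} {α : V → V [⋀^Fin n]→L[ℝ] ℝ}
    (h : IsClosedForm S α) {f : W → V} (hf : ContDiff ℝ ∞ f) (hm : MapsTo f S' S) :
    IsClosedForm S' (pullForm f α) := by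
  intro p hp
  obtain ⟨O, α', hO, hpO, hd, hc, he⟩ := h (f p) (hm hp)
  have hda : ∀ x ∈ f ⁻¹' O, DifferentiableAt ℝ α' (f x) := fun x hx =>
    (hd (f x) hx).differentiableAt (hO.mem_nhds hx)
  refine ⟨f ⁻¹' O, ChernWeil.pullForm f α', hO.preimage hf.continuous, hpO, fun x hx => ?_,
    fun x hx => ?_, fun x hx => ?_⟩
  · have h1 : DifferentiableAt ℝ (fderiv ℝ f) x :=
      ((contDiff_infty.1 hf 2).fderiv_right (m := 1) (by norm_num)).differentiable (by norm_num) x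
    have h2 : DifferentiableAt ℝ f x := hf.differentiable (by simp) x
    exact (((hda x hx).comp x h2).continuousAlternatingMapCompContinuousLinearMap
      h1).differentiableWithinAt
  · unfold ChernWeil.pullForm
    rw [extDeriv_pullback (hda x hx) (contDiff_infty.1 hf 2).contDiffAt (by simp),
      hc _ hx]
    rfl
  · simp only [ChernWeil.pullForm]
    rw [he ⟨hx.1, hm hx.2⟩]

/-! #### The wedge product -/

variable {p q : ℕ}

/-- The splitting of the first `p + q` indices into the first `p` and the last `q`. -/
def splitIndex (h : p + q = n) : Fin p ⊕ Fin q ≃ Fin n := finSumFinEquiv.trans (finCongr h)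

theorem splitIndex_inl (h : p + q = n) (i : Fin p) : (splitIndex h (Sum.inl i) : ℕ) = i := by
  simp [splitIndex]

theorem splitIndex_inr (h : p + q = n) (i : Fin q) : (splitIndex h (Sum.inr i) : ℕ) = p + i := by
  simp [splitIndex]

theorem IsMultilinear.blockMul (e : Fin p ⊕ Fin q ≃ Fin n) {f : (Fin p → V) → ℝ}
    {g : (Fin q → V) → ℝ} (hf : IsMultilinear f) (hg : IsMultilinear g) :
    IsMultilinear (blockMul e f g) := by
  obtain ⟨f, rfl⟩ := hf
  obtain ⟨g, rfl⟩ := hg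
  exact ⟨((LinearMap.mul' ℝ ℝ).compMultilinearMap (f.domCoprod g)).domDomCongr e, rfl⟩

theorem isMultilinear_coe (α : V [⋀^Fin n]→L[ℝ] ℝ) : IsMultilinear α :=
  ⟨α.toAlternatingMap.toMultilinearMap, rfl⟩

/-- The wedge product of alternating forms, with the normalization for which
`dx_1 ∧ ⋯ ∧ dx_n` has the value `1` on the standard basis. -/
def wedge (h : p + q = n) (α : V [⋀^Fin p]→L[ℝ] ℝ) (β : V [⋀^Fin q]→L[ℝ] ℝ) :
    V [⋀^Fin n]→L[ℝ] ℝ :=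
  ((p.factorial : ℝ) * q.factorial)⁻¹ • antisymm (blockMul (splitIndex h) α β)

theorem wedge_apply (h : p + q = n) (α : V [⋀^Fin p]→L[ℝ] ℝ) (β : V [⋀^Fin q]→L[ℝ] ℝ)
    (v : Fin n → V) : wedge h α β v =
      ((p.factorial : ℝ) * q.factorial)⁻¹ * altSum (blockMul (splitIndex h) α β) v := by
  rw [wedge, ContinuousAlternatingMap.smul_apply, antisymm_apply
    ((isMultilinear_coe α).blockMul _ (isMultilinear_coe β)), smul_eq_mul]

theorem wedge_antisymm (h : p + q = n) {f : (Fin p → V) → ℝ} {g : (Fin q → V) → ℝ}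
    (hf : IsMultilinear f) (hg : IsMultilinear g) :
    wedge h (antisymm f) (antisymm g) = antisymm (blockMul (splitIndex h) f g) := by
  ext v
  have h1 : blockMul (splitIndex h) (antisymm f) (antisymm g) =
      blockMul (splitIndex h) (altSum f) (altSum g) := by
    funext w
    simp only [blockMul, antisymm_apply hf, antisymm_apply hg]
  rw [wedge_apply, antisymm_apply (hf.blockMul _ hg), h1, altSum_blockMul_altSum, ← mul_assoc,
    inv_mul_cancel₀ (by positivity), one_mul]

theorem altSum_fderiv {α : V → V [⋀^Fin n]→L[ℝ] ℝ} {x : V} (hα : DifferentiableAt ℝ α x)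
    (hc : extDeriv α x = 0) (v : Fin (n + 1) → V) :
    altSum (fun w => fderiv ℝ α x (w 0) (Fin.tail w)) v = 0 := by
  rw [← altSum_succ (fun u w => fderiv ℝ α x u w)]
  have h1 := congrArg (fun η => η v) hc
  simp only [extDeriv_apply_real hα] at h1
  have h2 : ∀ i : Fin (n + 1), altSum (fun w => fderiv ℝ α x (v i) w) (i.removeNth v) =
      n.factorial * fderiv ℝ (α · (i.removeNth v)) x (v i) := fun i => by
    have := altSum_alternating (fderiv ℝ α x (v i)).toAlternatingMap (i.removeNth v)
    rw [fderiv_continuousAlternatingMap_apply_const_apply hα]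
    exact this
  simp only [h2, mul_left_comm _ (n.factorial : ℝ), ← Finset.mul_sum]
  exact mul_eq_zero_of_right _ h1

/-- The wedge product of closed forms is closed: after antisymmetrization, the derivative hits one of the
two factors, and the alternating sum over the arguments of that factor vanishes. -/
theorem extDeriv_wedge (h : p + q = n) {α : V → V [⋀^Fin p]→L[ℝ] ℝ}
    {β : V → V [⋀^Fin q]→L[ℝ] ℝ} {x : V} (hα : DifferentiableAt ℝ α x)
    (hβ : DifferentiableAt ℝ β x) (hc : extDeriv α x = 0) (hc' : extDeriv β x = 0) :
    DifferentiableAt ℝ (fun y => wedge h (α y) (β y)) x ∧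
      extDeriv (fun y => wedge h (α y) (β y)) x = 0 := by
  have hαw : ∀ w, DifferentiableAt ℝ (fun y => α y w) x := fun w =>
    hα.continuousAlternatingMap_apply_const w
  have hβw : ∀ w, DifferentiableAt ℝ (fun y => β y w) x := fun w =>
    hβ.continuousAlternatingMap_apply_const w
  have hd : ∀ w, DifferentiableAt ℝ (fun y => blockMul (splitIndex h) (α y) (β y) w) x := fun w =>
    (hαw _).mul (hβw _)
  unfold wedge
  refine ⟨(differentiableAt_antisymm hd).fun_const_smul _, ?_⟩
  have h1 := extDeriv_smul (x := x) (((p.factorial : ℝ) * q.factorial)⁻¹)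
    (fun y => antisymm (blockMul (splitIndex h) (α y) (β y)))
  refine h1.trans ?_
  ext v
  rw [ContinuousAlternatingMap.smul_apply, extDeriv_antisymm (Filter.Eventually.of_forall fun y =>
    (isMultilinear_coe (α y)).blockMul _ (isMultilinear_coe (β y))) hd]
  have h2 : ∀ w : Fin (n + 1) → V,
      fderiv ℝ (fun y => blockMul (splitIndex h) (α y) (β y) (Fin.tail w)) x (w 0) =
      blockMul (splitIndex (by omega : p + 1 + q = n + 1))
        (fun u => fderiv ℝ α x (u 0) (Fin.tail u)) (β x) w +
      blockMul (splitIndex (by omega : p + (q + 1) = n + 1)) (α x)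
        (fun u => fderiv ℝ β x (u 0) (Fin.tail u))
        (w ∘ Fin.cycleRange (⟨p, by omega⟩ : Fin (n + 1))) := by
    intro w
    have e0 : ∀ i, Fin.tail w (splitIndex h (Sum.inl i)) =
        w (splitIndex (by omega : p + 1 + q = n + 1) (Sum.inl i.succ)) := fun i => by
      rw [Fin.tail]
      congr 1
    have e1 : ∀ i, Fin.tail w (splitIndex h (Sum.inr i)) =
        w (splitIndex (by omega : p + 1 + q = n + 1) (Sum.inr i)) := fun i => by
      rw [Fin.tail]
      congr 1
      ext
      simp only [splitIndex_inr, Fin.val_succ]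
      omega
    have e2 : w (splitIndex (by omega : p + 1 + q = n + 1) (Sum.inl 0)) = w 0 := by
      congr 1
    have e3 : ∀ i : Fin p, w (Fin.cycleRange (⟨p, by omega⟩ : Fin (n + 1))
        (splitIndex (by omega : p + (q + 1) = n + 1) (Sum.inl i))) =
        w (splitIndex (by omega : p + 1 + q = n + 1) (Sum.inl i.succ)) := fun i => by
      congr 1
      ext
      rw [Fin.coe_cycleRange_of_lt (by rw [Fin.lt_def, splitIndex_inl]; exact i.2),
        splitIndex_inl, splitIndex_inl, Fin.val_succ]
    have e4 : w (Fin.cycleRange (⟨p, by omega⟩ : Fin (n + 1))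
        (splitIndex (by omega : p + (q + 1) = n + 1) (Sum.inr 0))) = w 0 := by
      congr 1
      exact Fin.cycleRange_of_eq (by ext; simp [splitIndex_inr])
    have e5 : ∀ i : Fin q, w (Fin.cycleRange (⟨p, by omega⟩ : Fin (n + 1))
        (splitIndex (by omega : p + (q + 1) = n + 1) (Sum.inr i.succ))) =
        w (splitIndex (by omega : p + 1 + q = n + 1) (Sum.inr i)) := fun i => by
      congr 1
      rw [Fin.cycleRange_of_gt (by rw [Fin.lt_def, splitIndex_inr, Fin.val_succ]; dsimp only; omega)]
      ext
      rw [splitIndex_inr, splitIndex_inr, Fin.val_succ]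
      omega
    simp only [blockMul, Function.comp_apply, e2]
    have hm := fderiv_fun_mul (hαw fun i => Fin.tail w (splitIndex h (Sum.inl i)))
      (hβw fun i => Fin.tail w (splitIndex h (Sum.inr i)))
    rw [hm]
    simp only [_root_.add_apply, _root_.smul_apply, smul_eq_mul,
      fderiv_continuousAlternatingMap_apply_const_apply hα,
      fderiv_continuousAlternatingMap_apply_const_apply hβ, Fin.tail_def (q := fun i : Fin (p + 1) =>
        w (splitIndex (by omega : p + 1 + q = n + 1) (Sum.inl i))), Fin.tail_def (q := fun i : Fin (q + 1) =>
        w (Fin.cycleRange (⟨p, by omega⟩ : Fin (n + 1))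
          (splitIndex (by omega : p + (q + 1) = n + 1) (Sum.inr i)))), e0, e1, e3, e4, e5]
    ring
  simp only [h2]
  rw [altSum_add, altSum_blockMul_left _ _ _ (altSum_fderiv hα hc),
    altSum_perm (fun w => blockMul _ _ _ w), altSum_blockMul_right _ _ _ (altSum_fderiv hβ hc')]
  simp

theorem IsClosedForm.wedge (h : p + q = n) {S : Set V} {α : V → V [⋀^Fin p]→L[ℝ] ℝ}
    {β : V → V [⋀^Fin q]→L[ℝ] ℝ} (hα : IsClosedForm S α) (hβ : IsClosedForm S β) :
    IsClosedForm S fun x => ChernWeil.wedge h (α x) (β x) := by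
  intro x hx
  obtain ⟨O, α', hO, hxO, hd, hc, he⟩ := hα x hx
  obtain ⟨O', β', hO', hxO', hd', hc', he'⟩ := hβ x hx
  have key : ∀ y ∈ O ∩ O', _ := fun y hy => extDeriv_wedge h
    (hd.differentiableAt (hO.mem_nhds hy.1)) (hd'.differentiableAt (hO'.mem_nhds hy.2))
    (hc y hy.1) (hc' y hy.2)
  refine ⟨O ∩ O', fun y => ChernWeil.wedge h (α' y) (β' y), hO.inter hO', ⟨hxO, hxO'⟩,
    fun y hy => (key y hy).1.differentiableWithinAt, fun y hy => (key y hy).2, fun y hy => ?_⟩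
  simp only [he ⟨hy.1.1, hy.2⟩, he' ⟨hy.1.2, hy.2⟩]

end Forms

/-! ### Gauge potentials, curvature and Chern–Weil forms -/

section Gauge

variable {V : Type*} [NormedAddCommGroup V] [NormedSpace ℝ V] [FiniteDimensional ℝ V]
  {E : Type*} [AddCommGroup E] [Module ℝ E] [TopologicalSpace E]
  [IsTopologicalAddGroup E] [ContinuousSMul ℝ E] [T2Space E] [LocallyConvexSpace ℝ E]
  {G : Type*} [Group G] [TopologicalSpace G] [ChartedSpace E G] [SmoothLieGroup E G]

theorem CInftyOn.dd_const {f : V → E} {O : Set V} (hO : IsOpen O) (hf : CInftyOn f O) (h : V) :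
    CInftyOn (fun y => ChernWeil.dd f y h) O :=
  CInftyOn.comp (g := fun p : V × V => ChernWeil.dd f p.1 p.2) (f := fun y => (y, h))
    (hO.prod isOpen_univ) (hf.dd hO)
    (CInftyOn.prodMk (CInftyOn.of_clm (ContinuousLinearMap.id ℝ _) O) (CInftyOn.const h O))
    fun _ hy => ⟨hy, mem_univ _⟩

theorem CInftyOn.pi {k : ℕ} {f : Fin k → V → E} {O : Set V} (hO : IsOpen O)
    (hf : ∀ i, CInftyOn (f i) O) : CInftyOn (fun y i => f i y) O := by
  have h1 : CInftyOn (fun y => ∑ i, ContinuousLinearMap.single ℝ (fun _ : Fin k => E) i (f i y)) O :=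
    CInftyOn.sum _ fun i _ => (hf i).clm_comp _
  refine h1.congr hO fun y _ => ?_
  exact Finset.univ_sum_single fun i => f i y

/-- Smooth functions which agree on a sufficiently large set have the same derivative. -/
theorem CInftyOn.dd_eq_of_eventuallyEq {f f' : V → E} {O O' S : Set V} (hO : IsOpen O)
    (hO' : IsOpen O') (hf : CInftyOn f O) (hf' : CInftyOn f' O') {x : V} (hx : x ∈ O)
    (hx' : x ∈ O') (hxS : x ∈ S) (hS : UniqueDiffWithinAt ℝ S x) (h : f =ᶠ[𝓝[S] x] f') (v : V) :
    ChernWeil.dd f x v = ChernWeil.dd f' x v := by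
  rw [← hf.fderivWithin_eq hO hx hxS hS (Filter.EventuallyEq.refl _ f) v,
    ← hf'.fderivWithin_eq hO' hx' hxS hS h v]

/-- `A` is a smooth `𝔤`-valued one-form on `O`. -/
structure IsPotential (A : V → V → E) (O : Set V) : Prop where
  smooth : ∀ h, CInftyOn (fun x => A x h) O
  add : ∀ x ∈ O, ∀ h k, A x (h + k) = A x h + A x k
  smul : ∀ x ∈ O, ∀ (r : ℝ) (h : V), A x (r • h) = r • A x h

theorem IsPotential.mono {A : V → V → E} {O O' : Set V} (h : IsPotential A O) (hO : O' ⊆ O) :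
    IsPotential A O' :=
  ⟨fun v => (h.smooth v).mono hO, fun x hx => h.add x (hO hx), fun x hx => h.smul x (hO hx)⟩

variable (G) in
/-- The curvature `dA + [A, A] / 2` of a one-form. -/
def curv (A : V → V → E) (x h k : V) : E :=
  dd (fun y => A y k) x h - dd (fun y => A y h) x k + bracket E G (A x h) (A x k)

theorem IsPotential.smooth_curv {A : V → V → E} {O : Set V} (hO : IsOpen O) (hA : IsPotential A O)
    (h k : V) : CInftyOn (fun x => curv G A x h k) O :=
  (((hA.smooth k).dd_const hO h).sub ((hA.smooth h).dd_const hO k)).add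
    ((hA.smooth h).bracket (hA.smooth k))

/-- The curvature at a point as a bilinear map. -/
def IsPotential.curvB {A : V → V → E} {O : Set V} (hO : IsOpen O) (hA : IsPotential A O) {x : V}
    (hx : x ∈ O) : V →ₗ[ℝ] V →ₗ[ℝ] E := by
  have hadd : ∀ h k l, dd (fun y => A y (h + k)) x l =
      dd (fun y => A y h) x l + dd (fun y => A y k) x l := fun h k l => by
    rw [← (((hA.smooth h).hasDD hx l).add ((hA.smooth k).hasDD hx l)).dd_eq]
    refine dd_congr ?_
    filter_upwards [hO.mem_nhds hx] with y hy
    exact hA.add y hy h k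
  have hsmul : ∀ (r : ℝ) h l, dd (fun y => A y (r • h)) x l = r • dd (fun y => A y h) x l :=
    fun r h l => by
      have h1 := ((hA.smooth h).hasDD hx l).clm_comp (r • ContinuousLinearMap.id ℝ E)
      simp only [_root_.smul_apply, ContinuousLinearMap.id_apply] at h1
      rw [← h1.dd_eq]
      refine dd_congr ?_
      filter_upwards [hO.mem_nhds hx] with y hy
      exact hA.smul y hy r h
  have hadd' : ∀ h k l, dd (fun y => A y l) x (h + k) =
      dd (fun y => A y l) x h + dd (fun y => A y l) x k := fun h k l =>
    (hA.smooth l).dd_add_right hO hx h k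
  have hsmul' : ∀ (r : ℝ) h l, dd (fun y => A y l) x (r • h) = r • dd (fun y => A y l) x h :=
    fun r h l => (((hA.smooth l).hasDD hx h).smul_right r).dd_eq
  refine LinearMap.mk₂ ℝ (curv G A x) ?_ ?_ ?_ ?_
  · intro h k l
    rw [curv, curv, curv, hadd, hadd', hA.add x hx, bracket_add_left]
    abel
  · intro r h l
    rw [curv, curv, hsmul, hsmul', hA.smul x hx, bracket_smul_left, smul_add, smul_sub]
  · intro h k l
    rw [curv, curv, curv, hadd, hadd', hA.add x hx, bracket_add_right]
    abel
  · intro r h l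
    rw [curv, curv, hsmul, hsmul', hA.smul x hx, bracket_smul_right, smul_add, smul_sub]

theorem IsPotential.curvB_apply {A : V → V → E} {O : Set V} (hO : IsOpen O) (hA : IsPotential A O)
    {x : V} (hx : x ∈ O) (h k : V) : hA.curvB (G := G) hO hx h k = curv G A x h k := rfl

theorem smooth_theta_const {g : V → G} {x : V} (hg : SmoothNear E g x) (h : V) :
    ∃ O, IsOpen O ∧ x ∈ O ∧ CInftyOn (fun y => theta E g y h) O := by
  obtain ⟨O, hO, hx, hs⟩ := smooth_theta hg
  exact ⟨O, hO, hx, CInftyOn.comp (hO.prod isOpen_univ) hs (f := fun y => (y, h))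
    (CInftyOn.prodMk (CInftyOn.of_clm (ContinuousLinearMap.id ℝ V) O) (CInftyOn.const _ _))
    fun y hy => ⟨hy, mem_univ _⟩⟩

/-- The curvature of a gauge transformed one-form. The transformation rule need only hold on a set
which is large enough to determine derivatives. -/
theorem curv_gauge {A A' : V → V → E} {g : V → G} {O S : Set V} {x : V} (hO : IsOpen O)
    (hx : x ∈ O) (hA : IsPotential A O) (hA' : IsPotential A' O) (hg : SmoothNear E g x)
    (hxS : x ∈ S) (hS : UniqueDiffWithinAt ℝ S x)
    (h : ∀ᶠ y in 𝓝[S] x, ∀ v, A' y v = Ad E (g y)⁻¹ (A y v) + theta E g y v) (u v : V) :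
    curv G A' x u v = Ad E (g x)⁻¹ (curv G A x u v) := by
  have key : ∀ u v, dd (fun y => A' y v) x u =
      Ad E (g x)⁻¹ (dd (fun y => A y v) x u) -
        bracket E G (theta E g x u) (Ad E (g x)⁻¹ (A x v)) + dd (fun y => theta E g y v) x u := by
    intro u v
    obtain ⟨O₁, hO₁, hx₁, h₁⟩ := smooth_Ad_apply hg.inv hO hx (hA.smooth v)
    obtain ⟨O₂, hO₂, hx₂, h₂⟩ := smooth_theta_const hg v
    have h3 : CInftyOn (fun y => Ad E (g y)⁻¹ (A y v) + theta E g y v) (O₁ ∩ O₂) :=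
      (h₁.mono inter_subset_left).add (h₂.mono inter_subset_right)
    rw [(hA'.smooth v).dd_eq_of_eventuallyEq hO (hO₁.inter hO₂) h3 hx ⟨hx₁, hx₂⟩ hxS hS
      (h.mono fun y hy => hy v)]
    exact ((HasDD.Ad_inv hg hO hx (hA.smooth v) u).add (hasDD_theta hg u v)).dd_eq
  have h0 := h.self_of_nhdsWithin hxS
  have hmc := maurerCartan hg u v
  rw [curv, key, key, h0, h0, curv, Ad_add, Ad_sub, Ad_bracket, bracket_add_left, bracket_add_right,
    bracket_add_right, bracket_antisymm (Ad E (g x)⁻¹ (A x u)) (theta E g x v),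
    bracket_antisymm (theta E g x u) (theta E g x v), ← hmc]
  abel

/-- The curvature of the pull-back of a one-form along an affine map. -/
theorem curv_pullback {W : Type*} [NormedAddCommGroup W] [NormedSpace ℝ W] [FiniteDimensional ℝ W]
    {A : V → V → E} {O : Set V} (hO : IsOpen O) (hA : IsPotential A O) (c : V) (L : W →L[ℝ] V)
    {x : W} (hx : c + L x ∈ O) (h k : W) :
    curv G (fun y v => A (c + L y) (L v)) x h k = curv G A (c + L x) (L h) (L k) := by
  have h1 : ∀ h, HasDD (fun y => c + L y) (L h) x h := fun h => by
    simpa using (HasDD.const c x h).add (HasDD.of_clm L x h)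
  have h2 : ∀ h k, dd (fun y => A (c + L y) (L k)) x h = dd (fun y => A y (L k)) (c + L x) (L h) :=
    fun h k => (HasDD.comp hO (hA.smooth (L k)) (h1 h) hx).dd_eq
  simp only [curv, h2]

theorem IsPotential.pullback {W : Type*} [NormedAddCommGroup W] [NormedSpace ℝ W]
    {A : V → V → E} {O : Set V} (hO : IsOpen O) (hA : IsPotential A O) (c : V) (L : W →L[ℝ] V) :
    IsPotential (fun y v => A (c + L y) (L v)) ((fun y => c + L y) ⁻¹' O) := by
  refine ⟨fun h => CInftyOn.comp (g := fun y => A y (L h)) (f := fun y => c + L y) hO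
    (hA.smooth (L h)) ((CInftyOn.const c _).add (CInftyOn.of_clm L _)) fun y hy => hy, ?_, ?_⟩
  · intro x hx h k
    rw [map_add]
    exact hA.add _ hx _ _
  · intro x hx r h
    rw [map_smul]
    exact hA.smul _ hx _ _

/-! #### Chern–Weil forms -/

variable {k : ℕ} (ρ : ContinuousMultilinearMap ℝ (fun _ : Fin k => E) ℝ)

/-- The even numbers in `{0, …, 2 k - 1}`. -/
def evenIdx (i : Fin k) : Fin (2 * k) := ⟨2 * i, by omega⟩

/-- The odd numbers in `{0, …, 2 k - 1}`. -/
def oddIdx (i : Fin k) : Fin (2 * k) := ⟨2 * i + 1, by omega⟩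

/-- The function `ρ (R (w₀, w₁), R (w₂, w₃), …)`. -/
def chernWeilFun (R : V → V → E) (w : Fin (2 * k) → V) : ℝ :=
  ρ fun i => R (w (evenIdx i)) (w (oddIdx i))

/-- Every argument occurs exactly once, in one of the two slots of a factor `R`. -/
theorem isMultilinear_chernWeilFun (B : V →ₗ[ℝ] V →ₗ[ℝ] E) :
    IsMultilinear (chernWeilFun ρ fun v w => B v w) := by
  classical
  have hcases : ∀ j : Fin (2 * k), ∃ i : Fin k, j = evenIdx i ∨ j = oddIdx i := fun j => by
    refine ⟨⟨j / 2, by omega⟩, ?_⟩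
    rcases Nat.even_or_odd' (j : ℕ) with ⟨c, hc | hc⟩
    · left; ext; simp only [evenIdx]; omega
    · right; ext; simp only [oddIdx]; omega
  have hee : ∀ i i' : Fin k, evenIdx i' = evenIdx i ↔ i' = i := fun i i' => by
    simp only [evenIdx, Fin.ext_iff]; omega
  have hoo : ∀ i i' : Fin k, oddIdx i' = oddIdx i ↔ i' = i := fun i i' => by
    simp only [oddIdx, Fin.ext_iff]; omega
  have heo : ∀ i i' : Fin k, oddIdx i' ≠ evenIdx i := fun i i' => by
    simp only [evenIdx, oddIdx, ne_eq, Fin.ext_iff]; omega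
  have hue : ∀ (w : Fin (2 * k) → V) i x,
      (fun i' => B (Function.update w (evenIdx i) x (evenIdx i'))
        (Function.update w (evenIdx i) x (oddIdx i'))) =
      Function.update (fun i' => B (w (evenIdx i')) (w (oddIdx i'))) i (B x (w (oddIdx i))) := by
    intro w i x
    funext i'
    by_cases hi : i' = i
    · subst hi
      simp [heo]
    · simp [hee, heo, hi]
  have huo : ∀ (w : Fin (2 * k) → V) i x,
      (fun i' => B (Function.update w (oddIdx i) x (evenIdx i'))
        (Function.update w (oddIdx i) x (oddIdx i'))) =
      Function.update (fun i' => B (w (evenIdx i')) (w (oddIdx i'))) i (B (w (evenIdx i)) x) := by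
    intro w i x
    funext i'
    by_cases hi : i' = i
    · subst hi
      simp [(heo _ _).symm]
    · simp [hoo, (heo _ _).symm, hi]
  refine ⟨{ toFun := chernWeilFun ρ fun v w => B v w, map_update_add' := ?_, map_update_smul' := ?_ },
    rfl⟩
  · intro inst w j x y
    rw [Subsingleton.elim inst (instDecidableEqFin _)]
    obtain ⟨i, rfl | rfl⟩ := hcases j
    · simp only [chernWeilFun, hue, map_add, LinearMap.add_apply, ρ.map_update_add]
    · simp only [chernWeilFun, huo, map_add, ρ.map_update_add]
  · intro inst w j r x
    rw [Subsingleton.elim inst (instDecidableEqFin _)]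
    obtain ⟨i, rfl | rfl⟩ := hcases j
    · simp only [chernWeilFun, hue, map_smul, LinearMap.smul_apply, ρ.map_update_smul]
    · simp only [chernWeilFun, huo, map_smul, ρ.map_update_smul]

/-- The alternating form `ρ (R ∧ ⋯ ∧ R)`. -/
def chernWeilAlt (R : V → V → E) : V [⋀^Fin (2 * k)]→L[ℝ] ℝ :=
  (1 / 2 ^ k : ℝ) • antisymm (chernWeilFun ρ R)

theorem chernWeilAlt_apply (B : V →ₗ[ℝ] V →ₗ[ℝ] E) (v : Fin (2 * k) → V) :
    chernWeilAlt ρ (fun v w => B v w) v =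
      1 / 2 ^ k * altSum (chernWeilFun ρ fun v w => B v w) v := by
  rw [chernWeilAlt, ContinuousAlternatingMap.smul_apply,
    antisymm_apply (isMultilinear_chernWeilFun ρ B), smul_eq_mul]

variable (G) in
/-- The `Ad`-invariance of a multilinear functional. -/
def AdInvariant : Prop := ∀ (g : G) (v : Fin k → E), (ρ fun i => Ad E g (v i)) = ρ v

variable {ρ}

theorem chernWeilFun_Ad (hρ : AdInvariant G ρ) (g : G) (R : V → V → E) :
    chernWeilFun ρ (fun u v => Ad E g (R u v)) = chernWeilFun ρ R := by
  funext w
  exact hρ g _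

/-- Chern–Weil forms are closed. By gauge invariance, it suffices to consider the points where
the one-form vanishes, and there the derivative of the curvature is the second derivative. -/
theorem extDeriv_chernWeilAlt (hρ : AdInvariant G ρ) {A : V → V → E} {O : Set V} (hO : IsOpen O)
    (hA : IsPotential A O) {x : V} (hx : x ∈ O) :
    DifferentiableAt ℝ (fun y => chernWeilAlt ρ (curv G A y)) x ∧
      extDeriv (fun y => chernWeilAlt ρ (curv G A y)) x = 0 := by
  have hd : ∀ {A : V → V → E} {O : Set V}, IsOpen O → IsPotential A O → x ∈ O → ∀ w,
      DifferentiableAt ℝ (fun y => chernWeilFun ρ (curv G A y) w) x := by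
    intro A O hO hA hx w
    have h1 : CInftyOn (fun y i => curv G A y (w (evenIdx i)) (w (oddIdx i))) O :=
      CInftyOn.pi hO fun i => hA.smooth_curv hO _ _
    have h2 : CInftyOn (fun y => chernWeilFun ρ (curv G A y) w) O :=
      CInftyOn.comp isOpen_univ (CInftyOn.multilinear ρ univ) h1 fun _ _ => mem_univ _
    exact (h2.hasFDerivAt hO hx).differentiableAt
  refine ⟨(differentiableAt_antisymm (hd hO hA hx)).fun_const_smul _, ?_⟩
  -- a gauge in which the one-form vanishes at `x`
  let L : V →L[ℝ] E := LinearMap.toContinuousLinearMap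
    { toFun := fun v => -A x v
      map_add' := fun h k => by rw [hA.add x hx, neg_add]
      map_smul' := fun r h => by rw [hA.smul x hx, smul_neg]; rfl }
  have hL : ∀ v, L v = -A x v := fun v => rfl
  let g : V → G := fun y => (oneChart E G).symm (oneCoord E G + L (y - x))
  have hg : SmoothNear E g x := smoothNear_chart L x
  have hg1 : g x = 1 := by simp [g]
  let A' : V → V → E := fun y v => Ad E (g y)⁻¹ (A y v) + theta E g y v
  have hA'0 : ∀ v, A' x v = 0 := fun v => by
    change Ad E (g x)⁻¹ (A x v) + theta E g x v = 0
    rw [hg1, inv_one, Ad_one, theta_chart, hL, add_neg_cancel]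
  obtain ⟨O', hO', hxO', hO'O, hgO', hA'⟩ : ∃ O', IsOpen O' ∧ x ∈ O' ∧ O' ⊆ O ∧
      (∀ y ∈ O', SmoothNear E g y) ∧ IsPotential A' O' := by
    obtain ⟨O₁, hO₁, hx₁, h₁⟩ := smooth_Ad_aux hg.inv
    obtain ⟨O₂, hO₂, hx₂, h₂⟩ := smooth_theta hg
    obtain ⟨O₃, h₃, hO₃, hx₃⟩ := eventually_nhds_iff.1 hg.eventually
    refine ⟨O ∩ O₁ ∩ O₂ ∩ O₃, ((hO.inter hO₁).inter hO₂).inter hO₃, ⟨⟨⟨hx, hx₁⟩, hx₂⟩, hx₃⟩,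
      fun y hy => hy.1.1.1, fun y hy => h₃ y hy.2, fun v => ?_, fun y hy u v => ?_,
      fun y hy r v => ?_⟩
    · refine CInftyOn.add ?_ ?_
      · exact CInftyOn.comp (g := fun q : V × E => Ad E (g q.1)⁻¹ q.2) (f := fun y => (y, A y v))
          (hO₁.prod isOpen_univ) h₁ (CInftyOn.prodMk
          (CInftyOn.of_clm (ContinuousLinearMap.id ℝ V) _)
          ((hA.smooth v).mono fun y hy => hy.1.1.1)) fun y hy => ⟨hy.1.1.2, mem_univ _⟩
      · exact CInftyOn.comp (hO₂.prod isOpen_univ) h₂ (f := fun y => (y, v))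
          (CInftyOn.prodMk (CInftyOn.of_clm (ContinuousLinearMap.id ℝ V) _) (CInftyOn.const _ _))
          fun y hy => ⟨hy.1.2, mem_univ _⟩
    · simp only [A']
      rw [hA.add y hy.1.1.1, Ad_add, theta_add (h₃ y hy.2)]
      abel
    · simp only [A']
      rw [hA.smul y hy.1.1.1, Ad_smul, theta_smul (h₃ y hy.2), smul_add]
  have hcw : ∀ y ∈ O', chernWeilAlt ρ (curv G A y) = chernWeilAlt ρ (curv G A' y) := by
    intro y hy
    have h1 : curv G A' y = fun u v => Ad E (g y)⁻¹ (curv G A y u v) := by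
      funext u v
      exact curv_gauge hO' hy (hA.mono hO'O) hA' (hgO' y hy) (mem_univ y) uniqueDiffWithinAt_univ
        (Filter.Eventually.of_forall fun z w => rfl) u v
    rw [chernWeilAlt, chernWeilAlt, h1, chernWeilFun_Ad hρ]
  have hev : (fun y => chernWeilAlt ρ (curv G A y)) =ᶠ[𝓝 x]
      fun y => chernWeilAlt ρ (curv G A' y) := by
    filter_upwards [hO'.mem_nhds hxO'] with y hy
    exact hcw y hy
  rw [hev.extDeriv_eq]
  have h1 := extDeriv_smul (x := x) (1 / 2 ^ k : ℝ)
    (fun y => antisymm (chernWeilFun ρ (curv G A' y)))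
  refine h1.trans ?_
  ext v
  have hm : ∀ᶠ y in 𝓝 x, IsMultilinear (chernWeilFun ρ (curv G A' y)) := by
    filter_upwards [hO'.mem_nhds hxO'] with y hy
    exact isMultilinear_chernWeilFun ρ (hA'.curvB hO' hy)
  rw [ContinuousAlternatingMap.smul_apply, extDeriv_antisymm hm (hd hO' hA' hxO')]
  -- the derivative of the curvature at `x`
  set DR : V → V → V → E := fun h u v => dd (fun y => curv G A' y u v) x h with hDR
  have hDRe : ∀ h u v, DR h u v = dd (fun y => dd (fun z => A' z v) y u) x h -
      dd (fun y => dd (fun z => A' z u) y v) x h := by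
    intro h u v
    have e1 := (((hA'.smooth v).dd_const hO' u).hasDD hxO' h).sub
      (((hA'.smooth u).dd_const hO' v).hasDD hxO' h)
    have e2 := HasDD.bracket (G := G) ((hA'.smooth u).hasDD hxO' h) ((hA'.smooth v).hasDD hxO' h)
    have e3 := (e1.add e2).dd_eq
    rw [hA'0, hA'0, ← bracketB_apply, ← bracketB_apply, map_zero, map_zero, LinearMap.zero_apply,
      add_zero, add_zero] at e3
    exact e3
  have hcyc : ∀ h u v, DR h u v + DR u v h + DR v h u = 0 := by
    intro h u v
    rw [hDRe, hDRe, hDRe, (hA'.smooth v).dd_comm hO' hxO' u h, (hA'.smooth u).dd_comm hO' hxO' v h,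
      (hA'.smooth h).dd_comm hO' hxO' v u]
    abel
  have hfd : ∀ w : Fin (2 * k + 1) → V,
      fderiv ℝ (fun y => chernWeilFun ρ (curv G A' y) (Fin.tail w)) x (w 0) =
      ∑ i, ρ (Function.update (fun j => curv G A' x (w (evenIdx j).succ) (w (oddIdx j).succ)) i
        (DR (w 0) (w (evenIdx i).succ) (w (oddIdx i).succ))) := by
    intro w
    have e1 : CInftyOn (fun y i => curv G A' y (Fin.tail w (evenIdx i)) (Fin.tail w (oddIdx i))) O' :=
      CInftyOn.pi hO' fun i => hA'.smooth_curv hO' _ _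
    have e2 : CInftyOn (fun y => chernWeilFun ρ (curv G A' y) (Fin.tail w)) O' :=
      CInftyOn.comp isOpen_univ (CInftyOn.multilinear ρ univ) e1 fun _ _ => mem_univ _
    rw [← e2.dd_eq_fderiv hO' hxO']
    exact (HasDD.multilinear ρ fun i => (hA'.smooth_curv hO' _ _).hasDD hxO' (w 0)).dd_eq
  simp only [hfd]
  rw [altSum_sum, Finset.sum_eq_zero, smul_zero]
  · rfl
  intro i _
  -- antisymmetrization over the cyclic permutations of three of the arguments
  set a : Fin (2 * k + 1) := 0
  set b : Fin (2 * k + 1) := (evenIdx i).succ with hb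
  set c : Fin (2 * k + 1) := (oddIdx i).succ with hc
  have hab : b ≠ a := Fin.succ_ne_zero _
  have hac : c ≠ a := Fin.succ_ne_zero _
  have hbc : b ≠ c := by simp [hb, hc, evenIdx, oddIdx, Fin.ext_iff]
  set σ : Equiv.Perm (Fin (2 * k + 1)) := Equiv.swap a b * Equiv.swap b c with hσ
  have hsa : σ a = b := by
    simp [hσ, Equiv.swap_apply_of_ne_of_ne hab.symm hac.symm]
  have hsb : σ b = c := by
    simp [hσ, Equiv.swap_apply_of_ne_of_ne hac hbc.symm]
  have hsc : σ c = a := by simp [hσ]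
  have hso : ∀ j, j ≠ a → j ≠ b → j ≠ c → σ j = j := fun j h1 h2 h3 => by
    simp [hσ, Equiv.swap_apply_of_ne_of_ne h1 h2, Equiv.swap_apply_of_ne_of_ne h2 h3]
  have hsign : Equiv.Perm.sign σ = 1 := by
    rw [hσ, Equiv.Perm.sign_mul, Equiv.Perm.sign_swap hab.symm, Equiv.Perm.sign_swap hbc]
    rfl
  refine altSum_eq_zero ![1, σ, σ * σ] _ (fun w => ?_) v
  have hoth : ∀ (τ : Equiv.Perm (Fin (2 * k + 1))) (z : E),
      (∀ j, j ≠ a → j ≠ b → j ≠ c → τ j = j) →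
      Function.update (fun j => curv G A' x ((w ∘ τ) (evenIdx j).succ) ((w ∘ τ) (oddIdx j).succ)) i z =
      Function.update (fun j => curv G A' x (w (evenIdx j).succ) (w (oddIdx j).succ)) i z := by
    intro τ z hτ
    funext j
    by_cases hj : j = i
    · subst hj
      simp
    · have hj' : (j : ℕ) ≠ i := fun h => hj (Fin.ext h)
      rw [Function.update_of_ne hj, Function.update_of_ne hj, Function.comp_apply,
        Function.comp_apply, hτ, hτ]
      · exact Fin.succ_ne_zero _
      · simp only [hb, oddIdx, evenIdx, ne_eq, Fin.ext_iff, Fin.val_succ]; omega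
      · simp only [hc, oddIdx, ne_eq, Fin.ext_iff, Fin.val_succ]; omega
      · exact Fin.succ_ne_zero _
      · simp only [hb, evenIdx, ne_eq, Fin.ext_iff, Fin.val_succ]; omega
      · simp only [hc, oddIdx, evenIdx, ne_eq, Fin.ext_iff, Fin.val_succ]; omega
  have hso2 : ∀ j, j ≠ a → j ≠ b → j ≠ c → (σ * σ) j = j := fun j h1 h2 h3 => by
    rw [Equiv.Perm.mul_apply, hso j h1 h2 h3, hso j h1 h2 h3]
  simp only [Fin.sum_univ_three, Matrix.cons_val_zero, Matrix.cons_val_one, Matrix.cons_val_two,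
    Matrix.tail_cons, Matrix.head_cons, Equiv.Perm.sign_one, Equiv.Perm.sign_mul, hsign, mul_one,
    Units.val_one, Int.cast_one, one_mul, Equiv.Perm.coe_one, Function.comp_id, hoth σ _ hso,
    hoth (σ * σ) _ hso2]
  rw [← ρ.map_update_add, ← ρ.map_update_add]
  simp only [Function.comp_apply, Equiv.Perm.mul_apply, hsa, hsb, hsc, ← hb, ← hc]
  rw [hcyc]
  exact ρ.map_coord_zero i (by simp)

end Gauge

/-! ### Integration of forms over simplices and Stokes' theorem -/

section Stokes

open MeasureTheory SimplexMap

/-- The standard basis of `ℝⁿ`. -/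
abbrev unitVec (n : ℕ) : Fin n → Fin n → ℝ := fun i => Pi.single i 1

/-- Stokes' theorem on the cube, for closed forms. -/
theorem stokes_cube {n : ℕ} {η : (Fin (n + 1) → ℝ) → (Fin (n + 1) → ℝ) [⋀^Fin n]→L[ℝ] ℝ}
    (h : IsClosedForm (Icc 0 1) η) :
    ∑ i : Fin (n + 1), (-1) ^ (i : ℕ) *
      ((∫ y in Icc (0 : Fin n → ℝ) 1, η (i.insertNth 1 y) fun j => unitVec (n + 1) (i.succAbove j)) -
        ∫ y in Icc (0 : Fin n → ℝ) 1, η (i.insertNth 0 y) fun j => unitVec (n + 1) (i.succAbove j)) =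
      0 := by
  have hcube : (pi Set.univ fun _ : Fin (n + 1) => Ioo (0 : ℝ) 1) ⊆ Icc 0 1 := fun x hx =>
    ⟨fun i => (hx i (mem_univ i)).1.le, fun i => (hx i (mem_univ i)).2.le⟩
  have hopen : IsOpen (pi Set.univ fun _ : Fin (n + 1) => Ioo (0 : ℝ) 1) :=
    isOpen_set_pi finite_univ fun _ _ => isOpen_Ioo
  have hd : ∀ x ∈ (pi Set.univ fun _ : Fin (n + 1) => Ioo (0 : ℝ) 1),
      DifferentiableAt ℝ η x ∧ extDeriv η x = 0 := by
    intro x hx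
    obtain ⟨O, η', hO, hxO, hdO, hc, he⟩ := h x (hcube hx)
    have hev : η =ᶠ[𝓝 x] η' := by
      filter_upwards [hO.mem_nhds hxO, hopen.mem_nhds hx] with y hy hy'
      exact he ⟨hy, hcube hy'⟩
    refine ⟨((hdO x hxO).differentiableAt (hO.mem_nhds hxO)).congr_of_eventuallyEq hev, ?_⟩
    rw [hev.extDeriv_eq]
    exact hc x hxO
  classical
  set v : Fin (n + 1) → Fin n → Fin (n + 1) → ℝ := fun i j => unitVec (n + 1) (i.succAbove j) with hv
  have hη : ∀ i, ContinuousOn (fun x => η x (v i)) (Icc 0 1) := fun i =>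
    (ContinuousAlternatingMap.apply ℝ (Fin (n + 1) → ℝ) ℝ (v i)).continuous.comp_continuousOn
      h.continuousOn
  set f' : Fin (n + 1) → (Fin (n + 1) → ℝ) → (Fin (n + 1) → ℝ) →L[ℝ] ℝ := fun i x =>
    if x ∈ (pi Set.univ fun _ : Fin (n + 1) => Ioo (0 : ℝ) 1) then
      fderiv ℝ (fun x => (-1) ^ (i : ℕ) * η x (v i)) x else 0 with hf'
  have hdiv : ∀ x, ∑ i, f' i x (Pi.single i 1) = 0 := by
    intro x
    by_cases hx : x ∈ (pi Set.univ fun _ : Fin (n + 1) => Ioo (0 : ℝ) 1)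
    · obtain ⟨h1, h2⟩ := hd x hx
      have h3 := congrArg (fun ζ => ζ (unitVec (n + 1))) h2
      simp only [extDeriv_apply_real h1] at h3
      change _ = (0 : ℝ) at h3
      rw [← h3]
      refine Finset.sum_congr rfl fun i _ => ?_
      simp only [hf', if_pos hx]
      rw [fderiv_const_mul (h1.continuousAlternatingMap_apply_const (v i))]
      rfl
    · simp only [hf', if_neg hx]
      simp
  have key := integral_divergence_of_hasFDerivAt_off_countable' (0 : Fin (n + 1) → ℝ) 1
    zero_le_one (fun i x => (-1) ^ (i : ℕ) * η x (v i)) f' ∅ countable_empty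
    (fun i => continuousOn_const.mul (hη i)) (fun x hx i => by
      have hx' : x ∈ (pi Set.univ fun _ : Fin (n + 1) => Ioo (0 : ℝ) 1) := hx.1
      simp only [hf', if_pos hx']
      exact (((hd x hx').1.continuousAlternatingMap_apply_const (v i)).const_mul _).hasFDerivAt)
    (by simp only [hdiv]; exact integrableOn_zero)
  simp only [hdiv, integral_zero, integral_const_mul, ← mul_sub] at key
  exact key.symm

/-- The change of variables formula for top forms. -/
theorem integral_pullForm {n : ℕ} {s : Set (Fin n → ℝ)} (hs : MeasurableSet s)
    {f : (Fin n → ℝ) → Fin n → ℝ} (hf : Differentiable ℝ f) (hinj : InjOn f s)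
    (hdet : ∀ x ∈ s, 0 ≤ (fderiv ℝ f x).det)
    (α : (Fin n → ℝ) → (Fin n → ℝ) [⋀^Fin n]→L[ℝ] ℝ) :
    ∫ y in f '' s, α y (unitVec n) = ∫ x in s, pullForm f α x (unitVec n) := by
  rw [integral_image_eq_integral_abs_det_fderiv_smul volume hs
    (fun x _ => (hf x).hasFDerivAt.hasFDerivWithinAt) hinj]
  refine setIntegral_congr_fun hs fun x hx => ?_
  have h1 := congrArg (fun ζ => ζ (fun i => fderiv ℝ f x (unitVec n i)))
    ((α (f x)).toAlternatingMap.eq_smul_basis_det (Pi.basisFun ℝ (Fin n)))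
  have h2 : (Pi.basisFun ℝ (Fin n)).det (fun i => fderiv ℝ f x (unitVec n i)) =
      (fderiv ℝ f x).det := by
    have := Module.Basis.det_comp (Pi.basisFun ℝ (Fin n)) (fderiv ℝ f x : (Fin n → ℝ) →ₗ[ℝ] Fin n → ℝ)
      (Pi.basisFun ℝ (Fin n))
    rw [Module.Basis.det_self, mul_one] at this
    rw [ContinuousLinearMap.det, ← this]
    congr 1
    funext i
    simp [unitVec]
  have h3 : (⇑(Pi.basisFun ℝ (Fin n)) : Fin n → Fin n → ℝ) = unitVec n := by
    funext i
    simp [unitVec]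
  simp only [abs_of_nonneg (hdet x hx), smul_eq_mul]
  rw [AlternatingMap.smul_apply, h2, h3] at h1
  rw [mul_comm]
  exact h1.symm

theorem contDiff_bary (n : ℕ) : ContDiff ℝ ∞ (bary : (Fin n → ℝ) → Fin (n + 1) → ℝ) := by
  refine contDiff_pi.2 fun i => ?_
  refine Fin.cases ?_ (fun i => ?_) i
  · simp only [bary, Fin.cons_zero]
    fun_prop
  · simp only [bary, Fin.cons_succ]
    fun_prop

theorem bary_smul_bary {n : ℕ} (r : ℝ) (x : Fin n → ℝ) :
    bary (r • bary x) = Fin.cons (1 - r) (r • bary x) := by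
  rw [bary]
  simp only [Pi.smul_apply, smul_eq_mul, ← Finset.mul_sum, sum_bary, mul_one]

theorem tail_bary {n : ℕ} (x : Fin n → ℝ) : Fin.tail (bary x) = x := rfl

theorem face_eq_succAbove {n : ℕ} (i : Fin (n + 2)) (j : Fin (n + 1)) :
    Cochain.face n i j = i.succAbove j := by
  ext
  rw [Cochain.face_apply]
  simp only [Fin.succAbove, Fin.lt_def, Fin.val_castSucc]
  split_ifs <;> simp

theorem bary_face {n : ℕ} (i : Fin (n + 2)) (x : Fin n → ℝ) :
    bary (affineFun (Cochain.face n i) x) = i.insertNth 0 (bary x) := by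
  funext j
  rw [bary_affineFun]
  simp only [face_eq_succAbove]
  rcases Fin.eq_self_or_eq_succAbove i j with rfl | ⟨k, rfl⟩
  · rw [Fin.insertNth_apply_same]
    exact Finset.sum_eq_zero fun k hk => absurd (Finset.mem_filter.1 hk).2 (Fin.succAbove_ne _ _)
  · rw [Fin.insertNth_apply_succAbove]
    have : Finset.univ.filter (fun l => i.succAbove l = i.succAbove k) = {k} := by
      ext l
      simp
    rw [this, Finset.sum_singleton]

/-- The map from the cube to the simplex which is `T_j - T_{j+1}` in the `j`-th coordinate, where
`T_j = u_0 ⋯ u_j`. It collapses the cube `[0, 1]ⁿ` onto the simplex. -/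
def collapse : ∀ n : ℕ, (Fin n → ℝ) → Fin n → ℝ
  | 0, u => u
  | n + 1, u => u 0 • bary (collapse n (Fin.tail u))

theorem contDiff_collapse (n : ℕ) : ContDiff ℝ ∞ (collapse n) := by
  induction n with
  | zero => exact contDiff_id
  | succ n ih =>
    have h1 : ContDiff ℝ ∞ (fun u : Fin (n + 1) → ℝ => Fin.tail u) :=
      contDiff_pi.2 fun i => contDiff_apply ℝ ℝ i.succ
    exact (contDiff_apply ℝ ℝ (0 : Fin (n + 1))).smul
      ((contDiff_bary n).comp (ih.comp h1))

theorem tail_mem_cube {n : ℕ} {u : Fin (n + 1) → ℝ} (hu : u ∈ Icc (0 : Fin (n + 1) → ℝ) 1) :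
    Fin.tail u ∈ Icc (0 : Fin n → ℝ) 1 :=
  ⟨fun i => hu.1 i.succ, fun i => hu.2 i.succ⟩

theorem collapse_mem {n : ℕ} {u : Fin n → ℝ} (hu : u ∈ Icc (0 : Fin n → ℝ) 1) :
    collapse n u ∈ Simplex n := by
  induction n with
  | zero => exact ⟨fun i => i.elim0, by simp⟩
  | succ n ih =>
    have h1 := bary_nonneg ⟨_, ih (tail_mem_cube hu)⟩
    refine ⟨fun i => mul_nonneg (hu.1 0) (h1 i), ?_⟩
    simp only [collapse, Pi.smul_apply, smul_eq_mul, ← Finset.mul_sum, sum_bary, mul_one]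
    exact hu.2 0

theorem affineFun_face {n : ℕ} (i : Fin (n + 2)) (x : Fin n → ℝ) :
    affineFun (Cochain.face n i) x = Fin.tail (i.insertNth 0 (bary x) : Fin (n + 2) → ℝ) := by
  rw [← bary_face, tail_bary]

theorem affineFun_face_smul_bary {n : ℕ} (i : Fin (n + 2)) (r : ℝ) (x : Fin n → ℝ) :
    affineFun (Cochain.face (n + 1) (i + 1 : ℕ)) (r • bary x) =
      r • bary (affineFun (Cochain.face n i) x) := by
  have h1 := affineFun_face i.succ (r • bary x)
  rw [Fin.val_succ] at h1
  rw [h1, bary_smul_bary, Fin.insertNth_succ_cons, Fin.tail_cons, bary_face,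
    Fin.insertNth_eq_iff]
  refine ⟨by simp, ?_⟩
  funext j
  simp [Fin.removeNth]

theorem collapse_succ_insertNth {n : ℕ} (i : Fin (n + 1)) (a : ℝ) (y : Fin (n + 1) → ℝ) :
    collapse (n + 2) (i.succ.insertNth a y) =
      y 0 • bary (collapse (n + 1) (i.insertNth a (Fin.tail y))) := by
  have h1 : (i.succ.insertNth a y : Fin (n + 2) → ℝ) = Fin.cons (y 0) (i.insertNth a (Fin.tail y)) := by
    rw [← Fin.insertNth_succ_cons, Fin.cons_self_tail]
  rw [h1]
  rfl

theorem collapse_insertNth_one {n : ℕ} (i : Fin (n + 1)) (y : Fin n → ℝ) :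
    collapse (n + 1) (i.insertNth 1 y) = affineFun (Cochain.face n i) (collapse n y) := by
  have hz : ∀ (n : ℕ) (y : Fin n → ℝ), collapse (n + 1) ((0 : Fin (n + 1)).insertNth 1 y) =
      affineFun (Cochain.face n ((0 : Fin (n + 1)) : ℕ)) (collapse n y) := by
    intro n y
    have h0 := affineFun_face 0 (collapse n y)
    rw [Fin.insertNth_zero', Fin.tail_cons] at h0
    rw [Fin.insertNth_zero']
    refine Eq.trans ?_ h0.symm
    simp [collapse]
  induction n with
  | zero =>
    obtain rfl : i = 0 := Fin.fin_one_eq_zero i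
    exact hz 0 y
  | succ n ih =>
    refine Fin.cases (hz (n + 1) y) (fun k => ?_) i
    have h1 := affineFun_face_smul_bary k.castSucc (y 0) (collapse n (Fin.tail y))
    rw [Fin.val_castSucc] at h1
    rw [collapse_succ_insertNth, ih, ← h1]
    rfl

theorem collapse_insertNth_last {n : ℕ} (y : Fin n → ℝ) :
    collapse (n + 1) ((Fin.last n).insertNth 0 y) =
      affineFun (Cochain.face n (n + 1)) (collapse n y) := by
  induction n with
  | zero =>
    funext j
    obtain rfl : j = 0 := Fin.fin_one_eq_zero j
    have h0 := congrFun (affineFun_face 1 (collapse 0 y)) 0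
    refine Eq.trans ?_ h0.symm
    simp [collapse, Fin.tail]
  | succ n ih =>
    have h1 := affineFun_face_smul_bary (Fin.last (n + 1)) (y 0) (collapse n (Fin.tail y))
    rw [← Fin.succ_last, collapse_succ_insertNth, ih]
    exact h1.symm

/-- The faces `u_i = 0` of the cube other than the last are collapsed to a face of smaller
dimension: the map does not depend on the last coordinate. -/
theorem collapse_insertNth_zero {n : ℕ} {i : Fin (n + 2)} (hi : i ≠ Fin.last (n + 1))
    {y y' : Fin (n + 1) → ℝ} (h : ∀ j, j ≠ Fin.last n → y j = y' j) :
    collapse (n + 2) (i.insertNth 0 y) = collapse (n + 2) (i.insertNth 0 y') := by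
  induction n with
  | zero =>
    obtain rfl : i = 0 := by
      ext
      have : (i : ℕ) ≠ 1 := fun h => hi (Fin.ext h)
      have := i.2
      simp
      omega
    rw [Fin.insertNth_zero', Fin.insertNth_zero']
    simp [collapse]
  | succ n ih =>
    induction i using Fin.cases with
    | zero =>
      rw [Fin.insertNth_zero', Fin.insertNth_zero']
      simp [collapse]
    | succ k =>
      rw [collapse_succ_insertNth, collapse_succ_insertNth, h 0 (by simp [Fin.ext_iff]),
        ih (fun hk => hi (by rw [hk, Fin.succ_last]))
          (y := Fin.tail y) (y' := Fin.tail y') fun j hj => h j.succ fun hj' =>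
            hj (by rwa [← Fin.succ_last, Fin.succ_inj] at hj')]

/-- The open simplex. -/
def openSimplex (n : ℕ) : Set (Fin n → ℝ) := {x | (∀ i, 0 < x i) ∧ ∑ i, x i < 1}

/-- The inverse of `collapse` on the open simplex is built from `u_0 = ∑ x_i`, by recursion. -/
theorem collapse_image (n : ℕ) :
    InjOn (collapse n) (pi univ fun _ => Ioo (0 : ℝ) 1) ∧
      collapse n '' (pi univ fun _ => Ioo (0 : ℝ) 1) = openSimplex n := by
  induction n with
  | zero =>
    refine ⟨fun x _ y _ _ => Subsingleton.elim _ _, ?_⟩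
    ext x
    simp only [mem_image, openSimplex, mem_ofPred_eq]
    refine ⟨fun _ => ⟨fun i => i.elim0, by simp⟩, fun _ => ⟨x, fun i => i.elim0, rfl⟩⟩
  | succ n ih =>
    have hsum : ∀ u : Fin (n + 1) → ℝ, ∑ i, collapse (n + 1) u i = u 0 := fun u => by
      simp only [collapse, Pi.smul_apply, smul_eq_mul, ← Finset.mul_sum, sum_bary, mul_one]
    constructor
    · intro u hu w hw huw
      have h0 : u 0 = w 0 := by rw [← hsum u, ← hsum w, huw]
      have hp : u 0 ≠ 0 := (hu 0 (mem_univ _)).1.ne'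
      have h1 : bary (collapse n (Fin.tail u)) = bary (collapse n (Fin.tail w)) := by
        simp only [collapse, ← h0] at huw
        exact smul_right_injective _ hp huw
      have h2 : Fin.tail u = Fin.tail w :=
        ih.1 (fun i _ => hu i.succ (mem_univ _)) (fun i _ => hw i.succ (mem_univ _))
          (congrArg Fin.tail h1)
      rw [← Fin.cons_self_tail u, ← Fin.cons_self_tail w, h0, h2]
    · ext x
      constructor
      · rintro ⟨u, hu, rfl⟩
        have h1 : collapse n (Fin.tail u) ∈ openSimplex n :=
          ih.2 ▸ mem_image_of_mem _ fun i _ => hu i.succ (mem_univ _)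
        refine ⟨fun i => mul_pos (hu 0 (mem_univ _)).1 ?_, by
          rw [hsum]; exact (hu 0 (mem_univ _)).2⟩
        refine Fin.cases ?_ (fun i => ?_) i
        · simpa [bary] using h1.2
        · simpa [bary] using h1.1 i
      · intro hx
        have hs : 0 < ∑ i, x i := Finset.sum_pos (fun i _ => hx.1 i) Finset.univ_nonempty
        have hmem : (fun i : Fin n => (∑ i, x i)⁻¹ * x i.succ) ∈ openSimplex n := by
          refine ⟨fun i => mul_pos (inv_pos.2 hs) (hx.1 _), ?_⟩
          rw [← Finset.mul_sum, inv_mul_lt_iff₀ hs, mul_one, Fin.sum_univ_succ]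
          linarith [hx.1 0]
        rw [← ih.2] at hmem
        obtain ⟨w, hw, hwx⟩ := hmem
        refine ⟨Fin.cons (∑ i, x i) w, fun i _ => ?_, ?_⟩
        · refine Fin.cases ?_ (fun i => ?_) i
          · exact ⟨hs, hx.2⟩
          · exact hw i (mem_univ _)
        · simp only [collapse, Fin.cons_zero, Fin.tail_cons, hwx]
          funext i
          refine Fin.cases ?_ (fun i => ?_) i
          · simp only [bary, Pi.smul_apply, Fin.cons_zero, smul_eq_mul, ← Finset.mul_sum]
            rw [mul_sub, mul_inv_cancel_left₀ hs.ne', Fin.sum_univ_succ]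
            ring
          · simp only [bary, Pi.smul_apply, Fin.cons_succ, smul_eq_mul]
            rw [mul_inv_cancel_left₀ hs.ne']

/-- The coordinates `t_j = ∑_{i ≥ j} x_i`, in which the simplex is given by `1 ≥ t_0 ≥ t_1 ≥ ⋯ ≥ 0`. -/
def tailSums (n : ℕ) : (Fin n → ℝ) →L[ℝ] Fin n → ℝ :=
  LinearMap.toContinuousLinearMap
    (Matrix.toLin' (Matrix.of fun j i : Fin n => if j ≤ i then (1 : ℝ) else 0))

theorem tailSums_apply {n : ℕ} (x : Fin n → ℝ) (j : Fin n) :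
    tailSums n x j = ∑ i, if j ≤ i then x i else 0 := by
  simp [tailSums, Matrix.toLin'_apply, Matrix.mulVec, dotProduct]

theorem det_tailSums (n : ℕ) : (tailSums n).det = 1 := by
  have h1 : (Matrix.of fun j i : Fin n => if j ≤ i then (1 : ℝ) else 0).det = 1 := by
    rw [Matrix.det_of_isUpperTriangular]
    · simp
    · intro i j hij
      simp only [id] at hij
      simp [not_le.2 hij]
  rw [← h1, tailSums, ContinuousLinearMap.det]
  exact LinearMap.det_toLin' _

theorem tailSums_collapse {n : ℕ} (u : Fin n → ℝ) (j : Fin n) :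
    tailSums n (collapse n u) j = ∏ i, if i ≤ j then u i else 1 := by
  induction n with
  | zero => exact j.elim0
  | succ n ih =>
    rw [tailSums_apply, Fin.prod_univ_succ, if_pos (Fin.zero_le j)]
    refine Fin.cases ?_ (fun k => ?_) j
    · simp only [Fin.zero_le, if_true, collapse, Pi.smul_apply, smul_eq_mul, ← Finset.mul_sum,
        sum_bary]
      simp [Fin.ext_iff]
    · simp only [Fin.succ_le_succ_iff]
      have := ih (Fin.tail u) k
      simp only [Fin.tail] at this
      rw [← this, tailSums_apply, Fin.sum_univ_succ]
      simp only [Fin.succ_le_succ_iff, collapse, Pi.smul_apply, smul_eq_mul, Finset.mul_sum,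
        Fin.le_zero_iff, Fin.succ_ne_zero, if_false, zero_add, mul_ite, mul_zero]
      rfl

/-- In the coordinates `T_j = u_0 ⋯ u_j` of the simplex, which are related to the `x_i` by a unimodular
matrix, the derivative of `collapse` is triangular with nonnegative diagonal entries. -/
theorem det_collapse_nonneg {n : ℕ} {u : Fin n → ℝ} (hu : u ∈ Icc (0 : Fin n → ℝ) 1) :
    0 ≤ (fderiv ℝ (collapse n) u).det := by
  set L : (Fin n → ℝ) →L[ℝ] Fin n → ℝ := (tailSums n).comp (fderiv ℝ (collapse n) u) with hL
  have h1 : L.det = (fderiv ℝ (collapse n) u).det := by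
    rw [hL, ContinuousLinearMap.det, ContinuousLinearMap.toLinearMap_comp, LinearMap.det_comp]
    have := det_tailSums n
    rw [ContinuousLinearMap.det] at this
    rw [this, one_mul]
  have hd : HasFDerivAt (fun u => tailSums n (collapse n u)) L u :=
    (tailSums n).hasFDerivAt.comp u
      (((contDiff_collapse n).differentiable (by simp)) u).hasFDerivAt
  have hentry : ∀ j k : Fin n, j ≤ k → L (Pi.single k 1) j =
      if j = k then ∏ i, (if i < j then u i else 1) else 0 := by
    intro j k hjk
    have h2 := (hasFDerivAt_pi'.1 hd j).hasLineDerivAt (Pi.single k 1)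
    have h3 : HasLineDerivAt ℝ (fun u => tailSums n (collapse n u) j)
        (if j = k then ∏ i, (if i < j then u i else 1) else 0) u (Pi.single k 1) := by
      rw [HasLineDerivAt]
      simp only [tailSums_collapse]
      split_ifs with h
      · subst h
        have : (fun t : ℝ => ∏ i, if i ≤ j then (u + t • (Pi.single j 1 : Fin n → ℝ)) i else 1) =
            fun t => (u j + t) * ∏ i, (if i < j then u i else 1) := by
          funext t
          rw [← Finset.mul_prod_erase _ _ (Finset.mem_univ j), ← Finset.mul_prod_erase _ (fun i =>
            if i < j then u i else 1) (Finset.mem_univ j)]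
          simp only [le_refl, if_true, lt_irrefl, if_false, one_mul]
          congr 1
          · simp
          · refine Finset.prod_congr rfl fun i hi => ?_
            have hij := Finset.ne_of_mem_erase hi
            simp [le_iff_lt_or_eq, hij]
        rw [this]
        have := ((hasDerivAt_id (0 : ℝ)).const_add (u j)).mul_const
          (∏ i, (if i < j then u i else 1))
        simpa using this
      · have hlt : j < k := lt_of_le_of_ne hjk h
        have : (fun t : ℝ => ∏ i, if i ≤ j then (u + t • (Pi.single k 1 : Fin n → ℝ)) i else 1) =
            fun t => ∏ i, if i ≤ j then u i else 1 := by
          funext t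
          refine Finset.prod_congr rfl fun i _ => ?_
          by_cases hi : i ≤ j
          · simp [hi, Pi.single_eq_of_ne (ne_of_lt (lt_of_le_of_lt hi hlt))]
          · simp [hi]
        rw [this]
        exact hasDerivAt_const _ _
    exact h2.unique h3
  rw [← h1, ContinuousLinearMap.det, ← LinearMap.det_toMatrix', Matrix.det_of_isLowerTriangular]
  · refine Finset.prod_nonneg fun j _ => ?_
    have := hentry j j le_rfl
    rw [if_pos rfl] at this
    change 0 ≤ L (Pi.single j 1) j
    rw [this]
    refine Finset.prod_nonneg fun i _ => ?_
    split_ifs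
    · exact hu.1 i
    · exact zero_le_one
  · intro j k hjk
    have hjk' : j < k := hjk
    have := hentry j k hjk'.le
    rw [if_neg hjk'.ne] at this
    exact this

theorem measurableSet_simplex (n : ℕ) : MeasurableSet (Simplex n) := by
  have h1 : IsClosed (Simplex n) := by
    have : Simplex n = (⋂ i, {x | 0 ≤ x i}) ∩ {x | ∑ i, x i ≤ 1} := by
      ext x
      simp [Simplex]
    rw [this]
    exact (isClosed_iInter fun i => isClosed_le continuous_const (continuous_apply i)).inter
      (isClosed_le (by fun_prop) continuous_const)
  exact h1.measurableSet

/-- The boundary of the simplex, being the frontier of a convex set, has measure zero. -/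
theorem openSimplex_ae_eq (n : ℕ) : openSimplex n =ᵐ[volume] Simplex n := by
  have hopen : IsOpen (openSimplex n) := by
    have : openSimplex n = (⋂ i, {x | 0 < x i}) ∩ {x | ∑ i, x i < 1} := by
      ext x
      simp [openSimplex]
    rw [this]
    exact (isOpen_iInter_of_finite fun i => isOpen_lt continuous_const (continuous_apply i)).inter
      (isOpen_lt (by fun_prop) continuous_const)
  have hsub : openSimplex n ⊆ Simplex n := fun x hx => ⟨fun i => (hx.1 i).le, hx.2.le⟩
  refine hsub.eventuallyLE.antisymm ?_
  rw [ae_le_set]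
  refine measure_mono_null ?_ ((convex_simplex n).addHaar_frontier volume)
  rintro x ⟨hx, hx'⟩
  refine ⟨subset_closure hx, fun hxi => hx' ?_⟩
  -- an interior point can be moved in every direction
  have hev : ∀ v : Fin n → ℝ, ∃ t : ℝ, 0 < t ∧ x + t • v ∈ Simplex n := by
    intro v
    have hc : Tendsto (fun t : ℝ => x + t • v) (𝓝[>] 0) (𝓝 x) := by
      have : Continuous fun t : ℝ => x + t • v := by fun_prop
      have h0 := this.tendsto 0
      simp only [zero_smul, add_zero] at h0
      exact h0.mono_left nhdsWithin_le_nhds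
    obtain ⟨t, h1, h2⟩ := ((hc.eventually (mem_interior_iff_mem_nhds.1 hxi)).and
      self_mem_nhdsWithin).exists
    exact ⟨t, h2, h1⟩
  have hpos : ∀ i, 0 < x i := by
    intro i
    obtain ⟨t, ht, h1, -⟩ := hev (-Pi.single i 1)
    have := h1 i
    simp at this
    linarith
  refine ⟨hpos, ?_⟩
  by_cases hn : Nonempty (Fin n)
  · obtain ⟨i⟩ := hn
    obtain ⟨t, ht, -, h1⟩ := hev (Pi.single i 1)
    simp only [Pi.add_apply, Pi.smul_apply, smul_eq_mul, Finset.sum_add_distrib,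
      ← Finset.mul_sum, Finset.sum_pi_single', Finset.mem_univ, if_true] at h1
    linarith
  · rw [not_nonempty_iff] at hn
    simp

/-- Integrals over the simplex are integrals over the cube, by means of `collapse`. -/
theorem integral_simplex_eq {n : ℕ} (α : (Fin n → ℝ) → (Fin n → ℝ) [⋀^Fin n]→L[ℝ] ℝ) :
    ∫ x in Simplex n, α x (unitVec n) =
      ∫ u in Icc (0 : Fin n → ℝ) 1, pullForm (collapse n) α u (unitVec n) := by
  have h1 : (pi univ fun _ : Fin n => Ioo (0 : ℝ) 1) =ᵐ[volume] Icc (0 : Fin n → ℝ) 1 :=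
    Measure.univ_pi_Ioo_ae_eq_Icc
  rw [← setIntegral_congr_set (openSimplex_ae_eq n), ← setIntegral_congr_set h1,
    ← (collapse_image n).2]
  refine integral_pullForm (MeasurableSet.univ_pi fun _ => measurableSet_Ioo)
    ((contDiff_collapse n).differentiable (by simp)) (collapse_image n).1 (fun x hx => ?_) α
  exact det_collapse_nonneg ⟨fun i => (hx i (mem_univ _)).1.le, fun i => (hx i (mem_univ _)).2.le⟩

end Stokes

/-! ### Closed simplicial forms and their integrals -/

section SimplicialForms

open MeasureTheory SimplexMap

universe v

section PullForm

variable {U V W : Type*} [NormedAddCommGroup U] [NormedSpace ℝ U]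
  [NormedAddCommGroup V] [NormedSpace ℝ V] [FiniteDimensional ℝ V]
  [NormedAddCommGroup W] [NormedSpace ℝ W] [FiniteDimensional ℝ W] {n : ℕ}

theorem IsClosedForm.mono {S S' : Set V} {α : V → V [⋀^Fin n]→L[ℝ] ℝ} (h : IsClosedForm S α)
    (hS : S' ⊆ S) : IsClosedForm S' α := fun p hp => by
  obtain ⟨O, α', hO, hpO, hd, hc, he⟩ := h p (hS hp)
  exact ⟨O, α', hO, hpO, hd, hc, he.mono (inter_subset_inter_right _ hS)⟩

theorem pullForm_apply (f : W → V) (α : V → V [⋀^Fin n]→L[ℝ] ℝ) (x : W) (v : Fin n → W) :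
    pullForm f α x v = α (f x) fun i => fderiv ℝ f x (v i) := rfl

theorem pullForm_comp [FiniteDimensional ℝ U] {f : W → V} {g : U → W} (hf : Differentiable ℝ f)
    (hg : Differentiable ℝ g) (α : V → V [⋀^Fin n]→L[ℝ] ℝ) :
    pullForm (fun x => f (g x)) α = pullForm g (pullForm f α) := by
  funext x
  ext v
  simp only [pullForm_apply]
  have := fderiv_comp x (hf (g x)) (hg x)
  simp only [Function.comp_def] at this
  rw [this]
  rfl

theorem pullForm_congr (f : W → V) {α α' : V → V [⋀^Fin n]→L[ℝ] ℝ} {x : W}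
    (h : α (f x) = α' (f x)) : pullForm f α x = pullForm f α' x := by
  simp only [pullForm, h]

theorem pullForm_wedge {p q : ℕ} (h : p + q = n) (f : W → V) (α : V → V [⋀^Fin p]→L[ℝ] ℝ)
    (β : V → V [⋀^Fin q]→L[ℝ] ℝ) (x : W) :
    pullForm f (fun y => wedge h (α y) (β y)) x = wedge h (pullForm f α x) (pullForm f β x) := by
  ext v
  rw [pullForm_apply, wedge_apply, wedge_apply]
  rfl

/-- A form of top degree vanishes when pulled back along a map which is constant in one of the
coordinate directions. -/
theorem pullForm_unitVec_eq_zero {f : (Fin n → ℝ) → V} (j : Fin n)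
    (hf : ∀ y y' : Fin n → ℝ, (∀ i, i ≠ j → y i = y' i) → f y = f y')
    (α : V → V [⋀^Fin n]→L[ℝ] ℝ) (y : Fin n → ℝ) : pullForm f α y (unitVec n) = 0 := by
  have h0 : fderiv ℝ f y (unitVec n j) = 0 := by
    by_cases hd : DifferentiableAt ℝ f y
    · have h1 := hd.hasFDerivAt.hasLineDerivAt (unitVec n j)
      have h2 : HasLineDerivAt ℝ f 0 y (unitVec n j) := by
        rw [HasLineDerivAt]
        have : (fun t : ℝ => f (y + t • unitVec n j)) = fun _ => f y := by
          funext t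
          refine hf _ _ fun i hi => ?_
          simp [unitVec, hi]
        rw [this]
        exact hasDerivAt_const _ _
      exact h1.unique h2
    · rw [fderiv_zero_of_not_differentiableAt hd]
      rfl
  rw [pullForm_apply]
  exact (α (f y)).toAlternatingMap.map_coord_zero j h0

end PullForm

theorem hasFDerivAt_insertNth {n : ℕ} (i : Fin (n + 1)) (a : ℝ) (y : Fin n → ℝ) :
    ContDiff ℝ ∞ (fun y : Fin n → ℝ => (i.insertNth a y : Fin (n + 1) → ℝ)) ∧
    ∀ j, fderiv ℝ (fun y : Fin n → ℝ => (i.insertNth a y : Fin (n + 1) → ℝ)) y (unitVec n j) =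
      unitVec (n + 1) (i.succAbove j) := by
  have hc : ContDiff ℝ ∞ (fun y : Fin n → ℝ => (i.insertNth a y : Fin (n + 1) → ℝ)) := by
    refine contDiff_pi.2 fun k => ?_
    rcases Fin.eq_self_or_eq_succAbove i k with rfl | ⟨l, rfl⟩
    · simp only [Fin.insertNth_apply_same]
      exact contDiff_const
    · simp only [Fin.insertNth_apply_succAbove]
      exact contDiff_apply ℝ ℝ l
  refine ⟨hc, fun j => ?_⟩
  have h1 := (hc.differentiable (by simp) y).hasFDerivAt.hasLineDerivAt (unitVec n j)
  refine h1.unique ?_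
  rw [HasLineDerivAt]
  refine hasDerivAt_pi.2 fun k => ?_
  rcases Fin.eq_self_or_eq_succAbove i k with rfl | ⟨l, rfl⟩
  · simp only [Fin.insertNth_apply_same]
    rw [unitVec, Pi.single_eq_of_ne (Fin.ne_succAbove _ _)]
    exact hasDerivAt_const _ _
  · simp only [Fin.insertNth_apply_succAbove, Pi.add_apply, Pi.smul_apply, smul_eq_mul]
    have h2 : unitVec (n + 1) (i.succAbove j) (i.succAbove l) = unitVec n j l := by
      simp [unitVec, Pi.single_apply]
    rw [h2]
    simpa using ((hasDerivAt_id (0 : ℝ)).mul_const (unitVec n j l)).const_add (y l)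

/-- Stokes' theorem on the cube, in terms of the pull-backs to the faces. -/
theorem stokes_cube' {n : ℕ} {η : (Fin (n + 1) → ℝ) → (Fin (n + 1) → ℝ) [⋀^Fin n]→L[ℝ] ℝ}
    (h : IsClosedForm (Icc 0 1) η) :
    ∑ i : Fin (n + 1), (-1) ^ (i : ℕ) *
      ((∫ y in Icc (0 : Fin n → ℝ) 1, pullForm (fun y => i.insertNth 1 y) η y (unitVec n)) -
        ∫ y in Icc (0 : Fin n → ℝ) 1, pullForm (fun y => i.insertNth 0 y) η y (unitVec n)) = 0 := by
  simp only [pullForm_apply, (hasFDerivAt_insertNth _ _ _).2]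
  exact stokes_cube h

theorem differentiable_insertNth {n : ℕ} (i : Fin (n + 1)) (a : ℝ) :
    Differentiable ℝ (fun y : Fin n → ℝ => (i.insertNth a y : Fin (n + 1) → ℝ)) :=
  (hasFDerivAt_insertNth i a 0).1.differentiable (by simp)

theorem differentiable_collapse (n : ℕ) : Differentiable ℝ (collapse n) :=
  (contDiff_collapse n).differentiable (by simp)

theorem differentiable_affineFun {k n : ℕ} (θ : Fin (k + 1) →o Fin (n + 1)) :
    Differentiable ℝ (affineFun θ) := (contDiff_affineFun θ).differentiable (by simp)

/-- Stokes' theorem on the simplex, for closed forms. -/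
theorem stokes_simplex {n : ℕ} {α : (Fin (n + 1) → ℝ) → (Fin (n + 1) → ℝ) [⋀^Fin n]→L[ℝ] ℝ}
    (h : IsClosedForm (Simplex (n + 1)) α) :
    ∑ i ∈ Finset.range (n + 2), (-1) ^ i *
      ∫ x in Simplex n, pullForm (affineFun (Cochain.face n i)) α x (unitVec n) = 0 := by
  have key := stokes_cube' (h.pullForm (contDiff_collapse (n + 1)) fun _ => collapse_mem)
  have h1 : ∀ i : ℕ, (∫ x in Simplex n, pullForm (affineFun (Cochain.face n i)) α x (unitVec n)) =
      ∫ y in Icc (0 : Fin n → ℝ) 1, pullForm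
        (fun y => affineFun (Cochain.face n i) (collapse n y)) α y (unitVec n) := fun i => by
    rw [integral_simplex_eq, pullForm_comp (differentiable_affineFun _) (differentiable_collapse _)]
  simp only [h1, ← pullForm_comp (differentiable_collapse (n + 1)) (differentiable_insertNth _ _),
    collapse_insertNth_one, mul_sub, Finset.sum_sub_distrib] at key ⊢
  rw [Finset.sum_range_succ, ← Fin.sum_univ_eq_sum_range (fun i => (-1 : ℝ) ^ i *
    ∫ y in Icc (0 : Fin n → ℝ) 1, pullForm
        (fun y => affineFun (Cochain.face n i) (collapse n y)) α y (unitVec n))]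
  rw [sub_eq_zero.1 key, Fin.sum_univ_castSucc, Finset.sum_eq_zero]
  · simp only [collapse_insertNth_last, Fin.val_last]
    ring
  · intro i _
    cases n with
    | zero => exact i.elim0
    | succ n =>
      refine mul_eq_zero_of_right _ ?_
      refine integral_eq_zero_of_ae (Eventually.of_forall fun y => ?_)
      exact pullForm_unitVec_eq_zero (Fin.last n) (fun y y' hy =>
        collapse_insertNth_zero (Fin.castSucc_lt_last i).ne hy) α y

/-- The prism `[0, 1] × Δⁿ`. -/
def Prism (n : ℕ) : Set (Fin (n + 1) → ℝ) := {z | z 0 ∈ Icc (0 : ℝ) 1 ∧ Fin.tail z ∈ Simplex n}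

/-- The map `id × f` of prisms. -/
def prismMap {k n : ℕ} (f : (Fin k → ℝ) → Fin n → ℝ) (z : Fin (k + 1) → ℝ) : Fin (n + 1) → ℝ :=
  Fin.cons (z 0) (f (Fin.tail z))

theorem contDiff_tail (n : ℕ) : ContDiff ℝ ∞ (fun u : Fin (n + 1) → ℝ => Fin.tail u) :=
  contDiff_pi.2 fun i => contDiff_apply ℝ ℝ i.succ

theorem contDiff_prismMap {k n : ℕ} {f : (Fin k → ℝ) → Fin n → ℝ} (hf : ContDiff ℝ ∞ f) :
    ContDiff ℝ ∞ (prismMap f) := by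
  refine contDiff_pi.2 fun i => ?_
  refine Fin.cases ?_ (fun i => ?_) i
  · exact contDiff_apply ℝ ℝ (0 : Fin (k + 1))
  · exact (contDiff_pi.1 hf i).comp (contDiff_tail k)

theorem differentiable_prismMap {k n : ℕ} {f : (Fin k → ℝ) → Fin n → ℝ} (hf : ContDiff ℝ ∞ f) :
    Differentiable ℝ (prismMap f) := (contDiff_prismMap hf).differentiable (by simp)

/-- Stokes' theorem on the prism, for closed forms. -/
theorem stokes_prism {n : ℕ} {β : (Fin (n + 2) → ℝ) → (Fin (n + 2) → ℝ) [⋀^Fin (n + 1)]→L[ℝ] ℝ}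
    (h : IsClosedForm (Prism (n + 1)) β) :
    (∫ x in Simplex (n + 1), pullForm (fun x => Fin.cons 1 x) β x (unitVec (n + 1))) -
      (∫ x in Simplex (n + 1), pullForm (fun x => Fin.cons 0 x) β x (unitVec (n + 1))) =
    ∑ i ∈ Finset.range (n + 2), (-1) ^ i *
      ∫ u in Icc (0 : Fin (n + 1) → ℝ) 1, pullForm (prismMap (collapse n))
        (pullForm (prismMap (affineFun (Cochain.face n i))) β) u (unitVec (n + 1)) := by
  have hC := contDiff_prismMap (contDiff_collapse (n + 1))
  have hCd := hC.differentiable (by simp)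
  have key := stokes_cube' (h.pullForm hC fun u hu =>
    ⟨⟨hu.1 0, hu.2 0⟩, collapse_mem (tail_mem_cube hu)⟩)
  have h0 : ∀ a : ℝ, (∫ x in Simplex (n + 1), pullForm (fun x => Fin.cons a x) β x
      (unitVec (n + 1))) = ∫ y in Icc (0 : Fin (n + 1) → ℝ) 1,
        pullForm (fun y => prismMap (collapse (n + 1)) ((0 : Fin (n + 2)).insertNth a y)) β y
          (unitVec (n + 1)) := fun a => by
    rw [integral_simplex_eq, ← pullForm_comp _ (differentiable_collapse _)]
    · simp only [Fin.insertNth_zero']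
      rfl
    · have := differentiable_insertNth (n := n + 1) 0 a
      simpa only [Fin.insertNth_zero'] using this
  have h1 : ∀ (i : Fin (n + 1)) (a : ℝ) (y : Fin (n + 1) → ℝ),
      prismMap (collapse (n + 1)) (i.succ.insertNth a y) =
        Fin.cons (y 0) (collapse (n + 1) (i.insertNth a (Fin.tail y))) := fun i a y => by
    have h2 : (i.succ.insertNth a y : Fin (n + 2) → ℝ) =
        Fin.cons (y 0) (i.insertNth a (Fin.tail y)) := by
      rw [← Fin.insertNth_succ_cons, Fin.cons_self_tail]
    rw [h2]
    rfl
  have h3 : ∀ i : ℕ, pullForm (prismMap (collapse n))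
        (pullForm (prismMap (affineFun (Cochain.face n i))) β) =
      pullForm (fun y => Fin.cons (y 0) (affineFun (Cochain.face n i) (collapse n (Fin.tail y)))) β :=
    fun i => by
      rw [← pullForm_comp (differentiable_prismMap (contDiff_affineFun _))
        (differentiable_prismMap (contDiff_collapse _))]
      rfl
  simp only [← pullForm_comp hCd (differentiable_insertNth _ _)] at key
  rw [Fin.sum_univ_succ] at key
  simp only [h0, h3]
  simp only [h1, collapse_insertNth_one, mul_sub, Finset.sum_sub_distrib, Fin.val_zero, pow_zero,
    one_mul, Fin.val_succ] at key
  rw [Fin.sum_univ_castSucc (f := fun i : Fin (n + 1) => (-1 : ℝ) ^ ((i : ℕ) + 1) *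
    ∫ y in Icc (0 : Fin (n + 1) → ℝ) 1, pullForm (fun y => Fin.cons (y 0)
      (collapse (n + 1) (i.insertNth 0 (Fin.tail y)))) β y (unitVec (n + 1))),
    Finset.sum_eq_zero (s := Finset.univ) (ι := Fin n)] at key
  · simp only [collapse_insertNth_last, Fin.val_last] at key
    rw [Finset.sum_range_succ, ← Fin.sum_univ_eq_sum_range (fun i => (-1 : ℝ) ^ i *
      ∫ y in Icc (0 : Fin (n + 1) → ℝ) 1, pullForm (fun y => Fin.cons (y 0)
        (affineFun (Cochain.face n i) (collapse n (Fin.tail y)))) β y (unitVec (n + 1)))]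
    simp only [pow_succ, mul_neg, mul_one, neg_mul, Finset.sum_neg_distrib] at key ⊢
    linarith
  · intro i _
    cases n with
    | zero => exact i.elim0
    | succ n =>
      refine mul_eq_zero_of_right _ ?_
      refine integral_eq_zero_of_ae (Eventually.of_forall fun y => ?_)
      refine pullForm_unitVec_eq_zero (Fin.last (n + 1)) (fun y y' hy => ?_) β y
      have h4 : y 0 = y' 0 := hy 0 (by simp [Fin.ext_iff])
      have h5 := collapse_insertNth_zero (Fin.castSucc_lt_last i).ne
        (y := Fin.tail y) (y' := Fin.tail y') fun j hj => hy j.succ fun hj' =>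
          hj (by rwa [← Fin.succ_last, Fin.succ_inj] at hj')
      rw [h4, h5]

/-- A family of closed `m`-forms on the simplices of `X`, compatible with the simplicial maps. -/
structure IsClosedSimplicialForm {X : SmoothSSet.{v}} {m : ℕ}
    (α : ∀ {n : ℕ}, X.obj n → (Fin n → ℝ) → (Fin n → ℝ) [⋀^Fin m]→L[ℝ] ℝ) : Prop where
  closed : ∀ {n : ℕ} (x : X.obj n), IsClosedForm (Simplex n) (α x)
  compat : ∀ {k n : ℕ} (θ : Fin (k + 1) →o Fin (n + 1)) (y : X.obj n),
    EqOn (α (X.res θ y)) (pullForm (affineFun θ) (α y)) (Simplex k)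

/-- A family of closed `m`-forms on the prisms over the simplices of `X`, compatible with
the simplicial maps. -/
structure IsClosedPrismForm {X : SmoothSSet.{v}} {m : ℕ}
    (β : ∀ {n : ℕ}, X.obj n → (Fin (n + 1) → ℝ) → (Fin (n + 1) → ℝ) [⋀^Fin m]→L[ℝ] ℝ) :
    Prop where
  closed : ∀ {n : ℕ} (x : X.obj n), IsClosedForm (Prism n) (β x)
  compat : ∀ {k n : ℕ} (θ : Fin (k + 1) →o Fin (n + 1)) (y : X.obj n),
    EqOn (β (X.res θ y)) (pullForm (prismMap (affineFun θ)) (β y)) (Prism k)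

/-- The cochain of the integrals of a family of top forms. -/
def integralCochain {X : SmoothSSet.{v}} {m : ℕ}
    (α : ∀ {n : ℕ}, X.obj n → (Fin n → ℝ) → (Fin n → ℝ) [⋀^Fin m]→L[ℝ] ℝ) : Cochain X m :=
  fun x => ∫ y in Simplex m, α x y (unitVec m)

variable {X : SmoothSSet.{v}} {m : ℕ}

/-- By Stokes' theorem, the integrals of a closed simplicial form are a cocycle. -/
theorem IsClosedSimplicialForm.coboundary_eq_zero
    {α : ∀ {n : ℕ}, X.obj n → (Fin n → ℝ) → (Fin n → ℝ) [⋀^Fin m]→L[ℝ] ℝ}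
    (h : IsClosedSimplicialForm α) : Cochain.coboundary m (integralCochain α) = 0 := by
  funext x
  change ∑ i ∈ Finset.range (m + 2), (-1) ^ i *
    integralCochain α (X.res (Cochain.face m i) x) = 0
  refine Eq.trans (Finset.sum_congr rfl fun i _ => ?_) (stokes_simplex (h.closed x))
  congr 1
  exact setIntegral_congr_fun (measurableSet_simplex m) fun y hy => by
    simp only [h.compat _ x hy]

theorem IsClosedSimplicialForm.mem_cocycles
    {α : ∀ {n : ℕ}, X.obj n → (Fin n → ℝ) → (Fin n → ℝ) [⋀^Fin m]→L[ℝ] ℝ}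
    (h : IsClosedSimplicialForm α) :
    DirectSum.of (Cochain X) m (integralCochain α) ∈ cocycles X := by
  change differential X _ = 0
  rw [differential_of, h.coboundary_eq_zero, map_zero]

/-- The ends of a closed form on the prisms have cohomologous integrals. -/
theorem IsClosedPrismForm.exists_differential
    {β : ∀ {n : ℕ}, X.obj n → (Fin (n + 1) → ℝ) → (Fin (n + 1) → ℝ) [⋀^Fin m]→L[ℝ] ℝ}
    (h : IsClosedPrismForm β)
    {α₀ α₁ : ∀ {n : ℕ}, X.obj n → (Fin n → ℝ) → (Fin n → ℝ) [⋀^Fin m]→L[ℝ] ℝ}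
    (h₀ : ∀ x : X.obj m, EqOn (α₀ x) (pullForm (fun x => Fin.cons 0 x) (β x)) (Simplex m))
    (h₁ : ∀ x : X.obj m, EqOn (α₁ x) (pullForm (fun x => Fin.cons 1 x) (β x)) (Simplex m)) :
    ∃ c, differential X c = DirectSum.of (Cochain X) m (integralCochain α₁) -
      DirectSum.of (Cochain X) m (integralCochain α₀) := by
  have e₀ : ∀ x : X.obj m, integralCochain α₀ x =
      ∫ y in Simplex m, pullForm (fun x => Fin.cons 0 x) (β x) y (unitVec m) := fun x =>
    setIntegral_congr_fun (measurableSet_simplex m) fun y hy => by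
      simp only [h₀ x hy]
  have e₁ : ∀ x : X.obj m, integralCochain α₁ x =
      ∫ y in Simplex m, pullForm (fun x => Fin.cons 1 x) (β x) y (unitVec m) := fun x =>
    setIntegral_congr_fun (measurableSet_simplex m) fun y hy => by
      simp only [h₁ x hy]
  cases m with
  | zero =>
    refine ⟨0, ?_⟩
    rw [map_zero, eq_comm, sub_eq_zero]
    congr 1
    funext x
    have key := stokes_cube' ((h.closed x).mono (S' := Icc 0 1)
      fun u hu => ⟨⟨hu.1 0, hu.2 0⟩, fun i => i.elim0, by simp⟩)
    rw [e₀, e₁, integral_simplex_eq, integral_simplex_eq]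
    rw [Fin.sum_univ_succ] at key
    simp only [Finset.univ_eq_empty, Finset.sum_empty, add_zero, Fin.val_zero, pow_zero, one_mul,
      Fin.insertNth_zero'] at key
    rw [sub_eq_zero] at key
    have hid : collapse 0 = id := rfl
    have hpull : ∀ γ : (Fin 0 → ℝ) → (Fin 0 → ℝ) [⋀^Fin 0]→L[ℝ] ℝ, pullForm id γ = γ := by
      intro γ
      funext y
      ext v
      rw [pullForm_apply, fderiv_id]
      rfl
    rw [hid, hpull, hpull]
    exact key
  | succ m =>
    set c : Cochain X m := fun x => ∫ u in Icc (0 : Fin (m + 1) → ℝ) 1,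
      pullForm (prismMap (collapse m)) (β x) u (unitVec (m + 1)) with hc
    refine ⟨DirectSum.of _ m c, ?_⟩
    rw [differential_of, ← map_sub]
    congr 1
    funext x
    change ∑ i ∈ Finset.range (m + 2), (-1) ^ i * c (X.res (Cochain.face m i) x) =
      integralCochain α₁ x - integralCochain α₀ x
    refine Eq.trans ?_ ((congrArg₂ _ (e₁ x) (e₀ x)).trans (stokes_prism (h.closed x))).symm
    refine Finset.sum_congr rfl fun i _ => ?_
    congr 1
    refine setIntegral_congr_fun measurableSet_Icc fun u hu => ?_
    have hu' : prismMap (collapse m) u ∈ Prism m :=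
      ⟨⟨hu.1 0, hu.2 0⟩, collapse_mem (tail_mem_cube hu)⟩
    rw [pullForm_congr _ (h.compat (Cochain.face m i) x hu')]

end SimplicialForms

/-! ### Multiplicativity: wedge products and cup products -/

section Multiplicativity

open MeasureTheory SimplexMap

universe v

/-- The sum of the barycentric coordinates with index at least `j`. -/
def upperSum {n : ℕ} (x : Fin n → ℝ) (j : ℕ) : ℝ := ∑ i : Fin (n + 1), if j ≤ i then bary x i else 0

theorem sum_telescope {n : ℕ} (g : ℕ → ℝ) {j : ℕ} (hj : j ≤ n) :
    (∑ i : Fin n, if j ≤ i then g i - g (i + 1) else 0) = g j - g n := by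
  rw [Fin.sum_univ_eq_sum_range (fun i => if j ≤ i then g i - g (i + 1) else 0)]
  induction n, hj using Nat.le_induction with
  | base =>
    rw [sub_self]
    exact Finset.sum_eq_zero fun i hi => if_neg (not_le.2 (Finset.mem_range.1 hi))
  | succ n hn ih => rw [Finset.sum_range_succ, ih, if_pos hn]; ring

theorem upperSum_zero {n : ℕ} (x : Fin n → ℝ) : upperSum x 0 = 1 := by
  simp [upperSum, sum_bary]

theorem upperSum_of_lt {n : ℕ} (x : Fin n → ℝ) {j : ℕ} (hj : n < j) : upperSum x j = 0 :=
  Finset.sum_eq_zero fun i _ => if_neg (by omega)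

theorem upperSum_sub {n : ℕ} (x : Fin n → ℝ) (i : Fin (n + 1)) :
    upperSum x i - upperSum x (i + 1) = bary x i := by
  rw [upperSum, upperSum, ← Finset.sum_sub_distrib, Finset.sum_eq_single i]
  · simp
  · intro k _ hk
    have : (k : ℕ) ≠ i := fun h => hk (Fin.ext h)
    split_ifs <;> first | omega | simp
  · simp

theorem tailSums_eq {n : ℕ} (x : Fin n → ℝ) (j : Fin n) : tailSums n x j = upperSum x (j + 1) := by
  rw [tailSums_apply, upperSum, Fin.sum_univ_succ]
  simp only [bary, Fin.cons_zero, Fin.cons_succ, Fin.val_zero, Fin.val_succ, Fin.le_def,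
    add_le_add_iff_right]
  rw [if_neg (by omega), zero_add]

theorem upperSum_ext {n : ℕ} {x y : Fin n → ℝ} (h : ∀ j, upperSum x j = upperSum y j) : x = y := by
  funext i
  have h1 := upperSum_sub x i.succ
  rw [h, h, upperSum_sub] at h1
  exact h1.symm

theorem upperSum_succ_le {n : ℕ} {x : Fin n → ℝ} (hx : x ∈ Simplex n) (j : ℕ) :
    upperSum x (j + 1) ≤ upperSum x j := by
  refine Finset.sum_le_sum fun i _ => ?_
  have := bary_nonneg ⟨x, hx⟩ i
  split_ifs <;> first | omega | linarith

theorem upperSum_antitone {n : ℕ} {x : Fin n → ℝ} (hx : x ∈ Simplex n) : Antitone (upperSum x) :=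
  antitone_nat_of_succ_le (upperSum_succ_le hx)

theorem upperSum_mem {n : ℕ} {x : Fin n → ℝ} (hx : x ∈ Simplex n) (j : ℕ) :
    upperSum x j ∈ Icc (0 : ℝ) 1 := by
  have h1 := upperSum_antitone hx (Nat.zero_le j)
  rw [upperSum_zero] at h1
  refine ⟨Finset.sum_nonneg fun i _ => ?_, h1⟩
  have := bary_nonneg ⟨x, hx⟩ i
  split_ifs <;> linarith

/-- The point of `ℝⁿ` with given coordinates `t_1, …, t_n`. -/
def ofUpper (n : ℕ) (g : ℕ → ℝ) : Fin n → ℝ := fun i => g (i + 1) - g (i + 2)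

theorem bary_ofUpper {n : ℕ} {g : ℕ → ℝ} (h0 : g 0 = 1) (h1 : g (n + 1) = 0) (i : Fin (n + 1)) :
    bary (ofUpper n g) i = g i - g (i + 1) := by
  refine Fin.cases ?_ (fun i => ?_) i
  · have := sum_telescope (n := n) (fun i => g (i + 1)) (Nat.zero_le n)
    simp only [Nat.zero_le, if_true, h1, sub_zero, zero_add] at this
    simp only [bary, ofUpper, Fin.cons_zero, Fin.val_zero, zero_add, h0]
    rw [← this]
  · simp [bary, ofUpper]

theorem upperSum_ofUpper {n : ℕ} {g : ℕ → ℝ} (h0 : g 0 = 1) (h1 : g (n + 1) = 0) {j : ℕ}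
    (hj : j ≤ n + 1) : upperSum (ofUpper n g) j = g j := by
  rw [upperSum]
  simp only [bary_ofUpper h0 h1]
  rw [sum_telescope (n := n + 1) g hj, h1, sub_zero]

theorem ofUpper_mem {n : ℕ} {g : ℕ → ℝ} (h0 : g 0 = 1) (h1 : g (n + 1) = 0) (hg : Antitone g) :
    ofUpper n g ∈ Simplex n := by
  have h : ∀ i, 0 ≤ bary (ofUpper n g) i := fun i => by
    rw [bary_ofUpper h0 h1]
    exact sub_nonneg.2 (hg (Nat.le_succ _))
  refine ⟨fun i => h i.succ, ?_⟩
  have := h 0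
  simpa [bary] using this

theorem upperSum_affineFun_eq {k n : ℕ} (θ : Fin (k + 1) →o Fin (n + 1)) (j : ℕ) (x : Fin k → ℝ) :
    upperSum (affineFun θ x) j = ∑ i, if j ≤ (θ i : ℕ) then bary x i else 0 := by
  simp only [upperSum, bary_affineFun]
  rw [← Finset.sum_fiberwise (s := Finset.univ) (g := θ)]
  refine Finset.sum_congr rfl fun l _ => ?_
  split_ifs with hl
  · refine Finset.sum_congr rfl fun i hi => ?_
    rw [(Finset.mem_filter.1 hi).2, if_pos hl]
  · refine (Finset.sum_eq_zero fun i hi => ?_).symm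
    rw [(Finset.mem_filter.1 hi).2, if_neg hl]

/-- Every coordinate `t_j` of the image of a point under a simplicial map is a coordinate of the point. -/
theorem upperSum_affineFun {k n : ℕ} (θ : Fin (k + 1) →o Fin (n + 1)) (j : ℕ) :
    ∃ l ≤ k + 1, ∀ x : Fin k → ℝ, upperSum (affineFun θ x) j = upperSum x l := by
  classical
  refine ⟨(Finset.univ.filter fun i => (θ i : ℕ) < j).card,
    (Finset.card_filter_le _ _).trans (by simp), fun x => ?_⟩
  have h1 : ∀ i : Fin (k + 1), (Finset.univ.filter fun i => (θ i : ℕ) < j).card ≤ (i : ℕ) ↔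
      j ≤ θ i := by
    intro i
    constructor
    · intro h
      by_contra hlt
      have hsub : Finset.Iic i ⊆ Finset.univ.filter fun i => (θ i : ℕ) < j := fun l hl => by
        have h2 : (θ l : ℕ) ≤ θ i := θ.monotone (Finset.mem_Iic.1 hl)
        simp
        omega
      have := Finset.card_le_card hsub
      rw [Fin.card_Iic] at this
      omega
    · intro h
      have hsub : (Finset.univ.filter fun i => (θ i : ℕ) < j) ⊆ Finset.Iio i := fun l hl => by
        rw [Finset.mem_Iio]
        by_contra hil
        have h2 : (θ i : ℕ) ≤ θ l := θ.monotone (not_lt.1 hil)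
        have := (Finset.mem_filter.1 hl).2
        omega
      have := Finset.card_le_card hsub
      rwa [Fin.card_Iio] at this
  rw [upperSum_affineFun_eq]
  simp only [upperSum, h1]

/-- The self-map of the simplex which applies `ψ` to all the coordinates `t_j`. For a function `ψ`
which preserves `0` and `1`, it is natural with respect to the simplicial maps. -/
def reparam (ψ : ℝ → ℝ) {n : ℕ} (x : Fin n → ℝ) : Fin n → ℝ := ofUpper n fun j => ψ (upperSum x j)

/-- A smooth monotone reparametrization of the unit interval. -/
structure IsReparam (ψ : ℝ → ℝ) : Prop where
  smooth : ContDiff ℝ ∞ ψ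
  mono : Monotone ψ
  zero : ψ 0 = 0
  one : ψ 1 = 1

variable {ψ : ℝ → ℝ}

theorem upperSum_reparam (hψ : IsReparam ψ) {n : ℕ} (x : Fin n → ℝ) (j : ℕ) :
    upperSum (reparam ψ x) j = ψ (upperSum x j) := by
  rcases le_or_gt j (n + 1) with hj | hj
  · refine upperSum_ofUpper ?_ ?_ hj
    · rw [upperSum_zero, hψ.one]
    · rw [upperSum_of_lt x (Nat.lt_succ_self n), hψ.zero]
  · rw [upperSum_of_lt _ (by omega), upperSum_of_lt _ (by omega), hψ.zero]

theorem reparam_mem (hψ : IsReparam ψ) {n : ℕ} {x : Fin n → ℝ} (hx : x ∈ Simplex n) :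
    reparam ψ x ∈ Simplex n := by
  refine ofUpper_mem ?_ ?_ (hψ.mono.comp_antitone (upperSum_antitone hx))
  · rw [upperSum_zero, hψ.one]
  · rw [upperSum_of_lt x (Nat.lt_succ_self n), hψ.zero]

theorem reparam_affineFun (hψ : IsReparam ψ) {k n : ℕ} (θ : Fin (k + 1) →o Fin (n + 1))
    (x : Fin k → ℝ) : reparam ψ (affineFun θ x) = affineFun θ (reparam ψ x) := by
  refine upperSum_ext fun j => ?_
  obtain ⟨l, -, h⟩ := upperSum_affineFun θ j
  rw [upperSum_reparam hψ, h, h, upperSum_reparam hψ]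

theorem contDiff_upperSum (n j : ℕ) : ContDiff ℝ ∞ (fun x : Fin n → ℝ => upperSum x j) := by
  refine ContDiff.sum fun i _ => ?_
  split_ifs
  · exact contDiff_pi.1 (contDiff_bary n) i
  · exact contDiff_const

theorem contDiff_reparam (hψ : IsReparam ψ) (n : ℕ) :
    ContDiff ℝ ∞ (reparam ψ : (Fin n → ℝ) → Fin n → ℝ) :=
  contDiff_pi.2 fun _ => (hψ.smooth.comp (contDiff_upperSum n _)).sub
    (hψ.smooth.comp (contDiff_upperSum n _))

theorem bary_convex {n : ℕ} (s t : ℝ) (hst : s + t = 1) (x y : Fin n → ℝ) (i : Fin (n + 1)) :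
    bary (s • x + t • y) i = s * bary x i + t * bary y i := by
  refine Fin.cases ?_ (fun i => ?_) i
  · simp only [bary, Fin.cons_zero, Pi.add_apply, Pi.smul_apply, smul_eq_mul,
      Finset.sum_add_distrib, ← Finset.mul_sum]
    linear_combination -hst
  · simp [bary]

theorem affineFun_convex {k n : ℕ} (θ : Fin (k + 1) →o Fin (n + 1)) (s t : ℝ) (hst : s + t = 1)
    (x y : Fin k → ℝ) :
    affineFun θ (s • x + t • y) = s • affineFun θ x + t • affineFun θ y := by
  funext j
  simp only [affineFun, bary_convex s t hst, Finset.sum_add_distrib, ← Finset.mul_sum,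
    Pi.add_apply, Pi.smul_apply, smul_eq_mul]

/-- The homotopy from the identity of the simplex to a reparametrization. -/
def reparamHomotopy (ψ : ℝ → ℝ) {n : ℕ} (z : Fin (n + 1) → ℝ) : Fin n → ℝ :=
  (1 - z 0) • Fin.tail z + z 0 • reparam ψ (Fin.tail z)

theorem contDiff_reparamHomotopy (hψ : IsReparam ψ) (n : ℕ) :
    ContDiff ℝ ∞ (reparamHomotopy ψ : (Fin (n + 1) → ℝ) → Fin n → ℝ) := by
  have h0 : ContDiff ℝ ∞ (fun z : Fin (n + 1) → ℝ => z 0) := contDiff_apply ℝ ℝ (0 : Fin (n + 1))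
  exact ((contDiff_const.sub h0).smul (contDiff_tail n)).add
    (h0.smul ((contDiff_reparam hψ n).comp (contDiff_tail n)))

theorem reparamHomotopy_mem (hψ : IsReparam ψ) {n : ℕ} {z : Fin (n + 1) → ℝ} (hz : z ∈ Prism n) :
    reparamHomotopy ψ z ∈ Simplex n :=
  convex_simplex n hz.2 (reparam_mem hψ hz.2) (sub_nonneg.2 hz.1.2) hz.1.1 (by ring)

theorem reparamHomotopy_prismMap (hψ : IsReparam ψ) {k n : ℕ} (θ : Fin (k + 1) →o Fin (n + 1))
    (z : Fin (k + 1) → ℝ) :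
    reparamHomotopy ψ (prismMap (affineFun θ) z) = affineFun θ (reparamHomotopy ψ z) := by
  simp only [reparamHomotopy, prismMap, Fin.cons_zero, Fin.tail_cons]
  rw [affineFun_convex θ _ _ (by ring), reparam_affineFun hψ]

variable {X : SmoothSSet.{v}} {m p q : ℕ}

theorem IsClosedSimplicialForm.reparam (hψ : IsReparam ψ)
    {α : ∀ {n : ℕ}, X.obj n → (Fin n → ℝ) → (Fin n → ℝ) [⋀^Fin m]→L[ℝ] ℝ}
    (h : IsClosedSimplicialForm α) :
    IsClosedSimplicialForm (X := X) (m := m) fun x => pullForm (ChernWeil.reparam ψ) (α x) where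
  closed x := (h.closed x).pullForm (contDiff_reparam hψ _) fun _ => reparam_mem hψ
  compat θ y z hz := by
    rw [pullForm_congr _ (h.compat θ y (reparam_mem hψ hz)),
      ← pullForm_comp (differentiable_affineFun _) ((contDiff_reparam hψ _).differentiable (by simp)),
      ← pullForm_comp ((contDiff_reparam hψ _).differentiable (by simp)) (differentiable_affineFun _)]
    simp only [reparam_affineFun hψ]

theorem IsClosedSimplicialForm.homotopy (hψ : IsReparam ψ)
    {α : ∀ {n : ℕ}, X.obj n → (Fin n → ℝ) → (Fin n → ℝ) [⋀^Fin m]→L[ℝ] ℝ}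
    (h : IsClosedSimplicialForm α) :
    IsClosedPrismForm (X := X) (m := m) fun x => pullForm (reparamHomotopy ψ) (α x) where
  closed x := (h.closed x).pullForm (contDiff_reparamHomotopy hψ _) fun _ => reparamHomotopy_mem hψ
  compat θ y z hz := by
    have hd : ∀ n, Differentiable ℝ (reparamHomotopy ψ : (Fin (n + 1) → ℝ) → Fin n → ℝ) :=
      fun n => (contDiff_reparamHomotopy hψ n).differentiable (by simp)
    rw [pullForm_congr _ (h.compat θ y (reparamHomotopy_mem hψ hz)),
      ← pullForm_comp (differentiable_affineFun _) (hd _),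
      ← pullForm_comp (hd _) (differentiable_prismMap (contDiff_affineFun _))]
    simp only [reparamHomotopy_prismMap hψ]

theorem IsClosedSimplicialForm.wedge (h : p + q = m)
    {α : ∀ {n : ℕ}, X.obj n → (Fin n → ℝ) → (Fin n → ℝ) [⋀^Fin p]→L[ℝ] ℝ}
    {β : ∀ {n : ℕ}, X.obj n → (Fin n → ℝ) → (Fin n → ℝ) [⋀^Fin q]→L[ℝ] ℝ}
    (hα : IsClosedSimplicialForm α) (hβ : IsClosedSimplicialForm β) :
    IsClosedSimplicialForm (X := X) (m := m) fun x y => ChernWeil.wedge h (α x y) (β x y) where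
  closed x := (hα.closed x).wedge h (hβ.closed x)
  compat θ y z hz := by
    beta_reduce
    rw [pullForm_wedge, hα.compat θ y hz, hβ.compat θ y hz]

theorem IsClosedPrismForm.wedge (h : p + q = m)
    {α : ∀ {n : ℕ}, X.obj n → (Fin (n + 1) → ℝ) → (Fin (n + 1) → ℝ) [⋀^Fin p]→L[ℝ] ℝ}
    {β : ∀ {n : ℕ}, X.obj n → (Fin (n + 1) → ℝ) → (Fin (n + 1) → ℝ) [⋀^Fin q]→L[ℝ] ℝ}
    (hα : IsClosedPrismForm α) (hβ : IsClosedPrismForm β) :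
    IsClosedPrismForm (X := X) (m := m) fun x y => ChernWeil.wedge h (α x y) (β x y) where
  closed x := (hα.closed x).wedge h (hβ.closed x)
  compat θ y z hz := by
    beta_reduce
    rw [pullForm_wedge, hα.compat θ y hz, hβ.compat θ y hz]

theorem pullForm_cons_zero_homotopy (hψ : IsReparam ψ) {n : ℕ}
    (α : (Fin n → ℝ) → (Fin n → ℝ) [⋀^Fin m]→L[ℝ] ℝ) :
    pullForm (fun x => Fin.cons 0 x) (pullForm (reparamHomotopy ψ) α) = α := by
  have hc : Differentiable ℝ (fun x : Fin n → ℝ => (Fin.cons 0 x : Fin (n + 1) → ℝ)) := by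
    simpa only [Fin.insertNth_zero'] using differentiable_insertNth (n := n) 0 0
  rw [← pullForm_comp ((contDiff_reparamHomotopy hψ _).differentiable (by simp)) hc]
  simp only [reparamHomotopy, Fin.cons_zero, Fin.tail_cons, sub_zero, one_smul, zero_smul, add_zero]
  funext x
  ext v
  rw [pullForm_apply, fderiv_fun_id]
  rfl

theorem pullForm_cons_one_homotopy (hψ : IsReparam ψ) {n : ℕ}
    (α : (Fin n → ℝ) → (Fin n → ℝ) [⋀^Fin m]→L[ℝ] ℝ) :
    pullForm (fun x => Fin.cons 1 x) (pullForm (reparamHomotopy ψ) α) =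
      pullForm (reparam ψ) α := by
  have hc : Differentiable ℝ (fun x : Fin n → ℝ => (Fin.cons 1 x : Fin (n + 1) → ℝ)) := by
    simpa only [Fin.insertNth_zero'] using differentiable_insertNth (n := n) 0 1
  rw [← pullForm_comp ((contDiff_reparamHomotopy hψ _).differentiable (by simp)) hc]
  simp only [reparamHomotopy, Fin.cons_zero, Fin.tail_cons, sub_self, one_smul, zero_smul, zero_add]

/-- Reparametrization does not change the cohomology class. -/
theorem exists_differential_reparam (hψ : IsReparam ψ)
    {α : ∀ {n : ℕ}, X.obj n → (Fin n → ℝ) → (Fin n → ℝ) [⋀^Fin m]→L[ℝ] ℝ}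
    (h : IsClosedSimplicialForm α) :
    ∃ c, differential X c = DirectSum.of (Cochain X) m
      (integralCochain (X := X) (m := m) fun x => pullForm (reparam ψ) (α x)) -
      DirectSum.of (Cochain X) m (integralCochain α) := by
  refine (h.homotopy hψ).exists_differential (fun x y _ => ?_) (fun x y _ => ?_)
  · rw [pullForm_cons_zero_homotopy hψ]
  · rw [pullForm_cons_one_homotopy hψ]

/-- Reparametrizing the two factors of a wedge product independently does not change its class. -/
theorem exists_differential_wedge_reparam (h : p + q = m) {ψ' : ℝ → ℝ} (hψ : IsReparam ψ)
    (hψ' : IsReparam ψ')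
    {α : ∀ {n : ℕ}, X.obj n → (Fin n → ℝ) → (Fin n → ℝ) [⋀^Fin p]→L[ℝ] ℝ}
    {β : ∀ {n : ℕ}, X.obj n → (Fin n → ℝ) → (Fin n → ℝ) [⋀^Fin q]→L[ℝ] ℝ}
    (hα : IsClosedSimplicialForm α) (hβ : IsClosedSimplicialForm β) :
    ∃ c, differential X c = DirectSum.of (Cochain X) m
      (integralCochain (X := X) (m := m) fun x y =>
        wedge h (pullForm (reparam ψ) (α x) y) (pullForm (reparam ψ') (β x) y)) -
      DirectSum.of (Cochain X) m (integralCochain (X := X) (m := m) fun x y =>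
        wedge h (α x y) (β x y)) := by
  refine ((hα.homotopy hψ).wedge h (hβ.homotopy hψ')).exists_differential
    (fun x y _ => ?_) (fun x y _ => ?_)
  · rw [pullForm_wedge, pullForm_cons_zero_homotopy hψ, pullForm_cons_zero_homotopy hψ']
  · rw [pullForm_wedge, pullForm_cons_one_homotopy hψ, pullForm_cons_one_homotopy hψ']

/-! #### The wedge product on vectors for which only one splitting contributes -/

section Wedge

variable {V : Type*} [NormedAddCommGroup V] [NormedSpace ℝ V] [FiniteDimensional ℝ V]

/-- The wedge product vanishes on `v` if no splitting of the vectors contributes. -/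
theorem wedge_eq_zero (h : p + q = m) {a : V [⋀^Fin p]→L[ℝ] ℝ} {b : V [⋀^Fin q]→L[ℝ] ℝ}
    {v : Fin m → V} (hv : ∀ η : Equiv.Perm (Fin m),
      a (fun i => v (η (splitIndex h (Sum.inl i)))) = 0 ∨
        b (fun i => v (η (splitIndex h (Sum.inr i)))) = 0) : wedge h a b v = 0 := by
  rw [wedge_apply, altSum, Finset.sum_eq_zero, mul_zero]
  intro η _
  refine mul_eq_zero_of_right _ ?_
  rcases hv η with h1 | h1
  · exact mul_eq_zero_of_left h1 _
  · exact mul_eq_zero_of_right _ h1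

/-- If `α` vanishes as soon as one of its arguments is among the last vectors, only the permutations
which preserve the splitting contribute to the wedge product. -/
theorem wedge_eq_mul (h : p + q = m) {a : V [⋀^Fin p]→L[ℝ] ℝ} {b : V [⋀^Fin q]→L[ℝ] ℝ}
    {v : Fin m → V} (hv : ∀ (w : Fin p → Fin m) (i : Fin p), p ≤ (w i : ℕ) → a (v ∘ w) = 0) :
    wedge h a b v = a (fun i => v (splitIndex h (Sum.inl i))) *
      b (fun i => v (splitIndex h (Sum.inr i))) := by
  classical
  set e := splitIndex h with he
  have hinj : Function.Injective (blockPerm e) := by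
    rintro ⟨σ, τ⟩ ⟨σ', τ'⟩ hπ
    have h1 : ∀ s, blockPerm e (σ, τ) (e s) = blockPerm e (σ', τ') (e s) := fun s => by rw [hπ]
    refine Prod.ext (Equiv.ext fun i => ?_) (Equiv.ext fun i => ?_)
    · have := h1 (Sum.inl i)
      rw [blockPerm_inl, blockPerm_inl] at this
      exact Sum.inl_injective (e.injective this)
    · have := h1 (Sum.inr i)
      rw [blockPerm_inr, blockPerm_inr] at this
      exact Sum.inr_injective (e.injective this)
  have hrange : ∀ η : Equiv.Perm (Fin m), η ∉ Finset.univ.map ⟨blockPerm e, hinj⟩ →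
      a (fun i => v (η (e (Sum.inl i)))) = 0 := by
    intro η hη
    by_contra hne
    have h1 : ∀ i, (η (e (Sum.inl i)) : ℕ) < p := fun i => by
      by_contra hi
      exact hne (hv (fun i => η (e (Sum.inl i))) i (not_lt.1 hi))
    have h2 : MapsTo (e.permCongr.symm η) (range Sum.inl) (range Sum.inl) := by
      rintro _ ⟨i, rfl⟩
      refine ⟨⟨_, h1 i⟩, ?_⟩
      rw [Equiv.permCongr_symm_apply, Equiv.eq_symm_apply]
      ext
      exact splitIndex_inl h _
    obtain ⟨π, hπ⟩ := Equiv.Perm.mem_sumCongrHom_range_of_perm_mapsTo_inl h2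
    refine hη (Finset.mem_map.2 ⟨π, Finset.mem_univ _, ?_⟩)
    have : η = e.permCongr (Equiv.Perm.sumCongrHom _ _ π) := by
      rw [hπ, Equiv.apply_symm_apply]
    rw [this]
    rfl
  rw [wedge_apply, ← he, altSum, ← Finset.sum_subset (Finset.subset_univ
    (Finset.univ.map ⟨blockPerm e, hinj⟩)), Finset.sum_map]
  · have hterm : ∀ π : Equiv.Perm (Fin p) × Equiv.Perm (Fin q),
        ((Equiv.Perm.sign (blockPerm e π) : ℤ) : ℝ) * blockMul e a b (v ∘ blockPerm e π) =
        a (fun i => v (e (Sum.inl i))) * b (fun i => v (e (Sum.inr i))) := by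
      intro π
      have ha := a.toAlternatingMap.map_perm (fun i => v (e (Sum.inl i))) π.1
      have hb := b.toAlternatingMap.map_perm (fun i => v (e (Sum.inr i))) π.2
      have ha' : a (fun i => v (e (Sum.inl (π.1 i)))) =
          ((Equiv.Perm.sign π.1 : ℤ) : ℝ) * a (fun i => v (e (Sum.inl i))) := by
        refine Eq.trans ha ?_
        rw [Units.smul_def, zsmul_eq_mul]
        rfl
      have hb' : b (fun i => v (e (Sum.inr (π.2 i)))) =
          ((Equiv.Perm.sign π.2 : ℤ) : ℝ) * b (fun i => v (e (Sum.inr i))) := by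
        refine Eq.trans hb ?_
        rw [Units.smul_def, zsmul_eq_mul]
        rfl
      simp only [blockMul, Function.comp_apply, blockPerm_inl, blockPerm_inr]
      rw [sign_blockPerm, ha', hb']
      have h1 : ((Equiv.Perm.sign π.1 : ℤ) : ℝ) * (Equiv.Perm.sign π.1 : ℤ) = 1 := by
        rcases Int.units_eq_one_or (Equiv.Perm.sign π.1) with h | h <;> simp [h]
      have h2 : ((Equiv.Perm.sign π.2 : ℤ) : ℝ) * (Equiv.Perm.sign π.2 : ℤ) = 1 := by
        rcases Int.units_eq_one_or (Equiv.Perm.sign π.2) with h | h <;> simp [h]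
      push_cast
      linear_combination (a (fun i => v (e (Sum.inl i))) * b (fun i => v (e (Sum.inr i)))) *
        ((Equiv.Perm.sign π.2 : ℤ) * (Equiv.Perm.sign π.2 : ℤ) * h1 + h2)
    simp only [Function.Embedding.coeFn_mk, hterm, Finset.sum_const, Finset.card_univ,
      Fintype.card_prod, Fintype.card_perm, Fintype.card_fin, nsmul_eq_mul]
    push_cast
    rw [inv_mul_cancel_left₀ (by positivity)]
  · intro η _ hη
    refine mul_eq_zero_of_right _ (mul_eq_zero_of_left (hrange η hη) _)

end Wedge

end Multiplicativity

/-! #### Cup products of integrals -/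

section Cup

open MeasureTheory SimplexMap

universe v

/-- The linear isomorphism from the coordinates `t_j` to the coordinates `x_i`. -/
def ofTailSums (n : ℕ) : (Fin n → ℝ) ≃L[ℝ] Fin n → ℝ :=
  ((tailSums n).toContinuousLinearEquivOfDetNeZero (by rw [det_tailSums]; exact one_ne_zero)).symm

theorem tailSums_ofTailSums {n : ℕ} (t : Fin n → ℝ) : tailSums n (ofTailSums n t) = t :=
  ((tailSums n).toContinuousLinearEquivOfDetNeZero
    (by rw [det_tailSums]; exact one_ne_zero)).apply_symm_apply t

theorem ofTailSums_tailSums {n : ℕ} (x : Fin n → ℝ) : ofTailSums n (tailSums n x) = x :=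
  ((tailSums n).toContinuousLinearEquivOfDetNeZero
    (by rw [det_tailSums]; exact one_ne_zero)).symm_apply_apply x

theorem tailSums_injective (n : ℕ) : Function.Injective (tailSums n) :=
  Function.LeftInverse.injective ofTailSums_tailSums

theorem det_ofTailSums (n : ℕ) :
    ((ofTailSums n : (Fin n → ℝ) →L[ℝ] Fin n → ℝ)).det = 1 := by
  have h1 : (tailSums n).comp (ofTailSums n : (Fin n → ℝ) →L[ℝ] Fin n → ℝ) =
      ContinuousLinearMap.id ℝ _ := by
    ext1 t
    exact tailSums_ofTailSums t
  have h2 := congrArg ContinuousLinearMap.det h1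
  rw [ContinuousLinearMap.det, ContinuousLinearMap.toLinearMap_comp, LinearMap.det_comp] at h2
  have h3 := det_tailSums n
  rw [ContinuousLinearMap.det] at h3 ⊢
  rw [h3, one_mul] at h2
  rw [h2]
  simp [ContinuousLinearMap.det]

theorem upperSum_ofTailSums {n : ℕ} (t : Fin n → ℝ) (j : Fin n) :
    upperSum (ofTailSums n t) (j + 1) = t j := by
  rw [← tailSums_eq, tailSums_ofTailSums]

/-- The simplex in the coordinates `t_j`. -/
def TailSimplex (n : ℕ) : Set (Fin n → ℝ) := {t | ofTailSums n t ∈ Simplex n}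

/-- In the coordinates `t_j`, the simplex is `1 ≥ t_0 ≥ t_1 ≥ ⋯ ≥ 0`. -/
theorem mem_tailSimplex {n : ℕ} {t : Fin n → ℝ} :
    t ∈ TailSimplex n ↔ Antitone t ∧ ∀ i, t i ∈ Icc (0 : ℝ) 1 := by
  constructor
  · intro h
    constructor
    · intro i j hij
      rw [← upperSum_ofTailSums t i, ← upperSum_ofTailSums t j]
      exact upperSum_antitone h (by have : (i : ℕ) ≤ j := hij; omega)
    · intro i
      rw [← upperSum_ofTailSums t i]
      exact upperSum_mem h _
  · rintro ⟨h1, h2⟩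
    have hb : ∀ i, 0 ≤ bary (ofTailSums n t) i := by
      intro i
      rw [← upperSum_sub, sub_nonneg]
      obtain ⟨i, hin⟩ := i
      simp only
      have hle : ∀ c : ℝ, 0 ≤ c → (∀ hi : i < n, t ⟨i, hi⟩ ≤ c) →
          upperSum (ofTailSums n t) (i + 1) ≤ c := fun c h0 hc => by
        rcases Nat.lt_or_ge i n with hi | hi
        · rw [upperSum_ofTailSums t ⟨i, hi⟩]
          exact hc hi
        · rwa [upperSum_of_lt _ (by omega)]
      rcases i with - | l
      · rw [upperSum_zero]
        exact hle 1 zero_le_one fun hi => (h2 _).2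
      · rw [upperSum_ofTailSums t ⟨l, by omega⟩]
        exact hle _ (h2 _).1 fun hi => h1 (by simp)
    refine ⟨fun i => hb i.succ, ?_⟩
    have := hb 0
    simpa [bary] using this

/-- The basis dual to the coordinates `t_j`. -/
def stepVec (n : ℕ) (j : Fin n) : Fin n → ℝ := ofTailSums n (unitVec n j)

theorem tailSums_stepVec {n : ℕ} (j : Fin n) : tailSums n (stepVec n j) = unitVec n j :=
  tailSums_ofTailSums _

theorem measurableSet_tailSimplex (n : ℕ) : MeasurableSet (TailSimplex n) :=
  (ofTailSums n).continuous.measurable (measurableSet_simplex n)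

/-- Integration over the simplex in the coordinates `t_j`, which are unimodular. -/
theorem integral_simplex_eq_tail {n : ℕ} (α : (Fin n → ℝ) → (Fin n → ℝ) [⋀^Fin n]→L[ℝ] ℝ) :
    ∫ x in Simplex n, α x (unitVec n) =
      ∫ t, (TailSimplex n).indicator (fun t => α (ofTailSums n t) (stepVec n)) t := by
  have h1 : ofTailSums n '' TailSimplex n = Simplex n :=
    image_preimage_eq _ (ofTailSums n).surjective
  rw [integral_indicator (measurableSet_tailSimplex n), ← h1,
    integral_pullForm (measurableSet_tailSimplex n) (ofTailSums n).differentiable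
      (ofTailSums n).injective.injOn (fun x _ => by
        rw [ContinuousLinearEquiv.fderiv, det_ofTailSums]
        exact zero_le_one)]
  refine setIntegral_congr_fun (measurableSet_tailSimplex n) fun t _ => ?_
  simp only [pullForm_apply, ContinuousLinearEquiv.fderiv]
  rfl

theorem tailSums_fderiv {k n : ℕ} {f : (Fin k → ℝ) → Fin n → ℝ} {x : Fin k → ℝ}
    (hf : DifferentiableAt ℝ f x) (v : Fin k → ℝ) (i : Fin n) :
    tailSums n (fderiv ℝ f x v) i = fderiv ℝ (fun y => tailSums n (f y) i) x v := by
  have h1 := (tailSums n).hasFDerivAt.comp x hf.hasFDerivAt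
  exact (congrArg (fun L => L v) (hasFDerivAt_pi'.1 h1 i).fderiv).symm

theorem fderiv_reparam {ψ : ℝ → ℝ} (hψ : IsReparam ψ) {n : ℕ} (x : Fin n → ℝ) (j : Fin n) :
    fderiv ℝ (reparam ψ) x (stepVec n j) = deriv ψ (tailSums n x j) • stepVec n j := by
  refine tailSums_injective n ?_
  funext i
  rw [tailSums_fderiv ((contDiff_reparam hψ n).differentiable (by simp) x)]
  have h1 : (fun y : Fin n → ℝ => tailSums n (reparam ψ y) i) = fun y => ψ (tailSums n y i) := by
    funext y
    rw [tailSums_eq, tailSums_eq, upperSum_reparam hψ]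
  have h2 := (hψ.smooth.differentiable (by simp) (tailSums n x i)).hasDerivAt.comp_hasFDerivAt x
    (hasFDerivAt_pi'.1 (tailSums n).hasFDerivAt i)
  rw [h1]
  refine (congrArg (fun L => L (stepVec n j)) h2.fderiv).trans ?_
  rw [map_smul, tailSums_stepVec]
  change deriv ψ (tailSums n x i) * tailSums n (stepVec n j) i = _
  rw [tailSums_stepVec]
  by_cases hij : i = j
  · subst hij
    rfl
  · simp [unitVec, hij]

/-- In the coordinates `t_j`, a reparametrization acts diagonally. -/
theorem pullForm_reparam {ψ : ℝ → ℝ} (hψ : IsReparam ψ) {m n : ℕ}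
    (α : (Fin n → ℝ) → (Fin n → ℝ) [⋀^Fin m]→L[ℝ] ℝ) (x : Fin n → ℝ) (w : Fin m → Fin n) :
    pullForm (reparam ψ) α x (stepVec n ∘ w) =
      (∏ i, deriv ψ (tailSums n x (w i))) * α (reparam ψ x) (stepVec n ∘ w) := by
  simp only [pullForm_apply, Function.comp_apply, fderiv_reparam hψ]
  exact (α (reparam ψ x)).toAlternatingMap.toMultilinearMap.map_smul_univ _ _

theorem upperSum_front {p n : ℕ} (h : 0 + p ≤ n) (y : Fin p → ℝ) (j : ℕ) :
    upperSum (affineFun (Cochain.incl 0 p n h) y) j = upperSum y j := by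
  rw [upperSum_affineFun_eq]
  simp only [Cochain.incl_apply, zero_add]
  rfl

theorem upperSum_back {p q n : ℕ} (h : p + q ≤ n) (y : Fin q → ℝ) (j : ℕ) :
    upperSum (affineFun (Cochain.incl p q n h) y) j = upperSum y (j - p) := by
  rw [upperSum_affineFun_eq]
  simp only [Cochain.incl_apply, upperSum, Nat.sub_le_iff_le_add']
  rfl

variable {p q n : ℕ}

/-- The front face in the coordinates `t_j`: the first `p` coordinates. -/
theorem fderiv_front (h : p + q = n) (h' : 0 + p ≤ n) (y : Fin p → ℝ) (i : Fin p) :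
    fderiv ℝ (affineFun (Cochain.incl 0 p n h')) y (stepVec p i) =
      stepVec n (splitIndex h (Sum.inl i)) := by
  refine tailSums_injective n ?_
  funext l
  rw [tailSums_fderiv (differentiable_affineFun _ y), tailSums_stepVec]
  simp only [tailSums_eq, upperSum_front]
  rcases Nat.lt_or_ge l p with hl | hl
  · have h1 : (fun y : Fin p → ℝ => upperSum y (l + 1)) = fun y => tailSums p y ⟨l, hl⟩ := by
      funext y
      rw [tailSums_eq]
    rw [h1, (hasFDerivAt_pi'.1 (tailSums p).hasFDerivAt ⟨l, hl⟩).fderiv]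
    change tailSums p (stepVec p i) ⟨l, hl⟩ = _
    rw [tailSums_stepVec]
    simp [unitVec, Pi.single_apply, Fin.ext_iff, splitIndex_inl]
  · have h1 : (fun y : Fin p → ℝ => upperSum y (l + 1)) = fun _ => 0 := by
      funext y
      exact upperSum_of_lt _ (by omega)
    rw [h1, fderiv_fun_const]
    have : l ≠ splitIndex h (Sum.inl i) := fun hli => by
      have := splitIndex_inl h i
      rw [← hli] at this
      omega
    simp [unitVec, this]

/-- The back face in the coordinates `t_j`: the last `q` coordinates. -/
theorem fderiv_back (h : p + q = n) (h' : p + q ≤ n) (y : Fin q → ℝ) (i : Fin q) :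
    fderiv ℝ (affineFun (Cochain.incl p q n h')) y (stepVec q i) =
      stepVec n (splitIndex h (Sum.inr i)) := by
  refine tailSums_injective n ?_
  funext l
  rw [tailSums_fderiv (differentiable_affineFun _ y), tailSums_stepVec]
  simp only [tailSums_eq, upperSum_back]
  rcases Nat.lt_or_ge l p with hl | hl
  · have h1 : (fun y : Fin q → ℝ => upperSum y (l + 1 - p)) = fun _ => 1 := by
      funext y
      rw [Nat.sub_eq_zero_of_le (by omega), upperSum_zero]
    rw [h1, fderiv_fun_const]
    have : l ≠ splitIndex h (Sum.inr i) := fun hli => by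
      have := splitIndex_inr h i
      rw [← hli] at this
      omega
    simp [unitVec, this]
  · have h1 : (fun y : Fin q → ℝ => upperSum y (l + 1 - p)) =
        fun y => tailSums q y ⟨l - p, by omega⟩ := by
      funext y
      rw [tailSums_eq]
      congr 1
      simp only
      omega
    rw [h1, (hasFDerivAt_pi'.1 (tailSums q).hasFDerivAt ⟨l - p, by omega⟩).fderiv]
    change tailSums q (stepVec q i) ⟨l - p, by omega⟩ = _
    rw [tailSums_stepVec]
    simp only [unitVec, Pi.single_apply, Fin.ext_iff, splitIndex_inr]
    congr 1
    simp only [eq_iff_iff]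
    omega

/-- The top form `ζ`, in the coordinates `t_j`, extended by zero outside the simplex. -/
def tailDensity (ζ : (Fin n → ℝ) → (Fin n → ℝ) [⋀^Fin n]→L[ℝ] ℝ) : (Fin n → ℝ) → ℝ :=
  (TailSimplex n).indicator fun t => ζ (ofTailSums n t) (stepVec n)

/-- After the reparametrizations, the density of the wedge product in the coordinates `t_j` is a product
of functions of the first `p` and of the last `q` coordinates. Indeed `d (ψ t_j)` vanishes for
`t_j ≤ 1 / 2` and `d (ψ' t_j)` for `t_j ≥ 1 / 2`, so that only the points with
`t_0, …, t_{p-1} > 1 / 2 > t_p, …, t_{n-1}` contribute. There the reparametrized point lies on the front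
face for `ψ`, and on the back face for `ψ'`. -/
theorem tailDensity_wedge (h : p + q = n) {ψ ψ' : ℝ → ℝ} (hψ : IsReparam ψ) (hψ' : IsReparam ψ')
    (hψ0 : ∀ t ≤ 1 / 2, ψ t = 0 ∧ deriv ψ t = 0) (hψ1 : ∀ t, 1 / 2 ≤ t → ψ' t = 1 ∧ deriv ψ' t = 0)
    (α : (Fin n → ℝ) → (Fin n → ℝ) [⋀^Fin p]→L[ℝ] ℝ)
    (β : (Fin n → ℝ) → (Fin n → ℝ) [⋀^Fin q]→L[ℝ] ℝ) (t : Fin n → ℝ) :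
    tailDensity (fun y => wedge h (pullForm (reparam ψ) α y) (pullForm (reparam ψ') β y)) t =
      tailDensity (pullForm (reparam ψ)
        (pullForm (affineFun (Cochain.incl 0 p n (by omega))) α))
        (fun i => t (splitIndex h (Sum.inl i))) *
      tailDensity (pullForm (reparam ψ')
        (pullForm (affineFun (Cochain.incl p q n (by omega))) β))
        (fun i => t (splitIndex h (Sum.inr i))) := by
  have hA : ∀ w : Fin p → Fin n, pullForm (reparam ψ) α (ofTailSums n t) (stepVec n ∘ w) ≠ 0 →
      ∀ i, 1 / 2 < t (w i) := by
    intro w hw i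
    by_contra hi
    refine hw ?_
    rw [pullForm_reparam hψ, Finset.prod_eq_zero (Finset.mem_univ i), zero_mul]
    rw [tailSums_ofTailSums]
    exact (hψ0 _ (not_lt.1 hi)).2
  have hB : ∀ w : Fin q → Fin n, pullForm (reparam ψ') β (ofTailSums n t) (stepVec n ∘ w) ≠ 0 →
      ∀ i, t (w i) < 1 / 2 := by
    intro w hw i
    by_contra hi
    refine hw ?_
    rw [pullForm_reparam hψ', Finset.prod_eq_zero (Finset.mem_univ i), zero_mul]
    rw [tailSums_ofTailSums]
    exact (hψ1 _ (not_lt.1 hi)).2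
  have hA' : ∀ s : Fin p → ℝ, tailDensity (pullForm (reparam ψ)
        (pullForm (affineFun (Cochain.incl 0 p n (by omega))) α)) s ≠ 0 →
      s ∈ TailSimplex p ∧ ∀ i, 1 / 2 < s i := by
    intro s hs
    refine ⟨mem_of_indicator_ne_zero hs, fun i => ?_⟩
    by_contra hi
    refine hs (indicator_apply_eq_zero.2 fun _ => ?_)
    refine (pullForm_reparam hψ _ _ id).trans ?_
    rw [Finset.prod_eq_zero (Finset.mem_univ i), zero_mul]
    rw [tailSums_ofTailSums]
    exact (hψ0 _ (not_lt.1 hi)).2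
  have hB' : ∀ s : Fin q → ℝ, tailDensity (pullForm (reparam ψ')
        (pullForm (affineFun (Cochain.incl p q n (by omega))) β)) s ≠ 0 →
      s ∈ TailSimplex q ∧ ∀ i, s i < 1 / 2 := by
    intro s hs
    refine ⟨mem_of_indicator_ne_zero hs, fun i => ?_⟩
    by_contra hi
    refine hs (indicator_apply_eq_zero.2 fun _ => ?_)
    refine (pullForm_reparam hψ' _ _ id).trans ?_
    rw [Finset.prod_eq_zero (Finset.mem_univ i), zero_mul]
    rw [tailSums_ofTailSums]
    exact (hψ1 _ (not_lt.1 hi)).2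
  have hsplit : ∀ l : Fin n, (∃ i : Fin p, l = splitIndex h (Sum.inl i)) ∨
      ∃ i : Fin q, l = splitIndex h (Sum.inr i) := by
    intro l
    obtain ⟨s, rfl⟩ := (splitIndex h).surjective l
    rcases s with i | i
    exacts [Or.inl ⟨i, rfl⟩, Or.inr ⟨i, rfl⟩]
  by_cases hgood : t ∈ TailSimplex n ∧ (∀ i : Fin p, 1 / 2 < t (splitIndex h (Sum.inl i))) ∧
      ∀ i : Fin q, t (splitIndex h (Sum.inr i)) < 1 / 2
  · obtain ⟨htn, h1, h2⟩ := hgood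
    obtain ⟨hanti, h01⟩ := mem_tailSimplex.1 htn
    have htp : (fun i => t (splitIndex h (Sum.inl i))) ∈ TailSimplex p :=
      mem_tailSimplex.2 ⟨fun i j hij => hanti (by
        rw [Fin.le_def, splitIndex_inl, splitIndex_inl]; exact hij), fun i => h01 _⟩
    have htq : (fun i => t (splitIndex h (Sum.inr i))) ∈ TailSimplex q :=
      mem_tailSimplex.2 ⟨fun i j hij => hanti (by
        rw [Fin.le_def, splitIndex_inr, splitIndex_inr]
        exact Nat.add_le_add_left hij _), fun i => h01 _⟩
    have hupper : ∀ j, j < n → ∀ l : Fin n, (l : ℕ) = j →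
        upperSum (ofTailSums n t) (j + 1) = t l := by
      rintro j hj l rfl
      exact upperSum_ofTailSums t l
    -- on the part of the simplex which contributes, the reparametrizations factor over the
    -- front and the back face
    have hfront : reparam ψ (ofTailSums n t) = affineFun (Cochain.incl 0 p n (by omega))
        (reparam ψ (ofTailSums p fun i => t (splitIndex h (Sum.inl i)))) := by
      refine upperSum_ext fun j => ?_
      rw [upperSum_front, upperSum_reparam hψ, upperSum_reparam hψ]
      rcases j with - | j
      · rw [upperSum_zero, upperSum_zero]
      · rcases Nat.lt_or_ge j p with hj | hj
        · rw [upperSum_ofTailSums (fun i => t (splitIndex h (Sum.inl i))) ⟨j, hj⟩]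
          rw [hupper j (by omega) _ (splitIndex_inl h ⟨j, hj⟩)]
        · rw [upperSum_of_lt (n := p) _ (by omega), hψ.zero]
          rcases Nat.lt_or_ge j n with hjn | hjn
          · refine (hψ0 _ ?_).1
            rw [hupper j hjn _ (show (splitIndex h (Sum.inr ⟨j - p, by omega⟩) : ℕ) = j by
              rw [splitIndex_inr]; simp only; omega)]
            exact (h2 _).le
          · rw [upperSum_of_lt _ (by omega), hψ.zero]
    have hback : reparam ψ' (ofTailSums n t) = affineFun (Cochain.incl p q n (by omega))
        (reparam ψ' (ofTailSums q fun i => t (splitIndex h (Sum.inr i)))) := by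
      refine upperSum_ext fun j => ?_
      rw [upperSum_back, upperSum_reparam hψ', upperSum_reparam hψ']
      rcases j with - | j
      · rw [Nat.zero_sub, upperSum_zero, upperSum_zero]
      · rcases Nat.lt_or_ge j p with hj | hj
        · rw [Nat.sub_eq_zero_of_le (by omega), upperSum_zero, hψ'.one]
          refine (hψ1 _ ?_).1
          rw [hupper j (by omega) _ (splitIndex_inl h ⟨j, hj⟩)]
          exact (h1 _).le
        · rcases Nat.lt_or_ge j n with hjn | hjn
          · rw [hupper j hjn _ (show (splitIndex h (Sum.inr ⟨j - p, by omega⟩) : ℕ) = j by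
              rw [splitIndex_inr]; simp only; omega)]
            rw [show j + 1 - p = (⟨j - p, by omega⟩ : Fin q) + 1 by simp only; omega,
              upperSum_ofTailSums (fun i => t (splitIndex h (Sum.inr i))) ⟨j - p, by omega⟩]
          · rw [upperSum_of_lt _ (by omega), upperSum_of_lt _ (by omega)]
    rw [tailDensity, indicator_of_mem htn, tailDensity, indicator_of_mem htp, tailDensity,
      indicator_of_mem htq]
    rw [wedge_eq_mul h (fun w i hi => by
      by_contra hne
      have h3 := hA w hne i
      rcases hsplit (w i) with ⟨l, hl⟩ | ⟨l, hl⟩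
      · rw [hl, splitIndex_inl] at hi
        have := l.2
        omega
      · rw [hl] at h3
        exact absurd (h2 l) (not_lt.2 h3.le))]
    congr 1
    · refine (pullForm_reparam hψ α (ofTailSums n t)
        (fun i => splitIndex h (Sum.inl i))).trans ?_
      refine Eq.trans ?_ (pullForm_reparam hψ _ _ id).symm
      simp only [tailSums_ofTailSums, id, Function.comp_id, pullForm_apply,
        fderiv_front h, ← hfront]
      rfl
    · refine (pullForm_reparam hψ' β (ofTailSums n t)
        (fun i => splitIndex h (Sum.inr i))).trans ?_
      refine Eq.trans ?_ (pullForm_reparam hψ' _ _ id).symm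
      simp only [tailSums_ofTailSums, id, Function.comp_id, pullForm_apply,
        fderiv_back h, ← hback]
      rfl
  · -- otherwise both sides vanish
    have hr : tailDensity (pullForm (reparam ψ)
        (pullForm (affineFun (Cochain.incl 0 p n (by omega))) α))
        (fun i => t (splitIndex h (Sum.inl i))) *
      tailDensity (pullForm (reparam ψ')
        (pullForm (affineFun (Cochain.incl p q n (by omega))) β))
        (fun i => t (splitIndex h (Sum.inr i))) = 0 := by
      by_contra hne
      obtain ⟨ha, ha'⟩ := hA' _ (left_ne_zero_of_mul hne)
      obtain ⟨hb, hb'⟩ := hB' _ (right_ne_zero_of_mul hne)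
      obtain ⟨ha1, ha2⟩ := mem_tailSimplex.1 ha
      obtain ⟨hb1, hb2⟩ := mem_tailSimplex.1 hb
      refine hgood ⟨mem_tailSimplex.2 ⟨fun i j hij => ?_, fun l => ?_⟩, ha', hb'⟩
      · rw [Fin.le_def] at hij
        rcases hsplit i with ⟨i, rfl⟩ | ⟨i, rfl⟩ <;> rcases hsplit j with ⟨j, rfl⟩ | ⟨j, rfl⟩
        · rw [splitIndex_inl, splitIndex_inl] at hij
          exact ha1 hij
        · exact ((hb' j).trans (ha' i)).le
        · rw [splitIndex_inl, splitIndex_inr] at hij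
          have := j.2
          omega
        · rw [splitIndex_inr, splitIndex_inr] at hij
          exact hb1 (Nat.le_of_add_le_add_left hij)
      · rcases hsplit l with ⟨i, rfl⟩ | ⟨i, rfl⟩
        exacts [ha2 i, hb2 i]
    rw [hr]
    refine indicator_apply_eq_zero.2 fun htn => wedge_eq_zero h fun η => ?_
    by_contra hne
    rw [not_or] at hne
    have h1 := hA (fun i => η (splitIndex h (Sum.inl i))) hne.1
    have h2 := hB (fun i => η (splitIndex h (Sum.inr i))) hne.2
    obtain ⟨hanti, -⟩ := mem_tailSimplex.1 htn
    -- the indices with large coordinate form an initial segment of length `p`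
    classical
    set S : Finset (Fin n) := Finset.univ.filter fun l => 1 / 2 < t l with hS
    have hcard : S.card = p := by
      have : S = Finset.univ.map ⟨fun i : Fin p => η (splitIndex h (Sum.inl i)), fun i j hij =>
          Sum.inl_injective ((splitIndex h).injective (η.injective hij))⟩ := by
        ext l
        simp only [hS, Finset.mem_filter, Finset.mem_univ, true_and, Finset.mem_map]
        constructor
        · intro hl
          obtain ⟨l', rfl⟩ := η.surjective l
          rcases hsplit l' with ⟨i, rfl⟩ | ⟨i, rfl⟩
          · exact ⟨i, rfl⟩
          · exact absurd (h2 i) (not_lt.2 (le_of_lt hl))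
        · rintro ⟨i, rfl⟩
          exact h1 i
      rw [this, Finset.card_map, Finset.card_univ, Fintype.card_fin]
    have hlow : ∀ l ∈ S, ∀ l' ≤ l, l' ∈ S := fun l hl l' hl' =>
      Finset.mem_filter.2 ⟨Finset.mem_univ _, lt_of_lt_of_le (Finset.mem_filter.1 hl).2 (hanti hl')⟩
    have hlt : ∀ l ∈ S, (l : ℕ) < p := fun l hl => by
      have := Finset.card_le_card (fun l' hl' => hlow l hl l' (Finset.mem_Iic.1 hl') :
        Finset.Iic l ⊆ S)
      rw [Fin.card_Iic] at this
      omega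
    have hge : ∀ l : Fin n, (l : ℕ) < p → l ∈ S := fun l hl => by
      by_contra hn
      have hsub : S ⊆ Finset.Iio l := fun l' hl' => by
        rw [Finset.mem_Iio]
        by_contra hle
        exact hn (hlow l' hl' l (not_lt.1 hle))
      have := Finset.card_le_card hsub
      rw [Fin.card_Iio] at this
      omega
    refine hgood ⟨htn, fun i => (Finset.mem_filter.1 (hge _ ?_)).2, fun i => ?_⟩
    · rw [splitIndex_inl]
      exact i.2
    · obtain ⟨l', hl'⟩ := η.surjective (splitIndex h (Sum.inr i))
      rcases hsplit l' with ⟨j, rfl⟩ | ⟨j, rfl⟩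
      · have h3 := hlt (splitIndex h (Sum.inr i)) (Finset.mem_filter.2 ⟨Finset.mem_univ _, by
          rw [← hl']; exact h1 j⟩)
        rw [splitIndex_inr] at h3
        omega
      · rw [← hl']
        exact h2 j

/-- Fubini's theorem for a product of functions of the first and of the last coordinates. -/
theorem integral_splitIndex (h : p + q = n) (f : (Fin p → ℝ) → ℝ) (g : (Fin q → ℝ) → ℝ) :
    ∫ t : Fin n → ℝ, f (fun i => t (splitIndex h (Sum.inl i))) *
      g (fun i => t (splitIndex h (Sum.inr i))) = (∫ s, f s) * ∫ s, g s := by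
  have h1 := (volume_measurePreserving_piCongrLeft (fun _ : Fin n => ℝ)
    (splitIndex h)).integral_comp' (fun t : Fin n → ℝ => f (fun i => t (splitIndex h (Sum.inl i))) *
      g (fun i => t (splitIndex h (Sum.inr i))))
  have h2 := (volume_measurePreserving_sumPiEquivProdPi
    (fun _ : Fin p ⊕ Fin q => ℝ)).integral_comp' (fun s : (Fin p → ℝ) × (Fin q → ℝ) => f s.1 * g s.2)
  rw [← h1, ← integral_prod_mul]
  refine Eq.trans ?_ h2
  congr 1
  funext s
  simp [MeasurableEquiv.piCongrLeft, Equiv.piCongrLeft_apply_apply, MeasurableEquiv.sumPiEquivProdPi,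
    Equiv.sumPiEquivProdPi]

variable {X : SmoothSSet.{v}} {m : ℕ}

/-- After the reparametrizations, the integral of the wedge product is exactly the cup product
of the integrals. -/
theorem integralCochain_wedge_reparam (h : p + q = m) {ψ ψ' : ℝ → ℝ} (hψ : IsReparam ψ)
    (hψ' : IsReparam ψ') (hψ0 : ∀ t ≤ 1 / 2, ψ t = 0 ∧ deriv ψ t = 0)
    (hψ1 : ∀ t, 1 / 2 ≤ t → ψ' t = 1 ∧ deriv ψ' t = 0)
    {α : ∀ {n : ℕ}, X.obj n → (Fin n → ℝ) → (Fin n → ℝ) [⋀^Fin p]→L[ℝ] ℝ}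
    {β : ∀ {n : ℕ}, X.obj n → (Fin n → ℝ) → (Fin n → ℝ) [⋀^Fin q]→L[ℝ] ℝ}
    (hα : IsClosedSimplicialForm α) (hβ : IsClosedSimplicialForm β) :
    (integralCochain (X := X) (m := m) fun x y =>
        wedge h (pullForm (reparam ψ) (α x) y) (pullForm (reparam ψ') (β x) y)) =
      Cochain.cup h (integralCochain (X := X) (m := p) fun x => pullForm (reparam ψ) (α x))
        (integralCochain (X := X) (m := q) fun x => pullForm (reparam ψ') (β x)) := by
  funext x
  have h1 : integralCochain (X := X) (m := p) (fun x => pullForm (reparam ψ) (α x))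
      (X.res (Cochain.incl 0 p m (by omega)) x) = ∫ y in Simplex p, pullForm (reparam ψ)
        (pullForm (affineFun (Cochain.incl 0 p m (by omega))) (α x)) y (unitVec p) :=
    setIntegral_congr_fun (measurableSet_simplex p) fun y hy => by
      simp only
      rw [pullForm_congr _ (hα.compat _ x (reparam_mem hψ hy))]
  have h2 : integralCochain (X := X) (m := q) (fun x => pullForm (reparam ψ') (β x))
      (X.res (Cochain.incl p q m (by omega)) x) = ∫ y in Simplex q, pullForm (reparam ψ')
        (pullForm (affineFun (Cochain.incl p q m (by omega))) (β x)) y (unitVec q) :=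
    setIntegral_congr_fun (measurableSet_simplex q) fun y hy => by
      simp only
      rw [pullForm_congr _ (hβ.compat _ x (reparam_mem hψ' hy))]
  rw [Cochain.cup, h1, h2, integral_simplex_eq_tail, integral_simplex_eq_tail,
    ← integral_splitIndex h]
  refine (integral_simplex_eq_tail _).trans (integral_congr_ae (Eventually.of_forall fun t => ?_))
  exact tailDensity_wedge h hψ hψ' hψ0 hψ1 (α x) (β x) t

/-- The cohomology class of a closed simplicial form. -/
def IsClosedSimplicialForm.toCohomology
    {α : ∀ {n : ℕ}, X.obj n → (Fin n → ℝ) → (Fin n → ℝ) [⋀^Fin m]→L[ℝ] ℝ}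
    (h : IsClosedSimplicialForm α) : Cohomology X :=
  Ideal.Quotient.mk (coboundaries X) ⟨_, h.mem_cocycles⟩

theorem IsClosedSimplicialForm.toCohomology_eq
    {α β : ∀ {n : ℕ}, X.obj n → (Fin n → ℝ) → (Fin n → ℝ) [⋀^Fin m]→L[ℝ] ℝ}
    (hα : IsClosedSimplicialForm α) (hβ : IsClosedSimplicialForm β)
    (h : ∃ c, differential X c = DirectSum.of (Cochain X) m (integralCochain α) -
      DirectSum.of (Cochain X) m (integralCochain β)) : hα.toCohomology = hβ.toCohomology :=
  Ideal.Quotient.eq.2 h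

/-- There is a reparametrization which is constant on `[0, 1 / 2]`. -/
theorem isReparam_smoothTransition_left : ∃ ψ : ℝ → ℝ, IsReparam ψ ∧
    ∀ t ≤ 1 / 2, ψ t = 0 ∧ deriv ψ t = 0 := by
  have h0 : ∀ t ≤ (1 / 2 : ℝ), Real.smoothTransition (2 * t - 1) = 0 := fun t ht =>
    Real.smoothTransition.zero_of_nonpos (by linarith)
  refine ⟨fun t => Real.smoothTransition (2 * t - 1), ⟨?_, ?_, h0 0 (by norm_num), ?_⟩,
    fun t ht => ⟨h0 t ht, ?_⟩⟩
  · exact Real.smoothTransition.contDiff.comp (by fun_prop)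
  · exact fun a b hab => Real.smoothTransition.monotone (by linarith)
  · exact Real.smoothTransition.one_of_one_le (by norm_num)
  · refine IsLocalMin.deriv_eq_zero (Eventually.of_forall fun s => ?_)
    beta_reduce
    rw [h0 t ht]
    exact Real.smoothTransition.nonneg _

/-- There is a reparametrization which is constant on `[1 / 2, 1]`. -/
theorem isReparam_smoothTransition_right : ∃ ψ : ℝ → ℝ, IsReparam ψ ∧
    ∀ t, 1 / 2 ≤ t → ψ t = 1 ∧ deriv ψ t = 0 := by
  have h1 : ∀ t, (1 / 2 : ℝ) ≤ t → Real.smoothTransition (2 * t) = 1 := fun t ht =>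
    Real.smoothTransition.one_of_one_le (by linarith)
  refine ⟨fun t => Real.smoothTransition (2 * t), ⟨?_, ?_, ?_, h1 1 (by norm_num)⟩,
    fun t ht => ⟨h1 t ht, ?_⟩⟩
  · exact Real.smoothTransition.contDiff.comp (by fun_prop)
  · exact fun a b hab => Real.smoothTransition.monotone (by linarith)
  · exact Real.smoothTransition.zero_of_nonpos (by norm_num)
  · refine IsLocalMax.deriv_eq_zero (Eventually.of_forall fun s => ?_)
    beta_reduce
    rw [h1 t ht]
    exact Real.smoothTransition.le_one _

/-- The class of a wedge product is the cup product of the classes: up to homotopy, the first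
factor may be supposed to be supported where the `t_j` are greater than `1 / 2`, and the second one
where they are less. -/
theorem IsClosedSimplicialForm.toCohomology_wedge (h : p + q = m)
    {α : ∀ {n : ℕ}, X.obj n → (Fin n → ℝ) → (Fin n → ℝ) [⋀^Fin p]→L[ℝ] ℝ}
    {β : ∀ {n : ℕ}, X.obj n → (Fin n → ℝ) → (Fin n → ℝ) [⋀^Fin q]→L[ℝ] ℝ}
    (hα : IsClosedSimplicialForm α) (hβ : IsClosedSimplicialForm β) :
    (hα.wedge h hβ).toCohomology = hα.toCohomology * hβ.toCohomology := by
  obtain ⟨ψ, hψ, hψ0⟩ := isReparam_smoothTransition_left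
  obtain ⟨ψ', hψ', hψ1⟩ := isReparam_smoothTransition_right
  rw [← (hα.reparam hψ).toCohomology_eq hα (exists_differential_reparam hψ hα),
    ← (hβ.reparam hψ').toCohomology_eq hβ (exists_differential_reparam hψ' hβ),
    ← ((hα.reparam hψ).wedge h (hβ.reparam hψ')).toCohomology_eq (hα.wedge h hβ)
      (exists_differential_wedge_reparam h hψ hψ' hα hβ)]
  refine Eq.trans ?_ (map_mul (Ideal.Quotient.mk (coboundaries X)) _ _)
  refine congrArg (Ideal.Quotient.mk (coboundaries X)) (Subtype.ext ?_)
  change DirectSum.of _ m _ = DirectSum.of _ p _ * DirectSum.of _ q _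
  rw [← of_cup h, integralCochain_wedge_reparam h hψ hψ' hψ0 hψ1 hα hβ]

end Cup

/-! ### The Chern–Weil form of a gauge field -/

section GaugeField

variable {V : Type*} [NormedAddCommGroup V] [NormedSpace ℝ V] [FiniteDimensional ℝ V]
  {W : Type*} [NormedAddCommGroup W] [NormedSpace ℝ W] [FiniteDimensional ℝ W]
  {E : Type*} [AddCommGroup E] [Module ℝ E] [TopologicalSpace E]
  [IsTopologicalAddGroup E] [ContinuousSMul ℝ E] [T2Space E] [LocallyConvexSpace ℝ E]
  {G : Type*} [Group G] [TopologicalSpace G] [ChartedSpace E G] [SmoothLieGroup E G]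

variable (G) in
/-- The potentials `A` and `A'` are gauge equivalent on `S` near `x`. -/
def GaugeEquiv (S : Set V) (A A' : V → V → E) (x : V) : Prop :=
  ∃ g : V → G, SmoothNear E g x ∧
    ∀ᶠ y in 𝓝[S] x, ∀ v, A' y v = Ad E (g y)⁻¹ (A y v) + theta E g y v

variable (G) in
/-- A connection on the subset `S` of a vector space, given by the sets `𝒜 x` of the gauge
potentials which represent it near the points `x`. -/
structure IsGaugeField (S : Set V) (𝒜 : V → Set (V → V → E)) : Prop where
  nonempty : ∀ x ∈ S, (𝒜 x).Nonempty
  potential : ∀ x ∈ S, ∀ A ∈ 𝒜 x, ∃ O, IsOpen O ∧ x ∈ O ∧ IsPotential A O ∧ ∀ y ∈ O ∩ S, A ∈ 𝒜 y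
  gauge : ∀ x ∈ S, ∀ A ∈ 𝒜 x, ∀ A' ∈ 𝒜 x, GaugeEquiv G S A A' x

variable (G) in
open Classical in
/-- The Chern–Weil form of a connection, computed in an arbitrary gauge. -/
def gaugeForm {k : ℕ} (ρ : ContinuousMultilinearMap ℝ (fun _ : Fin k => E) ℝ)
    (𝒜 : V → Set (V → V → E)) (x : V) : V [⋀^Fin (2 * k)]→L[ℝ] ℝ :=
  if h : (𝒜 x).Nonempty then chernWeilAlt ρ (curv G h.some x) else 0

variable {k : ℕ} {ρ : ContinuousMultilinearMap ℝ (fun _ : Fin k => E) ℝ}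

theorem chernWeilAlt_comp {A : V → V → E} {O : Set V} (hO : IsOpen O) (hA : IsPotential A O) {x : V}
    (hx : x ∈ O) (L : W →L[ℝ] V) :
    chernWeilAlt ρ (fun u v => curv G A x (L u) (L v)) =
      (chernWeilAlt ρ (curv G A x)).compContinuousLinearMap L := by
  ext v
  have h1 := chernWeilAlt_apply ρ ((hA.curvB (G := G) hO hx).compl₁₂ (L : W →ₗ[ℝ] V) (L : W →ₗ[ℝ] V)) v
  have h2 := chernWeilAlt_apply ρ (hA.curvB (G := G) hO hx) fun i => L (v i)
  simp only [LinearMap.compl₁₂_apply, IsPotential.curvB_apply] at h1 h2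
  exact h1.trans h2.symm

/-- Chern–Weil forms are invariant under gauge transformations, hence natural for affine maps. -/
theorem gaugeForm_eq_pullback (hρ : AdInvariant G ρ) {S : Set V} {S' : Set W}
    (hS' : UniqueDiffOn ℝ S')
    {𝒜 : V → Set (V → V → E)} {𝒜' : W → Set (W → W → E)} (h : IsGaugeField G S 𝒜)
    (h' : IsGaugeField G S' 𝒜') (c : V) (L : W →L[ℝ] V) (hm : MapsTo (fun y => c + L y) S' S)
    {x : W} (hx : x ∈ S') {A : V → V → E} (hA : A ∈ 𝒜 (c + L x)) {A' : W → W → E} (hA' : A' ∈ 𝒜' x)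
    (hg : GaugeEquiv G S' (fun y v => A (c + L y) (L v)) A' x) :
    chernWeilAlt ρ (curv G A' x) =
      (chernWeilAlt ρ (curv G A (c + L x))).compContinuousLinearMap L := by
  obtain ⟨O, hO, hxO, hAO, -⟩ := h.potential _ (hm hx) A hA
  obtain ⟨O', hO', hxO', hAO', -⟩ := h'.potential _ hx A' hA'
  obtain ⟨g, hgs, hgA⟩ := hg
  have hcont : Continuous fun y : W => c + L y := by fun_prop
  have hpull := hAO.pullback hO c L
  have hopen : IsOpen ((fun y => c + L y) ⁻¹' O) := hO.preimage hcont
  have h1 := fun u v => curv_gauge (hopen.inter hO') ⟨hxO, hxO'⟩ (hpull.mono inter_subset_left)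
    (hAO'.mono inter_subset_right) hgs hx (hS' x hx) hgA u v
  have h2 : curv G A' x = fun u v => Ad E (g x)⁻¹ (curv G A (c + L x) (L u) (L v)) := by
    funext u v
    rw [h1, curv_pullback hO hAO c L hxO]
  rw [h2, ← chernWeilAlt_comp hO hAO hxO, chernWeilAlt, chernWeilFun_Ad hρ, chernWeilAlt]

theorem GaugeEquiv.refl (S : Set V) (A : V → V → E) (x : V) : GaugeEquiv G S A A x :=
  ⟨fun _ => 1, SmoothNear.const 1 x, Eventually.of_forall fun y v => by
    rw [theta_const, inv_one, Ad_one, add_zero]⟩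

/-- The Chern–Weil form can be computed in an arbitrary gauge. -/
theorem gaugeForm_eq (hρ : AdInvariant G ρ) {S : Set V} (hS : UniqueDiffOn ℝ S)
    {𝒜 : V → Set (V → V → E)} (h : IsGaugeField G S 𝒜) {x : V} (hx : x ∈ S) {A : V → V → E}
    (hA : A ∈ 𝒜 x) : gaugeForm G ρ 𝒜 x = chernWeilAlt ρ (curv G A x) := by
  have hne : (𝒜 x).Nonempty := ⟨A, hA⟩
  have hid : (fun y => (0 : V) + ContinuousLinearMap.id ℝ V y) = id := by
    funext y
    simp
  have hx0 : (0 : V) + ContinuousLinearMap.id ℝ V x = x := by simp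
  rw [gaugeForm, dif_pos hne, gaugeForm_eq_pullback hρ hS h h 0 (ContinuousLinearMap.id ℝ V)
    (by rw [hid]; exact mapsTo_id S) hx (A := A) (by rwa [hx0]) hne.some_mem (by
      simpa using h.gauge x hx A hA _ hne.some_mem)]
  rw [hx0]
  rfl

theorem isClosedForm_gaugeForm (hρ : AdInvariant G ρ) {S : Set V} (hS : UniqueDiffOn ℝ S)
    {𝒜 : V → Set (V → V → E)} (h : IsGaugeField G S 𝒜) : IsClosedForm S (gaugeForm G ρ 𝒜) := by
  intro x hx
  obtain ⟨A, hA⟩ := h.nonempty x hx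
  obtain ⟨O, hO, hxO, hAO, hAy⟩ := h.potential x hx A hA
  refine ⟨O, fun y => chernWeilAlt ρ (curv G A y), hO, hxO, fun y hy => ?_, fun y hy => ?_,
    fun y hy => gaugeForm_eq hρ hS h hy.2 (hAy y hy)⟩
  · exact (extDeriv_chernWeilAlt hρ hO hAO hy).1.differentiableWithinAt
  · exact (extDeriv_chernWeilAlt hρ hO hAO hy).2

/-- Chern–Weil forms are compatible with pull-back along affine maps which respect the gauge fields. -/
theorem gaugeForm_pullForm (hρ : AdInvariant G ρ) {S : Set V} {S' : Set W} (hS : UniqueDiffOn ℝ S)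
    (hS' : UniqueDiffOn ℝ S') {𝒜 : V → Set (V → V → E)} {𝒜' : W → Set (W → W → E)}
    (h : IsGaugeField G S 𝒜) (h' : IsGaugeField G S' 𝒜') {f : W → V} (c : V) (L : W →L[ℝ] V)
    (hf : ∀ y, f y = c + L y) (hm : MapsTo f S' S)
    (hc : ∀ x ∈ S', ∃ A ∈ 𝒜 (f x), ∃ A' ∈ 𝒜' x,
      GaugeEquiv G S' (fun y v => A (f y) (L v)) A' x) :
    EqOn (gaugeForm G ρ 𝒜') (pullForm f (gaugeForm G ρ 𝒜)) S' := by
  obtain rfl : f = fun y => c + L y := funext hf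
  intro x hx
  obtain ⟨A, hA, A', hA', hg⟩ := hc x hx
  have hd : fderiv ℝ (fun y => c + L y) x = L := by
    rw [fderiv_const_add, ContinuousLinearMap.fderiv]
  rw [gaugeForm_eq hρ hS' h' hx hA', pullForm, hd, gaugeForm_eq hρ hS h (hm hx) hA]
  exact gaugeForm_eq_pullback hρ hS' h h' c L hm hx hA hA' hg

end GaugeField

/-! ### Chern–Weil forms of connections over simplices -/

section Simplices

open SimplexMap PrincipalBundle

universe v b u

theorem uniqueDiffOn_simplex (n : ℕ) : UniqueDiffOn ℝ (Simplex n) :=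
  uniqueDiffOn_convex (convex_simplex n) (simplex_interior_nonempty n)

theorem convex_prism (n : ℕ) : Convex ℝ (Prism n) := by
  rintro x ⟨hx, hx'⟩ y ⟨hy, hy'⟩ s t hs ht hst
  exact ⟨convex_Icc 0 1 hx hy hs ht hst, convex_simplex n hx' hy' hs ht hst⟩

theorem uniqueDiffOn_prism (n : ℕ) : UniqueDiffOn ℝ (Prism n) := by
  refine uniqueDiffOn_convex (convex_prism n) ?_
  obtain ⟨x, hx⟩ := simplex_interior_nonempty n
  refine ⟨Fin.cons (1 / 2) x, ?_⟩
  have hopen : IsOpen {z : Fin (n + 1) → ℝ | z 0 ∈ Ioo (0 : ℝ) 1 ∧ Fin.tail z ∈ interior (Simplex n)} :=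
    (isOpen_Ioo.preimage (continuous_apply 0)).inter
      (isOpen_interior.preimage (contDiff_tail n).continuous)
  refine interior_maximal ?_ hopen ⟨?_, ?_⟩
  · exact fun z hz => ⟨Ioo_subset_Icc_self hz.1, interior_subset hz.2⟩
  · simp only [Fin.cons_zero]
    norm_num
  · simpa using hx

variable {E : Type b} [AddCommGroup E] [Module ℝ E] [TopologicalSpace E]

section Model

variable {M : Type u} [TopologicalSpace M] [ChartedSpace E M]

theorem range_simplexModel (n : ℕ) : range (simplexModel n) = Simplex n := Subtype.range_coe

/-- Smoothness of a map defined on an open subset of a simplex, in terms of local extensions. -/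
theorem smoothOnTo_simplex_iff {n : ℕ} {U : Set (Simplex n)} {g : Simplex n → M} :
    SmoothOnTo (simplexModel n) E U g ↔ ∀ x ∈ U, ∃ F : (Fin n → ℝ) → M, SmoothNear E F x.1 ∧
      ∀ᶠ y in 𝓝[Simplex n] x.1, g (retract n y) = F y := by
  have h1 : ∀ x : Simplex n, extChartAt (simplexModel n) x x = x.1 := fun x => rfl
  have h2 : ∀ (x : Simplex n) (y : Fin n → ℝ), (extChartAt (simplexModel n) x).symm y = retract n y :=
    fun x y => rfl
  simp only [SmoothOnTo, h1, h2, range_simplexModel]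

end Model

variable [IsTopologicalAddGroup E] [ContinuousSMul ℝ E] [T2Space E] [LocallyConvexSpace ℝ E]
  {G : Type u} [Group G] [TopologicalSpace G] [ChartedSpace E G] [SmoothLieGroup E G]

theorem smoothNear_self_iff {V : Type*} [AddCommGroup V] [Module ℝ V] [TopologicalSpace V]
    {F : V → E} {x : V} : SmoothNear E F x ↔ ∃ O, IsOpen O ∧ x ∈ O ∧ CInftyOn F O := by
  constructor
  · rintro ⟨O, hO, hx, -, hs⟩
    exact ⟨O, hO, hx, hs⟩
  · rintro ⟨O, hO, hx, hs⟩
    exact ⟨O, hO, hx, fun _ _ => mem_univ _, hs⟩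

/-- The logarithmic derivative in terms of a local extension. -/
theorem logDeriv_eq {n : ℕ} {g : Simplex n → G} {F : (Fin n → ℝ) → G} {x : Simplex n}
    (hF : SmoothNear E F x.1) (h : ∀ᶠ y in 𝓝[Simplex n] x.1, g (retract n y) = F y)
    (v : Fin n → ℝ) : logDeriv E g x v = theta E F x.1 v := by
  have hx : g x = F x.1 := by
    have := h.self_of_nhdsWithin x.2
    rwa [retract_coe] at this
  obtain ⟨O, hO, hxO, -, hs⟩ := (hF.left_translate (F x.1)⁻¹).one_chart (by simp)
  refine hs.fderivWithin_eq hO hxO x.2 (uniqueDiffOn_simplex n _ x.2) ?_ v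
  filter_upwards [h] with y hy
  rw [hx, hy]

/-- The linear part of the affine map of a monotone map of vertices. -/
def affineLin {k n : ℕ} (θ : Fin (k + 1) →o Fin (n + 1)) : (Fin k → ℝ) →L[ℝ] Fin n → ℝ :=
  fderiv ℝ (affineFun θ) 0

theorem affineFun_eq {k n : ℕ} (θ : Fin (k + 1) →o Fin (n + 1)) (x : Fin k → ℝ) :
    affineFun θ x = affineFun θ 0 + affineLin θ x := by
  have h1 := ((differentiable_affineFun θ) 0).hasFDerivAt.hasLineDerivAt x
  have h2 : HasLineDerivAt ℝ (affineFun θ) (affineFun θ x - affineFun θ 0) 0 x := by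
    rw [HasLineDerivAt]
    have : (fun t : ℝ => affineFun θ (0 + t • x)) =
        fun t => affineFun θ 0 + t • (affineFun θ x - affineFun θ 0) := by
      funext t
      have := affineFun_convex θ (1 - t) t (by ring) 0 x
      rw [smul_zero] at this
      rw [this]
      module
    rw [this]
    simpa using ((hasDerivAt_id (0 : ℝ)).smul_const
      (affineFun θ x - affineFun θ 0)).const_add (affineFun θ 0)
  have h3 := h1.unique h2
  rw [affineLin, h3]
  abel

theorem tangentMap_affine {k n : ℕ} (θ : Fin (k + 1) →o Fin (n + 1)) (x : Simplex k)
    (v : Fin k → ℝ) : tangentMap (affine θ) x v = affineLin θ v := by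
  have h1 : EqOn (fun y => ((affine θ) (retract k y) : Fin n → ℝ)) (affineFun θ) (Simplex k) := by
    intro y hy
    have := retract_coe ⟨y, hy⟩
    simp only at this
    simp only [this]
    rfl
  have h2 : HasFDerivAt (affineFun θ) (affineLin θ) x.1 := by
    have : affineFun θ = fun y => affineFun θ 0 + affineLin θ y := funext (affineFun_eq θ)
    rw [this]
    exact (affineLin θ).hasFDerivAt.const_add _
  rw [tangentMap, fderivWithin_congr h1 (h1 x.2)]
  rw [h2.hasFDerivWithinAt.fderivWithin (uniqueDiffOn_simplex k _ x.2)]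

/-- The potential `A` on the open set `O` represents the connection `D` in the gauge `s`. -/
structure Connection.IsRepresentedBy {n : ℕ}
    {P : PrincipalBundle (simplexModel n) E G (Simplex n)} (D : Connection P)
    (s : LocalSection P.proj) (A : (Fin n → ℝ) → (Fin n → ℝ) → E) (O : Set (Fin n → ℝ)) : Prop where
  isOpen : IsOpen O
  potential : IsPotential A O
  mem_dom : ∀ y ∈ O ∩ Simplex n, retract n y ∈ s.dom
  form_eq : ∀ y ∈ O ∩ Simplex n, ∀ v, D.form s (retract n y) v = A y v

theorem eventually_mem_dom {n : ℕ} {P : Type*} {proj : P → Simplex n} (s : LocalSection proj)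
    {x : Simplex n} (hx : x ∈ s.dom) : ∀ᶠ y in 𝓝 x.1, retract n y ∈ s.dom := by
  have h1 := (continuous_retract n).continuousAt (x := x.1)
  rw [ContinuousAt, retract_coe] at h1
  exact h1.eventually (s.dom.2.mem_nhds hx)

theorem eventually_exists_open {V : Type*} [TopologicalSpace V] {S : Set V} {x : V} {p : V → Prop}
    (h : ∀ᶠ y in 𝓝[S] x, p y) : ∃ O, IsOpen O ∧ x ∈ O ∧ ∀ y ∈ O ∩ S, p y := by
  rw [eventually_nhdsWithin_iff] at h
  obtain ⟨O, h1, h2, h3⟩ := eventually_nhds_iff.1 h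
  exact ⟨O, h2, h3, fun y hy => h1 y hy.1 hy.2⟩

/-- Near every point of the simplex, the values of a connection in a local section extend smoothly to an
open set of the ambient vector space. -/
theorem Connection.exists_isRepresentedBy {n : ℕ}
    {P : PrincipalBundle (simplexModel n) E G (Simplex n)} (D : Connection P)
    {s : LocalSection P.proj} (hs : s ∈ P.sections) {x : Simplex n} (hx : x ∈ s.dom) :
    ∃ A O, x.1 ∈ O ∧ D.IsRepresentedBy s A O := by
  have h1 : ∀ i : Fin n, ∃ (F : (Fin n → ℝ) → E) (O : Set (Fin n → ℝ)), IsOpen O ∧ x.1 ∈ O ∧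
      CInftyOn F O ∧ ∀ y ∈ O ∩ Simplex n, D.form s (retract n y) (unitVec n i) = F y := by
    intro i
    obtain ⟨F, hF, hF'⟩ := smoothOnTo_simplex_iff.1 (D.smooth s hs (unitVec n i)) x hx
    obtain ⟨O, hO, hxO, hs⟩ := smoothNear_self_iff.1 hF
    obtain ⟨O', hO', hxO', hs'⟩ := eventually_exists_open hF'
    exact ⟨F, O ∩ O', hO.inter hO', ⟨hxO, hxO'⟩, hs.mono inter_subset_left,
      fun y hy => hs' y ⟨hy.1.2, hy.2⟩⟩
  choose F O hO hxO hF hFe using h1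
  obtain ⟨O', hO', hO'o, hxO'⟩ := eventually_nhds_iff.1 (eventually_mem_dom s hx)
  refine ⟨fun y v => ∑ i, v i • F i y, O' ∩ ⋂ i, O i, ⟨hxO', mem_iInter.2 hxO⟩,
    hO'o.inter (isOpen_iInter_of_finite hO), ⟨fun v => ?_, fun y _ v w => ?_, fun y _ r v => ?_⟩,
    fun y hy => hO' y hy.1.1, fun y hy v => ?_⟩
  · refine CInftyOn.sum _ fun i _ => ?_
    exact ((hF i).mono (inter_subset_right.trans (iInter_subset O i))).clm_comp
      ((v i) • ContinuousLinearMap.id ℝ E)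
  · simp only [Pi.add_apply, add_smul, Finset.sum_add_distrib]
  · simp only [Pi.smul_apply, smul_eq_mul, mul_smul, Finset.smul_sum]
  · have hv : v = ∑ i, v i • unitVec n i := by
      funext j
      simp [Finset.sum_apply, Pi.single_apply]
    conv_lhs => rw [hv, map_sum]
    refine Finset.sum_congr rfl fun i _ => ?_
    rw [map_smul, hFe i y ⟨mem_iInter.1 hy.1.2 i, hy.2⟩]

theorem Connection.IsRepresentedBy.mono {n : ℕ}
    {P : PrincipalBundle (simplexModel n) E G (Simplex n)} {D : Connection P}
    {s : LocalSection P.proj} {A : (Fin n → ℝ) → (Fin n → ℝ) → E} {O O' : Set (Fin n → ℝ)}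
    (h : D.IsRepresentedBy s A O) (hO : IsOpen O') (hO' : O' ⊆ O) : D.IsRepresentedBy s A O' :=
  ⟨hO, h.potential.mono hO', fun y hy => h.mem_dom y ⟨hO' hy.1, hy.2⟩,
    fun y hy => h.form_eq y ⟨hO' hy.1, hy.2⟩⟩

/-- In local sections, a bundle map is given by a smooth function, which is the gauge
transformation relating the potentials of all the connections which correspond to each other under
the bundle map. -/
theorem exists_gauge {k n : ℕ} {P : PrincipalBundle (simplexModel k) E G (Simplex k)}
    {P' : PrincipalBundle (simplexModel n) E G (Simplex n)} {θ : Fin (k + 1) →o Fin (n + 1)}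
    {Φ : P.Total → P'.Total} (hΦ : IsBundleMap P P' (affine θ) Φ) {s : LocalSection P.proj}
    (hs : s ∈ P.sections) {t : LocalSection P'.proj} (ht : t ∈ P'.sections) {x : Simplex k}
    (hx : x ∈ s.dom) (hx' : affine θ x ∈ t.dom) :
    ∃ g : (Fin k → ℝ) → G, SmoothNear E g x.1 ∧ ∀ (D : Connection P) (D' : Connection P'),
      IsPullbackForm D.form D'.form (affine θ) Φ → ∀ {A O A' O'}, D.IsRepresentedBy s A O →
      D'.IsRepresentedBy t A' O' → x.1 ∈ O → affineFun θ x.1 ∈ O' → ∀ᶠ y in 𝓝[Simplex k] x.1, ∀ v,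
        A y v = Ad E (g y)⁻¹ (A' (affineFun θ y) (affineLin θ v)) + theta E g y v := by
  obtain ⟨g, hg, hgΦ⟩ := hΦ.smooth s hs t ht
  obtain ⟨F, hF, hgF⟩ := smoothOnTo_simplex_iff.1 hg x ⟨hx, hx'⟩
  refine ⟨F, hF, fun D D' hpull A O A' O' hA hA' hxO hxO' => ?_⟩
  have h1 : ∀ᶠ y in 𝓝[Simplex k] x.1, SmoothNear E F y :=
    mem_nhdsWithin_of_mem_nhds hF.eventually
  have h2 : ∀ᶠ y in 𝓝[Simplex k] x.1, ∀ᶠ z in 𝓝[Simplex k] y, g (retract k z) = F z :=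
    eventually_eventually_nhdsWithin.2 hgF
  have h3 : ∀ᶠ y in 𝓝[Simplex k] x.1, y ∈ O :=
    mem_nhdsWithin_of_mem_nhds (hA.isOpen.mem_nhds hxO)
  have h4 : ∀ᶠ y in 𝓝[Simplex k] x.1, affineFun θ y ∈ O' :=
    mem_nhdsWithin_of_mem_nhds ((contDiff_affineFun θ).continuous.continuousAt
      (hA'.isOpen.mem_nhds hxO'))
  filter_upwards [h1, h2, h3, h4, hgF, self_mem_nhdsWithin] with y hy1 hy2 hy3 hy4 hy5 hyS v
  have hr : retract k y = ⟨y, hyS⟩ := retract_coe ⟨y, hyS⟩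
  have hθ : affine θ ⟨y, hyS⟩ = retract n (affineFun θ y) :=
    (retract_coe (affine θ ⟨y, hyS⟩)).symm
  have hmem : affineFun θ y ∈ Simplex n := affineFun_mem θ ⟨y, hyS⟩
  have hdom := hA.mem_dom y ⟨hy3, hyS⟩
  have hdom' := hA'.mem_dom _ ⟨hy4, hmem⟩
  have h5 := hpull s hs t ht g hgΦ (retract k y) hdom (by rw [hr, hθ]; exact hdom') v
  rw [hA.form_eq y ⟨hy3, hyS⟩, hr, hθ, hA'.form_eq _ ⟨hy4, hmem⟩, tangentMap_affine, ← hr, hy5] at h5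
  rw [h5, hr, logDeriv_eq hy1 hy2]

/-- The gauge field of a connection over a simplex. -/
def Connection.potentials {n : ℕ} {P : PrincipalBundle (simplexModel n) E G (Simplex n)}
    (D : Connection P) (x : Fin n → ℝ) : Set ((Fin n → ℝ) → (Fin n → ℝ) → E) :=
  {A | ∃ s ∈ P.sections, ∃ O, x ∈ O ∧ D.IsRepresentedBy s A O}

/-- The straight line between two potentials, as a potential on the prism. -/
def linePotential {n : ℕ} (A₀ A₁ : (Fin n → ℝ) → (Fin n → ℝ) → E) (z h : Fin (n + 1) → ℝ) : E :=
  (1 - z 0) • A₀ (Fin.tail z) (Fin.tail h) + z 0 • A₁ (Fin.tail z) (Fin.tail h)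

/-- The gauge field on the prism which interpolates between two connections. -/
def Connection.linePotentials {n : ℕ} {P : PrincipalBundle (simplexModel n) E G (Simplex n)}
    (D₀ D₁ : Connection P) (z : Fin (n + 1) → ℝ) :
    Set ((Fin (n + 1) → ℝ) → (Fin (n + 1) → ℝ) → E) :=
  {A | ∃ s ∈ P.sections, ∃ O, Fin.tail z ∈ O ∧ ∃ A₀ A₁, D₀.IsRepresentedBy s A₀ O ∧
    D₁.IsRepresentedBy s A₁ O ∧ A = linePotential A₀ A₁}

theorem affine_id_coe {n : ℕ} (x : Simplex n) :
    affine (OrderHom.id : Fin (n + 1) →o Fin (n + 1)) x = x := by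
  rw [affine_id]
  rfl

theorem affineFun_id {n : ℕ} (x : Fin n → ℝ) :
    affineFun (OrderHom.id : Fin (n + 1) →o Fin (n + 1)) x = x := by
  funext j
  simp [affineFun, bary, Finset.sum_filter]

theorem affineLin_id {n : ℕ} (v : Fin n → ℝ) :
    affineLin (OrderHom.id : Fin (n + 1) →o Fin (n + 1)) v = v := by
  have : affineFun (OrderHom.id : Fin (n + 1) →o Fin (n + 1)) = id := funext affineFun_id
  rw [affineLin, this, fderiv_id]
  rfl

theorem isBundleMap_affine_id {n : ℕ} (P : PrincipalBundle (simplexModel n) E G (Simplex n)) :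
    IsBundleMap P P (affine (OrderHom.id : Fin (n + 1) →o Fin (n + 1))) id := by
  have h : ((affine (OrderHom.id : Fin (n + 1) →o Fin (n + 1))) : Simplex n → Simplex n) = id :=
    funext affine_id_coe
  rw [h]
  refine ⟨fun _ => rfl, fun _ _ => rfl, fun s hs t ht => ?_⟩
  obtain ⟨g, hg, hg'⟩ := P.compatible t ht s hs
  refine ⟨g, hg.mono fun x hx => ⟨hx.2, hx.1⟩, fun x hs ht => hg' x ht hs⟩

theorem Connection.gauge_affine_id {n : ℕ} {P : PrincipalBundle (simplexModel n) E G (Simplex n)}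
    (D : Connection P) :
    IsPullbackForm D.form D.form (affine (OrderHom.id : Fin (n + 1) →o Fin (n + 1))) id := by
  have h : ((affine (OrderHom.id : Fin (n + 1) →o Fin (n + 1))) : Simplex n → Simplex n) = id :=
    funext affine_id_coe
  rw [h]
  exact D.gauge

/-- The potentials of a connection form a gauge field: its gauge transformation rule extends off the
simplex. -/
theorem Connection.isGaugeField {n : ℕ} {P : PrincipalBundle (simplexModel n) E G (Simplex n)}
    (D : Connection P) : IsGaugeField G (Simplex n) D.potentials where
  nonempty x hx := by
    obtain ⟨s, hs, hxs⟩ := P.exists_section ⟨x, hx⟩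
    obtain ⟨A, O, hxO, hA⟩ := D.exists_isRepresentedBy hs hxs
    exact ⟨A, s, hs, O, hxO, hA⟩
  potential := by
    rintro x hx A ⟨s, hs, O, hxO, hA⟩
    exact ⟨O, hA.isOpen, hxO, hA.potential, fun y hy => ⟨s, hs, O, hy.1, hA⟩⟩
  gauge := by
    rintro x hx A ⟨s, hs, O, hxO, hA⟩ A' ⟨s', hs', O', hxO', hA'⟩
    have hd := hA.mem_dom x ⟨hxO, hx⟩
    have hd' := hA'.mem_dom x ⟨hxO', hx⟩
    have hr : retract n x = ⟨x, hx⟩ := retract_coe ⟨x, hx⟩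
    rw [hr] at hd hd'
    obtain ⟨g, hg, h⟩ := exists_gauge (isBundleMap_affine_id P) hs' hs hd'
      (by rw [affine_id_coe]; exact hd)
    refine ⟨g, hg, ?_⟩
    filter_upwards [h D D D.gauge_affine_id hA' hA hxO' (by rw [affineFun_id]; exact hxO)]
      with y hy v
    rw [hy, affineFun_id, affineLin_id]

end Simplices

/-! ### The characteristic classes of a simplicial connection -/

section SimplicialConnections

open SimplexMap PrincipalBundle

universe v v₁ b u

variable {E : Type b} [AddCommGroup E] [Module ℝ E] [TopologicalSpace E]
  [IsTopologicalAddGroup E] [ContinuousSMul ℝ E] [T2Space E] [LocallyConvexSpace ℝ E]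
  {G : Type u} [Group G] [TopologicalSpace G] [ChartedSpace E G] [SmoothLieGroup E G]
  {k : ℕ} {ρ : ContinuousMultilinearMap ℝ (fun _ : Fin k => E) ℝ}

section OneSimplex

variable {n : ℕ} {P : PrincipalBundle (simplexModel n) E G (Simplex n)}

theorem Connection.IsRepresentedBy.curvature_eq {D : Connection P} {s : LocalSection P.proj}
    {A : (Fin n → ℝ) → (Fin n → ℝ) → E} {O : Set (Fin n → ℝ)} (h : D.IsRepresentedBy s A O)
    {x : Simplex n} (hx : x.1 ∈ O) (v w : Fin n → ℝ) :
    D.curvature s x v w = curv G A x.1 v w := by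
  have hev : ∀ u, (fun y => D.form s (retract n y) u) =ᶠ[𝓝[Simplex n] x.1] fun y => A y u :=
    fun u => by
      filter_upwards [mem_nhdsWithin_of_mem_nhds (h.isOpen.mem_nhds hx), self_mem_nhdsWithin]
        with y hy hyS
      exact h.form_eq y ⟨hy, hyS⟩ u
  have hd := fun u v => (h.potential.smooth u).fderivWithin_eq h.isOpen hx x.2
    (uniqueDiffOn_simplex n _ x.2) (hev u) v
  have hv := fun u => h.form_eq x.1 ⟨hx, x.2⟩ u
  simp only [retract_coe] at hv
  rw [Connection.curvature, hd, hd, hv, hv]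
  rfl

theorem Connection.chernWeilForm_eq (hρ : AdInvariant G ρ) (D : Connection P) (x : Simplex n)
    (v : Fin (2 * k) → Fin n → ℝ) : D.chernWeilForm ρ x v = gaugeForm G ρ D.potentials x.1 v := by
  obtain ⟨hs, hxs⟩ := (P.exists_section x).choose_spec
  obtain ⟨A, O, hxO, hA⟩ := D.exists_isRepresentedBy hs hxs
  rw [gaugeForm_eq hρ (uniqueDiffOn_simplex n) D.isGaugeField x.2 ⟨_, hs, O, hxO, hA⟩]
  have h1 := chernWeilAlt_apply ρ (hA.potential.curvB (G := G) hA.isOpen hxO) v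
  simp only [IsPotential.curvB_apply] at h1
  refine Eq.trans ?_ h1.symm
  simp only [Connection.chernWeilForm, hA.curvature_eq hxO]
  rfl

theorem gaugeForm_congr (hρ : AdInvariant G ρ) {V : Type*} [NormedAddCommGroup V]
    [NormedSpace ℝ V] [FiniteDimensional ℝ V] {S : Set V} (hS : UniqueDiffOn ℝ S)
    {𝒜 𝒜' : V → Set (V → V → E)} (h : IsGaugeField G S 𝒜) (h' : IsGaugeField G S 𝒜')
    (hsub : ∀ x ∈ S, 𝒜 x ⊆ 𝒜' x) : EqOn (gaugeForm G ρ 𝒜) (gaugeForm G ρ 𝒜') S := by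
  intro x hx
  obtain ⟨A, hA⟩ := h.nonempty x hx
  rw [gaugeForm_eq hρ hS h hx hA, gaugeForm_eq hρ hS h' hx (hsub x hx hA)]

/-- The projection `(t, x) ↦ x`. -/
def tailL (n : ℕ) : (Fin (n + 1) → ℝ) →L[ℝ] Fin n → ℝ :=
  ContinuousLinearMap.pi fun i => ContinuousLinearMap.proj i.succ

theorem tailL_apply (z : Fin (n + 1) → ℝ) : tailL n z = Fin.tail z := rfl

/-- The inclusion `x ↦ (0, x)`. -/
def consL (n : ℕ) : (Fin n → ℝ) →L[ℝ] Fin (n + 1) → ℝ :=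
  ContinuousLinearMap.pi (Fin.cons 0 fun i => ContinuousLinearMap.proj i)

theorem consL_apply (x : Fin n → ℝ) : consL n x = Fin.cons 0 x := by
  funext i
  refine Fin.cases ?_ (fun i => ?_) i <;> rfl

theorem linePotential_isPotential {A₀ A₁ : (Fin n → ℝ) → (Fin n → ℝ) → E} {O : Set (Fin n → ℝ)}
    (hO : IsOpen O) (h₀ : IsPotential A₀ O) (h₁ : IsPotential A₁ O) :
    IsPotential (linePotential A₀ A₁) (tailL n ⁻¹' O) where
  smooth h := by
    have hz : CInftyOn (fun z : Fin (n + 1) → ℝ => z 0) (tailL n ⁻¹' O) :=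
      CInftyOn.of_clm (ContinuousLinearMap.proj (R := ℝ) (φ := fun _ : Fin (n + 1) => ℝ) 0) _
    exact (((CInftyOn.const 1 _).sub hz).smul ((h₀.smooth (Fin.tail h)).comp_clm hO (tailL n))).add
      (hz.smul ((h₁.smooth (Fin.tail h)).comp_clm hO (tailL n)))
  add z hz h h' := by
    change Fin.tail z ∈ O at hz
    have e : Fin.tail (h + h') = Fin.tail h + Fin.tail h' := rfl
    rw [linePotential, e, h₀.add _ hz, h₁.add _ hz, linePotential, linePotential]
    module
  smul z hz r h := by
    change Fin.tail z ∈ O at hz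
    have e : Fin.tail (r • h) = r • Fin.tail h := rfl
    rw [linePotential, e, h₀.smul _ hz, h₁.smul _ hz, linePotential]
    module

/-- A gauge transformation which relates the ends of two straight lines relates the straight
lines. -/
theorem gaugeEquiv_line {k n : ℕ} {A₀ A₁ : (Fin k → ℝ) → (Fin k → ℝ) → E}
    {B₀ B₁ : (Fin n → ℝ) → (Fin n → ℝ) → E} {f : (Fin k → ℝ) → Fin n → ℝ}
    {L : (Fin k → ℝ) → Fin n → ℝ} {L' : (Fin (k + 1) → ℝ) → Fin (n + 1) → ℝ}
    (hL : ∀ v, Fin.tail (L' v) = L (Fin.tail v))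
    {z : Fin (k + 1) → ℝ} {g : (Fin k → ℝ) → G} (hg : SmoothNear E g (Fin.tail z))
    (h₀ : ∀ᶠ y in 𝓝[Simplex k] (Fin.tail z), ∀ v, A₀ y v =
      Ad E (g y)⁻¹ (B₀ (f y) (L v)) + theta E g y v)
    (h₁ : ∀ᶠ y in 𝓝[Simplex k] (Fin.tail z), ∀ v, A₁ y v =
      Ad E (g y)⁻¹ (B₁ (f y) (L v)) + theta E g y v) :
    GaugeEquiv G (Prism k) (fun y v => linePotential B₀ B₁ (prismMap f y) (L' v))
      (linePotential A₀ A₁) z := by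
  refine ⟨fun y => g (tailL k y), SmoothNear.comp_clm (tailL k) hg, ?_⟩
  have ht : Tendsto (tailL k) (𝓝[Prism k] z) (𝓝[Simplex k] (Fin.tail z)) :=
    tendsto_nhdsWithin_iff.2 ⟨((tailL k).continuous.tendsto z).mono_left nhdsWithin_le_nhds,
      by filter_upwards [self_mem_nhdsWithin] with y hy using hy.2⟩
  have hs : ∀ᶠ y in 𝓝[Simplex k] (Fin.tail z), SmoothNear E g y :=
    mem_nhdsWithin_of_mem_nhds hg.eventually
  filter_upwards [ht.eventually h₀, ht.eventually h₁, ht.eventually hs] with y hy₀ hy₁ hys v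
  rw [theta_comp hys (HasDD.of_clm (tailL k) y v)]
  simp only [linePotential, prismMap, Fin.cons_zero, Fin.tail_cons, hL]
  rw [← tailL_apply y, hy₀, hy₁, Ad_add, Ad_smul, Ad_smul, tailL_apply v]
  module

/-- The inclusion `x ↦ (a, x)` into the prism is affine. -/
theorem cons_eq_add (a : ℝ) (x : Fin n → ℝ) :
    (Fin.cons a x : Fin (n + 1) → ℝ) = Fin.cons a 0 + consL n x := by
  rw [consL_apply]
  funext i
  refine Fin.cases ?_ (fun i => ?_) i <;> simp

theorem Connection.linePotentials_nonempty (D₀ D₁ : Connection P) {s : LocalSection P.proj}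
    (hs : s ∈ P.sections) {x : Simplex n} (hx : x ∈ s.dom) :
    ∃ O A₀ A₁, x.1 ∈ O ∧ D₀.IsRepresentedBy s A₀ O ∧ D₁.IsRepresentedBy s A₁ O := by
  obtain ⟨A₀, O₀, hx₀, h₀⟩ := D₀.exists_isRepresentedBy hs hx
  obtain ⟨A₁, O₁, hx₁, h₁⟩ := D₁.exists_isRepresentedBy hs hx
  exact ⟨O₀ ∩ O₁, A₀, A₁, ⟨hx₀, hx₁⟩, h₀.mono (h₀.isOpen.inter h₁.isOpen) inter_subset_left,
    h₁.mono (h₀.isOpen.inter h₁.isOpen) inter_subset_right⟩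

/-- Both ends transform by the same gauge transformations, so the straight lines between them do, too. -/
theorem Connection.linePotentials_isGaugeField (D₀ D₁ : Connection P) :
    IsGaugeField G (Prism n) (D₀.linePotentials D₁) where
  nonempty z hz := by
    obtain ⟨s, hs, hxs⟩ := P.exists_section ⟨Fin.tail z, hz.2⟩
    obtain ⟨O, A₀, A₁, hO, h₀, h₁⟩ := D₀.linePotentials_nonempty D₁ hs hxs
    exact ⟨_, s, hs, O, hO, A₀, A₁, h₀, h₁, rfl⟩
  potential := by
    rintro z hz _ ⟨s, hs, O, hxO, A₀, A₁, h₀, h₁, rfl⟩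
    exact ⟨tailL n ⁻¹' O, h₀.isOpen.preimage (tailL n).continuous, hxO,
      linePotential_isPotential h₀.isOpen h₀.potential h₁.potential,
      fun y hy => ⟨s, hs, O, hy.1, A₀, A₁, h₀, h₁, rfl⟩⟩
  gauge := by
    rintro z hz _ ⟨s, hs, O, hxO, A₀, A₁, h₀, h₁, rfl⟩ _ ⟨s', hs', O', hxO', B₀, B₁, k₀, k₁, rfl⟩
    have hd := h₀.mem_dom _ ⟨hxO, hz.2⟩
    have hd' := k₀.mem_dom _ ⟨hxO', hz.2⟩
    have hr : retract n (Fin.tail z) = ⟨Fin.tail z, hz.2⟩ := retract_coe ⟨Fin.tail z, hz.2⟩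
    rw [hr] at hd hd'
    obtain ⟨g, hg, h⟩ := exists_gauge (isBundleMap_affine_id P) hs' hs hd'
      (by rw [affine_id_coe]; exact hd)
    have e := gaugeEquiv_line (L' := id) (f := affineFun OrderHom.id) (L := affineLin OrderHom.id)
      (fun v => (affineLin_id _).symm) hg
      (h D₀ D₀ D₀.gauge_affine_id k₀ h₀ hxO' (by rw [affineFun_id]; exact hxO))
      (h D₁ D₁ D₁.gauge_affine_id k₁ h₁ hxO' (by rw [affineFun_id]; exact hxO))
    have hp : (prismMap (affineFun OrderHom.id) : (Fin (n + 1) → ℝ) → _) = id := by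
      funext y
      rw [prismMap, affineFun_id]
      exact Fin.cons_self_tail y
    simpa only [hp, id] using e

end OneSimplex

variable {X : SmoothSSet.{v}} {P : SimplicialBundle E G X}

/-- The family of Chern–Weil forms of a simplicial connection. -/
def SimplicialConnection.chernWeil (ρ : ContinuousMultilinearMap ℝ (fun _ : Fin k => E) ℝ)
    (D : SimplicialConnection P) {n : ℕ} (x : X.obj n) :
    (Fin n → ℝ) → (Fin n → ℝ) [⋀^Fin (2 * k)]→L[ℝ] ℝ :=
  gaugeForm G ρ (D.conn x).potentials

theorem chernWeilCochain_eq (hρ : AdInvariant G ρ) (D : SimplicialConnection P) :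
    chernWeilCochain ρ D = integralCochain (D.chernWeil ρ) := by
  funext x
  refine MeasureTheory.setIntegral_congr_fun (measurableSet_simplex _) fun y hy => ?_
  have hr : retract (2 * k) y = ⟨y, hy⟩ := retract_coe ⟨y, hy⟩
  simp only [hr, Connection.chernWeilForm_eq hρ]
  rfl

theorem SimplicialConnection.isClosedSimplicialForm (hρ : AdInvariant G ρ)
    (D : SimplicialConnection P) :
    IsClosedSimplicialForm (X := X) (m := 2 * k) (D.chernWeil ρ) where
  closed x := isClosedForm_gaugeForm hρ (uniqueDiffOn_simplex _) (D.conn x).isGaugeField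
  compat {k n} θ y := by
    refine gaugeForm_pullForm hρ (uniqueDiffOn_simplex _) (uniqueDiffOn_simplex _)
      (D.conn y).isGaugeField (D.conn _).isGaugeField (affineFun θ 0) (affineLin θ)
      (affineFun_eq θ) (fun x hx => affineFun_mem θ ⟨x, hx⟩) fun x hx => ?_
    obtain ⟨s, hs, hxs⟩ := (P.obj (X.res θ y)).exists_section ⟨x, hx⟩
    obtain ⟨t, ht, hxt⟩ := (P.obj y).exists_section (affine θ ⟨x, hx⟩)
    obtain ⟨A, O, hxO, hA⟩ := (D.conn (X.res θ y)).exists_isRepresentedBy hs hxs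
    obtain ⟨B, O', hxO', hB⟩ := (D.conn y).exists_isRepresentedBy ht hxt
    obtain ⟨g, hg, h⟩ := exists_gauge (P.isBundleMap (affine θ) rfl) hs ht hxs hxt
    exact ⟨B, ⟨t, ht, O', hxO', hB⟩, A, ⟨s, hs, O, hxO, hA⟩, g, hg,
      h _ _ (D.compat θ rfl) hA hB hxO hxO'⟩

/-- The family of Chern–Weil forms on the prisms of the straight line between two simplicial
connections. -/
def SimplicialConnection.chernWeilLine (ρ : ContinuousMultilinearMap ℝ (fun _ : Fin k => E) ℝ)
    (D₀ D₁ : SimplicialConnection P) {n : ℕ} (x : X.obj n) :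
    (Fin (n + 1) → ℝ) → (Fin (n + 1) → ℝ) [⋀^Fin (2 * k)]→L[ℝ] ℝ :=
  gaugeForm G ρ ((D₀.conn x).linePotentials (D₁.conn x))

/-- The Chern–Weil forms of the straight line between two simplicial connections are a closed form on
the prisms, which interpolates between the Chern–Weil forms of the two connections. -/
theorem SimplicialConnection.isClosedPrismForm (hρ : AdInvariant G ρ)
    (D₀ D₁ : SimplicialConnection P) :
    IsClosedPrismForm (X := X) (m := 2 * k) (D₀.chernWeilLine ρ D₁) where
  closed x := isClosedForm_gaugeForm hρ (uniqueDiffOn_prism _)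
    ((D₀.conn x).linePotentials_isGaugeField (D₁.conn x))
  compat {k n} θ y := by
    set L' : (Fin (k + 1) → ℝ) →L[ℝ] Fin (n + 1) → ℝ :=
      ContinuousLinearMap.pi (Fin.cons (ContinuousLinearMap.proj 0) fun i =>
        (ContinuousLinearMap.proj i).comp ((affineLin θ).comp (tailL k))) with hL'
    refine gaugeForm_pullForm hρ (uniqueDiffOn_prism _) (uniqueDiffOn_prism _)
      ((D₀.conn y).linePotentials_isGaugeField (D₁.conn y))
      ((D₀.conn _).linePotentials_isGaugeField (D₁.conn _)) (Fin.cons 0 (affineFun θ 0)) L'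
      (fun z => ?_) (fun z hz => ⟨hz.1, affineFun_mem θ ⟨Fin.tail z, hz.2⟩⟩) fun z hz => ?_
    · rw [prismMap, affineFun_eq θ]
      funext i
      refine Fin.cases ?_ (fun i => ?_) i
      · simp [hL']
      · simp [hL', tailL_apply]
    obtain ⟨s, hs, hxs⟩ := (P.obj (X.res θ y)).exists_section ⟨Fin.tail z, hz.2⟩
    obtain ⟨t, ht, hxt⟩ := (P.obj y).exists_section (affine θ ⟨Fin.tail z, hz.2⟩)
    obtain ⟨O, A₀, A₁, hxO, h₀, h₁⟩ :=
      (D₀.conn (X.res θ y)).linePotentials_nonempty (D₁.conn _) hs hxs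
    obtain ⟨O', B₀, B₁, hxO', k₀, k₁⟩ := (D₀.conn y).linePotentials_nonempty (D₁.conn y) ht hxt
    obtain ⟨g, hg, h⟩ := exists_gauge (P.isBundleMap (affine θ) rfl) hs ht hxs hxt
    exact ⟨_, ⟨t, ht, O', hxO', B₀, B₁, k₀, k₁, rfl⟩, _, ⟨s, hs, O, hxO, A₀, A₁, h₀, h₁, rfl⟩,
      gaugeEquiv_line (L' := L') (f := affineFun θ) (L := affineLin θ) (fun v => rfl) hg
      (h _ _ (D₀.compat θ rfl) h₀ k₀ hxO hxO') (h _ _ (D₁.compat θ rfl) h₁ k₁ hxO hxO')⟩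

theorem SimplicialConnection.chernWeilLine_zero (hρ : AdInvariant G ρ)
    (D₀ D₁ : SimplicialConnection P) {n : ℕ} (x : X.obj n) :
    EqOn (D₀.chernWeil ρ x) (pullForm (fun y => Fin.cons 0 y) (D₀.chernWeilLine ρ D₁ x))
      (Simplex n) := by
  refine gaugeForm_pullForm hρ (uniqueDiffOn_prism _) (uniqueDiffOn_simplex _)
    ((D₀.conn x).linePotentials_isGaugeField (D₁.conn x)) (D₀.conn x).isGaugeField
    (Fin.cons 0 0) (consL n) (cons_eq_add 0) (fun y hy => ⟨by simp, by simpa using hy⟩)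
    fun y hy => ?_
  obtain ⟨s, hs, hxs⟩ := (P.obj x).exists_section ⟨y, hy⟩
  obtain ⟨O, A₀, A₁, hxO, h₀, h₁⟩ := (D₀.conn x).linePotentials_nonempty (D₁.conn x) hs hxs
  refine ⟨_, ⟨s, hs, O, by simpa using hxO, A₀, A₁, h₀, h₁, rfl⟩, A₀, ⟨s, hs, O, hxO, h₀⟩, ?_⟩
  have e : (fun y v => linePotential A₀ A₁ (Fin.cons 0 y) (consL n v)) = A₀ := by
    funext y v
    simp [linePotential, consL_apply]
  rw [e]
  exact GaugeEquiv.refl _ _ _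

theorem SimplicialConnection.chernWeilLine_one (hρ : AdInvariant G ρ)
    (D₀ D₁ : SimplicialConnection P) {n : ℕ} (x : X.obj n) :
    EqOn (D₁.chernWeil ρ x) (pullForm (fun y => Fin.cons 1 y) (D₀.chernWeilLine ρ D₁ x))
      (Simplex n) := by
  refine gaugeForm_pullForm hρ (uniqueDiffOn_prism _) (uniqueDiffOn_simplex _)
    ((D₀.conn x).linePotentials_isGaugeField (D₁.conn x)) (D₁.conn x).isGaugeField
    (Fin.cons 1 0) (consL n) (cons_eq_add 1) (fun y hy => ⟨by simp, by simpa using hy⟩)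
    fun y hy => ?_
  obtain ⟨s, hs, hxs⟩ := (P.obj x).exists_section ⟨y, hy⟩
  obtain ⟨O, A₀, A₁, hxO, h₀, h₁⟩ := (D₀.conn x).linePotentials_nonempty (D₁.conn x) hs hxs
  refine ⟨_, ⟨s, hs, O, by simpa using hxO, A₀, A₁, h₀, h₁, rfl⟩, A₁, ⟨s, hs, O, hxO, h₁⟩, ?_⟩
  have e : (fun y v => linePotential A₀ A₁ (Fin.cons 1 y) (consL n v)) = A₁ := by
    funext y v
    simp [linePotential, consL_apply]
  rw [e]
  exact GaugeEquiv.refl _ _ _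

/-- The Chern–Weil class of a simplicial connection. -/
def SimplicialConnection.chernWeilClass (hρ : AdInvariant G ρ) (D : SimplicialConnection P) :
    Cohomology X := (D.isClosedSimplicialForm hρ).toCohomology

/-- Independence of the connection: the straight line between two connections is a homotopy. -/
theorem SimplicialConnection.chernWeilClass_eq (hρ : AdInvariant G ρ)
    (D₀ D₁ : SimplicialConnection P) : D₀.chernWeilClass hρ = D₁.chernWeilClass hρ :=
  ((D₁.isClosedSimplicialForm hρ).toCohomology_eq (D₀.isClosedSimplicialForm hρ)
    ((D₀.isClosedPrismForm hρ D₁).exists_differential (D₀.chernWeilLine_zero hρ D₁)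
      (D₀.chernWeilLine_one hρ D₁))).symm

theorem SimplicialConnection.isClassOf (hρ : AdInvariant G ρ) (D : SimplicialConnection P) :
    IsClassOf (D.chernWeilClass hρ) (chernWeilCochain ρ D) := by
  rw [chernWeilCochain_eq hρ]
  exact ⟨_, rfl⟩

/-- The pull-back of a simplicial connection along a smooth map. -/
def SimplicialConnection.pullback {Y : SmoothSSet.{v₁}} {Q : SimplicialBundle E G Y}
    (D : SimplicialConnection Q) (f : X.Hom Y) : SimplicialConnection (Q.pullback f) where
  conn x := D.conn (f.app x)
  compat {k n} θ {x y} e := D.compat θ (by rw [← e, f.naturality])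

theorem SimplicialConnection.chernWeilClass_pullback {Y : SmoothSSet.{v₁}}
    {Q : SimplicialBundle E G Y} (hρ : AdInvariant G ρ) (D : SimplicialConnection Q)
    (f : X.Hom Y) : (D.pullback f).chernWeilClass hρ = cohomologyMap f (D.chernWeilClass hρ) := by
  change _ = Ideal.Quotient.mk (coboundaries X) (cocyclesMap f _)
  refine congrArg (Ideal.Quotient.mk (coboundaries X)) (Subtype.ext ?_)
  exact (cochainsMap_of f (integralCochain (X := Y) (m := 2 * k) (D.chernWeil ρ))).symm

/-- The image of a local section under a bundle map. -/
def mapSection {n : ℕ} {P Q : PrincipalBundle (simplexModel n) E G (Simplex n)}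
    {Φ : P.Total → Q.Total} (hΦ : IsBundleMap P Q id Φ) (s : LocalSection P.proj) :
    LocalSection Q.proj where
  dom := s.dom
  toFun x := Φ (s.toFun x)
  proj_toFun x := by rw [hΦ.proj_map, s.proj_toFun]; rfl

theorem mapSection_mem {n : ℕ} {P Q : PrincipalBundle (simplexModel n) E G (Simplex n)}
    {Φ : P.Total → Q.Total} (hΦ : IsBundleMap P Q id Φ) {s : LocalSection P.proj}
    (hs : s ∈ P.sections) : mapSection hΦ s ∈ Q.sections := by
  refine Q.maximal _ fun t ht => ?_
  obtain ⟨g, hg, h⟩ := hΦ.smooth s hs t ht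
  exact ⟨g, hg.mono fun x hx => ⟨hx.2, hx.1⟩, fun x hxt hxs => h x hxs hxt⟩

/-- The pull-back of a connection along an isomorphism of bundles. -/
def Connection.transport {n : ℕ} {P Q : PrincipalBundle (simplexModel n) E G (Simplex n)}
    (D : Connection Q) {Φ : P.Total → Q.Total} (hΦ : IsBundleMap P Q id Φ) : Connection P where
  form s := D.form (mapSection hΦ s)
  smooth _ hs := D.smooth _ (mapSection_mem hΦ hs)
  gauge _ hs _ ht g h := D.gauge _ (mapSection_mem hΦ hs) _ (mapSection_mem hΦ ht) g
    fun x hxs hxt => (hΦ.map_act _ _).symm.trans (congrArg Φ (h x hxs hxt))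

/-- The pull-back of a simplicial connection along an isomorphism of simplicial bundles. -/
def SimplicialConnection.transport {Q : SimplicialBundle E G X} (D : SimplicialConnection Q)
    (φ : SimplicialBundle.Map P Q) : SimplicialConnection P where
  conn x := (D.conn x).transport (φ.isBundleMap x)
  compat {k n} θ {x y} e := fun s hs t ht g h => D.compat θ e _ (mapSection_mem _ hs) _
    (mapSection_mem _ ht) g fun z hzs hzt => by
      refine ((φ.isBundleMap y).map_act _ _).symm.trans ((congrArg (φ.app y) (h z hzs hzt)).trans ?_)
      exact φ.naturality _ e _

theorem SimplicialConnection.chernWeilClass_transport {Q : SimplicialBundle E G X}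
    (hρ : AdInvariant G ρ) (D : SimplicialConnection Q) (φ : SimplicialBundle.Map P Q) :
    (D.transport φ).chernWeilClass hρ = D.chernWeilClass hρ := by
  refine congrArg (Ideal.Quotient.mk (coboundaries X)) (Subtype.ext ?_)
  refine congrArg (DirectSum.of (Cochain X) (2 * k)) (funext fun x => ?_)
  refine MeasureTheory.setIntegral_congr_fun (measurableSet_simplex _) fun y hy => ?_
  refine congrArg (fun α : (Fin (2 * k) → ℝ) [⋀^Fin (2 * k)]→L[ℝ] ℝ => α (unitVec (2 * k))) ?_
  refine gaugeForm_congr hρ (uniqueDiffOn_simplex _) ((D.transport φ).conn x).isGaugeField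
    (D.conn x).isGaugeField (fun z hz A hA => ?_) hy
  obtain ⟨s, hs, O, hzO, h⟩ := hA
  exact ⟨_, mapSection_mem (φ.isBundleMap x) hs, O, hzO, h.isOpen, h.potential, h.mem_dom,
    h.form_eq⟩

/-- Isomorphic simplicial bundles have the same Chern–Weil classes. -/
theorem chernWeilClass_eq_of_isomorphic {Q : SimplicialBundle E G X} (hρ : AdInvariant G ρ)
    (h : SimplicialBundle.Isomorphic P Q) (D : SimplicialConnection P)
    (D' : SimplicialConnection Q) : D.chernWeilClass hρ = D'.chernWeilClass hρ := by
  obtain ⟨φ, -, -⟩ := h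
  rw [← SimplicialConnection.chernWeilClass_transport hρ D' φ]
  exact D.chernWeilClass_eq hρ _

end SimplicialConnections

/-! ### Constructing connections -/

section LocalConnections

open SimplexMap PrincipalBundle

universe v v₁ b u

variable {E : Type b} [AddCommGroup E] [Module ℝ E] [TopologicalSpace E]
  [IsTopologicalAddGroup E] [ContinuousSMul ℝ E] [T2Space E] [LocallyConvexSpace ℝ E]
  {G : Type u} [Group G] [TopologicalSpace G] [ChartedSpace E G] [SmoothLieGroup E G]
  {k n : ℕ}

/-- Weights on the vertices, pushed forward along a map of vertices. -/
def push {k n : ℕ} (θ : Fin (k + 1) → Fin (n + 1)) (c : Fin (k + 1) → ℝ) (j : Fin (n + 1)) : ℝ :=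
  ∑ i with θ i = j, c i

theorem push_push {k m n : ℕ} (θ : Fin (m + 1) → Fin (n + 1)) (η : Fin (k + 1) → Fin (m + 1))
    (c : Fin (k + 1) → ℝ) : push θ (push η c) = push (θ ∘ η) c := by
  funext j
  simp only [push, Finset.sum_filter, Function.comp_apply]
  have h1 : ∀ y, (if θ y = j then ∑ i, if η i = y then c i else 0 else 0) =
      ∑ i, if η i = y then (if θ y = j then c i else 0) else 0 := by
    intro y
    split_ifs <;> simp
  simp only [h1]
  rw [Finset.sum_comm]
  simp

theorem push_congr {k n : ℕ} {θ η : Fin (k + 1) → Fin (n + 1)} {c : Fin (k + 1) → ℝ}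
    (h : ∀ i, c i ≠ 0 → θ i = η i) : push θ c = push η c := by
  funext j
  simp only [push, Finset.sum_filter]
  refine Finset.sum_congr rfl fun i _ => ?_
  by_cases hi : c i = 0
  · simp [hi]
  · rw [h i hi]

theorem push_id {n : ℕ} (c : Fin (n + 1) → ℝ) : push id c = c := by
  funext j
  simp [push, Finset.sum_filter]

theorem push_eq_zero {k n : ℕ} {θ : Fin (k + 1) → Fin (n + 1)} {j : Fin (n + 1)}
    (h : ∀ i, θ i ≠ j) (c : Fin (k + 1) → ℝ) : push θ c j = 0 := by
  rw [push, Finset.filter_false_of_mem fun i _ => h i, Finset.sum_empty]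

theorem sum_push {k n : ℕ} (θ : Fin (k + 1) → Fin (n + 1)) (c : Fin (k + 1) → ℝ) :
    ∑ j, push θ c j = ∑ i, c i :=
  Finset.sum_fiberwise (s := Finset.univ) (g := θ) (f := c)

theorem bary_injective {n : ℕ} {x y : Fin n → ℝ} (h : bary x = bary y) : x = y :=
  congrArg Fin.tail h

/-- The linear part of the barycentric coordinates. -/
def baryLin {n : ℕ} (v : Fin n → ℝ) : Fin (n + 1) → ℝ := Fin.cons (-∑ i, v i) v

theorem baryLin_injective {n : ℕ} {x y : Fin n → ℝ} (h : baryLin x = baryLin y) : x = y :=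
  congrArg Fin.tail h

/-- The affine map `ℝᵏ → ℝⁿ` of an arbitrary map of the vertices. -/
def vertexMap {k n : ℕ} (θ : Fin (k + 1) → Fin (n + 1)) (x : Fin k → ℝ) : Fin n → ℝ :=
  fun j => push θ (bary x) j.succ

theorem bary_vertexMap {k n : ℕ} (θ : Fin (k + 1) → Fin (n + 1)) (x : Fin k → ℝ) :
    bary (vertexMap θ x) = push θ (bary x) := by
  have h := sum_push θ (bary x)
  rw [sum_bary, Fin.sum_univ_succ] at h
  funext j
  refine Fin.cases ?_ (fun j => ?_) j
  · simp only [bary, Fin.cons_zero, vertexMap] at h ⊢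
    linarith
  · rfl

/-- The linear part of `vertexMap`. -/
def vertexLin {k n : ℕ} (θ : Fin (k + 1) → Fin (n + 1)) : (Fin k → ℝ) →ₗ[ℝ] Fin n → ℝ where
  toFun v j := push θ (baryLin v) j.succ
  map_add' v w := by
    funext j
    simp only [push, Pi.add_apply, ← Finset.sum_add_distrib]
    refine Finset.sum_congr rfl fun i _ => ?_
    refine Fin.cases ?_ (fun i => ?_) i
    · simp only [baryLin, Fin.cons_zero, Pi.add_apply, Finset.sum_add_distrib, neg_add]
    · simp [baryLin]
  map_smul' r v := by
    funext j
    simp only [push, Pi.smul_apply, smul_eq_mul, Finset.mul_sum, RingHom.id_apply]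
    refine Finset.sum_congr rfl fun i _ => ?_
    refine Fin.cases ?_ (fun i => ?_) i
    · simp [baryLin, Finset.mul_sum]
    · simp [baryLin]

theorem baryLin_vertexLin {k n : ℕ} (θ : Fin (k + 1) → Fin (n + 1)) (v : Fin k → ℝ) :
    baryLin (vertexLin θ v) = push θ (baryLin v) := by
  have h := sum_push θ (baryLin v)
  have h0 : ∑ i, baryLin v i = 0 := by simp [baryLin, Fin.sum_univ_succ]
  rw [h0, Fin.sum_univ_succ] at h
  funext j
  refine Fin.cases ?_ (fun j => ?_) j
  · simp only [baryLin, Fin.cons_zero]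
    exact (eq_neg_of_add_eq_zero_left h).symm
  · rfl

theorem vertexMap_eq {k n : ℕ} (θ : Fin (k + 1) → Fin (n + 1)) (x : Fin k → ℝ) :
    vertexMap θ x = vertexMap θ 0 + vertexLin θ x := by
  funext j
  simp only [vertexMap, vertexLin, LinearMap.coe_mk, AddHom.coe_mk, push, Pi.add_apply,
    ← Finset.sum_add_distrib]
  refine Finset.sum_congr rfl fun i _ => ?_
  refine Fin.cases ?_ (fun i => ?_) i
  · simp [bary, baryLin, sub_eq_add_neg]
  · simp [bary, baryLin]

theorem affineFun_eq_vertexMap {k n : ℕ} (θ : Fin (k + 1) →o Fin (n + 1)) :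
    affineFun θ = vertexMap θ := rfl

theorem affineLin_eq_vertexLin {k n : ℕ} (θ : Fin (k + 1) →o Fin (n + 1)) (v : Fin k → ℝ) :
    affineLin θ v = vertexLin θ v := by
  have h := affineFun_eq θ v
  rw [affineFun_eq_vertexMap, vertexMap_eq, add_right_inj] at h
  exact h.symm

theorem affineLin_comp {k m n : ℕ} (η : Fin (m + 1) →o Fin (n + 1)) (θ : Fin (k + 1) →o Fin (m + 1))
    (v : Fin k → ℝ) : affineLin (η.comp θ) v = affineLin η (affineLin θ v) := by
  simp only [affineLin_eq_vertexLin]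
  refine baryLin_injective ?_
  simp only [baryLin_vertexLin, push_push]
  rfl

theorem eventually_retract {x : Simplex n} {p : Simplex n → Prop} (h : ∀ᶠ y in 𝓝 x, p y) :
    ∀ᶠ y in 𝓝[Simplex n] x.1, p (retract n y) := by
  have h1 := (continuous_retract n).tendsto x.1
  rw [retract_coe] at h1
  exact (h1.mono_left nhdsWithin_le_nhds).eventually h

theorem SmoothOnTo.point_congr {M : Type*} [TopologicalSpace M] [ChartedSpace E M]
    {g g' : Simplex n → M} {x : Simplex n} (h : SmoothOnTo (simplexModel n) E {x} g)
    (e : ∀ᶠ y in 𝓝 x, g' y = g y) : SmoothOnTo (simplexModel n) E {x} g' := by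
  rw [smoothOnTo_simplex_iff] at h ⊢
  rintro y rfl
  obtain ⟨F, hF, hgF⟩ := h y rfl
  refine ⟨F, hF, ?_⟩
  filter_upwards [hgF, eventually_retract e] with z hz hz'
  rw [hz', hz]

theorem SmoothOnTo.point {M : Type*} [TopologicalSpace M] [ChartedSpace E M]
    {g : Simplex n → M} {U : Set (Simplex n)} {x : Simplex n}
    (h : SmoothOnTo (simplexModel n) E U g) (hx : x ∈ U) :
    SmoothOnTo (simplexModel n) E {x} g := h.mono (singleton_subset_iff.2 hx)

theorem smoothOnTo_of_point {M : Type*} [TopologicalSpace M] [ChartedSpace E M]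
    {g : Simplex n → M} {U : Set (Simplex n)}
    (h : ∀ x ∈ U, SmoothOnTo (simplexModel n) E {x} g) : SmoothOnTo (simplexModel n) E U g :=
  fun x hx => h x hx x rfl

theorem SmoothOnTo.point_affine {M : Type*} [TopologicalSpace M] [ChartedSpace E M]
    {g : Simplex n → M} {σ : SimplexMap k n} {x : Simplex k}
    (h : SmoothOnTo (simplexModel n) E {σ x} g) :
    SmoothOnTo (simplexModel k) E {x} fun y => g (σ y) :=
  (SmoothOnTo.comp σ.2 h).point rfl

theorem logDeriv_congr {g g' : Simplex n → G} {x : Simplex n} (e : ∀ᶠ y in 𝓝 x, g' y = g y)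
    (v : Fin n → ℝ) : logDeriv E g' x v = logDeriv E g x v := by
  rw [logDeriv, logDeriv]
  congr 1
  refine Filter.EventuallyEq.fderivWithin_eq ?_ ?_
  · filter_upwards [eventually_retract e] with y hy
    rw [hy, e.self_of_nhds]
  · simp only [retract_coe, e.self_of_nhds]

theorem logDeriv_const (g : G) (x : Simplex n) (v : Fin n → ℝ) :
    logDeriv E (fun _ => g) x v = 0 := by
  rw [logDeriv_eq (SmoothNear.const g x.1) (Eventually.of_forall fun _ => rfl), theta_const]

theorem logDeriv_mul {g h : Simplex n → G} {x : Simplex n}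
    (hg : SmoothOnTo (simplexModel n) E {x} g) (hh : SmoothOnTo (simplexModel n) E {x} h)
    (v : Fin n → ℝ) : logDeriv E (fun y => g y * h y) x v =
      Ad E (h x)⁻¹ (logDeriv E g x v) + logDeriv E h x v := by
  obtain ⟨F, hF, hgF⟩ := smoothOnTo_simplex_iff.1 hg x rfl
  obtain ⟨F', hF', hhF⟩ := smoothOnTo_simplex_iff.1 hh x rfl
  have hx := hhF.self_of_nhdsWithin x.2
  rw [retract_coe] at hx
  rw [logDeriv_eq hF hgF, logDeriv_eq hF' hhF, logDeriv_eq (hF.mul hF'), theta_mul hF hF', hx]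
  filter_upwards [hgF, hhF] with y hy hy'
  rw [hy, hy']

theorem hasDD_affineFun (θ : Fin (k + 1) →o Fin (n + 1)) (x v : Fin k → ℝ) :
    HasDD (affineFun θ) (affineLin θ v) x v := by
  have h : affineFun θ = fun y => affineFun θ 0 + affineLin θ y := funext (affineFun_eq θ)
  rw [h]
  simpa using (HasDD.const (affineFun θ 0) x v).add (HasDD.of_clm (affineLin θ) x v)

theorem logDeriv_affine {g : Simplex n → G} {θ : Fin (k + 1) →o Fin (n + 1)} {x : Simplex k}
    (hg : SmoothOnTo (simplexModel n) E {affine θ x} g) (v : Fin k → ℝ) :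
    logDeriv E (fun y => g (affine θ y)) x v = logDeriv E g (affine θ x) (affineLin θ v) := by
  obtain ⟨F, hF, hgF⟩ := smoothOnTo_simplex_iff.1 hg _ rfl
  have hF' : SmoothNear E F (affineFun θ x.1) := hF
  have hs : SmoothNear E (fun y => F (affineFun θ y)) x.1 :=
    SmoothNear.comp isOpen_univ (mem_univ _)
      (CInftyOn.of_contDiffOn isOpen_univ (contDiff_affineFun θ).contDiffOn) hF'
  rw [logDeriv_eq hF hgF, logDeriv_eq hs, theta_comp hF' (hasDD_affineFun θ x.1 v)]
  · rfl
  have ht : Tendsto (affineFun θ) (𝓝[Simplex k] x.1) (𝓝[Simplex n] (affineFun θ x.1)) :=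
    tendsto_nhdsWithin_iff.2 ⟨((contDiff_affineFun θ).continuous.tendsto x.1).mono_left
      nhdsWithin_le_nhds, by
        filter_upwards [self_mem_nhdsWithin] with y hy using affineFun_mem θ ⟨y, hy⟩⟩
  filter_upwards [ht.eventually hgF, self_mem_nhdsWithin] with y hy hyS
  have hr : retract k y = ⟨y, hyS⟩ := retract_coe ⟨y, hyS⟩
  rw [hr, ← hy, ← retract_coe (affine θ ⟨y, hyS⟩)]
  rfl

theorem tangentMap_id (x : Simplex n) (v : Fin n → ℝ) : tangentMap id x v = v := by
  have h := tangentMap_affine OrderHom.id x v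
  rw [affineLin_id] at h
  convert h using 2
  exact (funext affine_id_coe).symm

variable {P : PrincipalBundle (simplexModel k) E G (Simplex k)}
  {P' : PrincipalBundle (simplexModel n) E G (Simplex n)}

/-- The family `A` is the pull-back of `A'` at the point `x`. -/
def PullAt (A : FormFamily P.proj E) (A' : FormFamily P'.proj E) (f : Simplex k → Simplex n)
    (Φ : P.Total → P'.Total) (x : Simplex k) : Prop :=
  ∀ s ∈ P.sections, ∀ t ∈ P'.sections, ∀ g : Simplex k → G,
    (∀ (y : Simplex k) (hs : y ∈ s.dom) (ht : f y ∈ t.dom),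
      P'.act (t.toFun ⟨f y, ht⟩) (g y) = Φ (s.toFun ⟨y, hs⟩)) →
    x ∈ s.dom → f x ∈ t.dom → ∀ v : Fin k → ℝ,
      A s x v = Ad E (g x)⁻¹ (A' t (f x) (tangentMap f x v)) + logDeriv E g x v

/-- The family `A` obeys the gauge transformation rule at the point `x`. -/
def GaugeAt (A : FormFamily P.proj E) (x : Simplex k) : Prop :=
  ∀ s ∈ P.sections, ∀ t ∈ P.sections, ∀ g : Simplex k → G,
    (∀ (y : Simplex k) (hs : y ∈ s.dom) (ht : y ∈ t.dom),
      P.act (t.toFun ⟨y, ht⟩) (g y) = s.toFun ⟨y, hs⟩) →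
    x ∈ s.dom → x ∈ t.dom → ∀ v : Fin k → ℝ,
      A s x v = Ad E (g x)⁻¹ (A t x v) + logDeriv E g x v

theorem isPullbackForm_iff {A : FormFamily P.proj E} {A' : FormFamily P'.proj E}
    {f : Simplex k → Simplex n} {Φ : P.Total → P'.Total} :
    IsPullbackForm A A' f Φ ↔ ∀ x, PullAt A A' f Φ x :=
  ⟨fun h x s hs t ht g e hx hx' v => h s hs t ht g e x hx hx' v,
    fun h s hs t ht g e x hx hx' v => h x s hs t ht g e hx hx' v⟩

theorem Connection.gaugeAt (D : Connection P) (x : Simplex k) : GaugeAt D.form x := by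
  intro s hs t ht g e hx hx' v
  have h := D.gauge s hs t ht g e x hx hx' v
  rwa [tangentMap_id] at h

theorem act_left_cancel {p : P.Total} {g h : G} (e : P.act p g = P.act p h) : g = h :=
  (P.existsUnique_act p (P.act p h) (P.proj_act p h).symm).unique e rfl

/-- To be a pull-back can be checked in one pair of local sections which correspond to each
other. -/
theorem pullAt_of_adapted {A : FormFamily P.proj E} {A' : FormFamily P'.proj E}
    {θ : Fin (k + 1) →o Fin (n + 1)} {Φ : P.Total → P'.Total}
    (hΦ : IsBundleMap P P' (affine θ) Φ) {x : Simplex k} (hA : GaugeAt A x)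
    (hA' : GaugeAt A' (affine θ x)) {s : LocalSection P.proj} (hs : s ∈ P.sections)
    {t : LocalSection P'.proj} (ht : t ∈ P'.sections) (hxs : x ∈ s.dom)
    (hxt : affine θ x ∈ t.dom)
    (had : ∀ (y : Simplex k) (hs : y ∈ s.dom) (ht : affine θ y ∈ t.dom),
      Φ (s.toFun ⟨y, hs⟩) = t.toFun ⟨affine θ y, ht⟩)
    (h : ∀ v, A s x v = A' t (affine θ x) (affineLin θ v)) : PullAt A A' (affine θ) Φ x := by
  intro s₁ hs₁ t₁ ht₁ g e hx₁ hx₁' v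
  obtain ⟨a, ha, ha'⟩ := P.compatible s hs s₁ hs₁
  obtain ⟨b, hb, hb'⟩ := P'.compatible t ht t₁ ht₁
  have hc : Continuous (affine θ) := (affine θ).2.1
  have hev : ∀ᶠ y in 𝓝 x, b (affine θ y) * g y = a y := by
    filter_upwards [s.dom.2.mem_nhds hxs, s₁.dom.2.mem_nhds hx₁,
      (t.dom.2.preimage hc).mem_nhds hxt, (t₁.dom.2.preimage hc).mem_nhds hx₁'] with y h1 h2 h3 h4
    refine act_left_cancel (P := P') (p := t.toFun ⟨affine θ y, h3⟩) ?_
    rw [← P'.act_mul, hb' _ h3 h4, e y h2 h4, ← ha' y h1 h2, hΦ.map_act, had y h1 h3]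
  have hb1 : SmoothOnTo (simplexModel k) E {x} fun y => b (affine θ y) :=
    SmoothOnTo.point_affine (hb.point ⟨hxt, hx₁'⟩)
  have hg : SmoothOnTo (simplexModel k) E {x} g :=
    (hb1.inv.mul (ha.point ⟨hxs, hx₁⟩)).point_congr (hev.mono fun y hy => by
      rw [← hy, inv_mul_cancel_left])
  rw [hA s₁ hs₁ s hs a (fun y h1 h2 => ha' y h2 h1) hx₁ hxs, h,
    logDeriv_congr (hev.mono fun y hy => hy.symm), logDeriv_mul hb1 hg,
    logDeriv_affine (hb.point ⟨hxt, hx₁'⟩), tangentMap_affine,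
    hA' t₁ ht₁ t ht b (fun y h1 h2 => hb' y h2 h1) hx₁' hxt, ← hev.self_of_nhds, mul_inv_rev,
    Ad_mul, Ad_add, add_assoc]

/-- In corresponding local sections, pull-backs are pull-backs of one-forms, without a gauge
transformation. -/
theorem PullAt.adapted {A : FormFamily P.proj E} {A' : FormFamily P'.proj E}
    {θ : Fin (k + 1) →o Fin (n + 1)} {Φ : P.Total → P'.Total} {x : Simplex k}
    (h : PullAt A A' (affine θ) Φ x) {s : LocalSection P.proj} (hs : s ∈ P.sections)
    {t : LocalSection P'.proj} (ht : t ∈ P'.sections) (hxs : x ∈ s.dom)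
    (hxt : affine θ x ∈ t.dom)
    (had : ∀ (y : Simplex k) (hs : y ∈ s.dom) (ht : affine θ y ∈ t.dom),
      Φ (s.toFun ⟨y, hs⟩) = t.toFun ⟨affine θ y, ht⟩) (v : Fin k → ℝ) :
    A s x v = A' t (affine θ x) (affineLin θ v) := by
  have := h s hs t ht (fun _ => 1) (fun y h1 h2 => by rw [P'.act_one, had]) hxs hxt v
  rwa [logDeriv_const, inv_one, Ad_one, add_zero, tangentMap_affine] at this

/-- Smooth local sections can be pulled back along bundle maps. -/
theorem exists_adapted {f : Simplex k → Simplex n} (hf : Continuous f) {Φ : P.Total → P'.Total}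
    (hΦ : IsBundleMap P P' f Φ) {t : LocalSection P'.proj} (ht : t ∈ P'.sections) :
    ∃ s ∈ P.sections, (∀ y, y ∈ s.dom ↔ f y ∈ t.dom) ∧
      ∀ (y : Simplex k) (hs : y ∈ s.dom) (ht : f y ∈ t.dom),
        Φ (s.toFun ⟨y, hs⟩) = t.toFun ⟨f y, ht⟩ := by
  have hex : ∀ y : Simplex k, ∀ h : f y ∈ t.dom, ∃ p : P.Total, P.proj p = y ∧
      Φ p = t.toFun ⟨f y, h⟩ := by
    intro y h
    obtain ⟨r, -, hyr⟩ := P.exists_section y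
    obtain ⟨g, hg, -⟩ := P'.existsUnique_act (Φ (r.toFun ⟨y, hyr⟩)) (t.toFun ⟨f y, h⟩) (by
      rw [hΦ.proj_map, r.proj_toFun, t.proj_toFun])
    exact ⟨P.act (r.toFun ⟨y, hyr⟩) g, by rw [P.proj_act, r.proj_toFun], by rw [hΦ.map_act, hg]⟩
  choose p hp hpΦ using hex
  set s : LocalSection P.proj := ⟨⟨f ⁻¹' (t.dom : Set (Simplex n)), t.dom.2.preimage hf⟩,
    fun y => p y.1 y.2, fun y => hp y.1 y.2⟩ with hs
  refine ⟨s, P.maximal _ fun r hr => ?_, fun y => Iff.rfl, fun y h1 _ => hpΦ y h1⟩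
  obtain ⟨g, hg, hg'⟩ := hΦ.smooth r hr t ht
  refine ⟨fun y => (g y)⁻¹, hg.inv, fun y h1 h2 => ?_⟩
  obtain ⟨a, ha, -⟩ := P.existsUnique_act (r.toFun ⟨y, h1⟩) (p y h2) (by
    rw [r.proj_toFun, hp])
  have h3 : P'.act (t.toFun ⟨f y, h2⟩) (g y * a) = P'.act (t.toFun ⟨f y, h2⟩) 1 := by
    rw [← P'.act_mul, hg' y h1 h2, ← hΦ.map_act, ha, hpΦ, P'.act_one]
  have h4 : (g y)⁻¹ = a := (eq_inv_of_mul_eq_one_right (act_left_cancel h3)).symm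
  exact (congrArg _ h4).trans ha

/-- Pull-back is functorial: if `B` is the pull-back of `C`, then `A` is the pull-back of `C` if and only if
it is the pull-back of `B`. -/
theorem PullAt.trans {m : ℕ} {P'' : PrincipalBundle (simplexModel m) E G (Simplex m)}
    (A : Connection P) (A' : Connection P') (A'' : Connection P'')
    {θ : Fin (k + 1) →o Fin (n + 1)} {η : Fin (n + 1) →o Fin (m + 1)} {Φ : P.Total → P'.Total}
    {Ψ : P'.Total → P''.Total} (hΦ : IsBundleMap P P' (affine θ) Φ)
    (hΨ : IsBundleMap P' P'' (affine η) Ψ) {Ω : P.Total → P''.Total}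
    (hΩ : IsBundleMap P P'' (affine (η.comp θ)) Ω) (he : ∀ p, Ω p = Ψ (Φ p))
    (h' : IsPullbackForm A'.form A''.form (affine η) Ψ) :
    IsPullbackForm A.form A''.form (affine (η.comp θ)) Ω ↔
      IsPullbackForm A.form A'.form (affine θ) Φ := by
  simp only [isPullbackForm_iff] at h' ⊢
  refine forall_congr' fun x => ?_
  have hx : affine (η.comp θ) x = affine η (affine θ x) := by
    rw [affine_comp]
    rfl
  obtain ⟨r, hr, hxr⟩ := P''.exists_section (affine (η.comp θ) x)
  obtain ⟨t, ht, htd, htr⟩ := exists_adapted (affine η).2.1 hΨ hr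
  obtain ⟨s, hs, hsd, hst⟩ := exists_adapted (affine θ).2.1 hΦ ht
  have hxt : affine θ x ∈ t.dom := (htd _).2 (hx ▸ hxr)
  have hxs : x ∈ s.dom := (hsd x).2 hxt
  have hsr : ∀ (y : Simplex k) (h1 : y ∈ s.dom) (h2 : affine (η.comp θ) y ∈ r.dom),
      Ω (s.toFun ⟨y, h1⟩) = r.toFun ⟨affine (η.comp θ) y, h2⟩ := fun y h1 h2 => by
    have h3 : affine θ y ∈ t.dom := (hsd y).1 h1
    rw [he, hst y h1 h3, htr _ h3 ((htd _).1 h3)]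
    congr 2
    rw [affine_comp]
    rfl
  have key := (h' (affine θ x)).adapted ht hr hxt (hx ▸ hxr) htr
  refine ⟨fun h => ?_, fun h => ?_⟩
  · refine pullAt_of_adapted hΦ (A.gaugeAt x) (A'.gaugeAt _) hs ht hxs hxt hst fun v => ?_
    rw [h.adapted hs hr hxs hxr hsr, key, affineLin_comp, hx]
  · refine pullAt_of_adapted hΩ (A.gaugeAt x) (A''.gaugeAt _) hs hr hxs hxr hsr fun v => ?_
    rw [h.adapted hs ht hxs hxt hst, key, affineLin_comp, hx]

/-- Gauge transformation of smooth one-forms preserves smoothness. -/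
theorem smooth_gaugeTransform {g : Simplex n → G} {a : Simplex n → E} {x : Simplex n}
    (hg : SmoothOnTo (simplexModel n) E {x} g) (ha : SmoothOnTo (simplexModel n) E {x} a)
    (v : Fin n → ℝ) :
    SmoothOnTo (simplexModel n) E {x} fun y => Ad E (g y)⁻¹ (a y) + logDeriv E g y v := by
  rw [smoothOnTo_simplex_iff]
  rintro y rfl
  obtain ⟨F, hF, hgF⟩ := smoothOnTo_simplex_iff.1 hg y rfl
  obtain ⟨A, hA, haA⟩ := smoothOnTo_simplex_iff.1 ha y rfl
  obtain ⟨O, hO, hxO, hAO⟩ := smoothNear_self_iff.1 hA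
  obtain ⟨O₁, hO₁, hxO₁, h₁⟩ := smooth_Ad_apply hF.inv hO hxO hAO
  obtain ⟨O₂, hO₂, hxO₂, h₂⟩ := smooth_theta_const hF v
  refine ⟨fun z => Ad E (F z)⁻¹ (A z) + theta E F z v, smoothNear_self_iff.2 ⟨O₁ ∩ O₂, hO₁.inter hO₂,
    ⟨hxO₁, hxO₂⟩, (h₁.mono inter_subset_left).add (h₂.mono inter_subset_right)⟩, ?_⟩
  filter_upwards [hgF, haA, eventually_eventually_nhdsWithin.2 hgF,
    mem_nhdsWithin_of_mem_nhds hF.eventually, self_mem_nhdsWithin] with z h1 h2 h3 h4 hz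
  have hr : retract n z = ⟨z, hz⟩ := retract_coe ⟨z, hz⟩
  rw [h1, h2, hr, logDeriv_eq (F := F) h4 h3]

theorem SmoothOnTo.point_sum {ι : Type*} [Fintype ι] {f : ι → Simplex n → E} {x : Simplex n}
    (h : ∀ i, SmoothOnTo (simplexModel n) E {x} (f i)) :
    SmoothOnTo (simplexModel n) E {x} fun y => ∑ i, f i y := by
  rw [smoothOnTo_simplex_iff]
  rintro y rfl
  choose F hF hfF using fun i => smoothOnTo_simplex_iff.1 (h i) y rfl
  choose O hO hxO hs using fun i => smoothNear_self_iff.1 (hF i)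
  refine ⟨fun z => ∑ i, F i z, smoothNear_self_iff.2 ⟨⋂ i, O i, isOpen_iInter_of_finite hO,
    mem_iInter.2 hxO, CInftyOn.sum _ fun i _ => (hs i).mono (iInter_subset O i)⟩, ?_⟩
  filter_upwards [eventually_all.2 hfF] with z hz
  exact Finset.sum_congr rfl fun i _ => hz i

/-- A smooth function times a map which is smooth on the support of the function is smooth. -/
theorem SmoothOnTo.cutoff {χ : (Fin n → ℝ) → ℝ} (hχ : ContDiff ℝ ∞ χ) {f : Simplex n → E}
    {x : Simplex n} (h : x.1 ∈ tsupport χ → SmoothOnTo (simplexModel n) E {x} f) :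
    SmoothOnTo (simplexModel n) E {x} fun y => χ y.1 • f y := by
  rw [smoothOnTo_simplex_iff]
  rintro y rfl
  by_cases hy : y.1 ∈ tsupport χ
  · obtain ⟨F, hF, hfF⟩ := smoothOnTo_simplex_iff.1 (h hy) y rfl
    obtain ⟨O, hO, hxO, hs⟩ := smoothNear_self_iff.1 hF
    refine ⟨fun z => χ z • F z, smoothNear_self_iff.2 ⟨O, hO, hxO,
      CInftyOn.smul (CInftyOn.of_contDiffOn hO hχ.contDiffOn) hs⟩, ?_⟩
    filter_upwards [hfF, self_mem_nhdsWithin] with z hz hzS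
    have hr : retract n z = ⟨z, hzS⟩ := retract_coe ⟨z, hzS⟩
    rw [hz, hr]
  · refine ⟨fun _ => 0, smoothNear_self_iff.2 ⟨univ, isOpen_univ, mem_univ _, CInftyOn.const 0 _⟩, ?_⟩
    have h0 := notMem_tsupport_iff_eventuallyEq.1 hy
    filter_upwards [mem_nhdsWithin_of_mem_nhds h0, self_mem_nhdsWithin] with z hz hzS
    have hr : retract n z = ⟨z, hzS⟩ := retract_coe ⟨z, hzS⟩
    have hz' : χ z = 0 := hz
    rw [hr, hz', zero_smul]

open Classical in
/-- A smooth one-form determines a connection over the domain of a local section. -/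
theorem exists_induced {t : LocalSection P.proj} (ht : t ∈ P.sections)
    (a : Simplex k → (Fin k → ℝ) →ₗ[ℝ] E)
    (ha : ∀ v, ∀ x ∈ t.dom, SmoothOnTo (simplexModel k) E {x} fun x => a x v) :
    ∃ F : FormFamily P.proj E,
      (∀ s ∈ P.sections, ∀ v, ∀ x ∈ s.dom, x ∈ t.dom →
        SmoothOnTo (simplexModel k) E {x} fun x => F s x v) ∧
      (∀ x ∈ t.dom, GaugeAt F x) ∧ ∀ x ∈ t.dom, ∀ v, F t x v = a x v := by
  choose g hg hgt using fun s : P.sections => P.compatible t ht s.1 s.2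
  refine ⟨fun s x => if h : s ∈ P.sections then
    (AdL E (g ⟨s, h⟩ x)⁻¹ : E →ₗ[ℝ] E) ∘ₗ a x + (fderivWithin ℝ (fun y => chartAt E (1 : G)
      ((g ⟨s, h⟩ x)⁻¹ * g ⟨s, h⟩ (retract k y))) (Simplex k) x : (Fin k → ℝ) →ₗ[ℝ] E) else 0,
    fun s hs v x hx hxt => ?_, fun x hxt s hs s' hs' h e hx hx' v => ?_, fun x hxt v => ?_⟩
  · simp only [dif_pos hs]
    exact smooth_gaugeTransform ((hg ⟨s, hs⟩).point ⟨hxt, hx⟩) (ha v x hxt) v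
  · simp only [dif_pos hs, dif_pos hs']
    change Ad E _ (a x v) + logDeriv E _ x v = Ad E _ (Ad E _ (a x v) + logDeriv E _ x v) + _
    have hev : ∀ᶠ y in 𝓝 x, g ⟨s', hs'⟩ y * h y = g ⟨s, hs⟩ y := by
      filter_upwards [s.dom.2.mem_nhds hx, s'.dom.2.mem_nhds hx', t.dom.2.mem_nhds hxt]
        with y h1 h2 h3
      refine act_left_cancel (P := P) (p := t.toFun ⟨y, h3⟩) ?_
      rw [← P.act_mul, hgt ⟨s', hs'⟩ y h3 h2, e y h1 h2, hgt ⟨s, hs⟩ y h3 h1]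
    have hg' := (hg ⟨s', hs'⟩).point ⟨hxt, hx'⟩
    have hh : SmoothOnTo (simplexModel k) E {x} h :=
      (hg'.inv.mul ((hg ⟨s, hs⟩).point ⟨hxt, hx⟩)).point_congr (hev.mono fun y hy => by
        rw [← hy, inv_mul_cancel_left])
    rw [logDeriv_congr (hev.mono fun y hy => hy.symm), logDeriv_mul hg' hh, ← hev.self_of_nhds,
      mul_inv_rev, Ad_mul, Ad_add, add_assoc]
  · simp only [dif_pos ht]
    change Ad E _ (a x v) + logDeriv E _ x v = _
    have hev : ∀ᶠ y in 𝓝 x, g ⟨t, ht⟩ y = 1 := by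
      filter_upwards [t.dom.2.mem_nhds hxt] with y hy
      refine act_left_cancel (P := P) (p := t.toFun ⟨y, hy⟩) ?_
      rw [hgt ⟨t, ht⟩ y hy hy, P.act_one]
    rw [logDeriv_congr (g := fun _ => 1) hev, logDeriv_const, hev.self_of_nhds, inv_one, Ad_one,
      add_zero]

theorem sum_gaugeTransform {ι : Type*} [Fintype ι] {c : ι → ℝ} (hc : ∑ i, c i = 1) {u w : ι → E}
    {g : G} {θ : E} (h : ∀ i, c i ≠ 0 → u i = Ad E g (w i) + θ) :
    ∑ i, c i • u i = Ad E g (∑ i, c i • w i) + θ := by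
  have h1 : ∀ i, c i • u i = c i • AdL E g (w i) + c i • θ := fun i => by
    by_cases hi : c i = 0
    · simp [hi]
    · rw [h i hi, smul_add, AdL_apply]
  simp only [h1, Finset.sum_add_distrib, ← Finset.sum_smul, hc, one_smul, ← AdL_apply (E := E) g, map_sum,
    map_smul]

theorem isCompact_simplex (n : ℕ) : IsCompact (Simplex n) := by
  refine isCompact_Icc.of_isClosed_subset (s := Icc (0 : Fin n → ℝ) 1) ?_ fun x hx =>
    ⟨hx.1, fun i => ?_⟩
  · have h2 : Simplex n = {x | (retract n x : Fin n → ℝ) = x} := by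
      ext x
      exact ⟨fun hx => congrArg Subtype.val (retract_coe ⟨x, hx⟩), fun hx => by
        have h3 : (retract n x : Fin n → ℝ) = x := hx
        rw [← h3]
        exact (retract n x).2⟩
    rw [h2]
    exact isClosed_eq (continuous_subtype_val.comp (continuous_retract n)) continuous_id
  · exact (Finset.single_le_sum (fun j _ => hx.1 j) (Finset.mem_univ i)).trans hx.2

/-- Local connections can be glued by a partition of unity. At every point, the resulting
connection is an affine combination of the local ones. -/
theorem exists_connection (P : PrincipalBundle (simplexModel k) E G (Simplex k))
    (good : FormFamily P.proj E → Simplex k → Prop)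
    (h : ∀ x : Simplex k, ∃ (O : Set (Fin k → ℝ)) (F : FormFamily P.proj E), IsOpen O ∧ x.1 ∈ O ∧
      (∀ s ∈ P.sections, ∀ v, ∀ y ∈ s.dom, y.1 ∈ O →
        SmoothOnTo (simplexModel k) E {y} fun y => F s y v) ∧
      ∀ y : Simplex k, y.1 ∈ O → GaugeAt F y ∧ good F y) :
    ∃ D : Connection P, ∀ y, ∃ (ι : Type) (_ : Fintype ι) (c : ι → ℝ)
      (F : ι → FormFamily P.proj E), ∑ i, c i = 1 ∧
      (∀ s v, D.form s y v = ∑ i, c i • F i s y v) ∧ ∀ i, c i ≠ 0 → good (F i) y := by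
  choose O F hO hxO hs hgood using h
  obtain ⟨T, hT⟩ := (isCompact_simplex k).elim_nhds_subcover' (fun x hx => O ⟨x, hx⟩)
    fun x hx => (hO ⟨x, hx⟩).mem_nhds (hxO ⟨x, hx⟩)
  obtain ⟨f, hf⟩ := SmoothPartitionOfUnity.exists_isSubordinate (modelWithCornersSelf ℝ (Fin k → ℝ))
    (isCompact_simplex k).isClosed (fun i : T => O i.1) (fun i => hO i.1) fun x hx => by
      obtain ⟨y, hy, hxy⟩ := mem_iUnion₂.1 (hT hx)
      exact mem_iUnion.2 ⟨⟨y, hy⟩, hxy⟩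
  have hsm : ∀ i, ContDiff ℝ ∞ (f i) := fun i => (f i).contMDiff.contDiff
  have hsum : ∀ y : Simplex k, ∑ i, f i y.1 = 1 := fun y => by
    rw [← finsum_eq_sum_of_fintype]
    exact f.sum_eq_one y.2
  have hmem : ∀ i (y : Simplex k), f i y.1 ≠ 0 → y.1 ∈ O i.1 := fun i y hy =>
    hf i (subset_tsupport _ hy)
  have hform : ∀ s y v, (∑ i : T, f i y.1 • F i.1 s y) v = ∑ i : T, f i y.1 • F i.1 s y v :=
    fun s y v => by simp [LinearMap.sum_apply]
  refine ⟨⟨fun s y => ∑ i : T, f i y.1 • F i.1 s y, fun s hs' v => ?_,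
    fun s hs' t ht g e x hx hx' v => ?_⟩, fun y => ⟨T, inferInstance, fun i => f i y.1,
      fun i => F i.1, hsum y, fun s v => hform s y v, fun i hi => (hgood i.1 y (hmem i y hi)).2⟩⟩
  · refine smoothOnTo_of_point fun x hx => ?_
    simp only [hform]
    exact SmoothOnTo.point_sum fun i => SmoothOnTo.cutoff (hsm i) fun hi =>
      hs i.1 s hs' v x hx (hf i hi)
  · rw [tangentMap_id, hform, hform]
    exact sum_gaugeTransform (hsum x) fun i hi =>
      (hgood i.1 x (hmem i x hi)).1 s hs' t ht g e hx hx' v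

/-- Connections can be pulled back. -/
theorem exists_pullback {θ : Fin (k + 1) →o Fin (n + 1)} {Φ : P.Total → P'.Total}
    (hΦ : IsBundleMap P P' (affine θ) Φ) (D' : Connection P') :
    ∃ D : Connection P, IsPullbackForm D.form D'.form (affine θ) Φ := by
  obtain ⟨D, hD⟩ := exists_connection P (fun F y => PullAt F D'.form (affine θ) Φ y) fun x => by
    obtain ⟨t, ht, hxt⟩ := P'.exists_section (affine θ x)
    obtain ⟨s, hs, hsd, hst⟩ := exists_adapted (affine θ).2.1 hΦ ht
    obtain ⟨F, hF1, hF2, hF3⟩ := exists_induced hs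
      (fun y => D'.form t (affine θ y) ∘ₗ (affineLin θ : (Fin k → ℝ) →ₗ[ℝ] Fin n → ℝ))
      fun v y hy => (SmoothOnTo.comp (affine θ).2 (D'.smooth t ht (affineLin θ v))).point
        ((hsd y).1 hy)
    have hO : ∀ y : Simplex k, y.1 ∈ retract k ⁻¹' (s.dom : Set (Simplex k)) ↔ y ∈ s.dom := fun y => by
      rw [mem_preimage, retract_coe]
      rfl
    refine ⟨retract k ⁻¹' (s.dom : Set (Simplex k)), F, s.dom.2.preimage (continuous_retract k),
      (hO x).2 ((hsd x).2 hxt), fun r hr v y hy hy' => hF1 r hr v y hy ((hO y).1 hy'),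
      fun y hy => ?_⟩
    have hys := (hO y).1 hy
    exact ⟨hF2 y hys, pullAt_of_adapted hΦ (hF2 y hys) (D'.gaugeAt _) hs ht hys ((hsd y).1 hys) hst
      fun v => hF3 y hys v⟩
  refine ⟨D, isPullbackForm_iff.2 fun y s hs t ht g e hy hy' v => ?_⟩
  obtain ⟨ι, _, c, F, hc, hDF, hgood⟩ := hD y
  rw [hDF, sum_gaugeTransform (u := fun i => F i s y v) hc fun i hi =>
    hgood i hi s hs t ht g e hy hy' v, ← Finset.sum_smul, hc, one_smul]

end LocalConnections

/-! ### Extending connections from the boundary of a simplex -/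

section Extension

open SimplexMap PrincipalBundle

universe v v₁ b u

variable {E : Type b} [AddCommGroup E] [Module ℝ E] [TopologicalSpace E]
  [IsTopologicalAddGroup E] [ContinuousSMul ℝ E] [T2Space E] [LocallyConvexSpace ℝ E]
  {G : Type u} [Group G] [TopologicalSpace G] [ChartedSpace E G] [SmoothLieGroup E G]
  {k m n : ℕ}

theorem vertexMap_mem (θ : Fin (k + 1) → Fin (n + 1)) (x : Simplex k) :
    vertexMap θ x.1 ∈ Simplex n := by
  have h : ∀ j, 0 ≤ bary (vertexMap θ x.1) j := fun j => by
    rw [bary_vertexMap]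
    exact Finset.sum_nonneg fun i _ => bary_nonneg x i
  refine ⟨fun j => ?_, ?_⟩
  · simpa [bary] using h j.succ
  · simpa [bary] using h 0

theorem contDiff_vertexMap (θ : Fin (k + 1) → Fin (n + 1)) : ContDiff ℝ ∞ (vertexMap θ) := by
  have h : vertexMap θ = fun x => vertexMap θ 0 + LinearMap.toContinuousLinearMap (vertexLin θ) x :=
    funext (vertexMap_eq θ)
  rw [h]
  exact contDiff_const.add (ContinuousLinearMap.contDiff _)

/-- The affine map of simplices of an arbitrary map of the vertices. -/
def vertexSimplexMap (θ : Fin (k + 1) → Fin (n + 1)) : SimplexMap k n :=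
  ⟨fun x => ⟨vertexMap θ x.1, vertexMap_mem θ x⟩, by
    refine ⟨Continuous.subtype_mk
      ((contDiff_vertexMap θ).continuous.comp continuous_subtype_val) _, fun x =>
      ⟨vertexMap θ, univ, isOpen_univ, mem_univ _, (contDiff_vertexMap θ).contDiffOn, ?_⟩⟩
    filter_upwards [self_mem_nhdsWithin] with y hy
    rw [range_simplexModel] at hy
    have hr : (extChartAt (simplexModel k) x).symm y = ⟨y, hy⟩ := retract_coe ⟨y, hy⟩
    rw [hr]
    rfl⟩

theorem vertexSimplexMap_comp (θ : Fin (m + 1) → Fin (n + 1)) (η : Fin (k + 1) → Fin (m + 1))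
    (x : Simplex k) :
    vertexSimplexMap θ (vertexSimplexMap η x) = vertexSimplexMap (θ ∘ η) x := by
  refine Subtype.ext (bary_injective ?_)
  change bary (vertexMap θ (vertexMap η x.1)) = bary (vertexMap (θ ∘ η) x.1)
  simp only [bary_vertexMap, push_push]

theorem vertexSimplexMap_id (x : Simplex n) : vertexSimplexMap id x = x := by
  refine Subtype.ext (bary_injective ?_)
  change bary (vertexMap id x.1) = bary x.1
  rw [bary_vertexMap, push_id]

theorem vertexLin_comp (θ : Fin (m + 1) → Fin (n + 1)) (η : Fin (k + 1) → Fin (m + 1))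
    (v : Fin k → ℝ) : vertexLin θ (vertexLin η v) = vertexLin (θ ∘ η) v := by
  refine baryLin_injective ?_
  simp only [baryLin_vertexLin, push_push]

theorem vertexLin_id (v : Fin n → ℝ) : vertexLin id v = v := by
  refine baryLin_injective ?_
  rw [baryLin_vertexLin, push_id]

theorem vertexSimplexMap_injective {θ : Fin (k + 1) → Fin (n + 1)} (hθ : Function.Injective θ) :
    Function.Injective (vertexSimplexMap θ : Simplex k → Simplex n) := by
  intro x y h
  have h1 := congrArg (vertexSimplexMap (Function.invFun θ)) h
  rwa [vertexSimplexMap_comp, vertexSimplexMap_comp, Function.invFun_comp hθ, vertexSimplexMap_id,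
    vertexSimplexMap_id] at h1

theorem vertexLin_injective {θ : Fin (k + 1) → Fin (n + 1)} (hθ : Function.Injective θ) :
    Function.Injective (vertexLin θ) := by
  intro x y h
  have h1 := congrArg (vertexLin (Function.invFun θ)) h
  rwa [vertexLin_comp, vertexLin_comp, Function.invFun_comp hθ, vertexLin_id, vertexLin_id] at h1

/-- The pull-back of a one-form along the affine map of a map of vertices. -/
def pullOne (θ : Fin (k + 1) → Fin (n + 1)) (a : Simplex n → (Fin n → ℝ) →ₗ[ℝ] E) (x : Simplex k) :
    (Fin k → ℝ) →ₗ[ℝ] E := a (vertexSimplexMap θ x) ∘ₗ vertexLin θ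

/-- The smoothness of a one-form on a simplex. -/
def SmoothOne (a : Simplex n → (Fin n → ℝ) →ₗ[ℝ] E) : Prop :=
  ∀ v x, SmoothOnTo (simplexModel n) E {x} fun x => a x v

theorem SmoothOne.pullOne {a : Simplex n → (Fin n → ℝ) →ₗ[ℝ] E} (ha : SmoothOne a)
    (θ : Fin (k + 1) → Fin (n + 1)) : SmoothOne (pullOne θ a) := fun v _ =>
  SmoothOnTo.point_affine (σ := vertexSimplexMap θ) (ha (vertexLin θ v) _)

theorem SmoothOne.add_sub {a b c : Simplex n → (Fin n → ℝ) →ₗ[ℝ] E} (ha : SmoothOne a)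
    (hb : SmoothOne b) (hc : SmoothOne c) : SmoothOne fun x => a x + (b x - c x) := fun v _ => by
  rw [smoothOnTo_simplex_iff]
  rintro y rfl
  obtain ⟨A, hA, hA'⟩ := smoothOnTo_simplex_iff.1 (ha v y) y rfl
  obtain ⟨B, hB, hB'⟩ := smoothOnTo_simplex_iff.1 (hb v y) y rfl
  obtain ⟨C, hC, hC'⟩ := smoothOnTo_simplex_iff.1 (hc v y) y rfl
  obtain ⟨O₁, hO₁, hy₁, h₁⟩ := smoothNear_self_iff.1 hA
  obtain ⟨O₂, hO₂, hy₂, h₂⟩ := smoothNear_self_iff.1 hB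
  obtain ⟨O₃, hO₃, hy₃, h₃⟩ := smoothNear_self_iff.1 hC
  refine ⟨fun z => A z + (B z - C z), smoothNear_self_iff.2 ⟨O₁ ∩ (O₂ ∩ O₃),
    hO₁.inter (hO₂.inter hO₃), ⟨hy₁, hy₂, hy₃⟩, (h₁.mono inter_subset_left).add
      ((h₂.mono fun z hz => hz.2.1).sub (h₃.mono fun z hz => hz.2.2))⟩, ?_⟩
  filter_upwards [hA', hB', hC'] with z h1 h2 h3
  rw [LinearMap.add_apply, LinearMap.sub_apply, h1, h2, h3]

/-- Compatible smooth one-forms on some, but not all, of the faces of a simplex extend to the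
simplex. The faces are treated one after the other. To make the extension right on the face
opposite to the vertex `j`, the error is pulled back along the projection which moves the weight of
`j` to a vertex `i₀` whose opposite face is not prescribed; this does not disturb the other faces. -/
theorem exists_oneForm_extension {i₀ : Fin (m + 2)} {J : Finset (Fin (m + 2))} (hJ : i₀ ∉ J)
    {a : Fin (m + 2) → Simplex m → (Fin m → ℝ) →ₗ[ℝ] E} (ha : ∀ i, SmoothOne (a i))
    (hc : ∀ i j y y' v v', vertexSimplexMap i.succAbove y = vertexSimplexMap j.succAbove y' →
      vertexLin i.succAbove v = vertexLin j.succAbove v' → a i y v = a j y' v') :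
    ∃ c : Simplex (m + 1) → (Fin (m + 1) → ℝ) →ₗ[ℝ] E, SmoothOne c ∧
      ∀ i ∈ J, ∀ y v, c (vertexSimplexMap i.succAbove y) (vertexLin i.succAbove v) = a i y v := by
  induction J using Finset.induction_on with
  | empty => exact ⟨0, fun v x => by
      rw [smoothOnTo_simplex_iff]
      exact fun y _ => ⟨fun _ => 0, smoothNear_self_iff.2 ⟨univ, isOpen_univ, mem_univ _,
        CInftyOn.const 0 _⟩, Eventually.of_forall fun _ => rfl⟩, by simp⟩
  | insert j J hj ih =>
    rw [Finset.mem_insert, not_or] at hJ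
    obtain ⟨c, hcs, hca⟩ := ih hJ.2
    have hτ : ∀ l : Fin (m + 2), ∃ q, j.succAbove q = if l = j then i₀ else l := fun l => by
      split_ifs with h
      · exact Fin.exists_succAbove_eq hJ.1
      · exact Fin.exists_succAbove_eq h
    choose τ hτ using hτ
    have hτj : τ ∘ j.succAbove = id := by
      funext q
      refine Fin.succAbove_right_injective (p := j) ?_
      rw [Function.comp_apply, hτ, if_neg (Fin.succAbove_ne j q), id]
    refine ⟨fun x => c x + (pullOne τ (a j) x - pullOne (j.succAbove ∘ τ) c x),
      hcs.add_sub ((ha j).pullOne τ) (hcs.pullOne _), fun i hi y v => ?_⟩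
    simp only [pullOne, LinearMap.add_apply, LinearMap.sub_apply, LinearMap.comp_apply,
      vertexSimplexMap_comp, vertexLin_comp, Function.comp_assoc]
    rcases Finset.mem_insert.1 hi with rfl | hi
    · simp only [hτj, Function.comp_id, vertexSimplexMap_id, vertexLin_id]
      abel
    · have hij : i ≠ j := fun h => hj (h ▸ hi)
      have hi₀ : i₀ ≠ i := fun h => hJ.2 (h ▸ hi)
      have hρ : ∀ l, ∃ q, i.succAbove q = j.succAbove (τ (i.succAbove l)) := fun l => by
        refine Fin.exists_succAbove_eq ?_
        rw [hτ]
        split_ifs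
        exacts [hi₀, Fin.succAbove_ne i l]
      choose ρ hρ using hρ
      have he : j.succAbove ∘ τ ∘ i.succAbove = i.succAbove ∘ ρ := funext fun l => (hρ l).symm
      rw [he, ← vertexSimplexMap_comp i.succAbove ρ, ← vertexLin_comp i.succAbove ρ, hca i hi, hca i hi,
        hc i j (vertexSimplexMap ρ y) (vertexSimplexMap (τ ∘ i.succAbove) y) (vertexLin ρ v)
          (vertexLin (τ ∘ i.succAbove) v), sub_self, add_zero]
      · simp only [vertexSimplexMap_comp, he]
      · simp only [vertexLin_comp, he]

/-- The inclusion of the face opposite to the vertex `i`. -/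
def faceHom (i : Fin (m + 2)) : Fin (m + 1) →o Fin (m + 2) := (Fin.succAboveOrderEmb i).toOrderHom

/-- Compatible connections on the faces of a simplex extend to the simplex. -/
theorem exists_connection_extension (P : PrincipalBundle (simplexModel (m + 1)) E G (Simplex (m + 1)))
    {Q : Fin (m + 2) → PrincipalBundle (simplexModel m) E G (Simplex m)}
    {Φ : ∀ i, (Q i).Total → P.Total} (hΦ : ∀ i, IsBundleMap (Q i) P (affine (faceHom i)) (Φ i))
    (D : ∀ i, Connection (Q i))
    (hD : ∀ t ∈ P.sections, ∀ i j, ∀ s ∈ (Q i).sections, ∀ s' ∈ (Q j).sections,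
      (∀ (y : Simplex m) (hs : y ∈ s.dom) (ht : affine (faceHom i) y ∈ t.dom),
        Φ i (s.toFun ⟨y, hs⟩) = t.toFun ⟨affine (faceHom i) y, ht⟩) →
      (∀ (y : Simplex m) (hs : y ∈ s'.dom) (ht : affine (faceHom j) y ∈ t.dom),
        Φ j (s'.toFun ⟨y, hs⟩) = t.toFun ⟨affine (faceHom j) y, ht⟩) →
      ∀ y y' v v', y ∈ s.dom → y' ∈ s'.dom → affine (faceHom i) y ∈ t.dom →
        affine (faceHom i) y = affine (faceHom j) y' →
        affineLin (faceHom i) v = affineLin (faceHom j) v' →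
        (D i).form s y v = (D j).form s' y' v') :
    ∃ C : Connection P, ∀ i, IsPullbackForm (D i).form C.form (affine (faceHom i)) (Φ i) := by
  obtain ⟨C, hC⟩ := exists_connection P (fun F y => ∀ i z, affine (faceHom i) z = y →
      PullAt (D i).form F (affine (faceHom i)) (Φ i) z) fun x => by
    obtain ⟨t, ht, hxt⟩ := P.exists_section x
    choose s hs hsd hst using fun i => exists_adapted (affine (faceHom i)).2.1 (hΦ i) ht
    obtain ⟨i₀, hi₀⟩ : ∃ i₀, bary x.1 i₀ ≠ 0 := by
      by_contra! h
      have h1 := sum_bary x.1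
      simp only [h, Finset.sum_const_zero] at h1
      exact zero_ne_one h1
    -- a cut-off function, which is one near `x` and supported in the domain of `t`
    have hU : IsOpen (retract (m + 1) ⁻¹' (t.dom : Set (Simplex (m + 1)))) :=
      t.dom.2.preimage (continuous_retract _)
    have hmemU : ∀ y : Simplex (m + 1),
        y.1 ∈ retract (m + 1) ⁻¹' (t.dom : Set (Simplex (m + 1))) ↔ y ∈ t.dom := fun y => by
      rw [mem_preimage, retract_coe]
      rfl
    obtain ⟨ε, hε, hεU⟩ := Metric.isOpen_iff.1 hU x.1 ((hmemU x).2 hxt)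
    set χ : ContDiffBump x.1 := ⟨ε / 4, ε / 2, by positivity, by linarith⟩ with hχ
    have hχU : ∀ y : Simplex (m + 1), y.1 ∈ tsupport χ → y ∈ t.dom := fun y hy => by
      rw [χ.tsupport_eq] at hy
      exact (hmemU y).1 (hεU (Metric.closedBall_subset_ball (half_lt_self hε) hy))
    set a : Fin (m + 2) → Simplex m → (Fin m → ℝ) →ₗ[ℝ] E := fun i y =>
      χ (affineFun (faceHom i) y.1) • (D i).form (s i) y with ha
    have hasm : ∀ i, SmoothOne (a i) := fun i v y => by
      refine SmoothOnTo.cutoff (χ := fun y => χ (affineFun (faceHom i) y))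
        (χ.contDiff.comp (contDiff_affineFun _)) fun hy => ?_
      refine ((D i).smooth (s i) (hs i) v).point ((hsd i y).2 (hχU _ ?_))
      exact tsupport_comp_subset_preimage χ (contDiff_affineFun (faceHom i)).continuous hy
    have hac : ∀ i j y y' v v', vertexSimplexMap i.succAbove y = vertexSimplexMap j.succAbove y' →
        vertexLin i.succAbove v = vertexLin j.succAbove v' → a i y v = a j y' v' := by
      intro i j y y' v v' hy hv
      have hy' : affine (faceHom i) y = affine (faceHom j) y' := hy
      have hy'' : affineFun (faceHom i) y.1 = affineFun (faceHom j) y'.1 := congrArg Subtype.val hy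
      simp only [ha, LinearMap.smul_apply, hy'']
      by_cases h0 : affine (faceHom j) y' ∈ t.dom
      · rw [hD t ht i j (s i) (hs i) (s j) (hs j) (hst i) (hst j) y y' v v'
          ((hsd i y).2 (hy' ▸ h0)) ((hsd j y').2 h0) (hy' ▸ h0) hy'
          (by simp only [affineLin_eq_vertexLin]; exact hv)]
      · have : χ (affineFun (faceHom j) y'.1) = 0 := by
          by_contra h
          exact h0 (hχU _ (subset_tsupport _ h))
        rw [this, zero_smul, zero_smul]
    obtain ⟨c, hcs, hca⟩ := exists_oneForm_extension (i₀ := i₀)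
      (J := Finset.univ.filter fun i => bary x.1 i = 0) (by simp [hi₀]) hasm hac
    obtain ⟨F, hF1, hF2, hF3⟩ := exists_induced ht c fun v y _ => hcs v y
    have hev : ∀ᶠ z in 𝓝 x.1, (retract (m + 1) z ∈ t.dom ∧ χ z = 1) ∧
        ∀ i, bary x.1 i ≠ 0 → bary z i ≠ 0 := by
      refine ((hU.eventually_mem ((hmemU x).2 hxt)).and ?_).and (eventually_all.2 fun i => ?_)
      · filter_upwards [Metric.closedBall_mem_nhds x.1 χ.rIn_pos] with z hz
        exact χ.one_of_mem_closedBall hz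
      · by_cases hi : bary x.1 i = 0
        · exact Eventually.of_forall fun z h => absurd hi h
        · have hcont : Continuous fun z : Fin (m + 1) → ℝ => bary z i :=
            (continuous_apply i).comp (contDiff_bary (m + 1)).continuous
          filter_upwards [hcont.continuousAt.eventually_ne hi] with z hz _ using hz
    obtain ⟨O, hO, hOo, hxO⟩ := eventually_nhds_iff.1 hev
    refine ⟨O, F, hOo, hxO, fun r hr v y hy hyO => hF1 r hr v y hy ?_, fun y hyO => ?_⟩
    · have := (hO _ hyO).1.1
      rwa [retract_coe] at this
    have hyt := (hO _ hyO).1.1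
    rw [retract_coe] at hyt
    refine ⟨hF2 y hyt, ?_⟩
    rintro i z rfl
    refine pullAt_of_adapted (hΦ i) ((D i).gaugeAt z) (hF2 _ hyt) (hs i) ht ((hsd i z).2 hyt) hyt
      (hst i) fun v => ?_
    have hi : bary x.1 i = 0 := by
      by_contra hi
      refine (hO _ hyO).2 i hi ?_
      change bary (vertexMap (faceHom i) z.1) i = 0
      rw [bary_vertexMap]
      exact push_eq_zero (Fin.succAbove_ne i) _
    rw [hF3 _ hyt, affineLin_eq_vertexLin]
    refine Eq.symm ((hca i (by simpa using hi) z v).trans ?_)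
    have h1 : χ (affineFun (faceHom i) z.1) = 1 := (hO _ hyO).1.2
    simp only [ha, h1, one_smul]
  refine ⟨C, fun i => isPullbackForm_iff.2 fun y s hs t ht g e hy hy' v => ?_⟩
  obtain ⟨ι, _, c, F, hc, hCF, hgood⟩ := hC (affine (faceHom i) y)
  rw [hCF, ← sum_gaugeTransform (u := fun _ => (D i).form s y v) hc fun j hj =>
    hgood j hj i y rfl s hs t ht g e hy hy' v, ← Finset.sum_smul, hc, one_smul]

theorem nonempty_connection (P : PrincipalBundle (simplexModel n) E G (Simplex n)) :
    Nonempty (Connection P) := by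
  obtain ⟨D, -⟩ := exists_connection P (fun _ _ => True) fun x => by
    obtain ⟨t, ht, hxt⟩ := P.exists_section x
    obtain ⟨F, hF1, hF2, -⟩ := exists_induced ht 0 fun v y _ => by
      rw [smoothOnTo_simplex_iff]
      exact fun y _ => ⟨fun _ => 0, smoothNear_self_iff.2 ⟨univ, isOpen_univ, mem_univ _,
        CInftyOn.const 0 _⟩, Eventually.of_forall fun _ => rfl⟩
    have hO : ∀ y : Simplex n, y.1 ∈ retract n ⁻¹' (t.dom : Set (Simplex n)) ↔ y ∈ t.dom := fun y => by
      rw [mem_preimage, retract_coe]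
      rfl
    exact ⟨retract n ⁻¹' (t.dom : Set (Simplex n)), F, t.dom.2.preimage (continuous_retract n),
      (hO x).2 hxt, fun r hr v y hy hy' => hF1 r hr v y hy ((hO y).1 hy'),
      fun y hy => ⟨hF2 y ((hO y).1 hy), trivial⟩⟩
  exact ⟨D⟩

end Extension

/-! ### Existence of simplicial connections -/

section Existence

open SimplexMap PrincipalBundle

universe v b u

/-- Monotone maps factor into a surjection and an injection. -/
theorem exists_factorization {k n : ℕ} (θ : Fin (k + 1) →o Fin (n + 1)) :
    ∃ (r : ℕ) (π : Fin (k + 1) →o Fin (r + 1)) (ι : Fin (r + 1) →o Fin (n + 1)), r ≤ k ∧ r ≤ n ∧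
      Function.Surjective π ∧ Function.Injective ι ∧ ι.comp π = θ := by
  set K : Finset (Fin (n + 1)) := Finset.univ.image θ with hK
  have hne : K.Nonempty := ⟨θ 0, Finset.mem_image_of_mem _ (Finset.mem_univ _)⟩
  obtain ⟨r, hr⟩ : ∃ r, K.card = r + 1 := ⟨K.card - 1, by have := hne.card_pos; omega⟩
  have h1 : K.card ≤ k + 1 := Finset.card_image_le.trans (by simp)
  have h2 : K.card ≤ n + 1 := (Finset.card_le_univ K).trans (by simp)
  set e := K.orderIsoOfFin hr with he
  have hm : ∀ i, θ i ∈ K := fun i => Finset.mem_image_of_mem _ (Finset.mem_univ i)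
  refine ⟨r, ⟨fun i => e.symm ⟨θ i, hm i⟩, fun i j hij => e.symm.monotone (θ.monotone hij)⟩,
    ⟨fun i => e i, fun i j hij => e.monotone hij⟩, by omega, by omega, fun l => ?_, fun i j hij => ?_, ?_⟩
  · obtain ⟨i, -, hi⟩ := Finset.mem_image.1 (e l).2
    exact ⟨i, (e.symm_apply_eq (y := ⟨θ i, hm i⟩)).2 (Subtype.ext hi)⟩
  · exact e.injective (Subtype.ext hij)
  · ext i
    exact congrArg (fun z : K => (z.1 : ℕ)) (e.apply_symm_apply ⟨θ i, hm i⟩)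

/-- A monotone surjection has a monotone section through a given element. -/
theorem exists_section_through {k n : ℕ} {θ : Fin (k + 1) →o Fin (n + 1)}
    (hθ : Function.Surjective θ) (l : Fin (k + 1)) :
    ∃ μ : Fin (n + 1) →o Fin (k + 1), (∀ i, θ (μ i) = i) ∧ μ (θ l) = l := by
  classical
  set f := Function.update (Function.surjInv hθ) (θ l) l with hf
  have h : ∀ i, θ (f i) = i := fun i => by
    by_cases hi : i = θ l
    · rw [hi, hf, Function.update_self]
    · rw [hf, Function.update_of_ne hi]
      exact Function.surjInv_eq hθ i
  refine ⟨⟨f, fun i j hij => ?_⟩, h, Function.update_self ..⟩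
  by_contra hlt
  have h1 := θ.monotone (not_le.1 hlt).le
  rw [h, h] at h1
  exact hlt (le_antisymm hij h1 ▸ le_rfl)

theorem eq_id_of_injective {n : ℕ} {θ : Fin (n + 1) →o Fin (n + 1)} (hθ : Function.Injective θ) :
    θ = OrderHom.id := by
  have h := ((θ.monotone.strictMono_of_injective hθ).range_inj strictMono_id).1
    (by rw [(Finite.surjective_of_injective hθ).range_eq, range_id])
  ext i
  rw [h]
  rfl

/-- A monotone map which omits `i` factors through the `i`-th face. -/
theorem exists_lift_face {k m : ℕ} {μ : Fin (k + 1) →o Fin (m + 2)} {i : Fin (m + 2)}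
    (h : ∀ l, μ l ≠ i) : ∃ τ : Fin (k + 1) →o Fin (m + 1), (faceHom i).comp τ = μ := by
  choose τ hτ using fun l => Fin.exists_succAbove_eq (h l)
  refine ⟨⟨τ, fun l l' hl => ?_⟩, by ext l; exact congrArg Fin.val (hτ l)⟩
  rw [← Fin.succAbove_le_succAbove_iff (p := i), hτ, hτ]
  exact μ.monotone hl

/-- Points and tangent vectors common to two faces of a simplex come from a common subsimplex. -/
theorem exists_common_face {m : ℕ} {i j : Fin (m + 2)} {y y' : Simplex m} {v v' : Fin m → ℝ}
    (hy : affine (faceHom i) y = affine (faceHom j) y')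
    (hv : affineLin (faceHom i) v = affineLin (faceHom j) v') :
    ∃ (r : ℕ) (α β : Fin (r + 1) →o Fin (m + 1)) (z : Simplex r) (w : Fin r → ℝ), r ≤ m ∧
      (faceHom i).comp α = (faceHom j).comp β ∧ affine α z = y ∧ affine β z = y' ∧
      affineLin α w = v ∧ affineLin β w = v' := by
  set p : Simplex (m + 1) := vertexSimplexMap i.succAbove y with hp
  have hp' : p = vertexSimplexMap j.succAbove y' := hy
  set q := vertexLin i.succAbove v with hq
  have hq' : q = vertexLin j.succAbove v' := by
    simp only [affineLin_eq_vertexLin] at hv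
    exact hv
  set K : Finset (Fin (m + 2)) := Finset.univ.filter fun l => l ≠ i ∧ l ≠ j with hK
  have hpb : ∀ l, bary p.1 l ≠ 0 → l ∈ K := fun l hl => by
    refine Finset.mem_filter.2 ⟨Finset.mem_univ l, ?_, ?_⟩ <;> rintro rfl <;> refine hl ?_
    · exact (congrFun (bary_vertexMap l.succAbove y.1) l).trans (push_eq_zero (Fin.succAbove_ne l) _)
    · rw [hp']
      exact (congrFun (bary_vertexMap l.succAbove y'.1) l).trans (push_eq_zero (Fin.succAbove_ne l) _)
  have hqb : ∀ l, baryLin q l ≠ 0 → l ∈ K := fun l hl => by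
    refine Finset.mem_filter.2 ⟨Finset.mem_univ l, ?_, ?_⟩ <;> rintro rfl <;> refine hl ?_
    · exact (congrFun (baryLin_vertexLin l.succAbove v) l).trans
        (push_eq_zero (Fin.succAbove_ne l) _)
    · rw [hq']
      exact (congrFun (baryLin_vertexLin l.succAbove v') l).trans
        (push_eq_zero (Fin.succAbove_ne l) _)
  obtain ⟨l₀, hl₀⟩ : ∃ l, bary p.1 l ≠ 0 := by
    by_contra! h
    have h1 := sum_bary p.1
    simp only [h, Finset.sum_const_zero] at h1
    exact zero_ne_one h1
  obtain ⟨r, hr⟩ : ∃ r, K.card = r + 1 :=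
    ⟨K.card - 1, by have := Finset.card_pos.2 ⟨l₀, hpb l₀ hl₀⟩; omega⟩
  have hrm : r ≤ m := by
    have h1 : K ⊆ Finset.univ.erase i := fun l hl =>
      Finset.mem_erase.2 ⟨(Finset.mem_filter.1 hl).2.1, Finset.mem_univ l⟩
    have h2 := Finset.card_le_card h1
    rw [Finset.card_erase_of_mem (Finset.mem_univ i), Finset.card_univ, Fintype.card_fin] at h2
    omega
  set d : Fin (r + 1) →o Fin (m + 2) := (K.orderEmbOfFin hr).toOrderHom with hd
  have hdK : ∀ l, d l ∈ K := fun l => K.orderEmbOfFin_mem hr l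
  obtain ⟨α, hα⟩ := exists_lift_face (μ := d) (i := i) fun l => (Finset.mem_filter.1 (hdK l)).2.1
  obtain ⟨β, hβ⟩ := exists_lift_face (μ := d) (i := j) fun l => (Finset.mem_filter.1 (hdK l)).2.2
  have hζ : ∀ l ∈ K, d (Function.invFun d l) = l := fun l hl => Function.invFun_eq (by
    have h1 : l ∈ range (K.orderEmbOfFin hr) := by
      rw [Finset.range_orderEmbOfFin]
      exact hl
    exact h1)
  set ζ : Fin (m + 2) → Fin (r + 1) := Function.invFun d with hζd
  have hdp : vertexSimplexMap (d ∘ ζ) p = p := by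
    refine Subtype.ext (bary_injective ?_)
    refine (bary_vertexMap (d ∘ ζ) p.1).trans ?_
    exact (push_congr (η := id) fun l hl => hζ l (hpb l hl)).trans (push_id _)
  have hdq : vertexLin (d ∘ ζ) q = q := by
    refine baryLin_injective ?_
    rw [baryLin_vertexLin]
    exact (push_congr (η := id) fun l hl => hζ l (hqb l hl)).trans (push_id _)
  have hdα : (d : Fin (r + 1) → Fin (m + 2)) = i.succAbove ∘ α := congrArg DFunLike.coe hα.symm
  have hdβ : (d : Fin (r + 1) → Fin (m + 2)) = j.succAbove ∘ β := congrArg DFunLike.coe hβ.symm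
  refine ⟨r, α, β, vertexSimplexMap ζ p, vertexLin ζ q, hrm, hα.trans hβ.symm, ?_, ?_, ?_, ?_⟩
  · refine vertexSimplexMap_injective (Fin.succAbove_right_injective (p := i)) ?_
    change vertexSimplexMap i.succAbove (vertexSimplexMap α (vertexSimplexMap ζ p)) = p
    rw [vertexSimplexMap_comp, vertexSimplexMap_comp, ← hdα, hdp]
  · refine vertexSimplexMap_injective (Fin.succAbove_right_injective (p := j)) ?_
    change vertexSimplexMap j.succAbove (vertexSimplexMap β (vertexSimplexMap ζ p)) = _
    rw [vertexSimplexMap_comp, vertexSimplexMap_comp, ← hdβ, hdp, hp']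
  · refine vertexLin_injective (Fin.succAbove_right_injective (p := i)) ?_
    rw [affineLin_eq_vertexLin, vertexLin_comp, vertexLin_comp, ← hdα, hdq]
  · refine vertexLin_injective (Fin.succAbove_right_injective (p := j)) ?_
    rw [affineLin_eq_vertexLin, vertexLin_comp, vertexLin_comp, ← hdβ, hdq, hq']

variable {E : Type b} [AddCommGroup E] [Module ℝ E] [TopologicalSpace E]
  [IsTopologicalAddGroup E] [ContinuousSMul ℝ E] [T2Space E] [LocallyConvexSpace ℝ E]
  {G : Type u} [Group G] [TopologicalSpace G] [ChartedSpace E G] [SmoothLieGroup E G]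
  {X : SmoothSSet.{v}} {P : SimplicialBundle E G X}

/-- The connection `A` is the pull-back of `B` along the simplicial map `θ`. -/
def PullsBack {k n : ℕ} (θ : Fin (k + 1) →o Fin (n + 1)) {x : X.obj k} {y : X.obj n}
    (A : Connection (P.obj x)) (B : Connection (P.obj y)) : Prop :=
  ∀ e : X.res θ y = x, IsPullbackForm A.form B.form (affine θ) (P.map (affine θ) e)

theorem affine_comp_apply {k m n : ℕ} (θ : Fin (m + 1) →o Fin (n + 1))
    (η : Fin (k + 1) →o Fin (m + 1)) (y : Simplex k) :
    affine (θ.comp η) y = affine θ (affine η y) :=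
  congrFun (congrArg Subtype.val (affine_comp θ η)) y

/-- Functoriality of the bundle maps along simplicial maps. -/
theorem map_affine_comp {k m n : ℕ} (η : Fin (m + 1) →o Fin (n + 1)) (θ : Fin (k + 1) →o Fin (m + 1))
    {x : X.obj k} {y : X.obj m} {z : X.obj n} (e : X.res θ y = x) (e' : X.res η z = y)
    (e'' : X.res (η.comp θ) z = x) (p : (P.obj x).Total) :
    P.map (affine (η.comp θ)) e'' p = P.map (affine η) e' (P.map (affine θ) e p) := by
  have h : ∀ (σ : SimplexMap k n), σ = (affine η).comp (affine θ) → ∀ e'' : X.map σ z = x,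
      P.map σ e'' p = P.map (affine η) e' (P.map (affine θ) e p) := by
    rintro _ rfl e''
    exact P.map_comp _ _ e e' e'' p
  exact h _ (affine_comp η θ) e''

theorem map_affine_congr {k n : ℕ} {θ θ' : Fin (k + 1) →o Fin (n + 1)} (h : θ = θ') {x : X.obj k}
    {y : X.obj n} (e : X.res θ y = x) (e' : X.res θ' y = x) (p : (P.obj x).Total) :
    P.map (affine θ) e p = P.map (affine θ') e' p := by
  subst h
  rfl

/-- A bundle map is injective on the fibres. -/
theorem _root_.ChernWeil.PrincipalBundle.IsBundleMap.eq_of_proj_eq {k n : ℕ}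
    {P : PrincipalBundle (simplexModel k) E G (Simplex k)}
    {P' : PrincipalBundle (simplexModel n) E G (Simplex n)} {f : Simplex k → Simplex n}
    {Φ : P.Total → P'.Total} (hΦ : IsBundleMap P P' f Φ) {p q : P.Total} (h : P.proj p = P.proj q)
    (h' : Φ p = Φ q) : p = q := by
  obtain ⟨g, hg, -⟩ := P.existsUnique_act p q h
  have hg' : P.act p g = q := hg
  rw [← hg', hΦ.map_act] at h'
  have h1 : (1 : G) = g := act_left_cancel ((P'.act_one _).trans h')
  rw [← hg', ← h1, P.act_one]

theorem pullsBack_comp_iff {k m n : ℕ} {η : Fin (m + 1) →o Fin (n + 1)}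
    {θ : Fin (k + 1) →o Fin (m + 1)} {x : X.obj k} {y : X.obj m} {z : X.obj n}
    {A : Connection (P.obj x)} {B : Connection (P.obj y)} {C : Connection (P.obj z)}
    (e : X.res θ y = x) (e' : X.res η z = y) (h : PullsBack η B C) :
    PullsBack (η.comp θ) A C ↔ PullsBack θ A B := by
  have e'' : X.res (η.comp θ) z = x := by rw [← X.res_res, e', e]
  have := PullAt.trans A B C (P.isBundleMap (affine θ) e) (P.isBundleMap (affine η) e')
    (P.isBundleMap (affine (η.comp θ)) e'') (map_affine_comp η θ e e' e'') (h e')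
  exact ⟨fun h' _ => this.1 (h' e''), fun h' _ => this.2 (h' e)⟩

/-- The connection `C` on the bundle of the `n`-simplex `x` is compatible with given connections
in lower dimensions. -/
def IsCompatible {n : ℕ} (lower : ∀ m, m < n → ∀ y : X.obj m, Connection (P.obj y)) {x : X.obj n}
    (C : Connection (P.obj x)) : Prop :=
  (∀ (m : ℕ) (hm : m < n) (y : X.obj m) (θ : Fin (n + 1) →o Fin (m + 1)), X.res θ y = x →
    PullsBack θ C (lower m hm y)) ∧
  ∀ (m : ℕ) (hm : m < n) (y : X.obj m) (θ : Fin (m + 1) →o Fin (n + 1)), X.res θ x = y →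
    PullsBack θ (lower m hm y) C

/-- Compatibility with the connections in lower dimensions implies compatibility along all simplicial
maps, as these factor into a degeneracy and a face inclusion. -/
theorem pullsBack_of_isCompatible {N : ℕ} {D : ∀ m (y : X.obj m), Connection (P.obj y)}
    (hD : ∀ m < N, ∀ x : X.obj m, IsCompatible (fun l _ => D l) (D m x)) {k n : ℕ} (hk : k < N)
    (hn : n < N) (θ : Fin (k + 1) →o Fin (n + 1)) {x : X.obj k} {y : X.obj n} (e : X.res θ y = x) :
    PullsBack θ (D k x) (D n y) := by
  rcases lt_trichotomy k n with h | rfl | h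
  · exact (hD n hn y).2 k h x θ e
  · obtain ⟨r, π, ι, hr, -, hπ, hι, rfl⟩ := exists_factorization θ
    rcases hr.lt_or_eq with hr | rfl
    · have h1 := (hD k hn y).2 r hr (X.res ι y) ι rfl
      refine (pullsBack_comp_iff (by rw [X.res_res, e]) rfl h1).2 ?_
      exact (hD k hk x).1 r hr _ π (by rw [X.res_res, e])
    · obtain rfl := eq_id_of_injective hι
      obtain rfl := eq_id_of_injective (Finite.injective_iff_surjective.2 hπ)
      obtain rfl : y = x := (X.res_id y).symm.trans e
      intro e'
      have h1 : ∀ (σ : SimplexMap r r) (h : X.map σ y = y), σ = SimplexMap.id r →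
          P.map σ h = id := by
        rintro _ h rfl
        exact funext (P.map_id h)
      have h2 : P.map (affine (OrderHom.id.comp OrderHom.id)) e' = id := h1 _ e' (affine_id r)
      rw [h2]
      exact (D r y).gauge_affine_id
  · exact (hD k hk x).1 n h y θ e

/-- The inductive step in the construction of simplicial connections. On a degenerate simplex, the
connection has to be the pull-back along the degeneracy of minimal dimension. On a nondegenerate
simplex, it has to extend the connections on the faces, which agree on their intersections. -/
theorem exists_isCompatible {n : ℕ} {D : ∀ m (y : X.obj m), Connection (P.obj y)}
    (hD : ∀ m < n, ∀ x : X.obj m, IsCompatible (fun l _ => D l) (D m x)) (x : X.obj n) :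
    ∃ C : Connection (P.obj x), IsCompatible (fun l _ => D l) C := by
  classical
  have hlow : ∀ {k l : ℕ}, k < n → l < n → ∀ (θ : Fin (k + 1) →o Fin (l + 1)) {x : X.obj k}
      {y : X.obj l}, X.res θ y = x → PullsBack θ (D k x) (D l y) := fun hk hl θ _ _ e =>
    pullsBack_of_isCompatible hD hk hl θ e
  by_cases hdeg : ∃ m, m < n ∧ ∃ (y : X.obj m) (θ : Fin (n + 1) →o Fin (m + 1)), X.res θ y = x
  · -- a degenerate simplex: pull back along the degeneracy of minimal dimension
    obtain ⟨hm, y, θ, e⟩ := Nat.find_spec hdeg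
    have hmin : ∀ r < Nat.find hdeg, ∀ (z : X.obj r) (π : Fin (n + 1) →o Fin (r + 1)),
        X.res π z ≠ x := fun r hr z π h =>
      Nat.find_min hdeg hr ⟨hr.trans hm, z, π, h⟩
    generalize Nat.find hdeg = m at hm y θ e hmin
    obtain ⟨C, hC⟩ := exists_pullback (P.isBundleMap (affine θ) e) (D m y)
    have hCy : PullsBack θ C (D m y) := fun _ => hC
    -- by minimality, `θ` is surjective
    have hθ : Function.Surjective θ := by
      obtain ⟨r, π, ι, -, hr, hπ, hι, h⟩ := exists_factorization θ
      rcases hr.lt_or_eq with hr | rfl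
      · exact absurd (by rw [X.res_res, h, e]) (hmin r hr (X.res ι y) π)
      · rw [← h]
        exact (Finite.surjective_of_injective hι).comp hπ
    refine ⟨C, fun m' hm' y' θ' e' => ?_, fun l hl z μ e' => ?_⟩
    · obtain ⟨r, π, ι, -, hr, hπ, -, h⟩ := exists_factorization θ'
      have hrn : r < n := hr.trans_lt hm'
      have hz : X.res π (X.res ι y') = x := by rw [X.res_res, h, e']
      rw [← h, pullsBack_comp_iff hz rfl (hlow hrn hm' ι rfl)]
      obtain ⟨ν, hν, -⟩ := exists_section_through hπ 0
      have hzν : X.res ν x = X.res ι y' := by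
        rw [← hz, X.res_res, show π.comp ν = OrderHom.id from OrderHom.ext _ _ (funext hν),
          X.res_id]
      have hzy : X.res (θ.comp ν) y = X.res ι y' := by rw [← X.res_res, e, hzν]
      -- `θ` factors through every other degeneracy of which `x` is in the image
      have hθν : (θ.comp ν).comp π = θ := by
        ext l
        obtain ⟨μ, hμ, hμl⟩ := exists_section_through hθ l
        have hyμ : X.res μ x = y := by
          rw [← e, X.res_res, show θ.comp μ = OrderHom.id from OrderHom.ext _ _ (funext hμ),
            X.res_id]
        have hκ : X.res (((θ.comp ν).comp π).comp μ) y = y := by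
          rw [← X.res_res, ← X.res_res, hzy, hz, hyμ]
        obtain ⟨r', π', ι', -, hr', hπ', hι', h'⟩ := exists_factorization (((θ.comp ν).comp π).comp μ)
        rcases hr'.lt_or_eq with hr' | rfl
        · refine absurd ?_ (hmin r' hr' (X.res ι' y) (π'.comp θ))
          rw [← X.res_res π' θ, X.res_res ι' π', h', hκ, e]
        · have h1 := eq_id_of_injective hι'
          have h2 := eq_id_of_injective (Finite.injective_iff_surjective.2 hπ')
          rw [h1, h2] at h'
          have h3 := congrArg (fun f : Fin (r' + 1) →o Fin (r' + 1) => f (θ l)) h'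
          simp only [OrderHom.comp_coe, Function.comp_apply, hμl] at h3
          exact congrArg Fin.val h3.symm
      rw [← pullsBack_comp_iff hz hzy (hlow hrn hm (θ.comp ν) hzy), hθν]
      exact hCy
    · have h1 : X.res (θ.comp μ) y = z := by rw [← X.res_res, e, e']
      rw [← pullsBack_comp_iff e' e hCy]
      exact hlow hl hm _ h1
  · cases n with
    | zero =>
      obtain ⟨C⟩ := nonempty_connection (P.obj x)
      exact ⟨C, fun m hm => absurd hm (Nat.not_lt_zero m), fun m hm => absurd hm (Nat.not_lt_zero m)⟩
    | succ m =>
      obtain ⟨C, hC⟩ : ∃ C : Connection (P.obj x), ∀ i, IsPullbackForm (D m _).form C.form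
          (affine (faceHom i)) (P.map (affine (faceHom i)) (x := X.res (faceHom i) x) rfl) := by
        refine exists_connection_extension (P.obj x) (fun i => P.isBundleMap _ _)
          (fun i => D m (X.res (faceHom i) x)) ?_
        -- two faces meet in a common subsimplex, where both connections pull back to the given one
        intro t ht i j s hs s' hs' hst hst' y y' v v' hy hy' hyt hyy hvv
        obtain ⟨r, α, β, z, w, hr, hαβ, rfl, rfl, rfl, rfl⟩ := exists_common_face hyy hvv
        have hrm : r < m + 1 := Nat.lt_succ_of_le hr
        have hβ : X.res β (X.res (faceHom j) x) = X.res α (X.res (faceHom i) x) := by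
          rw [X.res_res, X.res_res, hαβ]
        have h1 := isPullbackForm_iff.1 (hlow hrm (Nat.lt_succ_self m) α
          (y := X.res (faceHom i) x) rfl rfl) z
        have h2 := isPullbackForm_iff.1 (hlow hrm (Nat.lt_succ_self m) β hβ hβ) z
        obtain ⟨q, hq, hqd, hqt⟩ := exists_adapted (affine ((faceHom i).comp α)).2.1
          (P.isBundleMap (affine ((faceHom i).comp α)) (X.res_res (faceHom i) α x).symm) ht
        have hc : ∀ (l : Fin (m + 2)) (γ : Fin (r + 1) →o Fin (m + 1))
            (e : X.res γ (X.res (faceHom l) x) = X.res α (X.res (faceHom i) x))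
            (_ : (faceHom i).comp α = (faceHom l).comp γ)
            (s : LocalSection (P.obj (X.res (faceHom l) x)).proj)
            (_ : ∀ (y : Simplex m) (hs : y ∈ s.dom) (ht : affine (faceHom l) y ∈ t.dom),
              P.map (affine (faceHom l)) (x := X.res (faceHom l) x) rfl (s.toFun ⟨y, hs⟩) =
                t.toFun ⟨affine (faceHom l) y, ht⟩)
            (u : Simplex r) (hu : u ∈ q.dom) (hu' : affine γ u ∈ s.dom),
            P.map (affine γ) e (q.toFun ⟨u, hu⟩) = s.toFun ⟨affine γ u, hu'⟩ := by
          intro l γ e h s hs u hu hu'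
          have hut := (hqd u).1 hu
          have hut' : affine (faceHom l) (affine γ u) ∈ t.dom := by
            rw [← affine_comp_apply, ← h]
            exact hut
          have e' := (X.res_res (faceHom i) α x).symm
          have e'' : X.res ((faceHom l).comp γ) x = X.res α (X.res (faceHom i) x) := by
            rw [← X.res_res, e]
          refine (P.isBundleMap (affine (faceHom l)) (x := X.res (faceHom l) x) rfl).eq_of_proj_eq
            (((P.isBundleMap (affine γ) e).proj_map _).trans ?_) ?_
          · exact (congrArg _ (q.proj_toFun _)).trans (s.proj_toFun ⟨affine γ u, hu'⟩).symm
          · refine (map_affine_comp (faceHom l) γ e rfl e'' _).symm.trans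
              ((map_affine_congr h e' e'' _).symm.trans ((hqt u hu hut).trans
                (Eq.trans (congrArg t.toFun (Subtype.ext ?_)) (hs _ hu' hut').symm)))
            change affine ((faceHom i).comp α) u = affine (faceHom l) (affine γ u)
            rw [← affine_comp_apply, h]
        have hzq : z ∈ q.dom := (hqd z).2 (by rw [affine_comp_apply]; exact hyt)
        rw [← h1.adapted hq hs hzq hy (hc i α rfl rfl s hst),
          ← h2.adapted hq hs' hzq hy' (hc j β hβ hαβ s' hst')]
      refine ⟨C, fun l hl y θ e => absurd ⟨l, hl, y, θ, e⟩ hdeg, fun l hl z μ e => ?_⟩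
      obtain ⟨i, hi⟩ : ∃ i, ∀ j, μ j ≠ i := by
        by_contra! h
        have := Fintype.card_le_of_surjective μ h
        simp only [Fintype.card_fin] at this
        omega
      obtain ⟨τ, rfl⟩ := exists_lift_face hi
      have hτ : X.res τ (X.res (faceHom i) x) = z := by rw [X.res_res, e]
      rw [pullsBack_comp_iff hτ rfl fun _ => hC i]
      exact hlow hl (Nat.lt_succ_self m) τ hτ

open Classical in
/-- A simplicial connection, constructed by induction on the dimension of simplices. -/
def simplicialConnection (P : SimplicialBundle E G X) (n : ℕ) (x : X.obj n) :
    Connection (P.obj x) :=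
  haveI := nonempty_connection (P.obj x)
  Classical.epsilon fun C => IsCompatible (fun m _ => simplicialConnection P m) C
termination_by n

/-- Every simplicial bundle has a simplicial connection. -/
theorem nonempty_simplicialConnection (P : SimplicialBundle E G X) :
    Nonempty (SimplicialConnection P) := by
  have key : ∀ n (x : X.obj n),
      IsCompatible (fun m _ => simplicialConnection P m) (simplicialConnection P n x) := by
    intro n
    induction n using Nat.strong_induction_on with
    | _ n ih =>
      intro x
      have h := exists_isCompatible (D := simplicialConnection P) ih x
      rw [simplicialConnection]
      exact Classical.epsilon_spec h
  exact ⟨⟨fun {n} x => simplicialConnection P n x, fun {k n} θ x y e =>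
    pullsBack_of_isCompatible (N := max k n + 1) (fun m _ => key m) (by omega) (by omega) θ e e⟩⟩

end Existence

/-! ### Homogeneous components and polarization -/

section Polarization

variable {M : Type*} [AddCommGroup M] [Module ℝ M]

/-- Polarization: a symmetric multilinear functional which vanishes on the diagonal is zero. Up to
a nonzero integer, `f v` is the coefficient of `t₁ ⋯ t_k` in `f (∑ t_j v_j, …, ∑ t_j v_j)`. -/
theorem eq_zero_of_diagonal {k : ℕ} {f : MultilinearMap ℝ (fun _ : Fin k => M) ℝ}
    (hf : ∀ (σ : Equiv.Perm (Fin k)) (v : Fin k → M), f (fun i => v (σ i)) = f v)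
    (h : ∀ x, f (fun _ => x) = 0) : f = 0 := by
  classical
  ext v
  set p : MvPolynomial (Fin k) ℝ :=
    ∑ J : Fin k → Fin k, MvPolynomial.C (f fun i => v (J i)) * ∏ i, MvPolynomial.X (J i) with hp
  have hp0 : p = 0 := by
    refine MvPolynomial.funext fun t => ?_
    have h1 := h (∑ j, t j • v j)
    rw [f.map_sum] at h1
    simp only [f.map_smul_univ, smul_eq_mul] at h1
    simp only [hp, map_sum, map_mul, MvPolynomial.eval_C, map_prod, MvPolynomial.eval_X, map_zero]
    rw [← h1]
    exact Finset.sum_congr rfl fun J _ => mul_comm _ _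
  have hX : ∀ J : Fin k → Fin k, (∏ i, MvPolynomial.X (J i) : MvPolynomial (Fin k) ℝ) =
      MvPolynomial.monomial (∑ i, Finsupp.single (J i) 1) 1 := fun J =>
    (MvPolynomial.monomial_sum_one _ _).symm
  have hJ : ∀ J : Fin k → Fin k,
      (∑ i, Finsupp.single (J i) 1 : Fin k →₀ ℕ) = ∑ i, Finsupp.single i 1 →
      f (fun i => v (J i)) = f v := fun J h => by
    have hs : Function.Surjective J := fun j => by
      by_contra! hj
      have h1 := DFunLike.congr_fun h j
      simp [Finsupp.single_apply, hj] at h1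
    exact hf (Equiv.ofBijective J (Finite.injective_iff_surjective.2 hs |> fun hi => ⟨hi, hs⟩)) v
  have h2 := congrArg (MvPolynomial.coeff (∑ i, Finsupp.single i 1)) hp0
  simp only [hp, hX, MvPolynomial.coeff_sum, MvPolynomial.coeff_C_mul, MvPolynomial.coeff_monomial,
    mul_ite, mul_one, mul_zero, MvPolynomial.coeff_zero] at h2
  rw [Finset.sum_congr rfl fun J _ => (ite_congr rfl (hJ J) fun _ => rfl), ← Finset.sum_filter,
    Finset.sum_const, nsmul_eq_mul, mul_eq_zero, Nat.cast_eq_zero] at h2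
  exact h2.resolve_left (Finset.card_ne_zero_of_mem (a := id) (by simp))

/-- Uniqueness of homogeneous components, by comparing the coefficients of the powers of `t` in
`∑ f_k (t x, …, t x)`. -/
theorem eq_zero_of_sum_diagonal (s : Finset ℕ) (f : ∀ k, MultilinearMap ℝ (fun _ : Fin k => M) ℝ)
    (hf : ∀ k (σ : Equiv.Perm (Fin k)) (v : Fin k → M), f k (fun i => v (σ i)) = f k v)
    (h : ∀ x, ∑ k ∈ s, f k (fun _ => x) = 0) : ∀ k ∈ s, f k = 0 := by
  intro k hk
  refine eq_zero_of_diagonal (hf k) fun x => ?_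
  have hp : (∑ k ∈ s, Polynomial.monomial k (f k fun _ => x) : Polynomial ℝ) = 0 := by
    refine Polynomial.funext fun t => ?_
    rw [Polynomial.eval_finsetSum, Polynomial.eval_zero, ← h (t • x)]
    refine Finset.sum_congr rfl fun l _ => ?_
    rw [Polynomial.eval_monomial, (f l).map_smul_univ (fun _ => t) fun _ => x]
    simp [mul_comm]
  have h1 := congrArg (fun p => Polynomial.coeff p k) hp
  simpa [Polynomial.finsetSum_coeff, Polynomial.coeff_monomial, hk] using h1

end Polarization

section Forms

universe b u

variable {E : Type b} [AddCommGroup E] [Module ℝ E] [TopologicalSpace E]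

/-- The symmetrization of a multilinear functional. -/
def symmetrize {k : ℕ} (ρ : ContinuousMultilinearMap ℝ (fun _ : Fin k => E) ℝ) :
    ContinuousMultilinearMap ℝ (fun _ : Fin k => E) ℝ :=
  (k.factorial : ℝ)⁻¹ • ∑ σ : Equiv.Perm (Fin k), ρ.domDomCongr σ

theorem symmetrize_apply {k : ℕ} (ρ : ContinuousMultilinearMap ℝ (fun _ : Fin k => E) ℝ)
    (v : Fin k → E) : symmetrize ρ v =
      (k.factorial : ℝ)⁻¹ * ∑ σ : Equiv.Perm (Fin k), ρ fun i => v (σ i) := by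
  simp [symmetrize]

theorem symmetrize_perm {k : ℕ} (ρ : ContinuousMultilinearMap ℝ (fun _ : Fin k => E) ℝ)
    (τ : Equiv.Perm (Fin k)) (v : Fin k → E) :
    symmetrize ρ (fun i => v (τ i)) = symmetrize ρ v := by
  rw [symmetrize_apply, symmetrize_apply]
  congr 1
  exact Fintype.sum_equiv (Equiv.mulLeft τ) _ _ fun σ => rfl

theorem sum_perm_const (k : ℕ) (c : ℝ) :
    (k.factorial : ℝ)⁻¹ * ∑ _σ : Equiv.Perm (Fin k), c = c := by
  rw [Finset.sum_const, Finset.card_univ, Fintype.card_perm, Fintype.card_fin, nsmul_eq_mul,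
    inv_mul_cancel_left₀ (by positivity)]

theorem symmetrize_diagonal {k : ℕ} (ρ : ContinuousMultilinearMap ℝ (fun _ : Fin k => E) ℝ)
    (x : E) : symmetrize ρ (fun _ => x) = ρ fun _ => x := by
  rw [symmetrize_apply, sum_perm_const]

/-- The product of two multilinear functionals. -/
def tensor {k l : ℕ} (ρ : ContinuousMultilinearMap ℝ (fun _ : Fin k => E) ℝ)
    (τ : ContinuousMultilinearMap ℝ (fun _ : Fin l => E) ℝ) :
    ContinuousMultilinearMap ℝ (fun _ : Fin (k + l) => E) ℝ :=
  ⟨((LinearMap.mul' ℝ ℝ).compMultilinearMap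
    (ρ.toMultilinearMap.domCoprod τ.toMultilinearMap)).domDomCongr finSumFinEquiv, by
    change Continuous fun v : Fin (k + l) → E =>
      ρ (fun i => v (finSumFinEquiv (Sum.inl i))) * τ (fun i => v (finSumFinEquiv (Sum.inr i)))
    exact (ρ.cont.comp (by fun_prop)).mul (τ.cont.comp (by fun_prop))⟩

theorem tensor_apply {k l : ℕ} (ρ : ContinuousMultilinearMap ℝ (fun _ : Fin k => E) ℝ)
    (τ : ContinuousMultilinearMap ℝ (fun _ : Fin l => E) ℝ) (v : Fin (k + l) → E) :
    tensor ρ τ v = ρ (fun i => v (Fin.castAdd l i)) * τ fun i => v (Fin.natAdd k i) := rfl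

variable {G : Type u} [Group G] [TopologicalSpace G] [ChartedSpace E G]
  {k l : ℕ} {ρ : ContinuousMultilinearMap ℝ (fun _ : Fin k => E) ℝ}
  {τ : ContinuousMultilinearMap ℝ (fun _ : Fin l => E) ℝ}

theorem AdInvariant.symmetrize (h : AdInvariant G ρ) : AdInvariant G (symmetrize ρ) := fun g v => by
  rw [symmetrize_apply, symmetrize_apply]
  simp only [fun σ : Equiv.Perm (Fin k) => h g fun i => v (σ i)]

theorem AdInvariant.tensor (h : AdInvariant G ρ) (h' : AdInvariant G τ) :
    AdInvariant G (tensor ρ τ) := fun g v => by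
  rw [tensor_apply, tensor_apply, h g fun i => v (Fin.castAdd l i), h' g fun i => v (Fin.natAdd k i)]

variable (E G) in
/-- The `Ad`-invariant symmetric multilinear functionals of degree `k`. -/
def invariantForms (k : ℕ) : Submodule ℝ (ContinuousMultilinearMap ℝ (fun _ : Fin k => E) ℝ) where
  carrier := {ρ | IsInvariant E G ρ}
  zero_mem' := ⟨fun _ _ => rfl, fun _ _ => rfl⟩
  add_mem' h h' := ⟨fun σ v => congrArg₂ (· + ·) (h.symm σ v) (h'.symm σ v),
    fun g v => congrArg₂ (· + ·) (h.map_Ad g v) (h'.map_Ad g v)⟩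
  smul_mem' r _ h := ⟨fun σ v => congrArg (r * ·) (h.symm σ v),
    fun g v => congrArg (r * ·) (h.map_Ad g v)⟩

variable (E G) in
/-- The polynomial function of a sum of invariant symmetric multilinear functionals. -/
def diagonal : (⨁ k, invariantForms E G k) →ₗ[ℝ] invariantPolynomials E G :=
  DirectSum.toModule ℝ ℕ _ fun _ =>
    { toFun := fun ρ => IsInvariant.polynomial ρ.2
      map_add' := fun _ _ => rfl
      map_smul' := fun _ _ => rfl }

theorem diagonal_of (hρ : IsInvariant E G ρ) :
    diagonal E G (DirectSum.of (fun k => invariantForms E G k) k ⟨ρ, hρ⟩) = hρ.polynomial :=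
  DirectSum.toModule_lof ℝ (M := fun k => invariantForms E G k) k ⟨ρ, hρ⟩

open Classical in
theorem diagonal_apply (a : ⨁ k, invariantForms E G k) {s : Finset ℕ} (hs : DFinsupp.support a ⊆ s)
    (x : E) : (diagonal E G a).1 x = ∑ k ∈ s, (a k).1 fun _ => x := by
  refine Eq.trans ?_ (Finset.sum_subset hs fun k _ hk => ?_)
  · conv_lhs => rw [← DirectSum.sum_support_of a, map_sum]
    rw [AddSubmonoidClass.coe_finsetSum, Finset.sum_apply]
    exact Finset.sum_congr rfl fun k _ => congrFun (congrArg Subtype.val (diagonal_of (a k).2)) x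
  · rw [DFinsupp.notMem_support_iff.1 hk]
    rfl

theorem diagonal_injective : Function.Injective (diagonal E G) := by
  classical
  intro a b hab
  set s := DFinsupp.support a ∪ DFinsupp.support b with hs
  have h := eq_zero_of_sum_diagonal s
    (fun k => (a k).1.toMultilinearMap - (b k).1.toMultilinearMap)
    (fun k σ v => congrArg₂ (· - ·) ((a k).2.symm σ v) ((b k).2.symm σ v)) fun x => by
      have h1 := diagonal_apply a (s := s) Finset.subset_union_left x
      rw [hab, diagonal_apply b (s := s) Finset.subset_union_right x] at h1
      exact (Finset.sum_sub_distrib ..).trans (sub_eq_zero.2 h1.symm)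
  refine DFinsupp.ext fun k => ?_
  by_cases hk : k ∈ s
  · exact Subtype.ext (ContinuousMultilinearMap.toMultilinearMap_injective (sub_eq_zero.1 (h k hk)))
  · rw [hs, Finset.mem_union, not_or] at hk
    rw [DFinsupp.notMem_support_iff.1 hk.1, DFinsupp.notMem_support_iff.1 hk.2]

/-- A continuous polynomial is a sum of diagonals of symmetric multilinear functionals. -/
theorem exists_symmetric_components {f : E → ℝ} (hf : f ∈ polynomials E) :
    ∃ (N : ℕ) (ρ : ∀ k, ContinuousMultilinearMap ℝ (fun _ : Fin k => E) ℝ),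
      (∀ k (σ : Equiv.Perm (Fin k)) (v : Fin k → E), ρ k (fun i => v (σ i)) = ρ k v) ∧
      ∀ n ≥ N, ∀ x, f x = ∑ k ∈ Finset.range n, ρ k fun _ => x := by
  classical
  refine Submodule.span_induction (p := fun f _ => ∃ (N : ℕ)
      (ρ : ∀ k, ContinuousMultilinearMap ℝ (fun _ : Fin k => E) ℝ),
      (∀ k (σ : Equiv.Perm (Fin k)) (v : Fin k → E), ρ k (fun i => v (σ i)) = ρ k v) ∧
      ∀ n ≥ N, ∀ x, f x = ∑ k ∈ Finset.range n, ρ k fun _ => x) ?_ ?_ ?_ ?_ hf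
  · rintro _ ⟨l, τ, rfl⟩
    refine ⟨l + 1, Pi.single l (symmetrize τ), fun k σ v => ?_, fun n hn x => ?_⟩
    · by_cases hk : k = l
      · subst hk
        rw [Pi.single_eq_same, symmetrize_perm]
      · rw [Pi.single_eq_of_ne hk]
        rfl
    · rw [Finset.sum_eq_single l, Pi.single_eq_same, symmetrize_diagonal]
      · intro k _ hk
        rw [Pi.single_eq_of_ne hk]
        rfl
      · exact fun h => absurd (Finset.mem_range.2 hn) h
  · exact ⟨0, 0, fun _ _ _ => rfl, fun n _ x => (Finset.sum_eq_zero fun _ _ => rfl).symm⟩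
  · rintro f f' - - ⟨N, ρ, hρ, h⟩ ⟨N', ρ', hρ', h'⟩
    refine ⟨max N N', ρ + ρ', fun k σ v => congrArg₂ (· + ·) (hρ k σ v) (hρ' k σ v),
      fun n hn x => ?_⟩
    rw [Pi.add_apply, h n (le_of_max_le_left hn), h' n (le_of_max_le_right hn),
      ← Finset.sum_add_distrib]
    rfl
  · rintro r f - ⟨N, ρ, hρ, h⟩
    refine ⟨N, r • ρ, fun k σ v => congrArg (r * ·) (hρ k σ v), fun n hn x => ?_⟩
    rw [Pi.smul_apply, h n hn, Finset.smul_sum]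
    rfl

variable [IsTopologicalAddGroup E] [ContinuousSMul ℝ E] [T2Space E] [LocallyConvexSpace ℝ E]
  [SmoothLieGroup E G]

/-- Every invariant polynomial is a sum of diagonals of invariant symmetric functionals, as the
homogeneous components of an invariant polynomial are unique, hence invariant. -/
theorem diagonal_surjective : Function.Surjective (diagonal E G) := by
  rintro ⟨f, hf, hfG⟩
  obtain ⟨N, ρ, hρ, h⟩ := exists_symmetric_components hf
  have hinv : ∀ k ∈ Finset.range N, IsInvariant E G (ρ k) := fun k hk => by
    refine ⟨hρ k, fun g v => ?_⟩
    have h1 := eq_zero_of_sum_diagonal (Finset.range N)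
      (fun k => (ρ k).toMultilinearMap.compLinearMap (fun _ => (AdL E g : E →ₗ[ℝ] E)) -
        (ρ k).toMultilinearMap)
      (fun k σ v => congrArg₂ (· - ·) (hρ k σ fun i => Ad E g (v i)) (hρ k σ v))
      (fun x => by
        have h2 := hfG g x
        rw [h N le_rfl, h N le_rfl, ← sub_eq_zero, ← Finset.sum_sub_distrib] at h2
        exact h2) k hk
    exact sub_eq_zero.1 (DFunLike.congr_fun h1 v)
  refine ⟨∑ k ∈ (Finset.range N).attach, DirectSum.of (fun k => invariantForms E G k) k.1
    ⟨ρ k.1, hinv k.1 k.2⟩, Subtype.ext (funext fun x => ?_)⟩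
  rw [map_sum, AddSubmonoidClass.coe_finsetSum, Finset.sum_apply]
  refine Eq.trans ?_ (h N le_rfl x).symm
  exact (Finset.sum_congr rfl fun k _ =>
    congrFun (congrArg Subtype.val (diagonal_of (hinv k.1 k.2))) x).trans
    (Finset.sum_attach (Finset.range N) fun k => ρ k fun _ => x)

end Forms

/-! ### The Chern–Weil homomorphism -/

section AlternatingForms

universe b u

variable {E : Type b} [AddCommGroup E] [Module ℝ E] [TopologicalSpace E]
  [IsTopologicalAddGroup E] [ContinuousSMul ℝ E] [T2Space E] [LocallyConvexSpace ℝ E]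
  {V : Type*} [NormedAddCommGroup V] [NormedSpace ℝ V] [FiniteDimensional ℝ V]
  {k l : ℕ} (ρ : ContinuousMultilinearMap ℝ (fun _ : Fin k => E) ℝ)

theorem chernWeilAlt_combination (ρ' : ContinuousMultilinearMap ℝ (fun _ : Fin k => E) ℝ) (r s : ℝ)
    (R : V → V → E) : chernWeilAlt (r • ρ + s • ρ') R =
      r • chernWeilAlt ρ R + s • chernWeilAlt ρ' R := by
  have h : antisymm (chernWeilFun (r • ρ + s • ρ') R) =
      r • antisymm (chernWeilFun ρ R) + s • antisymm (chernWeilFun ρ' R) := by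
    simp only [antisymm, Finset.smul_sum, ← Finset.sum_add_distrib, smul_smul, ← add_smul]
    rfl
  simp only [chernWeilAlt, h, smul_add, smul_comm (1 / 2 ^ k : ℝ)]

/-- The even and the odd numbers among the first `2 k` ones. -/
def evenOddEquiv (k : ℕ) : Fin k ⊕ Fin k ≃ Fin (2 * k) :=
  Equiv.ofBijective (Sum.elim evenIdx oddIdx) ((Fintype.bijective_iff_injective_and_card _).2
    ⟨by
      rintro (i | i) (j | j) h <;>
        simp only [Sum.elim_inl, Sum.elim_inr, evenIdx, oddIdx, Fin.mk.injEq] at h <;>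
        first | omega | exact congrArg _ (Fin.ext (by omega)), by simp [two_mul]⟩)

/-- The form `ρ (R ∧ ⋯ ∧ R)` depends only on the symmetrization of `ρ`: permutations of the
pairs of arguments are even. -/
theorem chernWeilAlt_symmetrize (B : V →ₗ[ℝ] V →ₗ[ℝ] E) :
    chernWeilAlt (symmetrize ρ) (fun v w => B v w) = chernWeilAlt ρ fun v w => B v w := by
  ext v
  rw [chernWeilAlt_apply, chernWeilAlt_apply]
  congr 1
  have h : ∀ w, chernWeilFun (symmetrize ρ) (fun v w => B v w) w = (k.factorial : ℝ)⁻¹ *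
      ∑ σ : Equiv.Perm (Fin k), chernWeilFun ρ (fun v w => B v w)
        (w ∘ blockPerm (evenOddEquiv k) (σ, σ)) := fun w => by
    rw [chernWeilFun, symmetrize_apply]
    congr 1
    refine Finset.sum_congr rfl fun σ _ => congrArg ρ (funext fun i => ?_)
    exact congrArg₂ (fun a b => B (w a) (w b))
      (blockPerm_inl (evenOddEquiv k) (σ, σ) i).symm (blockPerm_inr (evenOddEquiv k) (σ, σ) i).symm
  rw [funext h, altSum_const_mul, altSum_sum]
  simp only [altSum_perm, sign_blockPerm, Int.units_mul_self, Units.val_one, Int.cast_one, one_mul]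
  exact sum_perm_const k _

/-- The forms `ρ (R ∧ ⋯ ∧ R)` are multiplicative in `ρ`. -/
theorem wedge_chernWeilAlt (τ : ContinuousMultilinearMap ℝ (fun _ : Fin l => E) ℝ)
    (h : 2 * k + 2 * l = 2 * (k + l)) (B : V →ₗ[ℝ] V →ₗ[ℝ] E) :
    wedge h (chernWeilAlt ρ fun v w => B v w) (chernWeilAlt τ fun v w => B v w) =
      chernWeilAlt (tensor ρ τ) fun v w => B v w := by
  have h1 : wedge h (chernWeilAlt ρ fun v w => B v w) (chernWeilAlt τ fun v w => B v w) =
      (1 / 2 ^ k * (1 / 2 ^ l) : ℝ) • wedge h (antisymm (chernWeilFun ρ fun v w => B v w))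
        (antisymm (chernWeilFun τ fun v w => B v w)) := by
    ext v
    rw [ContinuousAlternatingMap.smul_apply, wedge_apply, wedge_apply, smul_eq_mul, mul_left_comm,
      ← altSum_const_mul (1 / 2 ^ k * (1 / 2 ^ l))]
    refine congrArg (fun f => _ * altSum f v) (funext fun w => ?_)
    simp only [blockMul, chernWeilAlt, ContinuousAlternatingMap.smul_apply, smul_eq_mul]
    ring
  have he : ∀ i, splitIndex h (Sum.inl (evenIdx i)) = evenIdx (Fin.castAdd l i) := fun i =>
    Fin.ext (splitIndex_inl h _)
  have ho : ∀ i, splitIndex h (Sum.inl (oddIdx i)) = oddIdx (Fin.castAdd l i) := fun i =>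
    Fin.ext (splitIndex_inl h _)
  have he' : ∀ i, splitIndex h (Sum.inr (evenIdx i)) = evenIdx (Fin.natAdd k i) := fun i =>
    Fin.ext ((splitIndex_inr h _).trans (by simp [evenIdx, mul_add]))
  have ho' : ∀ i, splitIndex h (Sum.inr (oddIdx i)) = oddIdx (Fin.natAdd k i) := fun i =>
    Fin.ext ((splitIndex_inr h _).trans (by simp [oddIdx, mul_add, add_assoc]))
  rw [h1, wedge_antisymm h (isMultilinear_chernWeilFun ρ B) (isMultilinear_chernWeilFun τ B),
    chernWeilAlt, pow_add, one_div_mul_one_div]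
  congr 2
  funext w
  simp only [blockMul, chernWeilFun, tensor_apply, he, ho, he', ho']

end AlternatingForms

section Homomorphism

universe v b u

variable {E : Type b} [AddCommGroup E] [Module ℝ E] [TopologicalSpace E]
  [IsTopologicalAddGroup E] [ContinuousSMul ℝ E] [T2Space E] [LocallyConvexSpace ℝ E]
  {G : Type u} [Group G] [TopologicalSpace G] [ChartedSpace E G] [SmoothLieGroup E G]
  {X : SmoothSSet.{v}}

/-- The class of a closed simplicial form depends linearly on the form. -/
theorem IsClosedSimplicialForm.toCohomology_combination {m : ℕ}
    {α β γ : ∀ {n : ℕ}, X.obj n → (Fin n → ℝ) → (Fin n → ℝ) [⋀^Fin m]→L[ℝ] ℝ}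
    (hα : IsClosedSimplicialForm α) (hβ : IsClosedSimplicialForm β) (hγ : IsClosedSimplicialForm γ)
    (r s : ℝ) (h : ∀ x : X.obj m, ∀ y ∈ Simplex m, γ x y = r • α x y + s • β x y) :
    hγ.toCohomology = r • hα.toCohomology + s • hβ.toCohomology := by
  have hint : ∀ {δ : ∀ {n : ℕ}, X.obj n → (Fin n → ℝ) → (Fin n → ℝ) [⋀^Fin m]→L[ℝ] ℝ},
      IsClosedSimplicialForm δ → ∀ x : X.obj m, MeasureTheory.IntegrableOn
        (fun y => δ x y fun i => Pi.single i 1) (Simplex m) := fun hδ x => by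
    refine ContinuousOn.integrableOn_compact (isCompact_simplex m) ?_
    exact (continuous_eval_const _).comp_continuousOn (hδ.closed x).continuousOn
  have hc : integralCochain γ = r • integralCochain α + s • integralCochain β := by
    funext x
    refine (MeasureTheory.setIntegral_congr_fun (measurableSet_simplex m)
      (g := fun y => r * α x y (fun i => Pi.single i 1) + s * β x y fun i => Pi.single i 1)
      fun y hy => by simp only [h x y hy]; rfl).trans ?_
    rw [MeasureTheory.integral_add ((hint hα x).const_mul r) ((hint hβ x).const_mul s),
      MeasureTheory.integral_const_mul, MeasureTheory.integral_const_mul]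
    rfl
  have hz : (⟨_, hγ.mem_cocycles⟩ : cocycles X) =
      r • ⟨_, hα.mem_cocycles⟩ + s • ⟨_, hβ.mem_cocycles⟩ := by
    refine Subtype.ext ?_
    change DirectSum.of (Cochain X) m (integralCochain γ) = r • DirectSum.lof ℝ ℕ (Cochain X) m _ +
      s • DirectSum.lof ℝ ℕ (Cochain X) m _
    rw [hc, ← map_smul, ← map_smul, ← map_add]
    rfl
  exact (congrArg (Ideal.Quotient.mkₐ ℝ (coboundaries X)) hz).trans (by
    rw [map_add, map_smul, map_smul]
    rfl)

theorem IsClosedSimplicialForm.toCohomology_congr {m : ℕ}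
    {α β : ∀ {n : ℕ}, X.obj n → (Fin n → ℝ) → (Fin n → ℝ) [⋀^Fin m]→L[ℝ] ℝ}
    (hα : IsClosedSimplicialForm α) (hβ : IsClosedSimplicialForm β)
    (h : ∀ x : X.obj m, ∀ y ∈ Simplex m, α x y = β x y) : hα.toCohomology = hβ.toCohomology := by
  refine (hβ.toCohomology_combination hβ hα 1 0 fun x y hy => ?_).trans ?_
  · rw [h x y hy, one_smul, zero_smul, add_zero]
  · rw [one_smul, zero_smul, add_zero]

namespace SimplicialConnection

variable {P : SimplicialBundle E G X} (D : SimplicialConnection P)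

/-- All Chern–Weil forms of a connection at a given point come from the same curvature. -/
theorem exists_curvature {n : ℕ} (x : X.obj n) {y : Fin n → ℝ} (hy : y ∈ Simplex n) :
    ∃ B : (Fin n → ℝ) →ₗ[ℝ] (Fin n → ℝ) →ₗ[ℝ] E,
      ∀ (k : ℕ) (ρ : ContinuousMultilinearMap ℝ (fun _ : Fin k => E) ℝ), AdInvariant G ρ →
        D.chernWeil ρ x y = chernWeilAlt ρ fun v w => B v w := by
  obtain ⟨A, hA⟩ := (D.conn x).isGaugeField.nonempty y hy
  obtain ⟨O, hO, hyO, hAO, -⟩ := (D.conn x).isGaugeField.potential y hy A hA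
  refine ⟨hAO.curvB (G := G) hO hyO, fun k ρ hρ => ?_⟩
  simp only [IsPotential.curvB_apply]
  exact gaugeForm_eq hρ (uniqueDiffOn_simplex n) (D.conn x).isGaugeField hy hA

variable {k l : ℕ} {ρ ρ' : ContinuousMultilinearMap ℝ (fun _ : Fin k => E) ℝ}
  {τ : ContinuousMultilinearMap ℝ (fun _ : Fin l => E) ℝ}

theorem chernWeilClass_combination (hρ : AdInvariant G ρ) (hρ' : AdInvariant G ρ') (r s : ℝ)
    (h : AdInvariant G (r • ρ + s • ρ')) :
    D.chernWeilClass h = r • D.chernWeilClass hρ + s • D.chernWeilClass hρ' := by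
  refine (D.isClosedSimplicialForm hρ).toCohomology_combination (D.isClosedSimplicialForm hρ')
    (D.isClosedSimplicialForm h) r s fun x y hy => ?_
  obtain ⟨B, hB⟩ := D.exists_curvature x hy
  rw [hB _ _ h, hB _ _ hρ, hB _ _ hρ', chernWeilAlt_combination]

theorem chernWeilClass_symmetrize (hρ : AdInvariant G ρ) :
    D.chernWeilClass hρ.symmetrize = D.chernWeilClass hρ := by
  refine (D.isClosedSimplicialForm hρ.symmetrize).toCohomology_congr
    (D.isClosedSimplicialForm hρ) fun x y hy => ?_
  obtain ⟨B, hB⟩ := D.exists_curvature x hy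
  rw [hB _ _ hρ.symmetrize, hB _ _ hρ, chernWeilAlt_symmetrize]

theorem chernWeilClass_tensor (hρ : AdInvariant G ρ) (hτ : AdInvariant G τ) :
    D.chernWeilClass (hρ.tensor hτ) = D.chernWeilClass hρ * D.chernWeilClass hτ := by
  have h : 2 * k + 2 * l = 2 * (k + l) := by omega
  refine Eq.trans ?_ ((D.isClosedSimplicialForm hρ).toCohomology_wedge h
    (D.isClosedSimplicialForm hτ))
  refine (D.isClosedSimplicialForm (hρ.tensor hτ)).toCohomology_congr
    ((D.isClosedSimplicialForm hρ).wedge h (D.isClosedSimplicialForm hτ)) fun x y hy => ?_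
  obtain ⟨B, hB⟩ := D.exists_curvature x hy
  rw [hB _ _ (hρ.tensor hτ), hB _ _ hρ, hB _ _ hτ, wedge_chernWeilAlt]

theorem chernWeilClass_one
    (h : AdInvariant G (ContinuousMultilinearMap.constOfIsEmpty ℝ (fun _ : Fin 0 => E) (1 : ℝ))) :
    D.chernWeilClass h = 1 := by
  refine congrArg (Ideal.Quotient.mk (coboundaries X)) (Subtype.ext ?_)
  refine congrArg (DirectSum.of (Cochain X) 0) (funext fun x => ?_)
  refine (MeasureTheory.setIntegral_congr_fun (measurableSet_simplex 0) (g := fun _ => (1 : ℝ))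
    fun y hy => ?_).trans ?_
  · obtain ⟨B, hB⟩ := D.exists_curvature (n := 0) x hy
    refine (congrArg (fun a => a fun i => Pi.single i 1) (hB _ _ h)).trans ?_
    refine (chernWeilAlt_apply _ B _).trans ?_
    simp [altSum, chernWeilFun]
  · change ∫ _ in Simplex 0, (1 : ℝ) = 1
    have hu : Simplex 0 = univ := eq_univ_of_forall fun y => by simp [Simplex]
    rw [hu, MeasureTheory.setIntegral_univ, MeasureTheory.Measure.volume_pi_eq_dirac,
      MeasureTheory.integral_dirac]

/-- The Chern–Weil class of a sum of invariant symmetric functionals of different degrees. -/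
def chernWeilSum : (⨁ k, invariantForms E G k) →ₗ[ℝ] Cohomology X :=
  DirectSum.toModule ℝ ℕ _ fun k =>
    { toFun := fun ρ => D.chernWeilClass ρ.2.map_Ad
      map_add' := fun ρ τ => by
        have h : AdInvariant G ((1 : ℝ) • ρ.1 + (1 : ℝ) • τ.1) := by
          rw [one_smul, one_smul]
          exact (ρ + τ).2.map_Ad
        have h1 := D.chernWeilClass_combination ρ.2.map_Ad τ.2.map_Ad 1 1 h
        simpa only [one_smul] using h1
      map_smul' := fun r ρ => by
        have h : AdInvariant G (r • ρ.1 + (0 : ℝ) • ρ.1) := by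
          rw [zero_smul, add_zero]
          exact (r • ρ).2.map_Ad
        have h1 := D.chernWeilClass_combination ρ.2.map_Ad ρ.2.map_Ad r 0 h
        simp only [zero_smul, add_zero] at h1
        exact h1 }

theorem chernWeilSum_of (hρ : IsInvariant E G ρ) :
    D.chernWeilSum (DirectSum.of (fun k => invariantForms E G k) k ⟨ρ, hρ⟩) =
      D.chernWeilClass hρ.map_Ad :=
  DirectSum.toModule_lof ℝ (M := fun k => invariantForms E G k) k ⟨ρ, hρ⟩

/-- Invariant polynomials are sums of invariant symmetric functionals. -/
def diagonalEquiv : (⨁ k, invariantForms E G k) ≃ₗ[ℝ] invariantPolynomials E G :=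
  LinearEquiv.ofBijective (diagonal E G) ⟨diagonal_injective, diagonal_surjective⟩

/-- The Chern–Weil homomorphism, as a linear map. -/
def chernWeilLinear : invariantPolynomials E G →ₗ[ℝ] Cohomology X :=
  D.chernWeilSum.comp (diagonalEquiv (E := E) (G := G)).symm.toLinearMap

theorem chernWeilLinear_polynomial (hρ : IsInvariant E G ρ) :
    D.chernWeilLinear hρ.polynomial = D.chernWeilClass hρ.map_Ad := by
  rw [← D.chernWeilSum_of hρ, chernWeilLinear, LinearMap.comp_apply]
  congr 1
  exact (LinearEquiv.symm_apply_eq _).2 (diagonal_of hρ).symm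

theorem chernWeilLinear_mul_polynomial (hρ : IsInvariant E G ρ) (hτ : IsInvariant E G τ) :
    D.chernWeilLinear (hρ.polynomial * hτ.polynomial) =
      D.chernWeilLinear hρ.polynomial * D.chernWeilLinear hτ.polynomial := by
  have hρ' : AdInvariant G ρ := hρ.map_Ad
  have hτ' : AdInvariant G τ := hτ.map_Ad
  have h : IsInvariant E G (symmetrize (tensor ρ τ)) :=
    ⟨symmetrize_perm _, (hρ'.tensor hτ').symmetrize⟩
  have hp : hρ.polynomial * hτ.polynomial = h.polynomial :=
    Subtype.ext (funext fun x => (symmetrize_diagonal (tensor ρ τ) x).symm)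
  rw [hp, chernWeilLinear_polynomial, chernWeilLinear_polynomial, chernWeilLinear_polynomial,
    ← D.chernWeilClass_tensor hρ' hτ', ← D.chernWeilClass_symmetrize (hρ'.tensor hτ')]

/-- The Chern–Weil homomorphism of a simplicial connection. -/
def chernWeilHom : invariantPolynomials E G →ₐ[ℝ] Cohomology X :=
  AlgHom.ofLinearMap D.chernWeilLinear
    (by
      have h : IsInvariant E G
          (ContinuousMultilinearMap.constOfIsEmpty ℝ (fun _ : Fin 0 => E) (1 : ℝ)) :=
        ⟨fun _ _ => rfl, fun _ _ => rfl⟩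
      exact (D.chernWeilLinear_polynomial h).trans (D.chernWeilClass_one h.map_Ad))
    (fun f g => by
      obtain ⟨a, rfl⟩ := diagonal_surjective f
      obtain ⟨b, rfl⟩ := diagonal_surjective g
      induction a using DirectSum.induction_on with
      | zero => simp only [map_zero, zero_mul]
      | add a a' ha ha' => simp only [map_add, add_mul, ha, ha']
      | of k ρ =>
        induction b using DirectSum.induction_on with
        | zero => simp only [map_zero, mul_zero]
        | add b b' hb hb' => simp only [map_add, mul_add, hb, hb']
        | of l τ =>
          have h := D.chernWeilLinear_mul_polynomial ρ.2 τ.2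
          rw [← diagonal_of ρ.2, ← diagonal_of τ.2] at h
          exact h)

theorem chernWeilHom_polynomial (hρ : IsInvariant E G ρ) :
    D.chernWeilHom hρ.polynomial = D.chernWeilClass hρ.map_Ad :=
  D.chernWeilLinear_polynomial hρ

end SimplicialConnection

end Homomorphism

end ChernWeil

end

open ChernWeil in
theorem mainTheorem9
    {E : Type*} [AddCommGroup E] [Module ℝ E] [UniformSpace E] [IsUniformAddGroup E]
    [ContinuousSMul ℝ E] [T2Space E] [CompleteSpace E] [LocallyConvexSpace ℝ E]
    {G : Type*} [Group G] [TopologicalSpace G] [ChartedSpace E G] [SmoothLieGroup E G]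
    (𝒰 : Set (Type _)) (h𝒰 : IsAdmissible G 𝒰) :
    Nonempty (SimplicialConnection (EG E G 𝒰)) ∧
    ∃ Φ : invariantPolynomials E G →ₐ[ℝ] Cohomology (BG E G 𝒰),
      (∀ (k : ℕ) (ρ : ContinuousMultilinearMap ℝ (fun _ : Fin k => E) ℝ) (hρ : IsInvariant E G ρ)
        (D : SimplicialConnection (EG E G 𝒰)),
        IsClassOf (Φ hρ.polynomial) (chernWeilCochain ρ D)) ∧
      ∀ {V : Type*} [NormedAddCommGroup V] [NormedSpace ℝ V] [FiniteDimensional ℝ V]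
        {H : Type*} [TopologicalSpace H] (I : ModelWithCorners ℝ V H)
        {Y : Type*} [TopologicalSpace Y] [ChartedSpace H Y] [IsManifold I ∞ Y]
        (Z : PrincipalBundle I E G Y) (hZ : Z.Total ∈ 𝒰),
        Classifies (classifyingMap (induced Z) (induced_isSmall Z h𝒰 hZ)) (induced Z) ∧
        Nonempty (SimplicialConnection (induced Z)) ∧
        ∀ f : (SmoothSSet.sing I Y).Hom (BG E G 𝒰), Classifies f (induced Z) →
          ∀ (k : ℕ) (ρ : ContinuousMultilinearMap ℝ (fun _ : Fin k => E) ℝ)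
            (hρ : IsInvariant E G ρ) (D : SimplicialConnection (induced Z)),
            IsClassOf (cohomologyMap f (Φ hρ.polynomial)) (chernWeilCochain ρ D) := by
  obtain ⟨D₀⟩ := nonempty_simplicialConnection (EG E G 𝒰)
  refine ⟨⟨D₀⟩, D₀.chernWeilHom, fun k ρ hρ D => ?_, ?_⟩
  · rw [D₀.chernWeilHom_polynomial hρ, D₀.chernWeilClass_eq hρ.map_Ad D]
    exact D.isClassOf hρ.map_Ad
  · intro V _ _ _ H _ I Y _ _ _ Z hZ
    refine ⟨classifies_classifyingMap _ _, nonempty_simplicialConnection _, fun f hf k ρ hρ D => ?_⟩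
    rw [D₀.chernWeilHom_polynomial hρ, ← D₀.chernWeilClass_pullback hρ.map_Ad f,
      chernWeilClass_eq_of_isomorphic hρ.map_Ad hf (D₀.pullback f) D]
    exact D.isClassOf hρ.map_Ad
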